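/- **Conventions.** All algebras are over $\mathbb C$. Let $A=\bigoplus_{n\ge 0}A_n$ be a finite dimensional $\mathbb N$-graded algebra with $A_0=\bigoplus_{\lambda\in\Lambda}\mathbb C e_\lambda$ for a finite family of nonzero orthogonal idempotents. For an $(A_0,A_0)$-bimodule $M$ let $M^\star$ be its $\mathbb C$-dual with $(bfc)(m)=f(cmb)$. The quadratic dual is $A^!=T_{A_0}(A_1^\star)/(\mathrm{Im}\,\phi^\star)$, where $\phi^\star\colon A_2^\star\to (A_1\otimes_{A_0}A_1)^\star\simeq A_1^\star\otimes_{A_0}A_1^\star$ is dual to the product; it is $\mathbb N$-graded with $A^!_0=A_0$, $A^!_1=A_1^\star$. The same definition applies to any finite dimensional $\mathbb N$-graded algebra $A'$ (for $A'_0$ semisimple and basic, which holds below). For $\Lambda'\subset\Lambda$ put $e_{\Lambda'}=\sum_{\lambda\in\Lambda'}e_\lambda$, $A_{\Lambda'}=e_{\Lambda'}Ae_{\Lambda'}$, and let ${}_{\Lambda'}A^!$ be the quotient of $A^!$ by the two-sided ideal generated by the idempotents $e_\lambda\in A^!_0$, $\lambda\notin\Lambda'$. For a graded algebra $R$, $\mathrm{grmod}(R)$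 is the category of $\mathbb Z$-graded left $R$-modules with finite dimensional homogeneous components and homogeneous maps of degree $0$; $(M\langle 1\rangle)_j=M_{j-1}$. $D^\downarrow(R)$ (resp. $D^\uparrow(R)$) is the localization at quasi-isomorphisms of the category of complexes $X^\bullet$ in $\mathrm{grmod}(R)$ such that, for some $N$, $(X^i)_j=0$ whenever $i>N$ or $i+j<-N$ (resp. $i<-N$ or $i+j>N$). The quadratic duality functor $\mathcal K'\colon D^\uparrow(A^!)\to D^\downarrow(A)$ is induced by the functor that sends a complex $M^\bullet$ to the complex with $n$-th term $\bigoplus_{i+k=n}A\otimes_{A_0}(M^i)_k$, where $a\otimes m$ with $a\in A_p$, $m\in (M^i)_k$ has degree $p-k$, and with differential $$a\otimes m\longmapsto a\otimes d_M(m)+(-1)^i\sum_s ab_s\otimes b_s^*m,$$ $(b_s)$ being a basis of $A_1$ and $(b_s^*)$ the dual basis of $A_1^\star=A_1^!$. (This is the total complex of the linear complexes attached to the $M^i$. It is part of the assertions below that this functor preserves quasi-isomorphisms, for $A$ and for $A'$.) Let $\iota\colon D^\uparrow({}_{\Lambda'}A^!)\to D^\uparrow(A^!)$ be the functor given by viewing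 ${}_{\Lambda'}A^!$-modules as $A^!$-modules. **Lemma.** Let $A'$ be a finite dimensional $\mathbb N$-graded algebra and let $\psi\colon A'\to A_{\Lambda'}$ be a unital homomorphism of graded algebras such that (a) $\psi$ is bijective in degrees $0$ and $1$; (b) $\psi$ induces an isomorphism from the kernel of $A'_1\otimes_{A'_0}A'_1\to A'_2$ onto the kernel of $(A_{\Lambda'})_1\otimes_{(A_{\Lambda'})_0}(A_{\Lambda'})_1\to (A_{\Lambda'})_2$. Then there is an isomorphism of graded algebras $\theta\colon (A')^!\simeq{}_{\Lambda'}A^!$, given in degree $0$ by $b\mapsto\psi(b)$ and in degree $1$ by $f\circ\psi\mapsto f$ ($f\in A_1^\star$). Let $T\colon\mathrm{grmod}(A')\to\mathrm{grmod}(A)$ be the functor $M\mapsto Ae_{\Lambda'}\otimes_{A'}M$, where $A'$ acts on $Ae_{\Lambda'}$ on the right through $\psi$. It has a left derived functor $LT\colon D^\downarrow(A')\to D^\downarrow(A)$, and the diagram $$ \begin{CD} D^\downarrow(A) @<{\mathcal K'}<< D^\uparrow(A^!)\\ @A{LT}AA @A{\iota}AA\\ D^\downarrow(A') @<{\mathcal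 K'}<< D^\uparrow({}_{\Lambda'}A^!) \end{CD} $$ commutes up to an isomorphism of functors; here the lower $\mathcal K'$ is the quadratic duality functor $D^\uparrow((A')^!)\to D^\downarrow(A')$ composed with the identification $(A')^!\simeq{}_{\Lambda'}A^!$ given by $\theta$. **Corollary.** Let $A'$ be a finite dimensional $\mathbb N$-graded algebra with $A'_0=\bigoplus_{\lambda\in\Lambda'}\mathbb C e'_\lambda$ for nonzero orthogonal idempotents $e'_\lambda$, and assume $\dim (A')^!=\dim {}_{\Lambda'}A^!$. Let $T\colon\mathrm{grmod}(A')\to\mathrm{grmod}(A)$ be an exact $\mathbb C$-linear functor commuting with the grading shift $\langle 1\rangle$ (up to isomorphism of functors) such that (a) $T(A'e'_\lambda)\simeq Ae_\lambda$ for all $\lambda\in\Lambda'$; (b) $T$ induces a bijection $\mathrm{Hom}(A'e'_\lambda\langle1\rangle,A'e'_\mu)\to\mathrm{Hom}(T(A'e'_\lambda\langle1\rangle),T(A'e'_\mu))\;(\simeq\mathrm{Hom}(Ae_\lambda\langle1\rangle,Ae_\mu))$ for all $\lambda,\mu\in\Lambda'$. Then there is an isomorphism of graded algebras $(A')^!\simeq{}_{\Lambda'}A^!$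 sending $e'_\lambda$ to $e_\lambda$ for each $\lambda\in\Lambda'$; the functor $T$ applied termwise to complexes induces a functor $T\colon D^\downarrow(A')\to D^\downarrow(A)$; and the diagram above, with $T$ in place of $LT$ and the lower $\mathcal K'$ formed with this isomorphism, commutes up to an isomorphism of functors. -/

import Mathlib

open CategoryTheory CategoryTheory.Limits
open scoped TensorProduct DirectSum

universe u

set_option linter.unusedSectionVars false

noncomputable section

namespace QuadDual

/-! ### Graded modules -/

/-- A `ℤ`-graded left module `⨁ V j` over the algebra `R` with homogeneous components `ℛ n`,
all of whose homogeneous components are finite dimensional over `ℂ`. The module structure is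
given by the action maps `ℛ n × V i → V (n + i)`. -/
structure GrMod {R : Type u} [Ring R] [Algebra ℂ R] (ℛ : ℤ → Submodule ℂ R) where
  V : ℤ → Type u
  [addCommGroup : ∀ j, AddCommGroup (V j)]
  [module : ∀ j, Module ℂ (V j)]
  [finiteDimensional : ∀ j, FiniteDimensional ℂ (V j)]
  act : ∀ {n i j : ℤ}, n + i = j → (ℛ n →ₗ[ℂ] V i →ₗ[ℂ] V j)
  one_act : ∀ {i : ℤ} (h : 0 + i = i) (a : ℛ 0) (v : V i), (a : R) = 1 → act h a v = v
  mul_act : ∀ {m n p i j k : ℤ} (h₁ : n + i = j) (h₂ : m + j = k) (h₃ : p + i = k)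
    (a : ℛ m) (b : ℛ n) (c : ℛ p) (v : V i), (c : R) = a * b → act h₃ c v = act h₂ a (act h₁ b v)

attribute [instance] GrMod.addCommGroup GrMod.module GrMod.finiteDimensional

namespace GrMod

section
variable {R : Type u} [Ring R] [Algebra ℂ R] {ℛ : ℤ → Submodule ℂ R}

/-- Homogeneous maps of degree `0` that commute with the action. -/
def homs (M N : GrMod ℛ) : Submodule ℂ (∀ j, M.V j →ₗ[ℂ] N.V j) where
  carrier := {f | ∀ {n i j : ℤ} (h : n + i = j) (a : ℛ n) (v : M.V i),
    f j (M.act h a v) = N.act h a (f i v)}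
  add_mem' := by
    intro f g hf hg n i j h a v
    simp [hf h, hg h]
  zero_mem' := by intro n i j h a v; simp
  smul_mem' := by
    intro c f hf n i j h a v
    simp [hf h]

/-- The category of graded modules (with finite dimensional components) and homogeneous
homomorphisms of degree `0`. -/
instance : Category.{u} (GrMod ℛ) where
  Hom M N := homs M N
  id M := ⟨fun _ => LinearMap.id, by intro n i j h a v; rfl⟩
  comp f g := ⟨fun j => (g.1 j).comp (f.1 j), by
    intro n i j h a v
    simp [f.2 h, g.2 h]⟩

/-- The component of degree `j` of a morphism. -/
def app {M N : GrMod ℛ} (f : M ⟶ N) (j : ℤ) : M.V j →ₗ[ℂ] N.V j := f.1 j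

/-- Constructor for morphisms. -/
def mkHom {M N : GrMod ℛ} (f : ∀ j, M.V j →ₗ[ℂ] N.V j)
    (hf : ∀ {n i j : ℤ} (h : n + i = j) (a : ℛ n) (v : M.V i),
      f j (M.act h a v) = N.act h a (f i v)) : M ⟶ N := ⟨f, hf⟩

@[simp] lemma app_mkHom {M N : GrMod ℛ} (f : ∀ j, M.V j →ₗ[ℂ] N.V j) (hf) (j : ℤ) :
    app (mkHom (M := M) (N := N) f hf) j = f j := rfl

lemma app_act {M N : GrMod ℛ} (f : M ⟶ N) {n i j : ℤ} (h : n + i = j) (a : ℛ n) (v : M.V i) :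
    app f j (M.act h a v) = N.act h a (app f i v) := f.2 h a v

@[ext] lemma hom_ext {M N : GrMod ℛ} {f g : M ⟶ N} (h : ∀ j, app f j = app g j) : f = g :=
  Subtype.ext (funext h)

@[simp] lemma id_app (M : GrMod ℛ) (j : ℤ) : app (𝟙 M) j = LinearMap.id := rfl

@[simp] lemma comp_app {M N P : GrMod ℛ} (f : M ⟶ N) (g : N ⟶ P) (j : ℤ) :
    app (f ≫ g) j = (app g j).comp (app f j) := rfl

instance (M N : GrMod ℛ) : AddCommGroup (M ⟶ N) := inferInstanceAs (AddCommGroup (homs M N))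
instance (M N : GrMod ℛ) : Module ℂ (M ⟶ N) := inferInstanceAs (Module ℂ (homs M N))

@[simp] lemma add_app {M N : GrMod ℛ} (f g : M ⟶ N) (j : ℤ) :
    app (f + g) j = app f j + app g j := rfl
@[simp] lemma neg_app {M N : GrMod ℛ} (f : M ⟶ N) (j : ℤ) : app (-f) j = - app f j := rfl
@[simp] lemma smul_app {M N : GrMod ℛ} (c : ℂ) (f : M ⟶ N) (j : ℤ) :
    app (c • f) j = c • app f j := rfl
@[simp] lemma zero_app' {M N : GrMod ℛ} (j : ℤ) : app (0 : M ⟶ N) j = 0 := rfl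

instance : Preadditive (GrMod ℛ) where
  add_comp := by intros; ext j; simp [LinearMap.comp_add]
  comp_add := by intros; ext j; simp [LinearMap.add_comp]

instance : Linear ℂ (GrMod ℛ) where
  smul_comp := by intros; ext j; simp
  comp_smul := by intros; ext j; simp

variable (ℛ) in
/-- The functor `M ↦ M_j`. -/
def ev (j : ℤ) : GrMod ℛ ⥤ ModuleCat.{u} ℂ where
  obj M := ModuleCat.of ℂ (M.V j)
  map f := ModuleCat.ofHom (app f j)

instance (j : ℤ) : (ev ℛ j).Additive where

variable (ℛ) in
/-- The shift of the grading, `(M⟨r⟩)_j = M_{j-r}`. -/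
def shift (r : ℤ) : GrMod ℛ ⥤ GrMod ℛ where
  obj M :=
    { V := fun j => M.V (j - r)
      act := fun {n i j} h => M.act (n := n) (i := i - r) (j := j - r) (by omega)
      one_act := fun _ a v ha => M.one_act _ a v ha
      mul_act := fun _ _ _ a b c v hc => M.mul_act _ _ _ a b c v hc }
  map f := mkHom (fun j => app f (j - r)) (fun h a v => app_act f _ a v)

end

section Restriction

variable {R S : Type u} [Ring R] [Algebra ℂ R] [Ring S] [Algebra ℂ S]
  (ℛ : ℤ → Submodule ℂ R) (𝒮 : ℤ → Submodule ℂ S)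

/-- Restriction of scalars along a homomorphism of graded algebras. -/
def res (f : R →ₐ[ℂ] S) (hf : ∀ n, ∀ a ∈ ℛ n, f a ∈ 𝒮 n) : GrMod 𝒮 ⥤ GrMod ℛ where
  obj M :=
    { V := M.V
      act := fun {n _ _} h => (M.act h).comp (f.toLinearMap.restrict (hf n))
      one_act := fun h a v ha => M.one_act h _ v
        (show f a = 1 by rw [ha, map_one])
      mul_act := fun h₁ h₂ h₃ a b c v hc => M.mul_act h₁ h₂ h₃ _ _ _ v
        (show f c = f a * f b by rw [hc, map_mul]) }
  map g := mkHom (fun j => app g j) (fun h a v => app_act g h _ v)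

instance (f : R →ₐ[ℂ] S) (hf : ∀ n, ∀ a ∈ ℛ n, f a ∈ 𝒮 n) : (res ℛ 𝒮 f hf).Additive where

end Restriction

section DirectSum

variable {R : Type u} [Ring R] [Algebra ℂ R] {ℛ : ℤ → Submodule ℂ R}
  {ι : Type}

lemma finite_directSum {V : ι → Type u} [∀ i, AddCommGroup (V i)] [∀ i, Module ℂ (V i)]
    [∀ i, FiniteDimensional ℂ (V i)] (h : {i | Nontrivial (V i)}.Finite) :
    FiniteDimensional ℂ (⨁ i, V i) := by
  classical
  let s := h.toFinset
  have : FiniteDimensional ℂ (∀ i : s, V i) := inferInstance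
  let φ : (⨁ i, V i) →ₗ[ℂ] (∀ i : s, V i) := LinearMap.pi fun i => DirectSum.component ℂ ι V i
  refine FiniteDimensional.of_injective φ ?_
  rw [← LinearMap.ker_eq_bot, LinearMap.ker_eq_bot']
  intro x hx
  ext i
  by_cases hi : Nontrivial (V i)
  · have := congrFun hx ⟨i, by simpa [s] using hi⟩
    exact this
  · rw [not_nontrivial_iff_subsingleton] at hi
    exact Subsingleton.elim _ _

variable [DecidableEq ι]

/-- The direct sum of a family of graded modules that is locally finite, i.e. for each degree only
finitely many members of the family are nonzero in that degree. -/
def dsum (N : ι → GrMod ℛ) (hN : ∀ j, {i | Nontrivial ((N i).V j)}.Finite) : GrMod ℛ where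
  V j := ⨁ i, (N i).V j
  finiteDimensional j := finite_directSum (hN j)
  act h :=
    { toFun := fun a => DirectSum.lmap fun i => (N i).act h a
      map_add' := by intros; ext; simp [DirectSum.lmap_lof]
      map_smul' := by intros; ext; simp [DirectSum.lmap_lof] }
  one_act h a v ha := by
    have : (DirectSum.lmap fun i => (N i).act h a) = LinearMap.id := by
      ext i x : 2
      simp [DirectSum.lmap_lof, (N i).one_act h a _ ha]
    exact LinearMap.congr_fun this v
  mul_act h₁ h₂ h₃ a b c v hc := by
    have : (DirectSum.lmap fun i => (N i).act h₃ c) =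
        (DirectSum.lmap fun i => (N i).act h₂ a).comp
          (DirectSum.lmap fun i => (N i).act h₁ b) := by
      ext i x : 2
      simp [DirectSum.lmap_lof, (N i).mul_act h₁ h₂ h₃ a b c _ hc]
    exact LinearMap.congr_fun this v

variable {N : ι → GrMod ℛ} {hN : ∀ j, {i | Nontrivial ((N i).V j)}.Finite}

lemma dsum_act_lof {n i j : ℤ} (h : n + i = j) (a : ℛ n) (k : ι) (v : (N k).V i) :
    (dsum N hN).act h a (DirectSum.lof ℂ ι (fun k => (N k).V i) k v) =
      DirectSum.lof ℂ ι (fun k => (N k).V j) k ((N k).act h a v) :=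
  DirectSum.lmap_lof ..

/-- The inclusion of a summand. -/
def inj (i : ι) : N i ⟶ dsum N hN :=
  mkHom (fun j => DirectSum.lof ℂ ι (fun i => (N i).V j) i) (fun h a v =>
    (dsum_act_lof h a i v).symm)

/-- The morphism out of a direct sum with given components. -/
def desc {P : GrMod ℛ} (f : ∀ i, N i ⟶ P) : dsum N hN ⟶ P :=
  mkHom (fun j => DirectSum.toModule ℂ ι (P.V j) fun i => app (f i) j) (fun {n i j} h a v => by
    have : (DirectSum.toModule ℂ ι (P.V j) fun i => app (f i) j).comp ((dsum N hN).act h a) =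
        (P.act h a).comp (DirectSum.toModule ℂ ι (P.V i) fun k => app (f k) i) := by
      apply DirectSum.linearMap_ext
      intro k
      ext x
      change DirectSum.toModule ℂ ι (P.V j) (fun i => app (f i) j) ((dsum N hN).act h a
        (DirectSum.lof ℂ ι (fun k => (N k).V i) k x)) = P.act h a
        (DirectSum.toModule ℂ ι (P.V i) (fun k => app (f k) i)
          (DirectSum.lof ℂ ι (fun k => (N k).V i) k x))
      rw [dsum_act_lof, DirectSum.toModule_lof, DirectSum.toModule_lof, app_act]
    exact LinearMap.congr_fun this v)

@[simp] lemma inj_desc {P : GrMod ℛ} (f : ∀ i, N i ⟶ P) (i : ι) :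
    (inj i : N i ⟶ dsum N hN) ≫ desc f = f i := by
  ext j x
  exact DirectSum.toModule_lof (M := fun i => (N i).V j) (φ := fun i => app (f i) j) ℂ i x

lemma dsum_ext {P : GrMod ℛ} {f g : dsum N hN ⟶ P} (h : ∀ i, inj i ≫ f = inj i ≫ g) : f = g := by
  ext j : 1
  apply DirectSum.linearMap_ext
  intro i
  exact congrArg (fun f => app f j) (h i)

end DirectSum

end GrMod

/-! ### Algebras and their quadratic duals -/

section Algebra

variable {A : Type u} [Ring A] [Algebra ℂ A] (𝒜 : ℤ → Submodule ℂ A)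

/-- The grading is concentrated in nonnegative degrees (an `ℕ`-grading). -/
class NonnegGraded : Prop where
  eq_bot : ∀ n < 0, 𝒜 n = ⊥

/-- `A₀ = ⨁ ℂ e_λ` for the family of nonzero orthogonal idempotents `e`. -/
structure IsBasic {Λ : Type*} [Fintype Λ] (e : Λ → A) : Prop where
  idem : CompleteOrthogonalIdempotents e
  ne_zero : ∀ l, e l ≠ 0
  span : Submodule.span ℂ (Set.range e) = 𝒜 0

section QuadraticDual

variable [SetLike.GradedMonoid 𝒜]

/-- Left multiplication by an element of degree `m`. -/
def lmul {m p q : ℤ} (h : m + p = q) : 𝒜 m →ₗ[ℂ] 𝒜 p →ₗ[ℂ] 𝒜 q :=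
  LinearMap.mk₂ ℂ (fun a x => ⟨a * x, h ▸ SetLike.mul_mem_graded a.2 x.2⟩)
    (fun _ _ _ => Subtype.ext (add_mul _ _ _)) (fun _ _ _ => Subtype.ext (smul_mul_assoc _ _ _))
    (fun _ _ _ => Subtype.ext (mul_add _ _ _)) (fun _ _ _ => Subtype.ext (mul_smul_comm _ _ _))

@[simp] lemma coe_lmul {m p q : ℤ} (h : m + p = q) (a : 𝒜 m) (x : 𝒜 p) :
    (lmul 𝒜 h a x : A) = a * x := rfl

/-- The generators of the quadratic dual: `A₀` in degree `0` and the dual bimodule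
`A₁⋆` in degree `1`. Its underlying space is the `ℂ`-dual of `A₁`, and the bimodule structure is
`(b f c)(m) = f (c m b)`; so `e_λ A₁⋆ e_μ` is the dual of `e_μ A₁ e_λ`. -/
abbrev Gens := 𝒜 0 × Module.Dual ℂ (𝒜 1)

/-- A degree `0` generator in the free algebra. -/
def pre0 (b : 𝒜 0) : TensorAlgebra ℂ (Gens 𝒜) := TensorAlgebra.ι ℂ (b, 0)

/-- A degree `1` generator in the free algebra. -/
def pre1 (f : Module.Dual ℂ (𝒜 1)) : TensorAlgebra ℂ (Gens 𝒜) := TensorAlgebra.ι ℂ (0, f)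

/-- The relations of `A^!`. The first four present the tensor algebra of the bimodule
`A₁⋆` over `A₀`. The last one divides out the image of the map
`φ⋆ : A₂⋆ → (A₁ ⊗ A₁)⋆ = A₁⋆ ⊗ A₁⋆` dual to the product, where the pairing of
`f ⊗ g ∈ A₁⋆ ⊗ A₁⋆` with `m ⊗ n ∈ A₁ ⊗ A₁` is `f(n) g(m)`: the tensor `∑ fᵢ ⊗ gᵢ` is the image
of `ξ ∈ A₂⋆` when `∑ fᵢ(n) gᵢ(m) = ξ(mn)` for all `m`, `n`. -/
inductive QRel : TensorAlgebra ℂ (Gens 𝒜) → TensorAlgebra ℂ (Gens 𝒜) → Prop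
  | one (b : 𝒜 0) (hb : (b : A) = 1) : QRel (pre0 𝒜 b) 1
  | mul (b c : 𝒜 0) : QRel (pre0 𝒜 b * pre0 𝒜 c) (pre0 𝒜 (lmul 𝒜 (zero_add 0) b c))
  | left (b : 𝒜 0) (f g : Module.Dual ℂ (𝒜 1))
      (h : ∀ m m' : 𝒜 1, (m' : A) = m * b → g m = f m') :
      QRel (pre0 𝒜 b * pre1 𝒜 f) (pre1 𝒜 g)
  | right (f g : Module.Dual ℂ (𝒜 1)) (b : 𝒜 0)
      (h : ∀ m m' : 𝒜 1, (m' : A) = b * m → g m = f m') :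
      QRel (pre1 𝒜 f * pre0 𝒜 b) (pre1 𝒜 g)
  | quad (k : ℕ) (f g : Fin k → Module.Dual ℂ (𝒜 1)) (ξ : Module.Dual ℂ (𝒜 2))
      (h : ∀ m n : 𝒜 1, ∑ i, f i n * g i m = ξ (lmul 𝒜 one_add_one_eq_two m n)) :
      QRel (∑ i, pre1 𝒜 (f i) * pre1 𝒜 (g i)) 0

/-- The quadratic dual algebra `A^! = T_{A₀}(A₁⋆) / (Im φ⋆)`. -/
def QDual : Type u := RingQuot (QRel 𝒜)

instance : Ring (QDual 𝒜) := inferInstanceAs (Ring (RingQuot (QRel 𝒜)))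
instance : Algebra ℂ (QDual 𝒜) := inferInstanceAs (Algebra ℂ (RingQuot (QRel 𝒜)))

namespace QDual

/-- The projection from the free algebra on the generators. -/
def proj : TensorAlgebra ℂ (Gens 𝒜) →ₐ[ℂ] QDual 𝒜 := RingQuot.mkAlgHom ℂ (QRel 𝒜)

lemma proj_rel {x y : TensorAlgebra ℂ (Gens 𝒜)} (h : QRel 𝒜 x y) : proj 𝒜 x = proj 𝒜 y :=
  RingQuot.mkAlgHom_rel ℂ h

/-- The inclusion of `A₀` in `A^!`. -/
def gen0 : 𝒜 0 →ₗ[ℂ] QDual 𝒜 :=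
  (proj 𝒜).toLinearMap ∘ₗ TensorAlgebra.ι ℂ ∘ₗ LinearMap.inl ℂ _ _

/-- The inclusion of `A₁⋆` in `A^!`. -/
def gen1 : Module.Dual ℂ (𝒜 1) →ₗ[ℂ] QDual 𝒜 :=
  (proj 𝒜).toLinearMap ∘ₗ TensorAlgebra.ι ℂ ∘ₗ LinearMap.inr ℂ _ _

/-- The grading of `A^!`: the component of degree `n` is `(A₁⋆)ⁿ A₀`. -/
def gr (n : ℤ) : Submodule ℂ (QDual 𝒜) :=
  if n < 0 then ⊥ else LinearMap.range (gen1 𝒜) ^ n.toNat * LinearMap.range (gen0 𝒜)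

lemma gen0_one (b : 𝒜 0) (hb : (b : A) = 1) : gen0 𝒜 b = 1 :=
  (proj_rel 𝒜 (QRel.one b hb)).trans (map_one _)

lemma gen0_mul (b c : 𝒜 0) :
    gen0 𝒜 b * gen0 𝒜 c = gen0 𝒜 (lmul 𝒜 (zero_add 0) b c) :=
  (map_mul (proj 𝒜) _ _).symm.trans (proj_rel 𝒜 (QRel.mul b c))

lemma gen0_mul_gen1 (b : 𝒜 0) (f g : Module.Dual ℂ (𝒜 1))
    (h : ∀ m m' : 𝒜 1, (m' : A) = m * b → g m = f m') :
    gen0 𝒜 b * gen1 𝒜 f = gen1 𝒜 g :=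
  (map_mul (proj 𝒜) _ _).symm.trans (proj_rel 𝒜 (QRel.left b f g h))

lemma gen1_mul_gen0 (f g : Module.Dual ℂ (𝒜 1)) (b : 𝒜 0)
    (h : ∀ m m' : 𝒜 1, (m' : A) = b * m → g m = f m') :
    gen1 𝒜 f * gen0 𝒜 b = gen1 𝒜 g :=
  (map_mul (proj 𝒜) _ _).symm.trans (proj_rel 𝒜 (QRel.right f g b h))

lemma quad {k : ℕ} (f g : Fin k → Module.Dual ℂ (𝒜 1)) (ξ : Module.Dual ℂ (𝒜 2))
    (h : ∀ m n : 𝒜 1, ∑ i, f i n * g i m = ξ (lmul 𝒜 one_add_one_eq_two m n)) :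
    ∑ i, gen1 𝒜 (f i) * gen1 𝒜 (g i) = 0 := by
  have := proj_rel 𝒜 (QRel.quad k f g ξ h)
  rw [map_sum, map_zero] at this
  rw [← this]
  exact Finset.sum_congr rfl fun i _ => (map_mul (proj 𝒜) _ _).symm

lemma quad' {ι : Type} [Fintype ι] (f g : ι → Module.Dual ℂ (𝒜 1)) (ξ : Module.Dual ℂ (𝒜 2))
    (h : ∀ m n : 𝒜 1, ∑ i, f i n * g i m = ξ (lmul 𝒜 one_add_one_eq_two m n)) :
    ∑ i, gen1 𝒜 (f i) * gen1 𝒜 (g i) = 0 := by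
  let s := (Fintype.equivFin ι).symm
  rw [← s.sum_comp]
  refine quad 𝒜 (f ∘ s) (g ∘ s) ξ fun m n => ?_
  rw [← h, ← s.sum_comp]
  rfl

lemma gen0_mem (b : 𝒜 0) : gen0 𝒜 b ∈ gr 𝒜 0 := by
  simp [gr]

lemma gen1_mem (f : Module.Dual ℂ (𝒜 1)) : gen1 𝒜 f ∈ gr 𝒜 1 := by
  have h : gen1 𝒜 f * gen0 𝒜 ⟨1, SetLike.GradedOne.one_mem⟩ = gen1 𝒜 f := by
    rw [gen0_one 𝒜 _ rfl, mul_one]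
  rw [← h]
  simpa [gr] using Submodule.mul_mem_mul (LinearMap.mem_range_self (gen1 𝒜) f)
    (LinearMap.mem_range_self (gen0 𝒜) _)

lemma gen1_mul_gen1_mem (f g : Module.Dual ℂ (𝒜 1)) : gen1 𝒜 f * gen1 𝒜 g ∈ gr 𝒜 2 := by
  have h : gen1 𝒜 f * gen1 𝒜 g * gen0 𝒜 ⟨1, SetLike.GradedOne.one_mem⟩ =
      gen1 𝒜 f * gen1 𝒜 g := by
    rw [gen0_one 𝒜 _ rfl, mul_one]
  rw [← h]
  have h2 : gr 𝒜 2 = LinearMap.range (gen1 𝒜) * LinearMap.range (gen1 𝒜) *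
      LinearMap.range (gen0 𝒜) := by
    simp [gr, pow_two]
  rw [h2]
  exact Submodule.mul_mem_mul (Submodule.mul_mem_mul (LinearMap.mem_range_self (gen1 𝒜) f)
    (LinearMap.mem_range_self (gen1 𝒜) g)) (LinearMap.mem_range_self (gen0 𝒜) _)

/-- `A₀`, as the subspace of generators of degree `0`. -/
def deg0 : 𝒜 0 →ₗ[ℂ] gr 𝒜 0 := (gen0 𝒜).codRestrict _ (gen0_mem 𝒜)

/-- `A₁⋆`, as the subspace of generators of degree `1`. -/
def deg1 : Module.Dual ℂ (𝒜 1) →ₗ[ℂ] gr 𝒜 1 := (gen1 𝒜).codRestrict _ (gen1_mem 𝒜)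

end QDual

/-- The algebra `_{Λ'}A^! = A^! / (e_λ^! ; λ ∉ Λ')`, where `e_λ^!` is the idempotent `e_λ`
viewed in `A₀ ⊆ A^!`. -/
def QDualQuot {Λ : Type*} (e : Λ → A) (L : Set Λ) : Type u :=
  RingQuot fun x y : QDual 𝒜 =>
    ∃ l ∉ L, ∃ b : 𝒜 0, (b : A) = e l ∧ x = QDual.gen0 𝒜 b ∧ y = 0

namespace QDualQuot

variable {Λ : Type*} (e : Λ → A) (L : Set Λ)

instance : Ring (QDualQuot 𝒜 e L) := inferInstanceAs (Ring (RingQuot _))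
instance : Algebra ℂ (QDualQuot 𝒜 e L) := inferInstanceAs (Algebra ℂ (RingQuot _))

/-- The projection `A^! → _{Λ'}A^!`. -/
def proj : QDual 𝒜 →ₐ[ℂ] QDualQuot 𝒜 e L := RingQuot.mkAlgHom ℂ _

/-- The grading of `_{Λ'}A^!` induced by the grading of `A^!`. -/
def gr (n : ℤ) : Submodule ℂ (QDualQuot 𝒜 e L) := (QDual.gr 𝒜 n).map (proj 𝒜 e L).toLinearMap

lemma proj_mem (n : ℤ) : ∀ a ∈ QDual.gr 𝒜 n, proj 𝒜 e L a ∈ gr 𝒜 e L n :=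
  fun a ha => ⟨a, ha, rfl⟩

end QDualQuot

end QuadraticDual

end Algebra

/-! ### Tensor products over noncommutative algebras -/

section Balanced

variable {X Y S : Type u} [AddCommGroup X] [Module ℂ X] [AddCommGroup Y] [Module ℂ Y]

/-- The span of the elements `x s ⊗ y - x ⊗ s y`. -/
def balRel (r : X → S → X) (l : S → Y → Y) : Submodule ℂ (X ⊗[ℂ] Y) :=
  Submodule.span ℂ {t | ∃ x s y, t = r x s ⊗ₜ[ℂ] y - x ⊗ₜ[ℂ] l s y}

/-- The tensor product over `S` of a right module `X` and a left module `Y`, with actions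
`r` and `l`. -/
abbrev Bal (r : X → S → X) (l : S → Y → Y) : Type u := (X ⊗[ℂ] Y) ⧸ balRel r l

/-- The map of tensor products induced by a pair of maps that are compatible with the actions. -/
def Bal.map {X' Y' S' : Type u} [AddCommGroup X'] [Module ℂ X'] [AddCommGroup Y'] [Module ℂ Y']
    {r : X → S → X} {l : S → Y → Y} {r' : X' → S' → X'} {l' : S' → Y' → Y'}
    (f : X →ₗ[ℂ] X') (σ : S → S') (g : Y →ₗ[ℂ] Y') (hf : ∀ x s, f (r x s) = r' (f x) (σ s))
    (hg : ∀ s y, g (l s y) = l' (σ s) (g y)) : Bal r l →ₗ[ℂ] Bal r' l' :=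
  Submodule.mapQ _ _ (TensorProduct.map f g) <| by
    rw [balRel, Submodule.span_le]
    rintro _ ⟨x, s, y, rfl⟩
    exact Submodule.subset_span ⟨f x, σ s, g y, by simp [hf, hg]⟩

end Balanced

section DegreeTwo

variable {A : Type u} [Ring A] [Algebra ℂ A] (𝒜 : ℤ → Submodule ℂ A) [SetLike.GradedMonoid 𝒜]

/-- `A₁ ⊗_{A₀} A₁`. -/
abbrev Deg2 : Type u :=
  Bal (X := 𝒜 1) (Y := 𝒜 1) (S := 𝒜 0)
    (fun x s => lmul 𝒜 (add_zero 1) x s) (fun s y => lmul 𝒜 (zero_add 1) s y)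

/-- The product `A₁ ⊗_{A₀} A₁ → A₂`. -/
def Deg2.mul : Deg2 𝒜 →ₗ[ℂ] 𝒜 2 :=
  Submodule.liftQ _ (TensorProduct.lift (lmul 𝒜 one_add_one_eq_two)) <| by
    rw [balRel, Submodule.span_le]
    rintro _ ⟨x, s, y, rfl⟩
    simp [sub_eq_zero, Subtype.ext_iff, mul_assoc]

/-- The map `A₁ ⊗_{A₀} A₁ → B₁ ⊗_{B₀} B₁` induced by a homomorphism of graded algebras `A → B`. -/
def Deg2.map {B : Type u} [Ring B] [Algebra ℂ B] (ℬ : ℤ → Submodule ℂ B) [SetLike.GradedMonoid ℬ]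
    (f : A →ₐ[ℂ] B) (hf : ∀ n, ∀ a ∈ 𝒜 n, f a ∈ ℬ n) : Deg2 𝒜 →ₗ[ℂ] Deg2 ℬ :=
  Bal.map (f.toLinearMap.restrict (hf 1)) (f.toLinearMap.restrict (hf 0))
    (f.toLinearMap.restrict (hf 1))
    (fun x s => Subtype.ext (map_mul f (x : A) (s : A)))
    (fun s y => Subtype.ext (map_mul f (s : A) (y : A)))

end DegreeTwo

/-! ### Corner algebras -/

section Corner

variable {A : Type u} [Ring A] [Algebra ℂ A] {e : A} (he : IsIdempotentElem e)

/-- `e A e` as a subspace of `A`. -/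
def cornerSubmodule (e : A) : Submodule ℂ A where
  carrier := Subsemigroup.corner e
  add_mem' ha hb := (NonUnitalRing.corner e).add_mem ha hb
  zero_mem' := (NonUnitalRing.corner e).zero_mem
  smul_mem' := by
    rintro c _ ⟨x, rfl⟩
    exact ⟨c • x, by simp⟩

instance : Module ℂ he.Corner := inferInstanceAs (Module ℂ (cornerSubmodule e))

/-- The inclusion `e A e → A`. -/
def cornerVal : he.Corner →ₗ[ℂ] A := (cornerSubmodule e).subtype

instance : Algebra ℂ he.Corner :=
  Algebra.ofModule (fun c x y => Subtype.ext (smul_mul_assoc c (cornerVal he x) (cornerVal he y)))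
    (fun c x y => Subtype.ext (mul_smul_comm c (cornerVal he x) (cornerVal he y)))

variable (𝒜 : ℤ → Submodule ℂ A)

lemma cornerVal_one : cornerVal he 1 = e := rfl

lemma cornerVal_mul (x y : he.Corner) : cornerVal he (x * y) = cornerVal he x * cornerVal he y :=
  rfl

lemma cornerVal_mul_right (x : he.Corner) : cornerVal he x * e = cornerVal he x :=
  congrArg (cornerVal he) (mul_one x)

/-- The grading of `e A e` induced by the grading of `A`. -/
def cornerGr (n : ℤ) : Submodule ℂ he.Corner := (𝒜 n).comap (cornerVal he)

lemma corner_gradedMonoid [SetLike.GradedMonoid 𝒜] (h0 : e ∈ 𝒜 0) :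
    SetLike.GradedMonoid (cornerGr he 𝒜) where
  one_mem := h0
  mul_mem _ _ _ _ hx hy := SetLike.mul_mem_graded (A := 𝒜) hx hy

end Corner

namespace IsBasic

variable {A : Type u} [Ring A] [Algebra ℂ A] {𝒜 : ℤ → Submodule ℂ A}
  {Λ : Type*} [Fintype Λ] {e : Λ → A}

lemma mem (h : IsBasic 𝒜 e) (l : Λ) : e l ∈ 𝒜 0 :=
  h.span ▸ Submodule.subset_span ⟨l, rfl⟩

lemma sum_mem (h : IsBasic 𝒜 e) (L : Finset Λ) : ∑ l ∈ L, e l ∈ 𝒜 0 :=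
  Submodule.sum_mem _ fun l _ => h.mem l

lemma isIdempotentElem (h : IsBasic 𝒜 e) (L : Finset Λ) :
    IsIdempotentElem (∑ l ∈ L, e l) :=
  h.idem.toOrthogonalIdempotents.isIdempotentElem_sum

end IsBasic

/-! ### The modules `A e` and the functor `A e ⊗_{A'} -` -/

section Tensor

variable {A : Type u} [Ring A] [Algebra ℂ A] (𝒜 : ℤ → Submodule ℂ A)

/-- The component `A_p e` of degree `p` of the left ideal `A e`, for an idempotent `e`. -/
def rightCut (e : A) (p : ℤ) : Submodule ℂ A where
  carrier := {x | x ∈ 𝒜 p ∧ x * e = x}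
  add_mem' := fun ha hb => ⟨add_mem ha.1 hb.1, by rw [add_mul, ha.2, hb.2]⟩
  zero_mem' := ⟨zero_mem _, zero_mul _⟩
  smul_mem' := fun c x hx => ⟨Submodule.smul_mem _ c hx.1, by rw [smul_mul_assoc, hx.2]⟩

variable [SetLike.GradedMonoid 𝒜]

/-- Left multiplication on `A e`. -/
def cutMul (e : A) {m p q : ℤ} (h : m + p = q) :
    𝒜 m →ₗ[ℂ] rightCut 𝒜 e p →ₗ[ℂ] rightCut 𝒜 e q :=
  LinearMap.mk₂ ℂ (fun a x => ⟨a * x, h ▸ SetLike.mul_mem_graded a.2 x.2.1, by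
      rw [mul_assoc, x.2.2]⟩)
    (fun _ _ _ => Subtype.ext (add_mul _ _ _)) (fun _ _ _ => Subtype.ext (smul_mul_assoc _ _ _))
    (fun _ _ _ => Subtype.ext (mul_add _ _ _)) (fun _ _ _ => Subtype.ext (mul_smul_comm _ _ _))

@[simp] lemma coe_cutMul (e : A) {m p q : ℤ} (h : m + p = q) (a : 𝒜 m) (x : rightCut 𝒜 e p) :
    (cutMul 𝒜 e h a x : A) = a * x := rfl

variable [FiniteDimensional ℂ A]

/-- The graded left module `A e`. -/
def idealMod (e : A) : GrMod 𝒜 where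
  V p := rightCut 𝒜 e p
  act h := cutMul 𝒜 e h
  one_act h a v ha := Subtype.ext (by simp [ha])
  mul_act h₁ h₂ h₃ a b c v hc := Subtype.ext (by simp [hc, mul_assoc])

end Tensor

/-! ### Linear complexes and the quadratic duality functor on complexes -/

section Koszul

open GrMod

variable {A : Type u} [Ring A] [Algebra ℂ A] (𝒜 : ℤ → Submodule ℂ A)
  [SetLike.GradedMonoid 𝒜]

/-- `A_p ⊗_{A₀} N_k` for a graded `A^!`-module `N`. -/
abbrev IndComp (N : GrMod (QDual.gr 𝒜)) (p k : ℤ) : Type u :=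
  Bal (X := 𝒜 p) (Y := N.V k) (S := 𝒜 0) (fun x s => lmul 𝒜 (add_zero p) x s)
    (fun s v => N.act (zero_add k) (QDual.deg0 𝒜 s) v)

variable {𝒜} in
/-- The class of `x ⊗ v`. -/
def IndComp.mk (N : GrMod (QDual.gr 𝒜)) {p k : ℤ} (x : 𝒜 p) (v : N.V k) : IndComp 𝒜 N p k :=
  Submodule.Quotient.mk (x ⊗ₜ v)

variable {𝒜} in
lemma IndComp.mk_smul (N : GrMod (QDual.gr 𝒜)) {p k : ℤ} (x : 𝒜 p) (s : 𝒜 0) (v : N.V k) :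
    mk N (lmul 𝒜 (add_zero p) x s) v = mk N x (N.act (zero_add k) (QDual.deg0 𝒜 s) v) :=
  (Submodule.Quotient.eq _).2 (Submodule.subset_span ⟨x, s, v, rfl⟩)

variable {𝒜} in
lemma IndComp.hom_ext {N : GrMod (QDual.gr 𝒜)} {p k : ℤ} {W : Type u} [AddCommGroup W] [Module ℂ W]
    {f g : IndComp 𝒜 N p k →ₗ[ℂ] W} (h : ∀ x v, f (mk N x v) = g (mk N x v)) : f = g := by
  apply Submodule.linearMap_qext
  apply TensorProduct.ext'
  exact h

variable [FiniteDimensional ℂ A]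

/-- The graded `A`-module `A ⊗_{A₀} N_k`, with `a ⊗ v` in degree `deg a - k`. -/
def ind (k : ℤ) (N : GrMod (QDual.gr 𝒜)) : GrMod 𝒜 where
  V j := IndComp 𝒜 N (j + k) k
  act {n i j} h :=
    { toFun := fun a => Bal.map (lmul 𝒜 (show n + (i + k) = j + k by omega) a) id LinearMap.id
        (fun x s => Subtype.ext (by simp [mul_assoc])) (fun _ _ => rfl)
      map_add' := fun a b => IndComp.hom_ext fun x v => congrArg (Submodule.Quotient.mk) (by
        simp [TensorProduct.add_tmul])
      map_smul' := fun c a => IndComp.hom_ext fun x v => congrArg (Submodule.Quotient.mk) (by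
        simp [TensorProduct.smul_tmul']) }
  one_act {i} h a v ha := by
    have : (Bal.map (lmul 𝒜 (show 0 + (i + k) = i + k by omega) a) id LinearMap.id
        (fun x s => Subtype.ext (by simp [mul_assoc])) (fun _ _ => rfl) :
        IndComp 𝒜 N (i + k) k →ₗ[ℂ] IndComp 𝒜 N (i + k) k) = LinearMap.id :=
      IndComp.hom_ext fun x v => congrArg (fun y => IndComp.mk N y v) (Subtype.ext (by simp [ha]))
    exact LinearMap.congr_fun this v
  mul_act {m n p i j l} h₁ h₂ h₃ a b c v hc := by
    have : (Bal.map (lmul 𝒜 (show p + (i + k) = l + k by omega) c) id LinearMap.id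
        (fun x s => Subtype.ext (by simp [mul_assoc])) (fun _ _ => rfl) :
        IndComp 𝒜 N (i + k) k →ₗ[ℂ] IndComp 𝒜 N (l + k) k) =
        (Bal.map (lmul 𝒜 (show m + (j + k) = l + k by omega) a) id LinearMap.id
        (fun x s => Subtype.ext (by simp [mul_assoc])) (fun _ _ => rfl) :
        IndComp 𝒜 N (j + k) k →ₗ[ℂ] IndComp 𝒜 N (l + k) k) ∘ₗ
        (Bal.map (lmul 𝒜 (show n + (i + k) = j + k by omega) b) id LinearMap.id
        (fun x s => Subtype.ext (by simp [mul_assoc])) (fun _ _ => rfl)) :=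
      IndComp.hom_ext fun x v => congrArg (fun y => IndComp.mk N y v)
        (Subtype.ext (by simp [hc, mul_assoc]))
    exact LinearMap.congr_fun this v

variable {𝒜} in
/-- The class of `x ⊗ v` in `A ⊗_{A₀} N_k`. -/
def indMk {k : ℤ} (N : GrMod (QDual.gr 𝒜)) {j : ℤ} (x : 𝒜 (j + k)) (v : N.V k) :
    (ind 𝒜 k N).V j := IndComp.mk N x v

/-- The class of `x ⊗ v` as a bilinear function. -/
def indMk₂ {k : ℤ} (N : GrMod (QDual.gr 𝒜)) (j : ℤ) :
    𝒜 (j + k) →ₗ[ℂ] N.V k →ₗ[ℂ] (ind 𝒜 k N).V j :=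
  (TensorProduct.mk ℂ _ _).compr₂ (balRel _ _).mkQ

lemma indMk₂_apply {k : ℤ} (N : GrMod (QDual.gr 𝒜)) {j : ℤ} (x : 𝒜 (j + k)) (v : N.V k) :
    indMk₂ 𝒜 N j x v = indMk N x v := rfl

lemma ind_act_mk (k : ℤ) (N : GrMod (QDual.gr 𝒜)) {n i j : ℤ} (h : n + i = j) (a : 𝒜 n)
    (x : 𝒜 (i + k)) (v : N.V k) :
    (ind 𝒜 k N).act h a (indMk N x v) =
      indMk N (lmul 𝒜 (show n + (i + k) = j + k by omega) a x) v := rfl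

/-- Functoriality of `A ⊗_{A₀} N_k` in `N`. -/
def indMap (k : ℤ) {M N : GrMod (QDual.gr 𝒜)} (f : M ⟶ N) : ind 𝒜 k M ⟶ ind 𝒜 k N :=
  mkHom (fun j => Bal.map LinearMap.id id (app f k) (fun _ _ => rfl)
      (fun s v => app_act f _ _ v)) (fun {n i j} h a v => by
    have : (Bal.map LinearMap.id id (app f k) (fun _ _ => rfl) (fun s v => app_act f _ _ v) :
        IndComp 𝒜 M (j + k) k →ₗ[ℂ] IndComp 𝒜 N (j + k) k) ∘ₗ (ind 𝒜 k M).act h a =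
        (ind 𝒜 k N).act h a ∘ₗ
        (Bal.map LinearMap.id id (app f k) (fun _ _ => rfl) (fun s v => app_act f _ _ v) :
        IndComp 𝒜 M (i + k) k →ₗ[ℂ] IndComp 𝒜 N (i + k) k) :=
      IndComp.hom_ext fun x v => rfl
    exact LinearMap.congr_fun this v)

lemma indMap_mk (k : ℤ) {M N : GrMod (QDual.gr 𝒜)} (f : M ⟶ N) (j : ℤ) (x : 𝒜 (j + k))
    (v : M.V k) : app (indMap 𝒜 k f) j (indMk M x v) = indMk N x (app f k v) := rfl

lemma ind_hom_ext {k : ℤ} {N : GrMod (QDual.gr 𝒜)} {P : GrMod 𝒜} {f g : ind 𝒜 k N ⟶ P}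
    (h : ∀ j (x : 𝒜 (j + k)) (v : N.V k), app f j (indMk N x v) = app g j (indMk N x v)) :
    f = g :=
  GrMod.hom_ext fun j => IndComp.hom_ext (h j)

/-- A basis of `A₁`. -/
abbrev basis1 := Module.finBasis ℂ (𝒜 1)

/-- Right multiplication by an element of degree `1`. -/
abbrev rmul1 (j k : ℤ) (b : 𝒜 1) : 𝒜 (j + k) →ₗ[ℂ] 𝒜 (j + (k + 1)) :=
  (lmul 𝒜 (add_assoc j k 1)).flip b

/-- The action of an element of `A₁⋆ ⊆ A^!` on a graded `A^!`-module. -/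
abbrev dualAct (N : GrMod (QDual.gr 𝒜)) (k : ℤ) (f : Module.Dual ℂ (𝒜 1)) :
    N.V k →ₗ[ℂ] N.V (k + 1) := N.act (add_comm 1 k) (QDual.deg1 𝒜 f)

lemma sum_smul_basis (M : Type u) [AddCommGroup M] [Module ℂ M]
    (β : 𝒜 1 →ₗ[ℂ] Module.Dual ℂ (𝒜 1) →ₗ[ℂ] M) (σ : 𝒜 1 →ₗ[ℂ] 𝒜 1) :
    ∑ i, β (σ (basis1 𝒜 i)) ((basis1 𝒜).coord i) =
      ∑ i, β (basis1 𝒜 i) ((basis1 𝒜).coord i ∘ₗ σ) := by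
  have h1 : ∀ i, σ (basis1 𝒜 i) = ∑ l, (basis1 𝒜).coord l (σ (basis1 𝒜 i)) • basis1 𝒜 l :=
    fun i => ((basis1 𝒜).sum_repr _).symm
  have h2 : ∀ l, (basis1 𝒜).coord l ∘ₗ σ =
      ∑ i, (basis1 𝒜).coord l (σ (basis1 𝒜 i)) • (basis1 𝒜).coord i := by
    intro l
    apply (basis1 𝒜).ext
    intro i
    simp [Finsupp.single_apply]
  simp_rw [h2]
  conv_lhs => enter [2, i]; rw [h1 i]
  simp only [map_sum, map_smul, LinearMap.sum_apply, LinearMap.smul_apply]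
  rw [Finset.sum_comm]

/-- The map `A ⊗_{A₀} N_k → A ⊗_{A₀} N_{k+1}`, `a ⊗ v ↦ ∑ᵢ a bᵢ ⊗ bᵢ* v`, where `bᵢ` is a basis of
`A₁` and `bᵢ*` is the dual basis of `A₁⋆ = A^!₁`. Here `v ↦ ∑ᵢ bᵢ ⊗ bᵢ* v` is the map
`N_k → A₁ ⊗_{A₀} N_{k+1}` adjoint to the action `A^!₁ ⊗_{A₀} N_k → N_{k+1}`. -/
def koszulLin (k : ℤ) (N : GrMod (QDual.gr 𝒜)) (j : ℤ) :
    (ind 𝒜 k N).V j →ₗ[ℂ] (ind 𝒜 (k + 1) N).V j :=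
  Submodule.liftQ _
    (∑ i, (balRel _ _).mkQ ∘ₗ TensorProduct.map (rmul1 𝒜 j k (basis1 𝒜 i))
      (dualAct 𝒜 N k ((basis1 𝒜).coord i))) (by
    rw [balRel, Submodule.span_le]
    rintro _ ⟨x, s, v, rfl⟩
    simp only [SetLike.mem_coe, LinearMap.mem_ker, map_sub, LinearMap.sum_apply, sub_eq_zero]
    let β : 𝒜 1 →ₗ[ℂ] Module.Dual ℂ (𝒜 1) →ₗ[ℂ] (ind 𝒜 (k + 1) N).V j :=
      (indMk₂ 𝒜 N j).compl₁₂ (lmul 𝒜 (add_assoc j k 1) x)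
        (((N.act (add_comm 1 k)).flip v) ∘ₗ QDual.deg1 𝒜)
    refine Eq.trans ?_ ((sum_smul_basis 𝒜 _ β (lmul 𝒜 (zero_add 1) s)).trans ?_)
    · refine Finset.sum_congr rfl fun i _ => ?_
      refine congrArg (fun y => IndComp.mk N y _) (Subtype.ext ?_)
      simp [mul_assoc]
    · refine Finset.sum_congr rfl fun i _ => ?_
      refine congrArg (fun y => IndComp.mk N _ y) ?_
      refine N.mul_act _ _ _ (QDual.deg1 𝒜 ((basis1 𝒜).coord i)) (QDual.deg0 𝒜 s)
        (QDual.deg1 𝒜 _) v ?_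
      refine (QDual.gen1_mul_gen0 𝒜 _ _ s fun m m' h => ?_).symm
      have h' : m' = lmul 𝒜 (zero_add 1) s m := Subtype.ext h
      rw [h']
      rfl)

lemma koszulLin_mk (k : ℤ) (N : GrMod (QDual.gr 𝒜)) (j : ℤ) (x : 𝒜 (j + k)) (v : N.V k) :
    koszulLin 𝒜 k N j (indMk N x v) =
      ∑ i, (indMk N (rmul1 𝒜 j k (basis1 𝒜 i) x) (dualAct 𝒜 N k ((basis1 𝒜).coord i) v) :
        (ind 𝒜 (k + 1) N).V j) := by
  change (∑ l, _ : _ →ₗ[ℂ] _) (_ ⊗ₜ _) = _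
  rw [LinearMap.sum_apply]
  rfl

/-- The differential `A ⊗_{A₀} N_k → A ⊗_{A₀} N_{k+1}` of the linear complex attached to `N`,
as a morphism of graded modules. -/
def koszulD (k : ℤ) (N : GrMod (QDual.gr 𝒜)) : ind 𝒜 k N ⟶ ind 𝒜 (k + 1) N :=
  mkHom (koszulLin 𝒜 k N) (fun {n i j} h a v => by
    refine LinearMap.congr_fun (IndComp.hom_ext
      (f := koszulLin 𝒜 k N j ∘ₗ (ind 𝒜 k N).act h a)
      (g := (ind 𝒜 (k + 1) N).act h a ∘ₗ koszulLin 𝒜 k N i) fun x v => ?_) v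
    change koszulLin 𝒜 k N j ((ind 𝒜 k N).act h a (indMk N x v)) =
      (ind 𝒜 (k + 1) N).act h a (koszulLin 𝒜 k N i (indMk N x v))
    rw [ind_act_mk, koszulLin_mk, koszulLin_mk, map_sum]
    refine Finset.sum_congr rfl fun l _ => ?_
    rw [ind_act_mk]
    exact congrArg (fun y => indMk N y _) (Subtype.ext (by simp [mul_assoc])))

lemma koszulD_mk (k : ℤ) (N : GrMod (QDual.gr 𝒜)) (j : ℤ) (x : 𝒜 (j + k)) (v : N.V k) :
    app (koszulD 𝒜 k N) j (indMk N x v) =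
      ∑ i, (indMk N (rmul1 𝒜 j k (basis1 𝒜 i) x) (dualAct 𝒜 N k ((basis1 𝒜).coord i) v) :
        (ind 𝒜 (k + 1) N).V j) :=
  koszulLin_mk 𝒜 k N j x v

lemma koszulD_naturality (k : ℤ) {M N : GrMod (QDual.gr 𝒜)} (f : M ⟶ N) :
    koszulD 𝒜 k M ≫ indMap 𝒜 (k + 1) f = indMap 𝒜 k f ≫ koszulD 𝒜 k N := by
  refine ind_hom_ext 𝒜 fun j x v => ?_
  rw [comp_app, comp_app, LinearMap.comp_apply, LinearMap.comp_apply]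
  rw [koszulD_mk, indMap_mk, koszulD_mk, map_sum]
  refine Finset.sum_congr rfl fun i _ => ?_
  rw [indMap_mk]
  exact congrArg (fun y => indMk N _ y) (app_act f _ _ v)

lemma koszulD_comp (k : ℤ) (N : GrMod (QDual.gr 𝒜)) :
    koszulD 𝒜 k N ≫ koszulD 𝒜 (k + 1) N = 0 := by
  refine ind_hom_ext 𝒜 fun j x v => ?_
  rw [comp_app, LinearMap.comp_apply, koszulD_mk, map_sum]
  simp_rw [koszulD_mk]
  let b := basis1 𝒜
  let c := Module.finBasis ℂ (𝒜 2)
  let ν (r) (i l) : ℂ := c.coord r (lmul 𝒜 one_add_one_eq_two (b i) (b l))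
  have hx : ∀ i l, rmul1 𝒜 j (k + 1) (b l) (rmul1 𝒜 j k (b i) x) =
      ∑ r, ν r i l • lmul 𝒜 (show j + k + 2 = j + (k + 1 + 1) by omega) x (c r) := by
    intro i l
    have h1 : rmul1 𝒜 j (k + 1) (b l) (rmul1 𝒜 j k (b i) x) =
        lmul 𝒜 (show j + k + 2 = j + (k + 1 + 1) by omega) x
          (lmul 𝒜 one_add_one_eq_two (b i) (b l)) :=
      Subtype.ext (by simp [mul_assoc])
    rw [h1]
    conv_lhs => rw [← c.sum_repr (lmul 𝒜 one_add_one_eq_two (b i) (b l))]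
    rw [map_sum]
    simp only [map_smul]
    rfl
  let γ (i l) : QDual.gr 𝒜 2 := ⟨_, QDual.gen1_mul_gen1_mem 𝒜 (b.coord l) (b.coord i)⟩
  have hv : ∀ i l, dualAct 𝒜 N (k + 1) (b.coord l) (dualAct 𝒜 N k (b.coord i) v) =
      N.act (show 2 + k = k + 1 + 1 by omega) (γ i l) v := fun i l =>
    (N.mul_act _ _ _ _ _ _ v rfl).symm
  have hrel : ∀ r, ∑ i, ∑ l, ν r i l • γ i l = 0 := by
    intro r
    apply Subtype.ext
    have := QDual.quad' 𝒜 (ι := _ × _) (fun il => ν r il.1 il.2 • b.coord il.2)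
      (fun il => b.coord il.1) (c.coord r) (fun m n => by
        conv_rhs => rw [← b.sum_repr m, ← b.sum_repr n]
        simp only [map_sum, map_smul, LinearMap.sum_apply, LinearMap.smul_apply]
        rw [Fintype.sum_prod_type, Finset.sum_comm]
        refine Finset.sum_congr rfl fun i _ => ?_
        rw [Finset.smul_sum]
        refine Finset.sum_congr rfl fun l _ => ?_
        simp only [smul_eq_mul, ν, Module.Basis.coord_apply]
        ring)
    rw [Fintype.sum_prod_type] at this
    simpa [γ] using this
  have key : ∑ i, ∑ l, indMk₂ 𝒜 N j (rmul1 𝒜 j (k + 1) (b l) (rmul1 𝒜 j k (b i) x))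
      (dualAct 𝒜 N (k + 1) (b.coord l) (dualAct 𝒜 N k (b.coord i) v)) = 0 := by
    simp_rw [hx, hv, map_sum, LinearMap.sum_apply, map_smul, LinearMap.smul_apply]
    have : ∀ r, ∑ i, ∑ l, ν r i l • indMk₂ 𝒜 N j
        (lmul 𝒜 (show j + k + 2 = j + (k + 1 + 1) by omega) x (c r))
        (N.act (show 2 + k = k + 1 + 1 by omega) (γ i l) v) = 0 := by
      intro r
      have h2 := congrArg (fun g => indMk₂ 𝒜 N j
        (lmul 𝒜 (show j + k + 2 = j + (k + 1 + 1) by omega) x (c r))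
        (N.act (show 2 + k = k + 1 + 1 by omega) g v)) (hrel r)
      simpa only [map_sum, map_smul, LinearMap.sum_apply, LinearMap.smul_apply, map_zero,
        LinearMap.zero_apply] using h2
    refine (Finset.sum_congr rfl fun i _ => Finset.sum_comm).trans ?_
    rw [Finset.sum_comm]
    exact Finset.sum_eq_zero fun r _ => this r
  exact key

lemma indMap_id (k : ℤ) (N : GrMod (QDual.gr 𝒜)) : indMap 𝒜 k (𝟙 N) = 𝟙 _ :=
  ind_hom_ext 𝒜 fun _ _ _ => rfl

lemma indMap_comp (k : ℤ) {M N P : GrMod (QDual.gr 𝒜)} (f : M ⟶ N) (g : N ⟶ P) :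
    indMap 𝒜 k (f ≫ g) = indMap 𝒜 k f ≫ indMap 𝒜 k g :=
  ind_hom_ext 𝒜 fun _ _ _ => rfl

lemma indMap_zero (k : ℤ) (M N : GrMod (QDual.gr 𝒜)) : indMap 𝒜 k (0 : M ⟶ N) = 0 :=
  ind_hom_ext 𝒜 fun j x _ => (indMk₂ 𝒜 N j x).map_zero

end Koszul

section Tot

open GrMod

variable {A : Type u} [Ring A] [Algebra ℂ A] (𝒜 : ℤ → Submodule ℂ A)
  [GradedAlgebra 𝒜] [FiniteDimensional ℂ A]

lemma finite_ne_bot : {n : ℤ | 𝒜 n ≠ ⊥}.Finite :=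
  WellFoundedGT.finite_ne_bot_of_iSupIndep (DirectSum.Decomposition.isInternal 𝒜).submodule_iSupIndep

lemma ind_subsingleton {k j : ℤ} (N : GrMod (QDual.gr 𝒜))
    (h : 𝒜 (j + k) = ⊥ ∨ Subsingleton (N.V k)) : Subsingleton ((ind 𝒜 k N).V j) := by
  refine subsingleton_of_forall_eq 0 fun y => ?_
  have : (LinearMap.id : (ind 𝒜 k N).V j →ₗ[ℂ] (ind 𝒜 k N).V j) = 0 := by
    refine IndComp.hom_ext fun x v => ?_
    change indMk₂ 𝒜 N j x v = 0
    rcases h with h | h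
    · have : x = 0 := Subtype.ext ((Submodule.mem_bot ℂ).1 (h ▸ x.2))
      rw [this, map_zero, LinearMap.zero_apply]
    · rw [Subsingleton.elim v 0, map_zero]
  exact LinearMap.congr_fun this y

/-- Pairs `(i, k)` with `i + k = n`. -/
abbrev Pairs (n : ℤ) : Type := {p : ℤ × ℤ // p.1 + p.2 = n}

lemma ind_finite (M : ℤ → GrMod (QDual.gr 𝒜)) (n j : ℤ) :
    {p : Pairs n | Nontrivial ((ind 𝒜 p.1.2 (M p.1.1)).V j)}.Finite := by
  have hinj : Function.Injective fun p : Pairs n => j + p.1.2 := by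
    rintro ⟨⟨a, b⟩, h⟩ ⟨⟨c, d⟩, h'⟩ hp
    simp only at h h' hp
    obtain rfl : b = d := by omega
    obtain rfl : a = c := by omega
    rfl
  refine ((finite_ne_bot 𝒜).preimage hinj.injOn).subset fun p hp => ?_
  intro h
  have := ind_subsingleton 𝒜 (M p.1.1) (Or.inl h)
  exact not_nontrivial_iff_subsingleton.2 this hp

/-- The term of degree `n` of the total complex: `⨁_{i + k = n} A ⊗_{A₀} (Mⁱ)_k`. -/
def totX (M : ℤ → GrMod (QDual.gr 𝒜)) (n : ℤ) : GrMod 𝒜 :=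
  dsum (fun p : Pairs n => ind 𝒜 p.1.2 (M p.1.1)) (ind_finite 𝒜 M n)

/-- The inclusion of the summand with index `(i, k)`. -/
def totInj (M : ℤ → GrMod (QDual.gr 𝒜)) {n i k : ℤ} (h : i + k = n) :
    ind 𝒜 k (M i) ⟶ totX 𝒜 M n :=
  inj (N := fun p : Pairs n => ind 𝒜 p.1.2 (M p.1.1)) ⟨(i, k), h⟩

/-- The morphism out of the total complex with given components. -/
def totDesc (M : ℤ → GrMod (QDual.gr 𝒜)) {n : ℤ} {P : GrMod 𝒜}
    (f : ∀ i k : ℤ, i + k = n → (ind 𝒜 k (M i) ⟶ P)) : totX 𝒜 M n ⟶ P :=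
  desc fun p : Pairs n => f p.1.1 p.1.2 p.2

@[simp] lemma totInj_desc (M : ℤ → GrMod (QDual.gr 𝒜)) {n i k : ℤ} {P : GrMod 𝒜}
    (f : ∀ i k : ℤ, i + k = n → (ind 𝒜 k (M i) ⟶ P)) (h : i + k = n) :
    totInj 𝒜 M h ≫ totDesc 𝒜 M f = f i k h :=
  inj_desc _ _

@[simp] lemma totInj_desc_assoc (M : ℤ → GrMod (QDual.gr 𝒜)) {n i k : ℤ} {P Q : GrMod 𝒜}
    (f : ∀ i k : ℤ, i + k = n → (ind 𝒜 k (M i) ⟶ P)) (h : i + k = n) (g : P ⟶ Q) :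
    totInj 𝒜 M h ≫ totDesc 𝒜 M f ≫ g = f i k h ≫ g := by
  rw [← Category.assoc, totInj_desc]

lemma tot_ext {M : ℤ → GrMod (QDual.gr 𝒜)} {n : ℤ} {P : GrMod 𝒜} {f g : totX 𝒜 M n ⟶ P}
    (h : ∀ i k (hik : i + k = n), totInj 𝒜 M hik ≫ f = totInj 𝒜 M hik ≫ g) : f = g :=
  dsum_ext fun p => h p.1.1 p.1.2 p.2

/-- The total differential: on the summand `A ⊗_{A₀} (Mⁱ)_k` it is the map induced by
the differential of `M` plus `(-1)ⁱ` times the differential of the linear complex. -/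
def totD (M : CochainComplex (GrMod (QDual.gr 𝒜)) ℤ) {n m : ℤ} (h : n + 1 = m) :
    totX 𝒜 M.X n ⟶ totX 𝒜 M.X m :=
  totDesc 𝒜 M.X fun i k hik =>
    indMap 𝒜 k (M.d i (i + 1)) ≫ totInj 𝒜 M.X (by omega : i + 1 + k = m) +
      i.negOnePow • (koszulD 𝒜 k (M.X i) ≫ totInj 𝒜 M.X (by omega : i + (k + 1) = m))

lemma totD_comp (M : CochainComplex (GrMod (QDual.gr 𝒜)) ℤ) {n m l : ℤ} (h : n + 1 = m)
    (h' : m + 1 = l) : totD 𝒜 M h ≫ totD 𝒜 M h' = 0 := by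
  refine tot_ext 𝒜 fun i k hik => ?_
  simp only [totD, totInj_desc_assoc, Preadditive.add_comp, Category.assoc, totInj_desc,
    Preadditive.comp_add, Linear.units_smul_comp, Linear.comp_units_smul, comp_zero,
    ← reassoc_of% (indMap_comp 𝒜 k), HomologicalComplex.d_comp_d, indMap_zero, zero_comp,
    Int.negOnePow_succ, smul_add, zero_add]
  rw [← reassoc_of% (koszulD_naturality 𝒜 k), reassoc_of% (koszulD_comp 𝒜 k)]
  simp

/-- The quadratic duality functor on complexes: the total complex of the complex of linear
complexes of `A`-modules attached to the complex `M` of graded `A^!`-modules. -/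
def koszulCom : CochainComplex (GrMod (QDual.gr 𝒜)) ℤ ⥤ CochainComplex (GrMod 𝒜) ℤ where
  obj M :=
    { X := totX 𝒜 M.X
      d := fun n m => if h : n + 1 = m then totD 𝒜 M h else 0
      shape := fun n m h => dif_neg h
      d_comp_d' := fun n m l h h' => by
        have h : n + 1 = m := h
        have h' : m + 1 = l := h'
        rw [dif_pos h, dif_pos h', totD_comp] }
  map {M N} f :=
    { f := fun n => totDesc 𝒜 M.X fun i k hik => indMap 𝒜 k (f.f i) ≫ totInj 𝒜 N.X hik
      comm' := fun n m h => by
        have h : n + 1 = m := h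
        dsimp only
        rw [dif_pos h, dif_pos h]
        refine tot_ext 𝒜 fun i k hik => ?_
        simp only [totD, totInj_desc_assoc, Preadditive.add_comp, Category.assoc, totInj_desc,
          Preadditive.comp_add, Linear.units_smul_comp, Linear.comp_units_smul,
          ← reassoc_of% (indMap_comp 𝒜 k), HomologicalComplex.Hom.comm]
        rw [reassoc_of% (koszulD_naturality 𝒜 k)] }
  map_id M := by
    ext n : 1
    refine tot_ext 𝒜 fun i k hik => ?_
    simp [indMap_id]
  map_comp f g := by
    ext n : 1
    refine tot_ext 𝒜 fun i k hik => ?_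
    simp [indMap_comp]

end Tot

section TensorFunctor

open GrMod

variable {A : Type u} [Ring A] [Algebra ℂ A] (𝒜 : ℤ → Submodule ℂ A)
  [GradedAlgebra 𝒜] [FiniteDimensional ℂ A]
  {B : Type u} [Ring B] [Algebra ℂ B] (ℬ : ℤ → Submodule ℂ B)
  {e : A} {he : IsIdempotentElem e} (ψ : B →ₐ[ℂ] he.Corner)
  (hψ : ∀ n, ∀ b ∈ ℬ n, ψ b ∈ cornerGr he 𝒜 n)

/-- The right action `x · b = x ψ(b)` of `B` on `A e`. -/
def cutAct {p n q : ℤ} (h : p + n = q) (x : rightCut 𝒜 e p) (b : ℬ n) : rightCut 𝒜 e q :=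
  ⟨x * cornerVal he (ψ b), h ▸ SetLike.mul_mem_graded x.2.1 (hψ n b b.2), by
    rw [mul_assoc, cornerVal_mul_right]⟩

/-- `⨁_{p + q = j} (A_p e) ⊗_ℂ M_q`. -/
abbrev TensFree (e : A) (M : GrMod ℬ) (j : ℤ) : Type u :=
  ⨁ pq : Pairs j, rightCut 𝒜 e pq.1.1 ⊗[ℂ] M.V pq.1.2

instance (e : A) (M : GrMod ℬ) (j : ℤ) : AddCommGroup (TensFree 𝒜 ℬ e M j) :=
  DirectSum.instAddCommGroup (β := fun pq : Pairs j => rightCut 𝒜 e pq.1.1 ⊗[ℂ] M.V pq.1.2)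

variable {ℬ} in
/-- The element `x ⊗ v` of `⨁_{p + q = j} (A_p e) ⊗_ℂ M_q`. -/
def tensFreeMk (M : GrMod ℬ) {p q j : ℤ} (h : p + q = j) (x : rightCut 𝒜 e p) (v : M.V q) :
    TensFree 𝒜 ℬ e M j :=
  DirectSum.lof ℂ (Pairs j) (fun pq => rightCut 𝒜 e pq.1.1 ⊗[ℂ] M.V pq.1.2) ⟨(p, q), h⟩ (x ⊗ₜ v)

/-- The span of the elements `x ψ(b) ⊗ v - x ⊗ b v` of degree `j`. -/
def tensRel (M : GrMod ℬ) (j : ℤ) : Submodule ℂ (TensFree 𝒜 ℬ e M j) :=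
  Submodule.span ℂ {t | ∃ (p n q : ℤ) (h : p + n + q = j) (x : rightCut 𝒜 e p) (b : ℬ n)
    (v : M.V q), t = tensFreeMk 𝒜 M h (cutAct 𝒜 ℬ ψ hψ rfl x b) v -
      tensFreeMk 𝒜 M ((add_assoc p n q).symm.trans h) x (M.act rfl b v)}

variable {𝒜 ℬ} in
lemma tensFree_ext {M : GrMod ℬ} {j : ℤ} {W : Type u} [AddCommGroup W] [Module ℂ W]
    {f g : TensFree 𝒜 ℬ e M j →ₗ[ℂ] W}
    (h : ∀ (p q : ℤ) (h : p + q = j) (x : rightCut 𝒜 e p) (v : M.V q),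
      f (tensFreeMk 𝒜 M h x v) = g (tensFreeMk 𝒜 M h x v)) : f = g := by
  apply DirectSum.linearMap_ext
  rintro ⟨⟨p, q⟩, hpq⟩
  apply TensorProduct.ext'
  exact h p q hpq

/-- Left multiplication by `a` on `⨁_{p + q = j} (A_p e) ⊗_ℂ M_q`. -/
def tensFreeAct (M : GrMod ℬ) {m i j : ℤ} (h : m + i = j) (a : 𝒜 m) :
    TensFree 𝒜 ℬ e M i →ₗ[ℂ] TensFree 𝒜 ℬ e M j :=
  DirectSum.toModule ℂ _ _ fun pq =>
    DirectSum.lof ℂ (Pairs j) (fun pq => rightCut 𝒜 e pq.1.1 ⊗[ℂ] M.V pq.1.2)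
      ⟨(m + pq.1.1, pq.1.2), by have := pq.2; simp only; omega⟩ ∘ₗ
        LinearMap.rTensor _ (cutMul 𝒜 e rfl a)

lemma tensFreeAct_mk (M : GrMod ℬ) {m i j : ℤ} (h : m + i = j) (a : 𝒜 m) {p q : ℤ}
    (hpq : p + q = i) (x : rightCut 𝒜 e p) (v : M.V q) :
    tensFreeAct 𝒜 ℬ M h a (tensFreeMk 𝒜 M hpq x v) =
      tensFreeMk 𝒜 M (by omega : m + p + q = j) (cutMul 𝒜 e rfl a x) v := by
  simp only [tensFreeAct, tensFreeMk]
  erw [DirectSum.toModule_lof]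
  rfl

lemma tensFreeMk_congr (M : GrMod ℬ) {p p' q j : ℤ} (h : p + q = j) (h' : p' + q = j)
    (x : rightCut 𝒜 e p) (x' : rightCut 𝒜 e p') (v : M.V q) (hx : (x : A) = x') :
    tensFreeMk 𝒜 M h x v = tensFreeMk 𝒜 M h' x' v := by
  obtain rfl : p = p' := by omega
  rw [Subtype.ext hx]

/-- The component of degree `j` of `A e ⊗_B M`. -/
abbrev TensComp (M : GrMod ℬ) (j : ℤ) : Type u := TensFree 𝒜 ℬ e M j ⧸ tensRel 𝒜 ℬ ψ hψ M j

variable {𝒜 ℬ ψ hψ} in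
lemma tens_ext {M : GrMod ℬ} {j : ℤ} {W : Type u} [AddCommGroup W] [Module ℂ W]
    {f g : TensComp 𝒜 ℬ ψ hψ M j →ₗ[ℂ] W}
    (h : ∀ (p q : ℤ) (h : p + q = j) (x : rightCut 𝒜 e p) (v : M.V q),
      f (Submodule.Quotient.mk (tensFreeMk 𝒜 M h x v)) =
        g (Submodule.Quotient.mk (tensFreeMk 𝒜 M h x v))) : f = g := by
  apply Submodule.linearMap_qext
  exact tensFree_ext h

/-- Left multiplication by `a` on `A e ⊗_B M`. -/
def tensAct (M : GrMod ℬ) {m i j : ℤ} (h : m + i = j) (a : 𝒜 m) :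
    TensComp 𝒜 ℬ ψ hψ M i →ₗ[ℂ] TensComp 𝒜 ℬ ψ hψ M j :=
  Submodule.mapQ _ _ (tensFreeAct 𝒜 ℬ M h a) <| by
    rw [tensRel, Submodule.span_le]
    rintro _ ⟨p, n, q, hi, x, b, v, rfl⟩
    refine Submodule.subset_span ⟨m + p, n, q, by omega, cutMul 𝒜 e rfl a x, b, v, ?_⟩
    rw [map_sub, tensFreeAct_mk, tensFreeAct_mk]
    congr 1
    exact tensFreeMk_congr _ _ _ _ _ _ _ _ (mul_assoc _ _ _).symm

lemma tensAct_mk (M : GrMod ℬ) {m i j : ℤ} (h : m + i = j) (a : 𝒜 m) {p q : ℤ}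
    (hpq : p + q = i) (x : rightCut 𝒜 e p) (v : M.V q) :
    tensAct 𝒜 ℬ ψ hψ M h a (Submodule.Quotient.mk (tensFreeMk 𝒜 M hpq x v)) =
      Submodule.Quotient.mk
        (tensFreeMk 𝒜 M (by omega : m + p + q = j) (cutMul 𝒜 e rfl a x) v) :=
  congrArg Submodule.Quotient.mk (tensFreeAct_mk ..)

lemma tensFreeMk_add (M : GrMod ℬ) {p q j : ℤ} (h : p + q = j) (x y : rightCut 𝒜 e p)
    (v : M.V q) : tensFreeMk 𝒜 M h (x + y) v = tensFreeMk 𝒜 M h x v + tensFreeMk 𝒜 M h y v := by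
  simp only [tensFreeMk, TensorProduct.add_tmul, map_add]

lemma tensFreeMk_smul (M : GrMod ℬ) {p q j : ℤ} (h : p + q = j) (c : ℂ) (x : rightCut 𝒜 e p)
    (v : M.V q) : tensFreeMk 𝒜 M h (c • x) v = c • tensFreeMk 𝒜 M h x v := by
  simp only [tensFreeMk]
  rw [← TensorProduct.smul_tmul', map_smul]

lemma tensFree_finite (e : A) (M : GrMod ℬ) (j : ℤ) :
    FiniteDimensional ℂ (TensFree 𝒜 ℬ e M j) := by
  refine finite_directSum (V := fun pq : Pairs j => rightCut 𝒜 e pq.1.1 ⊗[ℂ] M.V pq.1.2) ?_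
  have hinj : Function.Injective fun pq : Pairs j => pq.1.1 := by
    rintro ⟨⟨a, b⟩, h⟩ ⟨⟨c, d⟩, h'⟩ hp
    simp only at h h' hp
    obtain rfl : a = c := by omega
    obtain rfl : b = d := by omega
    rfl
  refine ((finite_ne_bot 𝒜).preimage hinj.injOn).subset fun pq hpq => ?_
  intro h
  have : Subsingleton (rightCut 𝒜 e pq.1.1) := by
    refine subsingleton_of_forall_eq 0 fun x => Subtype.ext ((Submodule.mem_bot ℂ).1 (h ▸ x.2.1))
  have : Subsingleton (rightCut 𝒜 e pq.1.1 ⊗[ℂ] M.V pq.1.2) := inferInstance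
  exact not_nontrivial_iff_subsingleton.2 this hpq

/-- The graded `A`-module `A e ⊗_B M`, where `B` acts on `A e` on the right through
`ψ : B → e A e`. Its component of degree `j` is the quotient of `⨁_{p + q = j} (A_p e) ⊗_ℂ M_q` by
the span of the elements `x ψ(b) ⊗ v - x ⊗ b v`. -/
def tensObj (M : GrMod ℬ) : GrMod 𝒜 where
  V j := TensComp 𝒜 ℬ ψ hψ M j
  finiteDimensional j :=
    have := tensFree_finite 𝒜 ℬ e M j
    inferInstance
  act h :=
    { toFun := fun a => tensAct 𝒜 ℬ ψ hψ M h a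
      map_add' := fun a b => tens_ext fun p q hpq x v => by
        rw [LinearMap.add_apply, tensAct_mk, tensAct_mk, tensAct_mk, map_add, LinearMap.add_apply,
          tensFreeMk_add, Submodule.Quotient.mk_add]
      map_smul' := fun c a => tens_ext fun p q hpq x v => by
        rw [LinearMap.smul_apply, tensAct_mk, tensAct_mk, map_smul, LinearMap.smul_apply,
          tensFreeMk_smul, Submodule.Quotient.mk_smul]; rfl }
  one_act h a v ha := by
    have : tensAct 𝒜 ℬ ψ hψ M h a = LinearMap.id := tens_ext fun p q hpq x v => by
      rw [tensAct_mk]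
      exact congrArg _ (tensFreeMk_congr _ _ _ _ _ _ _ _ (by simp [ha]))
    exact LinearMap.congr_fun this v
  mul_act h₁ h₂ h₃ a b c v hc := by
    have : tensAct 𝒜 ℬ ψ hψ M h₃ c =
        tensAct 𝒜 ℬ ψ hψ M h₂ a ∘ₗ tensAct 𝒜 ℬ ψ hψ M h₁ b := tens_ext fun p q hpq x v => by
      rw [LinearMap.comp_apply, tensAct_mk, tensAct_mk, tensAct_mk]
      exact congrArg _ (tensFreeMk_congr _ _ _ _ _ _ _ _ (by simp [hc, mul_assoc]))
    exact LinearMap.congr_fun this v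

variable {ℬ} in
/-- The map `x ⊗ v ↦ x ⊗ f(v)` before passing to the quotient. -/
def tensFreeMap {M N : GrMod ℬ} (f : M ⟶ N) (j : ℤ) :
    TensFree 𝒜 ℬ e M j →ₗ[ℂ] TensFree 𝒜 ℬ e N j :=
  DirectSum.lmap fun pq => LinearMap.lTensor _ (app f pq.1.2)

variable {ℬ} in
lemma tensFreeMap_mk {M N : GrMod ℬ} (f : M ⟶ N) {p q j : ℤ} (h : p + q = j)
    (x : rightCut 𝒜 e p) (v : M.V q) :
    tensFreeMap 𝒜 f j (tensFreeMk 𝒜 M h x v) = tensFreeMk 𝒜 N h x (app f q v) :=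
  DirectSum.lmap_lof ..

/-- The map `A e ⊗_B M → A e ⊗_B N`, `x ⊗ v ↦ x ⊗ f(v)`. -/
def tensMap {M N : GrMod ℬ} (f : M ⟶ N) (j : ℤ) :
    TensComp 𝒜 ℬ ψ hψ M j →ₗ[ℂ] TensComp 𝒜 ℬ ψ hψ N j :=
  Submodule.mapQ _ _ (tensFreeMap 𝒜 f j) <| by
    rw [tensRel, Submodule.span_le]
    rintro _ ⟨p, n, q, hi, x, b, v, rfl⟩
    refine Submodule.subset_span ⟨p, n, q, hi, x, b, app f q v, ?_⟩
    rw [map_sub, tensFreeMap_mk, tensFreeMap_mk, app_act]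

lemma tensMap_mk {M N : GrMod ℬ} (f : M ⟶ N) {p q j : ℤ} (h : p + q = j)
    (x : rightCut 𝒜 e p) (v : M.V q) :
    tensMap 𝒜 ℬ ψ hψ f j (Submodule.Quotient.mk (tensFreeMk 𝒜 M h x v)) =
      Submodule.Quotient.mk (tensFreeMk 𝒜 N h x (app f q v)) :=
  congrArg Submodule.Quotient.mk (tensFreeMap_mk ..)

/-- The functor `A e ⊗_B -` from graded `B`-modules to graded `A`-modules. -/
def tens : GrMod ℬ ⥤ GrMod 𝒜 where
  obj M := tensObj 𝒜 ℬ ψ hψ M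
  map {M N} f := mkHom (tensMap 𝒜 ℬ ψ hψ f) (fun {n i j} h a v => by
    have : tensMap 𝒜 ℬ ψ hψ f j ∘ₗ tensAct 𝒜 ℬ ψ hψ M h a =
        tensAct 𝒜 ℬ ψ hψ N h a ∘ₗ tensMap 𝒜 ℬ ψ hψ f i := tens_ext fun p q hpq x v => by
      rw [LinearMap.comp_apply, LinearMap.comp_apply, tensAct_mk, tensMap_mk, tensMap_mk,
        tensAct_mk]
    exact LinearMap.congr_fun this v)
  map_id M := GrMod.hom_ext fun j => tens_ext fun p q hpq x v => tensMap_mk ..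
  map_comp f g := GrMod.hom_ext fun j => tens_ext fun p q hpq x v => by
    refine (tensMap_mk 𝒜 ℬ ψ hψ (f ≫ g) hpq x v).trans ?_
    exact ((congrArg (tensMap 𝒜 ℬ ψ hψ g j) (tensMap_mk 𝒜 ℬ ψ hψ f hpq x v)).trans
      (tensMap_mk 𝒜 ℬ ψ hψ g hpq x _)).symm

instance : (tens 𝒜 ℬ ψ hψ).Additive where
  map_add {M N f g} := GrMod.hom_ext fun j => tens_ext fun p q hpq x v => by
    change tensMap 𝒜 ℬ ψ hψ (f + g) j _ =
      tensMap 𝒜 ℬ ψ hψ f j _ + tensMap 𝒜 ℬ ψ hψ g j _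
    rw [tensMap_mk, tensMap_mk, tensMap_mk, ← Submodule.Quotient.mk_add]
    simp only [tensFreeMk, ← map_add, ← TensorProduct.tmul_add]
    rfl

lemma tens_subsingleton (M : GrMod ℬ) (j : ℤ)
    (h : ∀ p q : ℤ, p + q = j → 𝒜 p = ⊥ ∨ Subsingleton (M.V q)) :
    Subsingleton (((tens 𝒜 ℬ ψ hψ).obj M).V j) := by
  refine subsingleton_of_forall_eq 0 fun y => ?_
  have : (LinearMap.id : TensComp 𝒜 ℬ ψ hψ M j →ₗ[ℂ] TensComp 𝒜 ℬ ψ hψ M j) = 0 := by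
    refine tens_ext fun p q hpq x v => ?_
    have h0 : x ⊗ₜ[ℂ] v = 0 := by
      rcases h p q hpq with h | h
      · rw [show x = 0 from Subtype.ext ((Submodule.mem_bot ℂ).1 (h ▸ x.2.1)),
          TensorProduct.zero_tmul]
      · rw [Subsingleton.elim v 0, TensorProduct.tmul_zero]
    rw [tensFreeMk, h0, map_zero]
    rfl
  exact LinearMap.congr_fun this y

end TensorFunctor

/-! ### Derived categories -/

section Derived

open GrMod

section

variable {R : Type u} [Ring R] [Algebra ℂ R] (ℛ : ℤ → Submodule ℂ R)

/-- Quasi-isomorphisms of complexes of graded modules, i.e. morphisms that induce isomorphisms on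
the cohomology of each homogeneous component. -/
def qis : MorphismProperty (CochainComplex (GrMod ℛ) ℤ) := fun _ _ f =>
  ∀ j, QuasiIso (((ev ℛ j).mapHomologicalComplex (ComplexShape.up ℤ)).map f)

/-- The complexes `X` such that `(Xⁱ)_j = 0` for `i ≫ 0` or `i + j ≪ 0`. -/
def isDown : ObjectProperty (CochainComplex (GrMod ℛ) ℤ) := fun X =>
  ∃ N : ℤ, ∀ i j : ℤ, N < i ∨ i + j < -N → Subsingleton ((X.X i).V j)

/-- The complexes `X` such that `(Xⁱ)_j = 0` for `i ≪ 0` or `i + j ≫ 0`. -/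
def isUp : ObjectProperty (CochainComplex (GrMod ℛ) ℤ) := fun X =>
  ∃ N : ℤ, ∀ i j : ℤ, i < -N ∨ N < i + j → Subsingleton ((X.X i).V j)

/-- The category `Com^↓`. -/
abbrev ComDown := (isDown ℛ).FullSubcategory

/-- The category `Com^↑`. -/
abbrev ComUp := (isUp ℛ).FullSubcategory

/-- Quasi-isomorphisms in `Com^↓`. -/
abbrev qisDown : MorphismProperty (ComDown ℛ) := (qis ℛ).inverseImage (isDown ℛ).ι

/-- Quasi-isomorphisms in `Com^↑`. -/
abbrev qisUp : MorphismProperty (ComUp ℛ) := (qis ℛ).inverseImage (isUp ℛ).ι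

/-- The derived category `D^↓`. -/
abbrev DDown := (qisDown ℛ).Localization

/-- The derived category `D^↑`. -/
abbrev DUp := (qisUp ℛ).Localization

/-- The localization functor `Com^↓ → D^↓`. -/
abbrev QDown : ComDown ℛ ⥤ DDown ℛ := (qisDown ℛ).Q

/-- The localization functor `Com^↑ → D^↑`. -/
abbrev QUp : ComUp ℛ ⥤ DUp ℛ := (qisUp ℛ).Q

end

section

variable {R S : Type u} [Ring R] [Algebra ℂ R] [Ring S] [Algebra ℂ S]
  {ℛ : ℤ → Submodule ℂ R} {𝒮 : ℤ → Submodule ℂ S}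

/-- The additive functor `T` preserves the boundedness conditions of `Com^↓`. -/
def PreservesDown (T : GrMod ℛ ⥤ GrMod 𝒮) [T.Additive] : Prop :=
  ∀ X, isDown ℛ X → isDown 𝒮 ((T.mapHomologicalComplex (ComplexShape.up ℤ)).obj X)

/-- The functor `Com^↓ → Com^↓` that applies `T` to each term of a complex. -/
def comDownMap (T : GrMod ℛ ⥤ GrMod 𝒮) [T.Additive] (hT : PreservesDown T) :
    ComDown ℛ ⥤ ComDown 𝒮 :=
  (isDown 𝒮).lift ((isDown ℛ).ι ⋙ T.mapHomologicalComplex (ComplexShape.up ℤ))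
    fun X => hT X.obj X.property

/-- The functor `D^↓ → D^↓` obtained by applying `T` to each term of a complex, when this operation
preserves quasi-isomorphisms (for instance when `T` is exact). -/
def inducedD (T : GrMod ℛ ⥤ GrMod 𝒮) [T.Additive] (hT : PreservesDown T)
    (h : (qisDown ℛ).IsInvertedBy (comDownMap T hT ⋙ QDown 𝒮)) : DDown ℛ ⥤ DDown 𝒮 :=
  Localization.lift (comDownMap T hT ⋙ QDown 𝒮) h (QDown ℛ)

/-- `LT : D^↓ → D^↓` is the left derived functor of `T`. -/
def IsLeftDerived (T : GrMod ℛ ⥤ GrMod 𝒮) [T.Additive] (hT : PreservesDown T)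
    (LT : DDown ℛ ⥤ DDown 𝒮) : Prop :=
  ∃ α : QDown ℛ ⋙ LT ⟶ comDownMap T hT ⋙ QDown 𝒮, LT.IsLeftDerivedFunctor α (qisDown ℛ)

variable (ℛ 𝒮) in
/-- Restriction of scalars on complexes. -/
def resCom (f : R →ₐ[ℂ] S) (hf : ∀ n, ∀ a ∈ ℛ n, f a ∈ 𝒮 n) : ComUp 𝒮 ⥤ ComUp ℛ :=
  (isUp ℛ).lift ((isUp 𝒮).ι ⋙ (res ℛ 𝒮 f hf).mapHomologicalComplex (ComplexShape.up ℤ))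
    fun X => X.property

lemma resCom_inverts (f : R →ₐ[ℂ] S) (hf : ∀ n, ∀ a ∈ ℛ n, f a ∈ 𝒮 n) :
    (qisUp 𝒮).IsInvertedBy (resCom ℛ 𝒮 f hf ⋙ QUp ℛ) := fun _ _ g hg =>
  Localization.inverts (QUp ℛ) (qisUp ℛ) ((resCom ℛ 𝒮 f hf).map g) hg

variable (ℛ 𝒮) in
/-- Restriction of scalars on derived categories. -/
def resD (f : R →ₐ[ℂ] S) (hf : ∀ n, ∀ a ∈ ℛ n, f a ∈ 𝒮 n) : DUp 𝒮 ⥤ DUp ℛ :=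
  Localization.lift (resCom ℛ 𝒮 f hf ⋙ QUp ℛ) (resCom_inverts f hf) (QUp 𝒮)

end

section

variable {A : Type u} [Ring A] [Algebra ℂ A] (𝒜 : ℤ → Submodule ℂ A)
  [GradedAlgebra 𝒜] [NonnegGraded 𝒜] [FiniteDimensional ℂ A]

lemma tot_subsingleton (M : CochainComplex (GrMod (QDual.gr 𝒜)) ℤ) (n j : ℤ)
    (h : ∀ i k : ℤ, i + k = n → 𝒜 (j + k) = ⊥ ∨ Subsingleton ((M.X i).V k)) :
    Subsingleton ((((koszulCom 𝒜).obj M).X n).V j) := by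
  have : ∀ p : Pairs n, Subsingleton ((ind 𝒜 p.1.2 (M.X p.1.1)).V j) := fun p =>
    ind_subsingleton 𝒜 _ (h p.1.1 p.1.2 p.2)
  exact inferInstanceAs (Subsingleton (⨁ p : Pairs n, (ind 𝒜 p.1.2 (M.X p.1.1)).V j))

lemma koszulCom_isDown (M : CochainComplex (GrMod (QDual.gr 𝒜)) ℤ) (hM : isUp _ M) :
    isDown 𝒜 ((koszulCom 𝒜).obj M) := by
  obtain ⟨N, hN⟩ := hM
  refine ⟨N, fun n j hnj => tot_subsingleton 𝒜 M n j fun i k hik => ?_⟩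
  by_cases hk : j + k < 0
  · exact Or.inl (NonnegGraded.eq_bot _ hk)
  · exact Or.inr (hN i k (by omega))

/-- The quadratic duality functor `Com^↑(A^!) → Com^↓(A)`. -/
def koszulUpDown : ComUp (QDual.gr 𝒜) ⥤ ComDown 𝒜 :=
  (isDown 𝒜).lift ((isUp (QDual.gr 𝒜)).ι ⋙ koszulCom 𝒜)
    fun X => koszulCom_isDown 𝒜 X.obj X.property

/-- The quadratic duality functor on complexes preserves quasi-isomorphisms. -/
def KoszulExact : Prop :=
  (qisUp (QDual.gr 𝒜)).IsInvertedBy (koszulUpDown 𝒜 ⋙ QDown 𝒜)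

/-- The quadratic duality functor `𝒦' : D^↑(A^!) → D^↓(A)`, induced by `koszulUpDown`. -/
def koszulDual (h : KoszulExact 𝒜) : DUp (QDual.gr 𝒜) ⥤ DDown 𝒜 :=
  Localization.lift (koszulUpDown 𝒜 ⋙ QDown 𝒜) h (QUp (QDual.gr 𝒜))

variable {B : Type u} [Ring B] [Algebra ℂ B] (ℬ : ℤ → Submodule ℂ B)
  {e : A} {he : IsIdempotentElem e} (ψ : B →ₐ[ℂ] he.Corner)
  (hψ : ∀ n, ∀ b ∈ ℬ n, ψ b ∈ cornerGr he 𝒜 n)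

lemma tens_preservesDown : PreservesDown (tens 𝒜 ℬ ψ hψ) := by
  rintro X ⟨N, hN⟩
  refine ⟨N, fun i j hij => tens_subsingleton 𝒜 ℬ ψ hψ (X.X i) j fun p q hpq => ?_⟩
  by_cases hp : p < 0
  · exact Or.inl (NonnegGraded.eq_bot _ hp)
  · exact Or.inr (hN i q (by omega))

/-- The map `B_n → (e A e)_n ⊆ A_n` given by a graded homomorphism `ψ : B → e A e`. -/
def cornerDeg (n : ℤ) : ℬ n →ₗ[ℂ] 𝒜 n :=
  (cornerVal he ∘ₗ ψ.toLinearMap).restrict (hψ n)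

end

end Derived

end QuadDual

end

noncomputable section

namespace QuadDual

open GrMod

/-! Lemma and corollary are two instances of one comparison. Write `e_L` for the sum of the
idempotents with index in `L`. Suppose `F` is a ℂ-linear functor from graded `B`-modules to graded
`A`-modules with isomorphisms `F(B⟨-k⟩) ≅ A e_L⟨-k⟩` that turn right multiplication by elements of
`B₀` and `B₁` into right multiplication by their images in `e_L A e_L` (`Transport`). For a graded
`B^!`-module `N` the module `B ⊗_{B₀} N_k` is a retract of a finite sum of copies of `B⟨-k⟩`, so
`F(B ⊗ N_k) ≅ A ⊗_{A₀} N_k`, where `A^!` acts on `N` through `A^! → B^!`. The differential of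
quadratic duality involves only multiplication by degree one elements and the canonical element of
`B₁ ⊗ B₁⋆`, so these isomorphisms commute with it. `F` also commutes with the direct sums in the
total complexes, because in each degree they live in finite dimensional spaces (`map_dsum_eq_sum`).
Hence the square commutes already on complexes (`koszulComIso`), and it remains to pass to derived
categories.

The isomorphism `θ` depends only on degrees at most two (`CornerDatum`). A relation of `B^!` comes
from a functional on `B₂`. It extends to `A₂` because `B₂ → A₂` is injective on products of degree
one elements. The relation of `A^!` thus obtained differs from the given one by terms that pass
through `1 - e_L`, and these vanish in the quotient (`proj_quad`).

Quadratic duality preserves quasi-isomorphisms because the total complex is triangular with respect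
to the degree `k` in `A ⊗ (Mⁱ)_k`. Its diagonal part is the functor `A ⊗_{A₀} (-)_k`, which is exact
as `A₀` is semisimple, and in a fixed internal degree `k` is bounded above
(`ConeAcyclic.of_triangular`).

For the lemma, `F = A e_L ⊗_B -` and multiplication gives `A e_L ⊗_B B ≅ A e_L`. The left derived
functor is computed by a functorial resolution with terms `B ⊗_{B₀} Ω^s M`. The terms of a complex
in the image of quadratic duality are split quotients of such standard modules, so there `F` itself
computes its derived functor.

For the corollary, the isomorphisms `T(B e'_l) ≅ A e_l` and the compatibility with the shift give
generators of all `T(B⟨-k⟩)`, hence coefficients in `A` for all right multiplications (`Frame`).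
Hypothesis (b) makes the coefficient map an isomorphism onto `e_L A₁ e_L` in degree one. Exactness
of `T` makes it injective in degree two (`coef_two_injective`), which is all that the relations
require. -/

lemma moduleCat_quasiIso_iff {S₁ S₂ : ShortComplex (ModuleCat.{u} ℂ)} (φ : S₁ ⟶ S₂) :
    ShortComplex.QuasiIso φ ↔
      (∀ x, S₁.g x = 0 → ∀ y, φ.τ₂ x = S₂.f y → ∃ w, S₁.f w = x) ∧
      (∀ y, S₂.g y = 0 → ∃ x w, S₁.g x = 0 ∧ φ.τ₂ x = y + S₂.f w) := by
  let h₁ := S₁.moduleCatLeftHomologyData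
  let h₂ := S₂.moduleCatLeftHomologyData
  rw [ShortComplex.quasiIso_iff_isIso_leftHomologyMap' φ h₁ h₂,
    ConcreteCategory.isIso_iff_bijective]
  have hπ : ∀ (x : h₁.K), ShortComplex.leftHomologyMap' φ h₁ h₂ (h₁.π x) =
      h₂.π (ShortComplex.cyclesMap' φ h₁ h₂ x) := fun x => by
    rw [← ModuleCat.comp_apply, ShortComplex.leftHomologyπ_naturality', ModuleCat.comp_apply]
  have hi : ∀ (x : h₁.K), (h₂.i (ShortComplex.cyclesMap' φ h₁ h₂ x)) = φ.τ₂ (h₁.i x) := fun x => by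
    rw [← ModuleCat.comp_apply, ShortComplex.cyclesMap'_i, ModuleCat.comp_apply]
  have e₁ : ∀ x : h₁.K, h₁.π x = 0 ↔ ∃ w, S₁.f w = h₁.i x := by
    intro x
    refine (Submodule.Quotient.mk_eq_zero _).trans ?_
    exact ⟨fun ⟨w, hw⟩ => ⟨w, congrArg Subtype.val hw⟩, fun ⟨w, hw⟩ => ⟨w, Subtype.ext hw⟩⟩
  have e₂ : ∀ x : h₂.K, h₂.π x = 0 ↔ ∃ w, S₂.f w = h₂.i x := by
    intro x
    refine (Submodule.Quotient.mk_eq_zero _).trans ?_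
    exact ⟨fun ⟨w, hw⟩ => ⟨w, congrArg Subtype.val hw⟩, fun ⟨w, hw⟩ => ⟨w, Subtype.ext hw⟩⟩
  have k₁ : ∀ x, S₁.g x = 0 → ∃ x' : h₁.K, h₁.i x' = x := fun x hx => ⟨⟨x, hx⟩, rfl⟩
  have k₂ : ∀ x, S₂.g x = 0 → ∃ x' : h₂.K, h₂.i x' = x := fun x hx => ⟨⟨x, hx⟩, rfl⟩
  have s₁ : Function.Surjective h₁.π := Submodule.mkQ_surjective _
  have s₂ : Function.Surjective h₂.π := Submodule.mkQ_surjective _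
  refine and_congr ?_ ?_
  · rw [injective_iff_map_eq_zero]
    constructor
    · intro h x hx y hy
      obtain ⟨x, rfl⟩ := k₁ x hx
      exact (e₁ x).1 (h _ (by
        rw [hπ, e₂]
        exact ⟨y, by rw [hi]; exact hy.symm⟩))
    · intro h x hx
      obtain ⟨x, rfl⟩ := s₁ x
      rw [hπ, e₂] at hx
      obtain ⟨w, hw⟩ := hx
      rw [hi] at hw
      obtain ⟨w', hw'⟩ := h (h₁.i x) x.2 w hw.symm
      exact (e₁ x).2 ⟨w', hw'⟩
  · constructor
    · intro h y hy
      obtain ⟨y, rfl⟩ := k₂ y hy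
      obtain ⟨x, hx⟩ := h (h₂.π y)
      obtain ⟨x, rfl⟩ := s₁ x
      rw [hπ, ← sub_eq_zero, ← map_sub, e₂] at hx
      obtain ⟨w, hw⟩ := hx
      rw [map_sub, hi] at hw
      exact ⟨h₁.i x, w, x.2, by rw [hw]; abel⟩
    · intro h y
      obtain ⟨y, rfl⟩ := s₂ y
      obtain ⟨x, w, hx, hw⟩ := h (h₂.i y) y.2
      obtain ⟨x, rfl⟩ := k₁ x hx
      refine ⟨h₁.π x, ?_⟩
      rw [hπ, ← sub_eq_zero, ← map_sub, e₂]
      refine ⟨w, ?_⟩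
      rw [map_sub, hi]
      exact eq_sub_of_add_eq' hw.symm

/-! ### Quasi-isomorphisms as morphisms with acyclic cone, in terms of elements. -/

section Cone

variable {R : Type u} [Ring R] [Algebra ℂ R] {ℛ : ℤ → Submodule ℂ R}

@[simp] lemma sub_app {M N : GrMod ℛ} (f g : M ⟶ N) (j : ℤ) :
    app (f - g) j = app f j - app g j := rfl

/-- `app` as an additive map. -/
def appHom (M N : GrMod ℛ) (j : ℤ) : (M ⟶ N) →+ (M.V j →ₗ[ℂ] N.V j) where
  toFun f := app f j
  map_zero' := rfl
  map_add' _ _ := rfl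

lemma sum_app {M N : GrMod ℛ} {ι : Type*} (s : Finset ι) (f : ι → (M ⟶ N)) (j : ℤ) :
    app (∑ i ∈ s, f i) j = ∑ i ∈ s, app (f i) j := map_sum (appHom M N j) f s

/-- The mapping cone of `f` is acyclic, in terms of elements. -/
def ConeAcyclic {X Y : CochainComplex (GrMod ℛ) ℤ} (f : X ⟶ Y) : Prop :=
  ∀ (j l n m r : ℤ), l + 1 = n → n + 1 = m → m + 1 = r →
    ∀ (x : (X.X m).V j) (y : (Y.X n).V j), app (X.d m r) j x = 0 →
      app (f.f m) j x = app (Y.d n m) j y →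
      ∃ (x' : (X.X n).V j) (y' : (Y.X l).V j), app (X.d n m) j x' = x ∧
        app (f.f n) j x' = y + app (Y.d l n) j y'

lemma app_comp_apply {M N P : GrMod ℛ} (f : M ⟶ N) (g : N ⟶ P) (j : ℤ) (x : M.V j) :
    app (f ≫ g) j x = app g j (app f j x) := rfl

lemma app_d_d {X : CochainComplex (GrMod ℛ) ℤ} (a b c : ℤ) (j : ℤ) (x : (X.X a).V j) :
    app (X.d b c) j (app (X.d a b) j x) = 0 := by
  rw [← app_comp_apply, X.d_comp_d]; rfl

lemma app_f_d {X Y : CochainComplex (GrMod ℛ) ℤ} (f : X ⟶ Y) (a b : ℤ) (j : ℤ) (x : (X.X a).V j) :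
    app (f.f b) j (app (X.d a b) j x) = app (Y.d a b) j (app (f.f a) j x) := by
  rw [← app_comp_apply, ← app_comp_apply, f.comm]

/-- Injectivity on cohomology in degree `m` and surjectivity in degree `n = m - 1` together say that
the cone is exact at one spot. The cone form is preferred because it can be filtered and transported
by functors. -/
lemma qis_iff {X Y : CochainComplex (GrMod ℛ) ℤ} (f : X ⟶ Y) :
    qis ℛ f ↔ ConeAcyclic f := by
  have key : ∀ j n, QuasiIsoAt (((ev ℛ j).mapHomologicalComplex (ComplexShape.up ℤ)).map f) n ↔
      (∀ x : (X.X n).V j, app (X.d n (n + 1)) j x = 0 → ∀ y : (Y.X (n - 1)).V j,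
        app (f.f n) j x = app (Y.d (n - 1) n) j y → ∃ w, app (X.d (n - 1) n) j w = x) ∧
      (∀ y : (Y.X n).V j, app (Y.d n (n + 1)) j y = 0 →
        ∃ (x : (X.X n).V j) (w : (Y.X (n - 1)).V j), app (X.d n (n + 1)) j x = 0 ∧
        app (f.f n) j x = y + app (Y.d (n - 1) n) j w) := by
    intro j n
    rw [quasiIsoAt_iff' _ (n - 1) n (n + 1) (by simp) (by simp), moduleCat_quasiIso_iff]
    rfl
  simp only [qis, quasiIso_iff, key]
  constructor
  · intro h j l n m r hl hm hr x y hx hy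
    obtain rfl : l = n - 1 := by omega
    obtain rfl : n = m - 1 := by omega
    obtain rfl : r = m + 1 := by omega
    -- Injectivity gives `x = d w`. Then `f w - y` is a cocycle, and surjectivity corrects `w` by a
    -- cocycle `x'` so that `f (w - x') - y` becomes a boundary.
    obtain ⟨w, rfl⟩ := (h j m).1 x hx y hy
    rw [app_f_d, ← sub_eq_zero, ← map_sub] at hy
    obtain ⟨x', y', h1, h2⟩ := (h j (m - 1)).2 (app (f.f (m - 1)) j w - y) (by
      have : m - 1 + 1 = m := by omega
      rwa [this])
    refine ⟨w - x', - y', ?_, ?_⟩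
    · rw [map_sub, sub_eq_self]
      have : m - 1 + 1 = m := by omega
      rwa [this] at h1
    · rw [map_sub, h2, map_neg]; abel
  · intro h j n
    constructor
    · intro x hx y hy
      obtain ⟨x', _, hx', _⟩ := h j (n - 1 - 1) (n - 1) n (n + 1) (by omega) (by omega) rfl x y hx hy
      exact ⟨x', hx'⟩
    · intro y hy
      obtain ⟨x', y', h1, h2⟩ := h j (n - 1) n (n + 1) (n + 1 + 1) (by omega) rfl rfl 0 y
        (map_zero _) (by rw [hy, map_zero])
      exact ⟨x', y', h1, h2⟩

/-- Successive approximation: subtracting the coboundary of `(x', y')` from a cocycle of the cone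
keeps it a cocycle and lowers the measure `t`, and measure `0` means zero. The corrections add up to
a primitive. -/
lemma ConeAcyclic.of_step {X Y : CochainComplex (GrMod ℛ) ℤ} {f : X ⟶ Y}
    (h : ∀ (j l n m r : ℤ), l + 1 = n → n + 1 = m → m + 1 = r →
      ∃ Q : ℕ → (X.X m).V j → (Y.X n).V j → Prop,
        (∀ x y, Q 0 x y → x = 0 ∧ y = 0) ∧ (∀ x y, ∃ t, Q t x y) ∧
        (∀ t x y, Q (t + 1) x y → app (X.d m r) j x = 0 →
          app (f.f m) j x = app (Y.d n m) j y →
          ∃ (x' : (X.X n).V j) (y' : (Y.X l).V j), Q t (x - app (X.d n m) j x')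
            (y - (app (f.f n) j x' - app (Y.d l n) j y')))) : ConeAcyclic f := by
  intro j l n m r hl hm hr
  obtain ⟨Q, h0, h1, hs⟩ := h j l n m r hl hm hr
  have main : ∀ t (x : (X.X m).V j) (y : (Y.X n).V j), Q t x y → app (X.d m r) j x = 0 →
      app (f.f m) j x = app (Y.d n m) j y →
      ∃ (x' : (X.X n).V j) (y' : (Y.X l).V j), app (X.d n m) j x' = x ∧
        app (f.f n) j x' = y + app (Y.d l n) j y' := by
    intro t
    induction t with
    | zero =>
      intro x y hQ _ _
      obtain ⟨rfl, rfl⟩ := h0 x y hQ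
      exact ⟨0, 0, map_zero _, by rw [map_zero, map_zero, add_zero]⟩
    | succ t ih =>
      intro x y hQ hx hy
      obtain ⟨x', y', hQ'⟩ := hs t x y hQ hx hy
      obtain ⟨x'', y'', e1, e2⟩ := ih _ _ hQ' (by rw [map_sub, hx, app_d_d, sub_zero]) (by
        simp only [map_sub, hy, app_d_d, app_f_d, sub_zero])
      refine ⟨x' + x'', y' + y'', ?_, ?_⟩
      · rw [map_add, e1]; abel
      · rw [map_add, e2, map_add]; abel
  intro x y hx hy
  obtain ⟨t, ht⟩ := h1 x y
  exact main t x y ht hx hy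

/-- The product of two graded modules. -/
def prod (M N : GrMod ℛ) : GrMod ℛ where
  V j := M.V j × N.V j
  act h := LinearMap.mk₂ ℂ (fun a v => (M.act h a v.1, N.act h a v.2))
    (by intros; simp) (by intros; simp) (by intros; simp) (by intros; simp)
  one_act h a v ha := Prod.ext (M.one_act h a _ ha) (N.one_act h a _ ha)
  mul_act h₁ h₂ h₃ a b c v hc :=
    Prod.ext (M.mul_act h₁ h₂ h₃ a b c _ hc) (N.mul_act h₁ h₂ h₃ a b c _ hc)

/-- The first projection. -/
def fst (M N : GrMod ℛ) : prod M N ⟶ M := mkHom (fun _ => LinearMap.fst ℂ _ _) (fun _ _ _ => rfl)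
/-- The second projection. -/
def snd (M N : GrMod ℛ) : prod M N ⟶ N := mkHom (fun _ => LinearMap.snd ℂ _ _) (fun _ _ _ => rfl)
/-- The first inclusion. -/
def inl (M N : GrMod ℛ) : M ⟶ prod M N :=
  mkHom (fun _ => LinearMap.inl ℂ _ _) (fun _ _ _ => Prod.ext rfl (map_zero _).symm)
/-- The second inclusion. -/
def inr (M N : GrMod ℛ) : N ⟶ prod M N :=
  mkHom (fun _ => LinearMap.inr ℂ _ _) (fun _ _ _ => Prod.ext (map_zero _).symm rfl)

@[simp] lemma inl_fst (M N : GrMod ℛ) : inl M N ≫ fst M N = 𝟙 M := rfl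
@[simp] lemma inl_snd (M N : GrMod ℛ) : inl M N ≫ snd M N = 0 := rfl
@[simp] lemma inr_fst (M N : GrMod ℛ) : inr M N ≫ fst M N = 0 := rfl
@[simp] lemma inr_snd (M N : GrMod ℛ) : inr M N ≫ snd M N = 𝟙 N := rfl

lemma fst_inl_add_snd_inr (M N : GrMod ℛ) :
    fst M N ≫ inl M N + snd M N ≫ inr M N = 𝟙 _ := by
  ext j : 1
  refine LinearMap.ext fun x => ?_
  exact Prod.ext (add_zero x.1) (zero_add x.2)

/-- Exactness in the middle term, in each degree. -/
def ExactSeq {M N P : GrMod ℛ} (f : M ⟶ N) (g : N ⟶ P) : Prop :=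
  ∀ j (z : N.V j), app g j z = 0 → ∃ w, app f j w = z

end Cone

/-! ### Functors that preserve exact sequences preserve acyclic cones. -/

section PreservesExact

variable {R S S' : Type u} [Ring R] [Algebra ℂ R] [Ring S] [Algebra ℂ S] [Ring S'] [Algebra ℂ S']
  {ℛ : ℤ → Submodule ℂ R} {𝒮 : ℤ → Submodule ℂ S} {𝒮' : ℤ → Submodule ℂ S'}

/-- The functor preserves exact sequences. -/
def PreservesExact (F : GrMod ℛ ⥤ GrMod 𝒮) : Prop :=
  ∀ ⦃M N P : GrMod ℛ⦄ (f : M ⟶ N) (g : N ⟶ P), f ≫ g = 0 → ExactSeq f g →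
    ExactSeq (F.map f) (F.map g)

lemma PreservesExact.comp {F : GrMod ℛ ⥤ GrMod 𝒮} {G : GrMod 𝒮 ⥤ GrMod 𝒮'} [F.Additive]
    (hF : PreservesExact F) (hG : PreservesExact G) : PreservesExact (F ⋙ G) :=
  fun _ _ _ f g hfg h => hG _ _ (by rw [← F.map_comp, hfg, F.map_zero]) (hF f g hfg h)

lemma PreservesExact.id : PreservesExact (𝟭 (GrMod ℛ)) := fun _ _ _ _ _ _ h => h

/-- The cone is a complex of graded modules with terms `prod (X.X b) (Y.X a)`, and its acyclicity is
exactness of `D l n m` and `D n m r`. Additivity carries over the identities between `D`, the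
inclusions and the projections, so exactness after `F` can be read off in the two coordinates. -/
lemma ConeAcyclic.map {X Y : CochainComplex (GrMod ℛ) ℤ} {f : X ⟶ Y} (hf : ConeAcyclic f)
    (F : GrMod ℛ ⥤ GrMod 𝒮) [F.Additive] (hF : PreservesExact F) :
    ConeAcyclic ((F.mapHomologicalComplex (ComplexShape.up ℤ)).map f) := by
  change ∀ (j l n m r : ℤ), l + 1 = n → n + 1 = m → m + 1 = r →
    ∀ (x : (F.obj (X.X m)).V j) (y : (F.obj (Y.X n)).V j), app (F.map (X.d m r)) j x = 0 →
      app (F.map (f.f m)) j x = app (F.map (Y.d n m)) j y →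
      ∃ (x' : (F.obj (X.X n)).V j) (y' : (F.obj (Y.X l)).V j), app (F.map (X.d n m)) j x' = x ∧
        app (F.map (f.f n)) j x' = y + app (F.map (Y.d l n)) j y'
  intro j l n m r hl hm hr x y hx hy
  let D (a b c : ℤ) : prod (X.X b) (Y.X a) ⟶ prod (X.X c) (Y.X b) :=
    fst _ _ ≫ X.d b c ≫ inl _ _ + fst _ _ ≫ f.f b ≫ inr _ _ - snd _ _ ≫ Y.d a b ≫ inr _ _
  have hD : ∀ a b c, D a b c ≫ fst _ _ = fst _ _ ≫ X.d b c := by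
    intro a b c; simp [D]
  have hD' : ∀ a b c, D a b c ≫ snd _ _ = fst _ _ ≫ f.f b - snd _ _ ≫ Y.d a b := by
    intro a b c; simp [D]
  have hDi : ∀ a b c, inl _ _ ≫ D a b c = X.d b c ≫ inl _ _ + f.f b ≫ inr _ _ := by
    intro a b c
    simp [D, reassoc_of% (inl_fst (X.X b) (Y.X a)), reassoc_of% (inl_snd (X.X b) (Y.X a))]
  have hDr : ∀ a b c, inr _ _ ≫ D a b c = - (Y.d a b ≫ inr _ _) := by
    intro a b c
    simp [D, reassoc_of% (inr_fst (X.X b) (Y.X a)), reassoc_of% (inr_snd (X.X b) (Y.X a))]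
  have h0 : D l n m ≫ D n m r = 0 := by
    have e : D n m r = D n m r ≫ (fst _ _ ≫ inl _ _ + snd _ _ ≫ inr _ _) := by
      rw [fst_inl_add_snd_inr, Category.comp_id]
    rw [e, Preadditive.comp_add, reassoc_of% (hD n m r), reassoc_of% (hD' n m r),
      Preadditive.comp_add, reassoc_of% (hD l n m), ← Category.assoc (D l n m),
      Preadditive.comp_sub, ← Category.assoc (D l n m), ← Category.assoc (D l n m), hD, hD']
    simp
  have hex : ExactSeq (D l n m) (D n m r) := by
    intro j z hz
    obtain ⟨x', y', e1, e2⟩ := hf j l n m r hl hm hr z.1 z.2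
      (by
          have := (congrArg (fun t => app t j z) (hD n m r)).symm.trans
            (congrArg (app (fst _ _) j) hz)
          exact this)
      (by
        have := (congrArg (fun t => app t j z) (hD' n m r)).symm.trans
            (congrArg (app (snd _ _) j) hz)
        exact sub_eq_zero.1 this)
    refine ⟨(x', y'), Prod.ext ?_ ?_⟩
    · exact (congrArg (fun t => app t j ((x', y') : (prod (X.X n) (Y.X l)).V j))
        (hD l n m)).trans e1
    · refine (congrArg (fun t => app t j ((x', y') : (prod (X.X n) (Y.X l)).V j))
        (hD' l n m)).trans ?_
      change app (f.f n) j x' - app (Y.d l n) j y' = z.2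
      rw [e2, add_sub_cancel_right]
  -- The pair `(x, y)`, viewed as an element of the image under `F` of the middle term of the cone,
  -- is a cocycle. The coordinates of a preimage `w` are the required elements.
  obtain ⟨w, hw⟩ := hF _ _ h0 hex j
    (app (F.map (inl _ _)) j x + app (F.map (inr _ _)) j y) (by
      rw [map_add, ← app_comp_apply, ← app_comp_apply, ← F.map_comp, ← F.map_comp, hDi, hDr,
        F.map_add, F.map_neg, F.map_comp, F.map_comp, F.map_comp]
      change app (F.map (inl _ _)) j (app (F.map (X.d m r)) j x) +
        app (F.map (inr _ _)) j (app (F.map (f.f m)) j x) +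
          -app (F.map (inr _ _)) j (app (F.map (Y.d n m)) j y) = 0
      rw [hx, hy, map_zero]
      abel)
  refine ⟨app (F.map (fst _ _)) j w, app (F.map (snd _ _)) j w, ?_, ?_⟩
  · rw [← app_comp_apply, ← F.map_comp, ← hD l n m, F.map_comp, app_comp_apply, hw, map_add,
      ← app_comp_apply, ← app_comp_apply, ← F.map_comp, ← F.map_comp, inl_fst, inr_fst]
    simp
  · have := congrArg (app (F.map (snd _ _)) j) hw
    rw [← app_comp_apply, ← F.map_comp, hD', map_add, ← app_comp_apply, ← app_comp_apply,
      ← F.map_comp, ← F.map_comp, inl_snd, inr_snd, F.map_sub, F.map_comp, F.map_comp] at this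
    rw [← sub_eq_iff_eq_add]
    simp only [id_app, F.map_id, F.map_zero, LinearMap.id_apply] at this
    simpa using this

end PreservesExact

/-! ### Linear functors and locally finite direct sums. -/

section DirectSum

variable {R S : Type u} [Ring R] [Algebra ℂ R] [Ring S] [Algebra ℂ S]
  {ℛ : ℤ → Submodule ℂ R} {𝒮 : ℤ → Submodule ℂ S}

/-- Projection of a direct sum to a summand. -/
def proj {ι : Type} [DecidableEq ι] {N : ι → GrMod ℛ}
    {hN : ∀ j, {i | Nontrivial ((N i).V j)}.Finite} (i : ι) : dsum N hN ⟶ N i :=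
  desc fun k => if h : k = i then h ▸ 𝟙 _ else 0

variable {ι : Type} [DecidableEq ι] {N : ι → GrMod ℛ}
  {hN : ∀ j, {i | Nontrivial ((N i).V j)}.Finite}

@[simp] lemma inj_proj_self (i : ι) : (inj i : N i ⟶ dsum N hN) ≫ proj i = 𝟙 _ := by
  rw [proj, inj_desc, dif_pos rfl]

lemma inj_proj_ne {i k : ι} (h : k ≠ i) : (inj k : N k ⟶ dsum N hN) ≫ proj i = 0 := by
  rw [proj, inj_desc, dif_neg h]

/-- A `ℂ`-linear functor preserves locally finite direct sums. -/
theorem map_dsum_eq_sum (F : GrMod ℛ ⥤ GrMod 𝒮) [F.Additive] [F.Linear ℂ] (c : ι → ℂ)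
    (hc : Function.Injective c) (j : ℤ) (y : (F.obj (dsum N hN)).V j) :
    ∃ s : Finset ι, (∀ i ∉ s, app (F.map (proj i)) j y = 0) ∧
      y = ∑ i ∈ s, app (F.map (inj i : N i ⟶ dsum N hN)) j (app (F.map (proj i)) j y) := by
  suffices ∃ s : Finset ι, y = ∑ i ∈ s, app (F.map (inj i : N i ⟶ dsum N hN)) j
      (app (F.map (proj i)) j y) by
    obtain ⟨s, hs⟩ := this
    refine ⟨s, fun k hk => ?_, hs⟩
    rw [hs, map_sum]
    refine Finset.sum_eq_zero fun i hi => ?_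
    rw [← app_comp_apply (F.map (inj i)) (F.map (proj k)), ← F.map_comp,
      inj_proj_ne (fun h : i = k => hk (h ▸ hi)), F.map_zero]
    rfl
  classical
  let W := F.obj (dsum N hN)
  -- `D g` scales the summand `i` by `g i`. Since `g ↦ D g` is multiplicative and `F` is linear,
  -- polynomials in `Z = F(D c)` are again of the form `F(D g)`.
  let D (g : ι → ℂ) : dsum N hN ⟶ dsum N hN := desc fun i => g i • inj i
  let Z : W.V j →ₗ[ℂ] W.V j := app (F.map (D c)) j
  have hD : ∀ g i, inj i ≫ D g = g i • (inj i : N i ⟶ dsum N hN) := fun g i => inj_desc _ _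
  have hmul : ∀ g h : ι → ℂ, D g ≫ D h = D (fun i => g i * h i) := by
    intro g h
    refine dsum_ext fun i => ?_
    simp only [← Category.assoc, hD, Linear.smul_comp, smul_smul]
  have hpoly : ∀ p : Polynomial ℂ, app (F.map (D fun i => p.eval (c i))) j = Polynomial.aeval Z p := by
    intro p
    induction p using Polynomial.induction_on' with
    | add p q hp hq =>
      rw [map_add, ← hp, ← hq, ← add_app, ← F.map_add]
      congr 2
      refine dsum_ext fun i => ?_
      simp only [Preadditive.comp_add, hD, Polynomial.eval_add, add_smul]
    | monomial n a =>
      have hn : app (F.map (D fun i => c i ^ n)) j = Z ^ n := by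
        induction n with
        | zero =>
          have : (D fun i => c i ^ 0) = 𝟙 _ := dsum_ext fun i => by
            simp only [hD, pow_zero, one_smul, Category.comp_id]
          rw [this, F.map_id, pow_zero]; rfl
        | succ n ih =>
          rw [pow_succ, ← ih]
          have : (D fun i => c i ^ (n + 1)) = D c ≫ D fun i => c i ^ n := by
            rw [hmul]; simp only [pow_succ']
          rw [this, F.map_comp, comp_app]; rfl
      have : (D fun i => (Polynomial.monomial n a).eval (c i)) = a • D fun i => c i ^ n :=
        dsum_ext fun i => by
          simp only [Linear.comp_smul, hD, Polynomial.eval_monomial, smul_smul]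
      rw [this, F.map_smul, smul_app, hn, Polynomial.aeval_monomial]
      rfl
  -- The component in degree `j` is finite dimensional, so `Z` has a minimal polynomial. The scalars
  -- `c i` are distinct, so `p` vanishes at only finitely many of them, and these `i` form `s`.
  let p := minpoly ℂ Z
  have hp0 : p ≠ 0 := minpoly.ne_zero (Algebra.IsIntegral.isIntegral Z)
  have hpZ : app (F.map (D fun i => p.eval (c i))) j = 0 := (hpoly p).trans (minpoly.aeval ℂ Z)
  have hfin : {i | p.eval (c i) = 0}.Finite :=
    ((p.roots.toFinset.finite_toSet).preimage hc.injOn).subset fun i hi => by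
      simpa [hp0] using hi
  let s := hfin.toFinset
  -- Outside `s` the scalar `p (c i)` is invertible, so the projection to the complementary summands
  -- factors through `D (p ∘ c)`. Applying `F` in degree `j` gives zero, by the choice of `p`.
  have hE : 𝟙 (dsum N hN) - ∑ i ∈ s, proj i ≫ inj i =
      D (fun i => if i ∈ s then 0 else (p.eval (c i))⁻¹) ≫ D fun i => p.eval (c i) := by
    rw [hmul]
    refine dsum_ext fun i => ?_
    simp only [hD, Preadditive.comp_sub, Category.comp_id, Preadditive.comp_sum]
    by_cases hi : i ∈ s
    · rw [if_pos hi, zero_mul, zero_smul, Finset.sum_eq_single i, ← Category.assoc, inj_proj_self,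
        Category.id_comp, sub_self]
      · intro k _ hk
        rw [← Category.assoc, inj_proj_ne hk.symm, zero_comp]
      · exact fun h => absurd hi h
    · rw [if_neg hi, inv_mul_cancel₀ (fun h => hi (by simpa [s] using h)), one_smul,
        Finset.sum_eq_zero, sub_zero]
      intro k hk
      rw [← Category.assoc, inj_proj_ne (fun h : i = k => hi (h ▸ hk)), zero_comp]
  refine ⟨s, ?_⟩
  have h1 := congrArg (fun f => app (F.map f) j y) hE
  simp only [F.map_comp, comp_app, LinearMap.comp_apply, hpZ, LinearMap.zero_apply, F.map_sub,
    F.map_id, sub_app, id_app, LinearMap.sub_apply, LinearMap.id_apply, F.map_sum, sum_app,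
    LinearMap.sum_apply] at h1
  exact sub_eq_zero.1 h1

end DirectSum

/-! ### Kernels, epimorphisms, and elementwise exactness of exact functors. -/

section Kernels

variable {R S : Type u} [Ring R] [Algebra ℂ R] [Ring S] [Algebra ℂ S]
  {ℛ : ℤ → Submodule ℂ R} {𝒮 : ℤ → Submodule ℂ S}

/-- The graded submodule with given components. -/
def sub (M : GrMod ℛ) (W : ∀ j, Submodule ℂ (M.V j))
    (hW : ∀ {n i j : ℤ} (h : n + i = j) (a : ℛ n) (v : M.V i), v ∈ W i → M.act h a v ∈ W j) :
    GrMod ℛ where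
  V j := W j
  act {n i j} h := LinearMap.mk₂ ℂ (fun a v => ⟨M.act h a v, hW h a v v.2⟩)
    (fun _ _ _ => Subtype.ext (by simp)) (fun _ _ _ => Subtype.ext (by simp))
    (fun _ _ _ => Subtype.ext (by simp)) (fun _ _ _ => Subtype.ext (by simp))
  one_act h a v ha := Subtype.ext (M.one_act h a v ha)
  mul_act h₁ h₂ h₃ a b c v hc := Subtype.ext (M.mul_act h₁ h₂ h₃ a b c v hc)

/-- The quotient by the graded submodule with given components. -/
def quot (M : GrMod ℛ) (W : ∀ j, Submodule ℂ (M.V j))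
    (hW : ∀ {n i j : ℤ} (h : n + i = j) (a : ℛ n) (v : M.V i), v ∈ W i → M.act h a v ∈ W j) :
    GrMod ℛ where
  V j := M.V j ⧸ W j
  act {n i j} h :=
    { toFun := fun a => (W i).mapQ (W j) (M.act h a) (fun v hv => hW h a v hv)
      map_add' := fun _ _ => Submodule.linearMap_qext _ (LinearMap.ext fun _ => by simp)
      map_smul' := fun _ _ => Submodule.linearMap_qext _ (LinearMap.ext fun _ => by simp) }
  one_act {i} h a v ha := by
    induction v using Submodule.Quotient.induction_on with
    | _ v => exact congrArg (W i).mkQ (M.one_act h a v ha)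
  mul_act {m n p i j k} h₁ h₂ h₃ a b c v hc := by
    induction v using Submodule.Quotient.induction_on with
    | _ v => exact congrArg (W k).mkQ (M.mul_act h₁ h₂ h₃ a b c v hc)

variable {M N : GrMod ℛ}

/-- The kernel of a morphism. -/
def kerObj (f : M ⟶ N) : GrMod ℛ :=
  sub M (fun j => LinearMap.ker (app f j)) fun h a v hv => by
    rw [LinearMap.mem_ker] at hv ⊢
    rw [app_act, hv, map_zero]

/-- The inclusion of the kernel. -/
def kerι (f : M ⟶ N) : kerObj f ⟶ M := mkHom (fun _ => Submodule.subtype _) fun _ _ _ => rfl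

lemma kerι_injective (f : M ⟶ N) (j : ℤ) : Function.Injective (app (kerι f) j) :=
  Subtype.val_injective

lemma kerι_comp (f : M ⟶ N) : kerι f ≫ f = 0 := by
  ext j x
  exact x.2

/-- Lift to the kernel. -/
def kerLift (f : M ⟶ N) {P : GrMod ℛ} (g : P ⟶ M) (h : g ≫ f = 0) : P ⟶ kerObj f :=
  mkHom (fun j => (app g j).codRestrict _ fun x => congrArg (fun t => app t j x) h)
    fun h a v => Subtype.ext (app_act g h a v)

@[simp] lemma kerLift_ι (f : M ⟶ N) {P : GrMod ℛ} (g : P ⟶ M) (h : g ≫ f = 0) :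
    kerLift f g h ≫ kerι f = g := rfl

lemma hom_ext_of_injective {P : GrMod ℛ} {f g : P ⟶ M} (i : M ⟶ N)
    (hi : ∀ j, Function.Injective (app i j)) (h : f ≫ i = g ≫ i) : f = g := by
  ext j x
  exact hi j (congrArg (fun t => app t j x) h)

/-- The inclusion of the kernel is a kernel. -/
def kerIsLimit (f : M ⟶ N) : IsLimit (KernelFork.ofι (kerι f) (kerι_comp f)) :=
  KernelFork.IsLimit.ofι _ _ (fun g h => kerLift f g h) (fun g h => kerLift_ι f g h)
    (fun g h _ hm => hom_ext_of_injective (kerι f) (kerι_injective f) (hm.trans (kerLift_ι f g h).symm))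

lemma epi_of_surjective (f : M ⟶ N) (hf : ∀ j, Function.Surjective (app f j)) : Epi f where
  left_cancellation g h e := by
    ext j x
    obtain ⟨y, rfl⟩ := hf j x
    exact congrArg (fun t => app t j y) e

/-- An epimorphism cannot distinguish the projection to its cokernel from zero. -/
lemma surjective_of_epi (f : M ⟶ N) [Epi f] (j : ℤ) : Function.Surjective (app f j) := by
  let C : GrMod ℛ := quot N (fun j => LinearMap.range (app f j)) (by
    rintro n i j h a _ ⟨v, rfl⟩
    exact ⟨M.act h a v, app_act f h a v⟩)
  let π : N ⟶ C := mkHom (fun j => Submodule.mkQ _) fun _ _ _ => rfl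
  have h0 : f ≫ π = f ≫ 0 := by
    ext j x
    exact (Submodule.Quotient.mk_eq_zero _).2 ⟨x, rfl⟩
  have : π = 0 := (cancel_epi f).1 h0
  intro x
  exact (Submodule.Quotient.mk_eq_zero (LinearMap.range (app f j))).1
    (congrArg (fun t => app t j x) this)

lemma isIso_of_bijective (f : M ⟶ N) (hf : ∀ j, Function.Bijective (app f j)) : IsIso f := by
  let e (j : ℤ) : M.V j ≃ₗ[ℂ] N.V j := LinearEquiv.ofBijective (app f j) (hf j)
  have he : ∀ j x, e j x = app f j x := fun _ _ => rfl
  refine ⟨mkHom (fun j => (e j).symm) ?_, ?_, ?_⟩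
  · intro n i j h a v
    apply (hf j).1
    rw [app_act]
    refine ((e j).apply_symm_apply _).trans ?_
    rw [← he i]
    simp
  · ext j x
    exact (e j).symm_apply_apply x
  · ext j x
    exact (e j).apply_symm_apply x

lemma surjective_map (F : GrMod ℛ ⥤ GrMod 𝒮) [PreservesFiniteColimits F] (f : M ⟶ N)
    (hf : ∀ j, Function.Surjective (app f j)) (j : ℤ) : Function.Surjective (app (F.map f) j) :=
  have := epi_of_surjective f hf
  have : Epi (F.map f) := inferInstance
  surjective_of_epi _ j

/-- Exactness in the middle says that `M` maps onto the kernel of `g`. Preservation of kernels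
identifies the kernel of `F.map g`, and preservation of epimorphisms keeps the map to it surjective.
-/
lemma preservesExact_of_preservesLimits (F : GrMod ℛ ⥤ GrMod 𝒮) [F.Additive]
    [PreservesFiniteLimits F] [PreservesFiniteColimits F] : PreservesExact F := by
  intro M N P f g hfg h j z hz
  let f' := kerLift g f hfg
  have hf' : ∀ j, Function.Surjective (app f' j) := by
    intro j y
    obtain ⟨w, hw⟩ := h j (app (kerι g) j y) y.2
    exact ⟨w, kerι_injective g j hw⟩
  obtain ⟨k, hk⟩ := KernelFork.IsLimit.lift' (isLimitForkMapOfIsLimit' F (kerι_comp g) (kerIsLimit g))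
    (kerι (F.map g)) (kerι_comp (F.map g))
  obtain ⟨w, hw⟩ := surjective_map F f' hf' j (app k j ⟨z, hz⟩)
  refine ⟨w, ?_⟩
  have e : f = f' ≫ kerι g := rfl
  rw [e, F.map_comp, app_comp_apply, hw]
  exact congrArg (fun t => app t j (⟨z, hz⟩ : (kerObj (F.map g)).V j)) hk

end Kernels

/-! ### Triangular decompositions of complexes. -/

section Filtration

variable {R : Type u} [Ring R] [Algebra ℂ R] {ℛ : ℤ → Submodule ℂ R}

/-- A decomposition of a graded module in summands indexed by `ℤ`. -/
structure Splitting (K : GrMod ℛ) (A : ℤ → GrMod ℛ) where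
  inc (k : ℤ) : A k ⟶ K
  pr (k : ℤ) : K ⟶ A k
  sum_eq (j : ℤ) (z : K.V j) : ∃ s : Finset ℤ, (∀ k ∉ s, app (pr k) j z = 0) ∧
    z = ∑ k ∈ s, app (inc k) j (app (pr k) j z)

namespace Splitting

lemma eq_zero {K : GrMod ℛ} {A : ℤ → GrMod ℛ} (σ : Splitting K A) {j : ℤ} {z : K.V j}
    (h : ∀ k, app (σ.pr k) j z = 0) : z = 0 := by
  obtain ⟨s, -, hs⟩ := σ.sum_eq j z
  rw [hs]
  exact Finset.sum_eq_zero fun k _ => by rw [h, map_zero]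

lemma map_eq_sum {K L : GrMod ℛ} {A : ℤ → GrMod ℛ} (σ : Splitting K A) (g : K ⟶ L) (j : ℤ)
    (z : K.V j) : ∃ s : Finset ℤ, (∀ k ∉ s, app (σ.pr k) j z = 0) ∧
      app g j z = ∑ k ∈ s, app (σ.inc k ≫ g) j (app (σ.pr k) j z) := by
  obtain ⟨s, h0, hs⟩ := σ.sum_eq j z
  refine ⟨s, h0, ?_⟩
  conv_lhs => rw [hs]
  rw [map_sum]
  rfl

lemma map_triangular {K L : GrMod ℛ} {A : ℤ → GrMod ℛ} (σ : Splitting K A) {C : GrMod ℛ}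
    (g : K ⟶ L) (q : L ⟶ C) (j : ℤ) (z : K.V j) (k : ℤ) (hz : ∀ k' < k, app (σ.pr k') j z = 0)
    (hg : ∀ k', k < k' → σ.inc k' ≫ g ≫ q = 0) :
    app q j (app g j z) = app (σ.inc k ≫ g ≫ q) j (app (σ.pr k) j z) := by
  obtain ⟨s, h0, hs⟩ := σ.map_eq_sum (g ≫ q) j z
  refine hs.trans (Finset.sum_eq_single k (fun k' _ hk' => ?_) fun h => ?_)
  · rcases lt_or_gt_of_ne hk' with h | h
    · rw [hz _ h, map_zero]
    · rw [hg _ h]; rfl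
  · rw [h0 k h, map_zero]

end Splitting

/-- A morphism of complexes that are decomposed in such a way that the differentials and the
morphism are triangular has an acyclic cone when its diagonal part has. -/
theorem ConeAcyclic.of_triangular {K L : CochainComplex (GrMod ℛ) ℤ} {f : K ⟶ L}
    {A B : ℤ → ℤ → GrMod ℛ} (σ : ∀ n, Splitting (K.X n) (A n)) (τ : ∀ n, Splitting (L.X n) (B n))
    (hK : ∀ n m k k', k' < k → (σ n).inc k ≫ K.d n m ≫ (σ m).pr k' = 0)
    (hL : ∀ n m k k', k' < k → (τ n).inc k ≫ L.d n m ≫ (τ m).pr k' = 0)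
    (hf : ∀ n k k', k' < k → (σ n).inc k ≫ f.f n ≫ (τ n).pr k' = 0)
    (hbK : ∀ n j, ∃ b : ℤ, ∀ k, b < k → ∀ z, app ((σ n).pr k) j z = 0)
    (hbL : ∀ n j, ∃ b : ℤ, ∀ k, b < k → ∀ z, app ((τ n).pr k) j z = 0)
    (hs : ∀ (j l n m r : ℤ), l + 1 = n → n + 1 = m → m + 1 = r → ∀ k (x : (K.X m).V j)
      (y : (L.X n).V j),
      app ((σ m).inc k ≫ K.d m r ≫ (σ r).pr k) j (app ((σ m).pr k) j x) = 0 →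
      app ((σ m).inc k ≫ f.f m ≫ (τ m).pr k) j (app ((σ m).pr k) j x) =
        app ((τ n).inc k ≫ L.d n m ≫ (τ m).pr k) j (app ((τ n).pr k) j y) →
      ∃ (x' : (A n k).V j) (y' : (B l k).V j),
        app ((σ n).inc k ≫ K.d n m ≫ (σ m).pr k) j x' = app ((σ m).pr k) j x ∧
        app ((σ n).inc k ≫ f.f n ≫ (τ n).pr k) j x' =
          app ((τ n).pr k) j y + app ((τ l).inc k ≫ L.d l n ≫ (τ n).pr k) j y') :
    ConeAcyclic f := by
  refine ConeAcyclic.of_step fun j l n m r hl hm hr => ?_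
  obtain ⟨b₁, hb₁⟩ := hbK m j
  obtain ⟨b₂, hb₂⟩ := hbL n j
  let b := max b₁ b₂
  -- The measure counts the indices up to the bound `b` that may still carry a nonzero component.
  -- Components are removed from the lowest index upwards, because the maps never lower the index.
  refine ⟨fun t x y => (∀ k, k ≤ b - t → app ((σ m).pr k) j x = 0) ∧
    (∀ k, k ≤ b - t → app ((τ n).pr k) j y = 0), ?_, ?_, ?_⟩
  · rintro x y ⟨hx, hy⟩
    refine ⟨(σ m).eq_zero fun k => ?_, (τ n).eq_zero fun k => ?_⟩
    · by_cases hk : k ≤ b - (0 : ℕ)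
      · exact hx k hk
      · exact hb₁ k (by simp [b] at hk; omega) x
    · by_cases hk : k ≤ b - (0 : ℕ)
      · exact hy k hk
      · exact hb₂ k (by simp [b] at hk; omega) y
  · intro x y
    obtain ⟨s, h0, -⟩ := (σ m).sum_eq j x
    obtain ⟨s', h0', -⟩ := (τ n).sum_eq j y
    -- An element has finitely many nonzero components, so it has none below some `c`, and `b - c +
    -- 1` steps suffice.
    obtain ⟨c, hc⟩ := (s ∪ s').finite_toSet.bddBelow
    have hc' : ∀ k, k < c → k ∉ s ∧ k ∉ s' := fun k hk =>
      ⟨fun h => not_le.2 hk (hc (by simp [h])), fun h => not_le.2 hk (hc (by simp [h]))⟩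
    exact ⟨(b - c + 1).toNat, fun k hk => h0 k (hc' k (by omega)).1,
      fun k hk => h0' k (hc' k (by omega)).2⟩
  · rintro t x y ⟨hx, hy⟩ hdx hfx
    let k : ℤ := b - t
    have hx' : ∀ k' < k, app ((σ m).pr k') j x = 0 := fun k' hk' => hx k' (by push_cast; omega)
    have hy' : ∀ k' < k, app ((τ n).pr k') j y = 0 := fun k' hk' => hy k' (by push_cast; omega)
    have e1 := (σ m).map_triangular (K.d m r) ((σ r).pr k) j x k hx' (fun k' h => hK _ _ _ _ h)
    have e2 := (σ m).map_triangular (f.f m) ((τ m).pr k) j x k hx' (fun k' h => hf _ _ _ h)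
    have e3 := (τ n).map_triangular (L.d n m) ((τ m).pr k) j y k hy' (fun k' h => hL _ _ _ _ h)
    obtain ⟨u, v, h1, h2⟩ := hs j l n m r hl hm hr k x y (by rw [← e1, hdx, map_zero])
      (by rw [← e2, ← e3, hfx])
    -- The correction supported in index `k` leaves lower components zero by triangularity, and it
    -- cancels the component `k` by the choice of `u` and `v`.
    refine ⟨app ((σ n).inc k) j u, app ((τ l).inc k) j v, fun k' hk' => ?_, fun k' hk' => ?_⟩
    · rcases hk'.lt_or_eq with h | rfl
      · rw [map_sub, hx' _ h, zero_sub, neg_eq_zero]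
        exact congrArg (fun t => app t j u) (hK n m k k' h)
      · rw [map_sub, ← h1]
        exact sub_self _
    · rcases hk'.lt_or_eq with h | rfl
      · rw [map_sub, map_sub, hy' _ h, zero_sub, neg_eq_zero]
        have a1 := congrArg (fun t => app t j u) (hf n k k' h)
        have a2 := congrArg (fun t => app t j v) (hL l n k k' h)
        exact (congrArg₂ (· - ·) a1 a2).trans (sub_zero _)
      · rw [map_sub, map_sub, sub_eq_zero, eq_sub_iff_add_eq]
        exact h2.symm

end Filtration

/-! ### Coordinates in `A₀` with respect to the idempotents. -/

section Basic

variable {A : Type u} [Ring A] [Algebra ℂ A] {𝒜 : ℤ → Submodule ℂ A}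
  {Λ : Type*} [Fintype Λ] {e : Λ → A}

namespace IsBasic

/-- The idempotent `e l` in the component of degree `0`. -/
def e₀ (h : IsBasic 𝒜 e) (l : Λ) : 𝒜 0 := ⟨e l, h.mem l⟩

@[simp] lemma coe_e₀ (h : IsBasic 𝒜 e) (l : Λ) : (h.e₀ l : A) = e l := rfl

lemma sum_e (h : IsBasic 𝒜 e) : ∑ l, e l = 1 := h.idem.complete

lemma e_mul_self (h : IsBasic 𝒜 e) (l : Λ) : e l * e l = e l := h.idem.idem l

lemma e_mul_ne (h : IsBasic 𝒜 e) {l m : Λ} (hlm : l ≠ m) : e l * e m = 0 := h.idem.ortho hlm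

lemma linearIndependent (h : IsBasic 𝒜 e) : LinearIndependent ℂ e := by
  classical
  rw [Fintype.linearIndependent_iff]
  intro g hg l
  have := congrArg (· * e l) hg
  simp only [Finset.sum_mul, smul_mul_assoc, zero_mul] at this
  rw [Finset.sum_eq_single l, h.e_mul_self] at this
  · exact (smul_eq_zero.1 this).resolve_right (h.ne_zero l)
  · intro m _ hm
    rw [h.e_mul_ne hm, smul_zero]
  · simp

/-- The idempotents form a basis of the component of degree `0`. -/
def basis (h : IsBasic 𝒜 e) : Module.Basis Λ ℂ (𝒜 0) :=
  (Module.Basis.span h.linearIndependent).map (LinearEquiv.ofEq _ _ h.span)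

@[simp] lemma basis_apply (h : IsBasic 𝒜 e) (l : Λ) : h.basis l = h.e₀ l := by
  apply Subtype.ext
  simp [basis, Module.Basis.span_apply]

/-- The coordinates with respect to the idempotents. -/
def coef (h : IsBasic 𝒜 e) (l : Λ) : 𝒜 0 →ₗ[ℂ] ℂ := h.basis.coord l

lemma sum_coef (h : IsBasic 𝒜 e) (a : 𝒜 0) : ∑ l, h.coef l a • e l = a := by
  have := congrArg Subtype.val (h.basis.sum_repr a)
  simpa [coef] using this

lemma coef_e₀ [DecidableEq Λ] (h : IsBasic 𝒜 e) (l m : Λ) :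
    h.coef l (h.e₀ m) = if m = l then 1 else 0 := by
  rw [← h.basis_apply, coef, Module.Basis.coord_apply, Module.Basis.repr_self,
    Finsupp.single_apply]

lemma mul_e (h : IsBasic 𝒜 e) (a : 𝒜 0) (l : Λ) : (a : A) * e l = h.coef l a • e l := by
  classical
  conv_lhs => rw [← h.sum_coef a]
  rw [Finset.sum_mul, Finset.sum_eq_single l]
  · rw [smul_mul_assoc, h.e_mul_self]
  · intro m _ hm
    rw [smul_mul_assoc, h.e_mul_ne hm, smul_zero]
  · simp

lemma e_mul (h : IsBasic 𝒜 e) (a : 𝒜 0) (l : Λ) : e l * (a : A) = h.coef l a • e l := by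
  classical
  conv_lhs => rw [← h.sum_coef a]
  rw [Finset.mul_sum, Finset.sum_eq_single l]
  · rw [mul_smul_comm, h.e_mul_self]
  · intro m _ hm
    rw [mul_smul_comm, h.e_mul_ne hm.symm, smul_zero]
  · simp

end IsBasic

end Basic

/-! ### Exactness of `N ↦ A ⊗_{A₀} N_k`. -/

section IndExact

variable {A : Type u} [Ring A] [Algebra ℂ A] {𝒜 : ℤ → Submodule ℂ A}
  [SetLike.GradedMonoid 𝒜] {Λ : Type*} [Fintype Λ] {e : Λ → A} (hA : IsBasic 𝒜 e)

include hA in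
lemma IsBasic.deg0_mul (N : GrMod (QDual.gr 𝒜)) {k : ℤ} (a : 𝒜 0) (l : Λ) (v : N.V k) :
    N.act (zero_add k) (QDual.deg0 𝒜 (hA.e₀ l)) (N.act (zero_add k) (QDual.deg0 𝒜 a) v) =
      hA.coef l a • N.act (zero_add k) (QDual.deg0 𝒜 (hA.e₀ l)) v := by
  rw [← LinearMap.smul_apply, ← map_smul, ← map_smul]
  refine (N.mul_act _ _ _ _ _ _ v ?_).symm
  refine Eq.trans ?_ (QDual.gen0_mul 𝒜 _ _).symm
  exact congrArg (QDual.gen0 𝒜) (Subtype.ext (hA.e_mul a l).symm)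

include hA in
lemma IsBasic.sum_deg0 (N : GrMod (QDual.gr 𝒜)) {k : ℤ} (v : N.V k) :
    ∑ l, N.act (zero_add k) (QDual.deg0 𝒜 (hA.e₀ l)) v = v := by
  rw [← LinearMap.sum_apply, ← map_sum, ← map_sum]
  refine N.one_act _ _ v ?_
  refine QDual.gen0_one 𝒜 _ ?_
  rw [AddSubmonoidClass.coe_finsetSum]
  exact hA.sum_e

/-- The linear map out of the balanced tensor product given by a balanced bilinear map. -/
def IndComp.lift (N : GrMod (QDual.gr 𝒜)) {p k : ℤ} {W : Type u} [AddCommGroup W] [Module ℂ W]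
    (g : 𝒜 p →ₗ[ℂ] N.V k →ₗ[ℂ] W)
    (hg : ∀ x s v, g (lmul 𝒜 (add_zero p) x s) v =
      g x (N.act (zero_add k) (QDual.deg0 𝒜 s) v)) : IndComp 𝒜 N p k →ₗ[ℂ] W :=
  Submodule.liftQ (balRel _ _) (TensorProduct.lift g) (by
    rw [balRel, Submodule.span_le]
    rintro _ ⟨x, s, v, rfl⟩
    simp only [SetLike.mem_coe, LinearMap.mem_ker, map_sub, sub_eq_zero, TensorProduct.lift.tmul]
    exact hg x s v)

/-- The idempotent `x ⊗ v ↦ ∑ x e_l ⊗ e_l v`. -/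
def balIdem (N : GrMod (QDual.gr 𝒜)) (p k : ℤ) : 𝒜 p ⊗[ℂ] N.V k →ₗ[ℂ] 𝒜 p ⊗[ℂ] N.V k :=
  ∑ l : Λ, TensorProduct.map ((lmul 𝒜 (add_zero p)).flip (hA.e₀ l))
    (N.act (zero_add k) (QDual.deg0 𝒜 (hA.e₀ l)))

lemma balIdem_tmul (N : GrMod (QDual.gr 𝒜)) (p k : ℤ) (x : 𝒜 p) (v : N.V k) :
    balIdem hA N p k (x ⊗ₜ v) = ∑ l, lmul 𝒜 (add_zero p) x (hA.e₀ l) ⊗ₜ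
      N.act (zero_add k) (QDual.deg0 𝒜 (hA.e₀ l)) v := by
  rw [balIdem, LinearMap.sum_apply]
  rfl

/-- The natural section of the projection to the tensor product over `A₀`. -/
def balSection (N : GrMod (QDual.gr 𝒜)) (p k : ℤ) : IndComp 𝒜 N p k →ₗ[ℂ] 𝒜 p ⊗[ℂ] N.V k :=
  IndComp.lift (W := 𝒜 p ⊗[ℂ] N.V k) N
    (show 𝒜 p →ₗ[ℂ] N.V k →ₗ[ℂ] 𝒜 p ⊗[ℂ] N.V k from TensorProduct.curry (balIdem hA N p k)) (by
    intro x s v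
    change balIdem hA N p k (_ ⊗ₜ _) = balIdem hA N p k (_ ⊗ₜ _)
    rw [balIdem_tmul, balIdem_tmul]
    refine Finset.sum_congr rfl fun l _ => ?_
    have hx : lmul 𝒜 (add_zero p) (lmul 𝒜 (add_zero p) x s) (hA.e₀ l) =
        hA.coef l s • lmul 𝒜 (add_zero p) x (hA.e₀ l) :=
      Subtype.ext (by simp [mul_assoc, hA.mul_e])
    rw [hA.deg0_mul, hx]
    exact TensorProduct.smul_tmul _ _ _)

lemma balSection_mk (N : GrMod (QDual.gr 𝒜)) (p k : ℤ) (x : 𝒜 p) (v : N.V k) :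
    balSection hA N p k (IndComp.mk N x v) = ∑ l, lmul 𝒜 (add_zero p) x (hA.e₀ l) ⊗ₜ
      N.act (zero_add k) (QDual.deg0 𝒜 (hA.e₀ l)) v :=
  balIdem_tmul hA N p k x v

/-- The projection to the balanced tensor product. -/
def IndComp.ofTensor (N : GrMod (QDual.gr 𝒜)) (p k : ℤ) : 𝒜 p ⊗[ℂ] N.V k →ₗ[ℂ] IndComp 𝒜 N p k :=
  Submodule.mkQ _

lemma IndComp.ofTensor_tmul (N : GrMod (QDual.gr 𝒜)) {p k : ℤ} (x : 𝒜 p) (v : N.V k) :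
    IndComp.ofTensor N p k (x ⊗ₜ v) = IndComp.mk N x v := rfl

/-- The class of `x ⊗ v` as a bilinear function. -/
def IndComp.mk₂ (N : GrMod (QDual.gr 𝒜)) (p k : ℤ) : 𝒜 p →ₗ[ℂ] N.V k →ₗ[ℂ] IndComp 𝒜 N p k :=
  (TensorProduct.mk ℂ _ _).compr₂ (IndComp.ofTensor N p k)

lemma IndComp.mk₂_apply (N : GrMod (QDual.gr 𝒜)) {p k : ℤ} (x : 𝒜 p) (v : N.V k) :
    IndComp.mk₂ N p k x v = IndComp.mk N x v := rfl

include hA in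
lemma IndComp.sum_mk_e (N : GrMod (QDual.gr 𝒜)) {p k : ℤ} (x : 𝒜 p) (v : N.V k) :
    ∑ l, IndComp.mk N (lmul 𝒜 (add_zero p) x (hA.e₀ l))
      (N.act (zero_add k) (QDual.deg0 𝒜 (hA.e₀ l)) v) = IndComp.mk N x v := by
  classical
  simp only [IndComp.mk_smul, hA.deg0_mul, hA.coef_e₀, if_pos, one_smul]
  simp only [← IndComp.mk₂_apply]
  rw [← map_sum, hA.sum_deg0]

lemma ofTensor_balSection (N : GrMod (QDual.gr 𝒜)) (p k : ℤ) (z : IndComp 𝒜 N p k) :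
    IndComp.ofTensor N p k (balSection hA N p k z) = z := by
  refine LinearMap.congr_fun (f := IndComp.ofTensor N p k ∘ₗ balSection hA N p k)
    (g := LinearMap.id) (IndComp.hom_ext fun x v => ?_) z
  rw [LinearMap.comp_apply, balSection_mk, map_sum]
  simp only [IndComp.ofTensor_tmul]
  exact IndComp.sum_mk_e hA N x v

variable [FiniteDimensional ℂ A]

variable (𝒜) in
/-- The functor `N ↦ A ⊗_{A₀} N_k`. -/
def indF (k : ℤ) : GrMod (QDual.gr 𝒜) ⥤ GrMod 𝒜 where
  obj N := ind 𝒜 k N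
  map f := indMap 𝒜 k f
  map_id N := indMap_id 𝒜 k N
  map_comp f g := indMap_comp 𝒜 k f g

instance (k : ℤ) : (indF 𝒜 k).Additive where
  map_add {_ N _ _} := ind_hom_ext 𝒜 fun j x _ => (indMk₂ 𝒜 N j x).map_add _ _

lemma ind_linear_ext {k : ℤ} {N : GrMod (QDual.gr 𝒜)} {j : ℤ} {W : Type u} [AddCommGroup W]
    [Module ℂ W] {f g : (ind 𝒜 k N).V j →ₗ[ℂ] W}
    (h : ∀ (x : 𝒜 (j + k)) (v : N.V k), f (indMk N x v) = g (indMk N x v)) : f = g :=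
  IndComp.hom_ext h

/-- The natural section `x ⊗ v ↦ ∑ x e_l ⊗ e_l v` on the components of `A ⊗_{A₀} N_k`. -/
def indSection (k : ℤ) (N : GrMod (QDual.gr 𝒜)) (j : ℤ) :
    (ind 𝒜 k N).V j →ₗ[ℂ] 𝒜 (j + k) ⊗[ℂ] N.V k := balSection hA N (j + k) k

lemma indSection_mk (k : ℤ) (N : GrMod (QDual.gr 𝒜)) {j : ℤ} (x : 𝒜 (j + k)) (v : N.V k) :
    indSection hA k N j (indMk N x v) = ∑ l, lmul 𝒜 (add_zero (j + k)) x (hA.e₀ l) ⊗ₜ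
      N.act (zero_add k) (QDual.deg0 𝒜 (hA.e₀ l)) v := balSection_mk hA N _ _ x v

/-- The projection to the components of `A ⊗_{A₀} N_k`. -/
def indOfTensor (k : ℤ) (N : GrMod (QDual.gr 𝒜)) (j : ℤ) :
    𝒜 (j + k) ⊗[ℂ] N.V k →ₗ[ℂ] (ind 𝒜 k N).V j := IndComp.ofTensor N (j + k) k

lemma indOfTensor_indSection (k : ℤ) (N : GrMod (QDual.gr 𝒜)) (j : ℤ) (z : (ind 𝒜 k N).V j) :
    indOfTensor k N j (indSection hA k N j z) = z := ofTensor_balSection hA N _ _ z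

include hA in
-- Semisimplicity of `A₀` enters here: the section `x ⊗ v ↦ ∑ x e_l ⊗ e_l v` makes the tensor
-- product over `A₀` a natural retract of the one over ℂ, which is exact by flatness.
lemma indF_preservesExact (k : ℤ) : PreservesExact (indF 𝒜 k) := by
  intro M N P f g _ h j z hz
  have nat : ∀ {M N : GrMod (QDual.gr 𝒜)} (f : M ⟶ N) (w : (ind 𝒜 k M).V j),
      indSection hA k N j (app (indMap 𝒜 k f) j w) =
        LinearMap.lTensor _ (app f k) (indSection hA k M j w) := by
    intro M N f w
    refine LinearMap.congr_fun (ind_linear_ext (W := 𝒜 (j + k) ⊗[ℂ] N.V k)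
      (f := indSection hA k N j ∘ₗ app (indMap 𝒜 k f) j)
      (g := LinearMap.lTensor _ (app f k) ∘ₗ indSection hA k M j) fun x v => ?_) w
    rw [LinearMap.comp_apply, LinearMap.comp_apply, indMap_mk, indSection_mk, indSection_mk,
      map_sum]
    refine Finset.sum_congr rfl fun l _ => ?_
    rw [LinearMap.lTensor_tmul, app_act]
  have hex : Function.Exact (LinearMap.lTensor (𝒜 (j + k)) (app f k))
      (LinearMap.lTensor (𝒜 (j + k)) (app g k)) := by
    refine Module.Flat.lTensor_exact _ fun y => ⟨fun hy => h k y hy, ?_⟩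
    rintro ⟨w, rfl⟩
    exact congrArg (fun t => app t k w) ‹f ≫ g = 0›
  have hz' : app (indMap 𝒜 k g) j z = 0 := hz
  obtain ⟨w, hw⟩ := (hex (indSection hA k N j z)).1 (by rw [← nat g z, hz', map_zero])
  refine ⟨indOfTensor k M j w, ?_⟩
  refine Eq.trans ?_ (indOfTensor_indSection hA k N j z)
  rw [← hw]
  exact LinearMap.congr_fun (f := app (indMap 𝒜 k f) j ∘ₗ indOfTensor k M j)
    (g := indOfTensor k N j ∘ₗ LinearMap.lTensor _ (app f k))
    (TensorProduct.ext' fun x v => rfl) w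

end IndExact

/-! ### Decompositions indexed by integers. -/

section DsumSplit

variable {R S : Type u} [Ring R] [Algebra ℂ R] [Ring S] [Algebra ℂ S]
  {ℛ : ℤ → Submodule ℂ R} {𝒮 : ℤ → Submodule ℂ S}
  {ι : Type} [DecidableEq ι] {N : ι → GrMod ℛ}
  {hN : ∀ j, {i | Nontrivial ((N i).V j)}.Finite}

/-- The decomposition of the image of a direct sum under a linear functor. -/
def dsumSplit (F : GrMod ℛ ⥤ GrMod 𝒮) [F.Additive] [F.Linear ℂ] {A : ℤ → GrMod 𝒮}
    (inc : ∀ k, A k ⟶ F.obj (dsum N hN)) (pr : ∀ k, F.obj (dsum N hN) ⟶ A k) (g : ι → ℤ)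
    (hg : Function.Injective g) (h₁ : ∀ i, pr (g i) ≫ inc (g i) = F.map (proj i) ≫ F.map (inj i))
    (h₂ : ∀ k j (z : (F.obj (dsum N hN)).V j),
      (∀ i, g i = k → app (F.map (proj i)) j z = 0) → app (pr k) j z = 0) :
    Splitting (F.obj (dsum N hN)) A where
  inc := inc
  pr := pr
  sum_eq j z := by
    -- The injective integer index, viewed in ℂ, supplies the pairwise distinct scalars.
    obtain ⟨s, h0, hs⟩ := map_dsum_eq_sum F (fun i => (g i : ℂ))
      (Int.cast_injective.comp hg) j z
    refine ⟨s.map ⟨g, hg⟩, fun k hk => h₂ k j z ?_, ?_⟩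
    · rintro i rfl
      exact h0 i fun hi => hk (by simpa using hi)
    · conv_lhs => rw [hs]
      rw [Finset.sum_map]
      exact Finset.sum_congr rfl fun i _ => congrArg (fun t => app t j z) (h₁ i).symm

end DsumSplit

/-! ### Quadratic duality preserves quasi-isomorphisms. -/

section KoszulExact

variable {A : Type u} [Ring A] [Algebra ℂ A] (𝒜 : ℤ → Submodule ℂ A)
  [GradedAlgebra 𝒜] [FiniteDimensional ℂ A]

/-- The projection to the summand with index `(i, k)`. -/
def totProj (M : ℤ → GrMod (QDual.gr 𝒜)) {n i k : ℤ} (h : i + k = n) :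
    totX 𝒜 M n ⟶ ind 𝒜 k (M i) :=
  proj (N := fun p : Pairs n => ind 𝒜 p.1.2 (M p.1.1)) ⟨(i, k), h⟩

lemma totInj_proj (M : ℤ → GrMod (QDual.gr 𝒜)) {n i k : ℤ} (h : i + k = n) :
    totInj 𝒜 M h ≫ totProj 𝒜 M h = 𝟙 _ := inj_proj_self _

lemma totInj_proj_ne (M : ℤ → GrMod (QDual.gr 𝒜)) {n i k i' k' : ℤ} (h : i + k = n)
    (h' : i' + k' = n) (hk : k' ≠ k) : totInj 𝒜 M h ≫ totProj 𝒜 M h' = 0 :=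
  inj_proj_ne fun e => hk (congrArg (fun p => p.1.2) e).symm

/-- The differential of the total complex, between objects given in their explicit form. -/
def koszulDiff (M : CochainComplex (GrMod (QDual.gr 𝒜)) ℤ) (n m : ℤ) :
    totX 𝒜 M.X n ⟶ totX 𝒜 M.X m := ((koszulCom 𝒜).obj M).d n m

/-- The morphism of total complexes, between objects given in their explicit form. -/
def koszulMap {M N : CochainComplex (GrMod (QDual.gr 𝒜)) ℤ} (f : M ⟶ N) (n : ℤ) :
    totX 𝒜 M.X n ⟶ totX 𝒜 N.X n := ((koszulCom 𝒜).map f).f n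

lemma koszulDiff_eq (M : CochainComplex (GrMod (QDual.gr 𝒜)) ℤ) {n m : ℤ} (h : n + 1 = m) :
    koszulDiff 𝒜 M n m = totD 𝒜 M h := dif_pos h

lemma koszulDiff_eq_zero (M : CochainComplex (GrMod (QDual.gr 𝒜)) ℤ) {n m : ℤ} (h : n + 1 ≠ m) :
    koszulDiff 𝒜 M n m = 0 := dif_neg h

lemma koszulMap_eq {M N : CochainComplex (GrMod (QDual.gr 𝒜)) ℤ} (f : M ⟶ N) (n : ℤ) :
    koszulMap 𝒜 f n =
      totDesc 𝒜 M.X fun i k hik => indMap 𝒜 k (f.f i) ≫ totInj 𝒜 N.X hik := rfl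

/-- The decomposition of the terms of the total complex, after application of a functor. -/
def totSplit {S : Type u} [Ring S] [Algebra ℂ S] {𝒮 : ℤ → Submodule ℂ S}
    (F : GrMod 𝒜 ⥤ GrMod 𝒮) [F.Additive] [F.Linear ℂ] (M : ℤ → GrMod (QDual.gr 𝒜)) (n : ℤ) :
    Splitting (F.obj (totX 𝒜 M n)) (fun k => F.obj (ind 𝒜 k (M (n - k)))) :=
  dsumSplit F (fun k => F.map (totInj 𝒜 M (by omega))) (fun k => F.map (totProj 𝒜 M (by omega)))
    (fun p => p.1.2) (by
      rintro ⟨⟨i, k⟩, h⟩ ⟨⟨i', k'⟩, h'⟩ (e : k = k')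
      subst e
      obtain rfl : i = i' := by omega
      rfl) (by
      rintro ⟨⟨i, k⟩, h⟩
      obtain rfl : i = n - k := by omega
      rfl) (fun k j z hz => hz ⟨(n - k, k), by omega⟩ rfl)

/-- The differential of `M` keeps `k` and the linear differential raises it by one. -/
lemma totInj_d_proj_lt (M : CochainComplex (GrMod (QDual.gr 𝒜)) ℤ) {n m i k i' k' : ℤ}
    (h : i + k = n) (h' : i' + k' = m) (hk : k' < k) :
    totInj 𝒜 M.X h ≫ koszulDiff 𝒜 M n m ≫ totProj 𝒜 M.X h' = 0 := by
  by_cases hnm : n + 1 = m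
  · rw [koszulDiff_eq 𝒜 M hnm, totD, totInj_desc_assoc, Preadditive.add_comp, Linear.units_smul_comp,
      Category.assoc, Category.assoc, totInj_proj_ne _ _ _ _ (by omega),
      totInj_proj_ne _ _ _ _ (by omega)]
    simp
  · rw [koszulDiff_eq_zero 𝒜 M hnm, zero_comp, comp_zero]

lemma totInj_d_proj_self (M : CochainComplex (GrMod (QDual.gr 𝒜)) ℤ) {n m i k i' : ℤ}
    (hnm : n + 1 = m) (h : i + k = n) (h' : i' + k = m) :
    totInj 𝒜 M.X h ≫ koszulDiff 𝒜 M n m ≫ totProj 𝒜 M.X h' =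
      indMap 𝒜 k (M.d i i') := by
  obtain rfl : i' = i + 1 := by omega
  rw [koszulDiff_eq 𝒜 M hnm, totD, totInj_desc_assoc, Preadditive.add_comp, Linear.units_smul_comp,
    Category.assoc, Category.assoc, totInj_proj, totInj_proj_ne _ _ _ _ (by omega)]
  simp

lemma totInj_f_proj_ne {M N : CochainComplex (GrMod (QDual.gr 𝒜)) ℤ} (f : M ⟶ N)
    {n i k i' k' : ℤ} (h : i + k = n) (h' : i' + k' = n) (hk : k' ≠ k) :
    totInj 𝒜 M.X h ≫ koszulMap 𝒜 f n ≫ totProj 𝒜 N.X h' = 0 := by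
  rw [koszulMap_eq, totInj_desc_assoc, Category.assoc, totInj_proj_ne _ _ _ _ hk, comp_zero]

lemma totInj_f_proj_self {M N : CochainComplex (GrMod (QDual.gr 𝒜)) ℤ} (f : M ⟶ N)
    {n i k : ℤ} (h : i + k = n) :
    totInj 𝒜 M.X h ≫ koszulMap 𝒜 f n ≫ totProj 𝒜 N.X h = indMap 𝒜 k (f.f i) := by
  rw [koszulMap_eq, totInj_desc_assoc, Category.assoc, totInj_proj, Category.comp_id]

/-- Because `A` is finite dimensional, the index `k` is bounded above in each internal degree. This
is the only boundedness needed to eliminate components, so the complexes themselves may be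
unbounded. -/
lemma exists_eq_bot (j : ℤ) : ∃ b : ℤ, ∀ k, b < k → 𝒜 (j + k) = ⊥ := by
  obtain ⟨c, hc⟩ := (finite_ne_bot 𝒜).bddAbove
  refine ⟨c - j, fun k hk => ?_⟩
  by_contra h
  have := hc h
  omega

variable {Λ : Type*} [Fintype Λ] {e : Λ → A}

/-- The decomposition of the terms of the total complex. -/
def totSplitting (M : ℤ → GrMod (QDual.gr 𝒜)) (n : ℤ) :
    Splitting (totX 𝒜 M n) (fun k => ind 𝒜 k (M (n - k))) :=
  totSplit 𝒜 (𝟭 _) M n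

/-- With respect to `k`, the diagonal part of the total complex is the complex `A ⊗_{A₀} (M^•)_k`,
whose cone is acyclic by `indF_preservesExact`. -/
theorem koszulCom_coneAcyclic (hA : IsBasic 𝒜 e) {M N : CochainComplex (GrMod (QDual.gr 𝒜)) ℤ}
    {f : M ⟶ N} (hf : ConeAcyclic f) : ConeAcyclic ((koszulCom 𝒜).map f) := by
  have hb : ∀ (M : ℤ → GrMod (QDual.gr 𝒜)) (n j : ℤ), ∃ b : ℤ, ∀ k, b < k → ∀ z : (totX 𝒜 M n).V j,
      app ((totSplitting 𝒜 M n).pr k) j z = 0 := by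
    intro M n j
    obtain ⟨b, hb⟩ := exists_eq_bot 𝒜 j
    refine ⟨b, fun k hk z => ?_⟩
    have := ind_subsingleton 𝒜 (k := k) (j := j) (M (n - k)) (Or.inl (hb k hk))
    exact Subsingleton.elim _ _
  refine ConeAcyclic.of_triangular (K := (koszulCom 𝒜).obj M) (L := (koszulCom 𝒜).obj N)
    (fun n => totSplitting 𝒜 M.X n) (fun n => totSplitting 𝒜 N.X n)
    (fun n m k k' h => totInj_d_proj_lt 𝒜 M _ _ h) (fun n m k k' h => totInj_d_proj_lt 𝒜 N _ _ h)
    (fun n k k' h => totInj_f_proj_ne 𝒜 f _ _ h.ne) (hb M.X) (hb N.X) ?_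
  intro j l n m r hl hm hr k x y hx hy
  have eM : ∀ {n m : ℤ}, n + 1 = m → (totSplitting 𝒜 M.X n).inc k ≫ koszulDiff 𝒜 M n m ≫
      (totSplitting 𝒜 M.X m).pr k = indMap 𝒜 k (M.d (n - k) (m - k)) := fun h =>
    totInj_d_proj_self 𝒜 M h _ _
  have eN : ∀ {n m : ℤ}, n + 1 = m → (totSplitting 𝒜 N.X n).inc k ≫ koszulDiff 𝒜 N n m ≫
      (totSplitting 𝒜 N.X m).pr k = indMap 𝒜 k (N.d (n - k) (m - k)) := fun h =>
    totInj_d_proj_self 𝒜 N h _ _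
  have ef : ∀ n : ℤ, (totSplitting 𝒜 M.X n).inc k ≫ koszulMap 𝒜 f n ≫
      (totSplitting 𝒜 N.X n).pr k = indMap 𝒜 k (f.f (n - k)) := fun n =>
    totInj_f_proj_self 𝒜 f _
  obtain ⟨x', y', h1, h2⟩ := hf.map (indF 𝒜 k) (indF_preservesExact hA k) j (l - k) (n - k) (m - k)
    (r - k) (by omega) (by omega) (by omega) (app ((totSplitting 𝒜 M.X m).pr k) j x)
    (app ((totSplitting 𝒜 N.X n).pr k) j y)
    ((congrArg (fun t => app t j _) (eM hr)).symm.trans hx)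
    ((congrArg (fun t => app t j _) (ef m)).symm.trans
      (hy.trans (congrArg (fun t => app t j _) (eN hm))))
  exact ⟨x', y', (congrArg (fun t => app t j _) (eM hm)).trans h1,
    (congrArg (fun t => app t j _) (ef n)).trans
      (h2.trans (congrArg (fun t => _ + app t j y') (eN hl)).symm)⟩

theorem koszulExact [NonnegGraded 𝒜] (hA : IsBasic 𝒜 e) : KoszulExact 𝒜 := fun _ _ f hf =>
  Localization.inverts (QDown 𝒜) (qisDown 𝒜) ((koszulUpDown 𝒜).map f)
    ((qis_iff _).2 (koszulCom_coneAcyclic 𝒜 hA ((qis_iff _).1 hf)))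

end KoszulExact

/-! ### Universal properties of `A^!` and of its quotient. -/

section UniversalProperty

variable {A : Type u} [Ring A] [Algebra ℂ A] (𝒜 : ℤ → Submodule ℂ A) [SetLike.GradedMonoid 𝒜]

namespace QDual

variable {W : Type u} [Ring W] [Algebra ℂ W]

/-- The universal property of the quadratic dual. -/
def lift (g₀ : 𝒜 0 →ₗ[ℂ] W) (g₁ : Module.Dual ℂ (𝒜 1) →ₗ[ℂ] W)
    (one : ∀ b : 𝒜 0, (b : A) = 1 → g₀ b = 1)
    (mul : ∀ b c, g₀ b * g₀ c = g₀ (lmul 𝒜 (zero_add 0) b c))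
    (left : ∀ b f, g₀ b * g₁ f = g₁ (f ∘ₗ (lmul 𝒜 (add_zero 1)).flip b))
    (right : ∀ f b, g₁ f * g₀ b = g₁ (f ∘ₗ lmul 𝒜 (zero_add 1) b))
    (quad : ∀ (k : ℕ) (f g : Fin k → Module.Dual ℂ (𝒜 1)) (ξ : Module.Dual ℂ (𝒜 2)),
      (∀ m n : 𝒜 1, ∑ i, f i n * g i m = ξ (lmul 𝒜 one_add_one_eq_two m n)) →
      ∑ i, g₁ (f i) * g₁ (g i) = 0) : QDual 𝒜 →ₐ[ℂ] W :=
  RingQuot.liftAlgHom ℂ ⟨TensorAlgebra.lift ℂ (g₀.coprod g₁), by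
    have h0 : ∀ b, TensorAlgebra.lift ℂ (g₀.coprod g₁) (pre0 𝒜 b) = g₀ b := fun b =>
      (TensorAlgebra.lift_ι_apply _ _).trans (by simp)
    have h1 : ∀ f, TensorAlgebra.lift ℂ (g₀.coprod g₁) (pre1 𝒜 f) = g₁ f := fun f =>
      (TensorAlgebra.lift_ι_apply _ _).trans (by simp)
    intro x y h
    induction h with
    | one b hb => rw [h0, map_one, one b hb]
    | mul b c => rw [map_mul, h0, h0, h0, mul]
    | left b f g h =>
      rw [map_mul, h0, h1, h1, left]
      exact congrArg g₁ (LinearMap.ext fun m => (h m (lmul 𝒜 (add_zero 1) m b) rfl).symm)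
    | right f g b h =>
      rw [map_mul, h0, h1, h1, right]
      exact congrArg g₁ (LinearMap.ext fun m => (h m (lmul 𝒜 (zero_add 1) b m) rfl).symm)
    | quad k f g ξ h =>
      rw [map_sum, map_zero]
      simp only [map_mul, h1]
      exact quad k f g ξ h⟩

section

variable {g₀ : 𝒜 0 →ₗ[ℂ] W} {g₁ : Module.Dual ℂ (𝒜 1) →ₗ[ℂ] W} (h₁ h₂ h₃ h₄ h₅)

lemma lift_proj (t : TensorAlgebra ℂ (Gens 𝒜)) : lift 𝒜 g₀ g₁ h₁ h₂ h₃ h₄ h₅ (proj 𝒜 t) =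
    TensorAlgebra.lift ℂ (g₀.coprod g₁) t :=
  RingQuot.liftAlgHom_mkAlgHom_apply ..

lemma lift_gen0 (b : 𝒜 0) : lift 𝒜 g₀ g₁ h₁ h₂ h₃ h₄ h₅ (gen0 𝒜 b) = g₀ b :=
  (lift_proj 𝒜 h₁ h₂ h₃ h₄ h₅ (pre0 𝒜 b)).trans ((TensorAlgebra.lift_ι_apply _ _).trans (by simp))

lemma lift_gen1 (f : Module.Dual ℂ (𝒜 1)) :
    lift 𝒜 g₀ g₁ h₁ h₂ h₃ h₄ h₅ (gen1 𝒜 f) = g₁ f :=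
  (lift_proj 𝒜 h₁ h₂ h₃ h₄ h₅ (pre1 𝒜 f)).trans ((TensorAlgebra.lift_ι_apply _ _).trans (by simp))

end

lemma algHom_ext {φ φ' : QDual 𝒜 →ₐ[ℂ] W} (h0 : ∀ b, φ (gen0 𝒜 b) = φ' (gen0 𝒜 b))
    (h1 : ∀ f, φ (gen1 𝒜 f) = φ' (gen1 𝒜 f)) : φ = φ' := by
  refine RingQuot.ringQuot_ext' ℂ _ _ ?_
  refine TensorAlgebra.hom_ext ?_
  refine LinearMap.prod_ext (LinearMap.ext h0) (LinearMap.ext h1)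

/-- The component of degree `n` is `(A₁⋆)ⁿ A₀`, so the images of the generators control the image in
every degree. This turns statements about generators into compatibility with gradings. -/
lemma map_gr_le (φ : QDual 𝒜 →ₐ[ℂ] W) (P₀ P₁ : Submodule ℂ W) (h0 : ∀ b, φ (gen0 𝒜 b) ∈ P₀)
    (h1 : ∀ f, φ (gen1 𝒜 f) ∈ P₁) (n : ℤ) :
    (gr 𝒜 n).map φ.toLinearMap ≤ if n < 0 then ⊥ else P₁ ^ n.toNat * P₀ := by
  rw [gr]
  split_ifs
  · simp
  · rw [Submodule.map_mul, Submodule.map_pow]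
    refine mul_le_mul' (pow_le_pow_left' ?_ _) ?_
    · rintro _ ⟨_, ⟨f, rfl⟩, rfl⟩
      exact h1 f
    · rintro _ ⟨_, ⟨f, rfl⟩, rfl⟩
      exact h0 f

end QDual

namespace QDualQuot

variable {Λ : Type*} (e : Λ → A) (L : Set Λ) {W : Type u} [Ring W] [Algebra ℂ W]

lemma proj_gen0 {l : Λ} (hl : l ∉ L) (b : 𝒜 0) (hb : (b : A) = e l) :
    proj 𝒜 e L (QDual.gen0 𝒜 b) = 0 :=
  (RingQuot.mkAlgHom_rel ℂ ⟨l, hl, b, hb, rfl, rfl⟩).trans (map_zero _)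

/-- The universal property of the quotient. -/
def lift (φ : QDual 𝒜 →ₐ[ℂ] W)
    (hφ : ∀ l ∉ L, ∀ b : 𝒜 0, (b : A) = e l → φ (QDual.gen0 𝒜 b) = 0) :
    QDualQuot 𝒜 e L →ₐ[ℂ] W :=
  RingQuot.liftAlgHom ℂ ⟨φ, by
    rintro _ _ ⟨l, hl, b, hb, rfl, rfl⟩
    rw [hφ l hl b hb, map_zero]⟩

lemma lift_proj (φ : QDual 𝒜 →ₐ[ℂ] W) (hφ) (a : QDual 𝒜) :
    lift 𝒜 e L φ hφ (proj 𝒜 e L a) = φ a :=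
  RingQuot.liftAlgHom_mkAlgHom_apply ..

lemma algHom_ext {φ φ' : QDualQuot 𝒜 e L →ₐ[ℂ] W}
    (h : φ.comp (proj 𝒜 e L) = φ'.comp (proj 𝒜 e L)) : φ = φ' :=
  RingQuot.ringQuot_ext' ℂ _ _ h

lemma gr_eq (n : ℤ) : gr 𝒜 e L n = if n < 0 then ⊥ else
    (LinearMap.range ((proj 𝒜 e L).toLinearMap ∘ₗ QDual.gen1 𝒜)) ^ n.toNat *
      LinearMap.range ((proj 𝒜 e L).toLinearMap ∘ₗ QDual.gen0 𝒜) := by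
  rw [gr, QDual.gr]
  split_ifs
  · simp
  · rw [Submodule.map_mul, Submodule.map_pow, LinearMap.range_comp, LinearMap.range_comp]

end QDualQuot

end UniversalProperty

/-! ### Corner data: the part of `B → e_L A e_L` in degrees at most two. -/

section CornerDatum

variable {A : Type u} [Ring A] [Algebra ℂ A] {𝒜 : ℤ → Submodule ℂ A} [SetLike.GradedMonoid 𝒜]
  {Λ : Type*} [Fintype Λ] {e : Λ → A} (hA : IsBasic 𝒜 e) {L : Finset Λ}
  {B : Type u} [Ring B] [Algebra ℂ B] {ℬ : ℤ → Submodule ℂ B} [SetLike.GradedMonoid ℬ]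
  {e' : L → B} (hB : IsBasic ℬ e')

/-- The part in degrees at most `2` of a homomorphism from `B` to the corner `e_L A e_L` that is an
isomorphism in degrees `0` and `1` and reflects the quadratic relations. -/
structure CornerDatum (hA : IsBasic 𝒜 e) (hB : IsBasic ℬ e') where
  ψ : ℬ 1 →ₗ[ℂ] 𝒜 1
  injective : Function.Injective ψ
  exists_eq : ∀ a : 𝒜 1, (∑ l ∈ L, e l) * (a : A) * (∑ l ∈ L, e l) = a → ∃ b, ψ b = a
  map_e_mul : ∀ (l : L) (b : ℬ 1),
    ψ (lmul ℬ (zero_add 1) (hB.e₀ l) b) = lmul 𝒜 (zero_add 1) (hA.e₀ l) (ψ b)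
  map_mul_e : ∀ (l : L) (b : ℬ 1),
    ψ (lmul ℬ (add_zero 1) b (hB.e₀ l)) = lmul 𝒜 (add_zero 1) (ψ b) (hA.e₀ l)
  ψ₂ : ℬ 2 →ₗ[ℂ] 𝒜 2
  ψ₂_lmul : ∀ b c : ℬ 1,
    ψ₂ (lmul ℬ one_add_one_eq_two b c) = lmul 𝒜 one_add_one_eq_two (ψ b) (ψ c)
  rel : ∀ t : ℬ 1 ⊗[ℂ] ℬ 1, ψ₂ (TensorProduct.lift (lmul ℬ one_add_one_eq_two) t) = 0 →
    TensorProduct.lift (lmul ℬ one_add_one_eq_two) t = 0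

namespace IsBasic

lemma lmul_right (h : IsBasic 𝒜 e) {p : ℤ} (x : 𝒜 p) (s : 𝒜 0) :
    lmul 𝒜 (add_zero p) x s = ∑ l, h.coef l s • lmul 𝒜 (add_zero p) x (h.e₀ l) := by
  conv_lhs => rw [← h.basis.sum_repr s]
  rw [map_sum]
  exact Finset.sum_congr rfl fun l _ => by rw [map_smul, h.basis_apply]; rfl

lemma lmul_left (h : IsBasic 𝒜 e) {p : ℤ} (s : 𝒜 0) (x : 𝒜 p) :
    lmul 𝒜 (zero_add p) s x = ∑ l, h.coef l s • lmul 𝒜 (zero_add p) (h.e₀ l) x := by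
  conv_lhs => rw [← h.basis.sum_repr s]
  rw [map_sum, LinearMap.sum_apply]
  exact Finset.sum_congr rfl fun l _ => by rw [map_smul, h.basis_apply]; rfl

lemma sum_lmul_right (h : IsBasic 𝒜 e) {p : ℤ} (x : 𝒜 p) :
    ∑ l, lmul 𝒜 (add_zero p) x (h.e₀ l) = x := by
  apply Subtype.ext
  rw [AddSubmonoidClass.coe_finsetSum]
  simp only [coe_lmul, coe_e₀]
  rw [← Finset.mul_sum, h.sum_e, mul_one]

lemma sum_lmul_left (h : IsBasic 𝒜 e) {p : ℤ} (x : 𝒜 p) :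
    ∑ l, lmul 𝒜 (zero_add p) (h.e₀ l) x = x := by
  apply Subtype.ext
  rw [AddSubmonoidClass.coe_finsetSum]
  simp only [coe_lmul, coe_e₀]
  rw [← Finset.sum_mul, h.sum_e, one_mul]

lemma coef_mul (h : IsBasic 𝒜 e) (l : Λ) (a b : 𝒜 0) :
    h.coef l (lmul 𝒜 (zero_add 0) a b) = h.coef l a * h.coef l b := by
  have h1 := h.mul_e (lmul 𝒜 (zero_add 0) a b) l
  rw [coe_lmul, mul_assoc, h.mul_e b, mul_smul_comm, h.mul_e a, smul_smul] at h1
  have := sub_eq_zero.2 h1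
  rw [← sub_smul, smul_eq_zero] at this
  rw [mul_comm (h.coef l a)]
  exact (sub_eq_zero.1 (this.resolve_right (h.ne_zero l))).symm

lemma coef_one (h : IsBasic 𝒜 e) (l : Λ) (b : 𝒜 0) (hb : (b : A) = 1) : h.coef l b = 1 := by
  have h1 := h.mul_e b l
  rw [hb, one_mul] at h1
  have := sub_eq_zero.2 h1
  rw [← one_smul ℂ (e l), smul_smul, ← sub_smul, smul_eq_zero, mul_one] at this
  exact (sub_eq_zero.1 (this.resolve_right (h.ne_zero l))).symm

lemma eq_of_coef (h : IsBasic 𝒜 e) {a b : 𝒜 0} (hab : ∀ l, h.coef l a = h.coef l b) : a = b := by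
  apply Subtype.ext
  rw [← h.sum_coef a, ← h.sum_coef b]
  simp only [hab]

end IsBasic

namespace CornerDatum

variable {hA hB} (D : CornerDatum hA hB)

include hA in
variable (hA) in
lemma e_mul_eL (l : L) : e l * ∑ m ∈ L, e m = e l := by
  classical
  rw [Finset.mul_sum, Finset.sum_eq_single_of_mem (l : Λ) l.2, hA.e_mul_self]
  exact fun m _ hm => hA.e_mul_ne hm.symm

include hA in
variable (hA) in
lemma eL_mul_e (l : L) : (∑ m ∈ L, e m) * e l = e l := by
  classical
  rw [Finset.sum_mul, Finset.sum_eq_single_of_mem (l : Λ) l.2, hA.e_mul_self]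
  exact fun m _ hm => hA.e_mul_ne hm

include hA in
variable (hA) in
lemma eL_mul_e_of_notMem {l : Λ} (hl : l ∉ L) : (∑ m ∈ L, e m) * e l = 0 := by
  rw [Finset.sum_mul]
  exact Finset.sum_eq_zero fun m hm => hA.e_mul_ne (by rintro rfl; exact hl hm)

include hA in
variable (hA) in
lemma e_mul_eL_of_notMem {l : Λ} (hl : l ∉ L) : e l * (∑ m ∈ L, e m) = 0 := by
  rw [Finset.mul_sum]
  exact Finset.sum_eq_zero fun m hm => hA.e_mul_ne (by rintro rfl; exact hl hm)

lemma eL_mul_ψ (b : ℬ 1) : (∑ l ∈ L, e l) * (D.ψ b : A) = D.ψ b := by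
  conv_rhs => rw [← hB.sum_lmul_left b, map_sum, AddSubmonoidClass.coe_finsetSum]
  rw [← Finset.sum_coe_sort, Finset.sum_mul]
  exact Finset.sum_congr rfl fun l _ => by rw [D.map_e_mul]; rfl

lemma ψ_mul_eL (b : ℬ 1) : (D.ψ b : A) * (∑ l ∈ L, e l) = D.ψ b := by
  conv_rhs => rw [← hB.sum_lmul_right b, map_sum, AddSubmonoidClass.coe_finsetSum]
  rw [← Finset.sum_coe_sort, Finset.mul_sum]
  exact Finset.sum_congr rfl fun l _ => by rw [D.map_mul_e]; rfl

/-- The sum of the idempotents with index in `L`. -/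
def eL (hA : IsBasic 𝒜 e) (L : Finset Λ) : 𝒜 0 := ⟨∑ l ∈ L, e l, hA.sum_mem L⟩

/-- The map `a ↦ e_L a e_L` in degree `1`. -/
def cutE (hA : IsBasic 𝒜 e) (L : Finset Λ) : 𝒜 1 →ₗ[ℂ] 𝒜 1 :=
  (lmul 𝒜 (add_zero 1)).flip (eL hA L) ∘ₗ lmul 𝒜 (zero_add 1) (eL hA L)

lemma coe_cutE (a : 𝒜 1) :
    (cutE hA L a : A) = (∑ l ∈ L, e l) * a * (∑ l ∈ L, e l) := rfl

lemma cutE_mem (a : 𝒜 1) : cutE hA L a ∈ LinearMap.range D.ψ := by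
  obtain ⟨b, hb⟩ := D.exists_eq (cutE hA L a) (by
    have := hA.isIdempotentElem L
    rw [coe_cutE, ← mul_assoc, ← mul_assoc, this, mul_assoc, this])
  exact ⟨b, hb⟩

/-- The projection to `e_L A₁ e_L` followed by the inverse of `ψ`. -/
def κ : 𝒜 1 →ₗ[ℂ] ℬ 1 :=
  (LinearEquiv.ofInjective D.ψ D.injective).symm.toLinearMap ∘ₗ
    (cutE hA L).codRestrict (LinearMap.range D.ψ) D.cutE_mem

lemma ψ_κ (a : 𝒜 1) : D.ψ (D.κ a) = cutE hA L a :=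
  congrArg Subtype.val ((LinearEquiv.ofInjective D.ψ D.injective).apply_symm_apply
    ⟨cutE hA L a, D.cutE_mem a⟩)

lemma κ_ψ (b : ℬ 1) : D.κ (D.ψ b) = b := by
  apply D.injective
  rw [ψ_κ]
  apply Subtype.ext
  rw [coe_cutE, D.eL_mul_ψ, D.ψ_mul_eL]

/-- The inclusion of `B₀` in `A₀`. -/
def ψ₀ (hA : IsBasic 𝒜 e) (hB : IsBasic ℬ e') : ℬ 0 →ₗ[ℂ] 𝒜 0 :=
  ∑ l : L, (hB.coef l).smulRight (hA.e₀ l)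

lemma ψ₀_apply (b : ℬ 0) : ψ₀ hA hB b = ∑ l : L, hB.coef l b • hA.e₀ l := by
  rw [ψ₀, LinearMap.sum_apply]
  rfl

/-- The projection of `A₀` to `B₀`. -/
def χ₀ (hA : IsBasic 𝒜 e) (hB : IsBasic ℬ e') : 𝒜 0 →ₗ[ℂ] ℬ 0 :=
  ∑ l : L, (hA.coef (l : Λ)).smulRight (hB.e₀ l)

lemma χ₀_apply (a : 𝒜 0) : χ₀ hA hB a = ∑ l : L, hA.coef (l : Λ) a • hB.e₀ l := by
  rw [χ₀, LinearMap.sum_apply]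
  rfl

@[simp] lemma coef_χ₀ (l : L) (a : 𝒜 0) : hB.coef l (χ₀ hA hB a) = hA.coef (l : Λ) a := by
  classical
  rw [χ₀_apply, map_sum]
  simp [hB.coef_e₀]

lemma coef_ψ₀ (l : L) (b : ℬ 0) : hA.coef (l : Λ) (ψ₀ hA hB b) = hB.coef l b := by
  classical
  rw [ψ₀_apply, map_sum]
  simp [hA.coef_e₀]

lemma coef_ψ₀_of_notMem {l : Λ} (hl : l ∉ L) (b : ℬ 0) : hA.coef l (ψ₀ hA hB b) = 0 := by
  classical
  rw [ψ₀_apply, map_sum]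
  refine Finset.sum_eq_zero fun m _ => ?_
  rw [map_smul, hA.coef_e₀, if_neg (by rintro rfl; exact hl m.2), smul_zero]

lemma χ₀_ψ₀ (b : ℬ 0) : χ₀ hA hB (ψ₀ hA hB b) = b := hB.eq_of_coef fun l => by
  rw [coef_χ₀, coef_ψ₀]

lemma ψ₀_e₀ (l : L) : ψ₀ hA hB (hB.e₀ l) = hA.e₀ l := by
  classical
  rw [ψ₀_apply]
  simp [hB.coef_e₀]

lemma ψ₀_mul (b c : ℬ 0) : ψ₀ hA hB (lmul ℬ (zero_add 0) b c) =
    lmul 𝒜 (zero_add 0) (ψ₀ hA hB b) (ψ₀ hA hB c) := hA.eq_of_coef fun l => by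
  rw [hA.coef_mul]
  by_cases hl : l ∈ L
  · have := fun x => coef_ψ₀ (hA := hA) (hB := hB) ⟨l, hl⟩ x
    simp only at this
    rw [this, this, this, hB.coef_mul]
  · simp only [coef_ψ₀_of_notMem hl, mul_zero]

/-- `ψ` is linear over all of `A₀`, acting on `B` through `χ₀`, since the idempotents outside `L`
annihilate its image. Dually, `f ↦ f ∘ ψ` respects the bimodule relations, which is what `χ` needs.
-/
lemma ψ_lmul_χ₀ (a : 𝒜 0) (b : ℬ 1) :
    D.ψ (lmul ℬ (zero_add 1) (χ₀ hA hB a) b) = lmul 𝒜 (zero_add 1) a (D.ψ b) := by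
  classical
  rw [hB.lmul_left, map_sum, hA.lmul_left, ← Finset.sum_subset L.subset_univ]
  · refine Eq.trans ?_ (Finset.sum_coe_sort L _)
    exact Finset.sum_congr rfl fun l _ => by rw [map_smul, D.map_e_mul, coef_χ₀]
  · intro l _ hl
    have : lmul 𝒜 (zero_add 1) (hA.e₀ l) (D.ψ b) = 0 := Subtype.ext (by
      rw [coe_lmul, hA.coe_e₀, ← D.eL_mul_ψ, ← mul_assoc, e_mul_eL_of_notMem hA hl, zero_mul]; rfl)
    rw [this, smul_zero]

lemma ψ_lmul_χ₀_right (b : ℬ 1) (a : 𝒜 0) :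
    D.ψ (lmul ℬ (add_zero 1) b (χ₀ hA hB a)) = lmul 𝒜 (add_zero 1) (D.ψ b) a := by
  classical
  rw [hB.lmul_right, map_sum, hA.lmul_right, ← Finset.sum_subset L.subset_univ]
  · refine Eq.trans ?_ (Finset.sum_coe_sort L _)
    exact Finset.sum_congr rfl fun l _ => by rw [map_smul, D.map_mul_e, coef_χ₀]
  · intro l _ hl
    have : lmul 𝒜 (add_zero 1) (D.ψ b) (hA.e₀ l) = 0 := Subtype.ext (by
      rw [coe_lmul, hA.coe_e₀, ← D.ψ_mul_eL, mul_assoc, eL_mul_e_of_notMem hA hl, mul_zero]; rfl)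
    rw [this, smul_zero]

/-- `e_L` commutes with the image of `B₀`, so the cut `a ↦ e_L a e_L` is `B₀`-linear. This is the
bimodule relation needed for `θHom`. -/
lemma κ_lmul_ψ₀ (b : ℬ 0) (a : 𝒜 1) :
    D.κ (lmul 𝒜 (zero_add 1) (ψ₀ hA hB b) a) = lmul ℬ (zero_add 1) b (D.κ a) := by
  apply D.injective
  conv_rhs => rw [← χ₀_ψ₀ (hA := hA) (hB := hB) b, ψ_lmul_χ₀]
  rw [ψ_κ, ψ_κ]
  apply Subtype.ext
  have h1 : (∑ l ∈ L, e l) * (ψ₀ hA hB b : A) = ψ₀ hA hB b * ∑ l ∈ L, e l := by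
    rw [ψ₀_apply, AddSubmonoidClass.coe_finsetSum, Finset.mul_sum, Finset.sum_mul]
    refine Finset.sum_congr rfl fun l _ => ?_
    change (∑ l ∈ L, e l) * (hB.coef l b • e l) = (hB.coef l b • e l) * (∑ l ∈ L, e l)
    rw [mul_smul_comm, smul_mul_assoc, eL_mul_e hA, e_mul_eL hA]
  rw [coe_lmul, coe_cutE, coe_cutE, coe_lmul, ← mul_assoc, h1]
  simp only [mul_assoc]

lemma κ_lmul_ψ₀_right (a : 𝒜 1) (b : ℬ 0) :
    D.κ (lmul 𝒜 (add_zero 1) a (ψ₀ hA hB b)) = lmul ℬ (add_zero 1) (D.κ a) b := by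
  apply D.injective
  conv_rhs => rw [← χ₀_ψ₀ (hA := hA) (hB := hB) b, ψ_lmul_χ₀_right]
  rw [ψ_κ, ψ_κ]
  apply Subtype.ext
  have h1 : (∑ l ∈ L, e l) * (ψ₀ hA hB b : A) = ψ₀ hA hB b * ∑ l ∈ L, e l := by
    rw [ψ₀_apply, AddSubmonoidClass.coe_finsetSum, Finset.mul_sum, Finset.sum_mul]
    refine Finset.sum_congr rfl fun l _ => ?_
    change (∑ l ∈ L, e l) * (hB.coef l b • e l) = (hB.coef l b • e l) * (∑ l ∈ L, e l)
    rw [mul_smul_comm, smul_mul_assoc, eL_mul_e hA, e_mul_eL hA]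
  rw [coe_lmul, coe_cutE, coe_cutE, coe_lmul, ← mul_assoc, mul_assoc _ _ (∑ l ∈ L, e l), ← h1]
  simp only [mul_assoc]

end CornerDatum

end CornerDatum

/-! ### The isomorphism between `B^!` and the quotient of `A^!`. -/

section CornerDual

lemma exists_dual_comp_eq {U V : Type u} [AddCommGroup U] [Module ℂ U] [AddCommGroup V]
    [Module ℂ V] (f : U →ₗ[ℂ] V) (φ : U →ₗ[ℂ] ℂ) (h : ∀ x, f x = 0 → φ x = 0) :
    ∃ ξ : V →ₗ[ℂ] ℂ, ξ ∘ₗ f = φ := by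
  have : φ ∈ LinearMap.range f.dualMap := by
    rw [LinearMap.range_dualMap_eq_dualAnnihilator_ker]
    exact (Submodule.mem_dualAnnihilator _).2 h
  exact this

variable {A : Type u} [Ring A] [Algebra ℂ A] [FiniteDimensional ℂ A]
  {𝒜 : ℤ → Submodule ℂ A} [SetLike.GradedMonoid 𝒜]
  {Λ : Type*} [Fintype Λ] {e : Λ → A} {hA : IsBasic 𝒜 e} {L : Finset Λ}
  {B : Type u} [Ring B] [Algebra ℂ B] {ℬ : ℤ → Submodule ℂ B} [SetLike.GradedMonoid ℬ]
  {e' : L → B} {hB : IsBasic ℬ e'}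

namespace CornerDatum

variable (D : CornerDatum hA hB)

/-- The homomorphism `A^! → B^!`. -/
def χ : QDual 𝒜 →ₐ[ℂ] QDual ℬ :=
  QDual.lift 𝒜 (QDual.gen0 ℬ ∘ₗ χ₀ hA hB) (QDual.gen1 ℬ ∘ₗ D.ψ.dualMap)
    (fun b hb => QDual.gen0_one ℬ _ (by
      have : χ₀ hA hB b = ⟨1, SetLike.GradedOne.one_mem⟩ := hB.eq_of_coef fun l => by
        rw [coef_χ₀, hA.coef_one _ _ hb, hB.coef_one _ _ rfl]
      rw [this]))
    (fun b c => (QDual.gen0_mul ℬ _ _).trans (congrArg (QDual.gen0 ℬ) (hB.eq_of_coef fun l => by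
      rw [coef_χ₀, hB.coef_mul, coef_χ₀, coef_χ₀, hA.coef_mul])))
    (fun b f => QDual.gen0_mul_gen1 ℬ _ _ _ fun m m' h => by
      obtain rfl : m' = lmul ℬ (add_zero 1) m (χ₀ hA hB b) := Subtype.ext h
      exact congrArg f (D.ψ_lmul_χ₀_right m b).symm)
    (fun f b => QDual.gen1_mul_gen0 ℬ _ _ _ fun m m' h => by
      obtain rfl : m' = lmul ℬ (zero_add 1) (χ₀ hA hB b) m := Subtype.ext h
      exact congrArg f (D.ψ_lmul_χ₀ b m).symm)
    (fun k f g ξ h => QDual.quad ℬ _ _ (ξ ∘ₗ D.ψ₂) fun m n => by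
      refine (h (D.ψ m) (D.ψ n)).trans ?_
      rw [LinearMap.comp_apply, D.ψ₂_lmul])

@[simp] lemma χ_gen0 (a : 𝒜 0) : D.χ (QDual.gen0 𝒜 a) = QDual.gen0 ℬ (χ₀ hA hB a) :=
  QDual.lift_gen0 ..

@[simp] lemma χ_gen1 (f : Module.Dual ℂ (𝒜 1)) :
    D.χ (QDual.gen1 𝒜 f) = QDual.gen1 ℬ (f ∘ₗ D.ψ) := QDual.lift_gen1 ..

lemma χ_mem (n : ℤ) (a : QDual 𝒜) (ha : a ∈ QDual.gr 𝒜 n) : D.χ a ∈ QDual.gr ℬ n :=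
  QDual.map_gr_le 𝒜 D.χ _ _ (fun b => by rw [χ_gen0]; exact ⟨_, rfl⟩)
    (fun f => by rw [χ_gen1]; exact ⟨_, rfl⟩) n ⟨a, ha, rfl⟩

/-- By `rel`, the functional `ξ` composed with multiplication vanishes on the kernel of `B₁ ⊗ B₁ →
B₂ → A₂`, so it factors through `A₂`. -/
lemma exists_extension (ξ : Module.Dual ℂ (ℬ 2)) : ∃ ξ' : Module.Dual ℂ (𝒜 2), ∀ b c : ℬ 1,
    ξ' (lmul 𝒜 one_add_one_eq_two (D.ψ b) (D.ψ c)) = ξ (lmul ℬ one_add_one_eq_two b c) := by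
  let μ : ℬ 1 ⊗[ℂ] ℬ 1 →ₗ[ℂ] ℬ 2 := TensorProduct.lift (lmul ℬ one_add_one_eq_two)
  obtain ⟨ξ', h⟩ := exists_dual_comp_eq (U := ℬ 1 ⊗[ℂ] ℬ 1) (D.ψ₂ ∘ₗ μ) (ξ ∘ₗ μ) fun t ht =>
    (congrArg ξ (D.rel t ht)).trans (map_zero ξ)
  refine ⟨ξ', fun b c => ?_⟩
  rw [← D.ψ₂_lmul]
  exact LinearMap.congr_fun h (b ⊗ₜ c)

include hA in
lemma proj_gen0_compl (a : 𝒜 0) (ha : (a : A) = 1 - ∑ l ∈ L, e l) :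
    QDualQuot.proj 𝒜 e L (QDual.gen0 𝒜 a) = 0 := by
  classical
  have : a = ∑ l ∈ Finset.univ \ L, hA.e₀ l := by
    apply Subtype.ext
    rw [ha, AddSubmonoidClass.coe_finsetSum, ← hA.sum_e, sub_eq_iff_eq_add]
    exact (Finset.sum_sdiff L.subset_univ).symm
  rw [this, map_sum, map_sum]
  refine Finset.sum_eq_zero fun l hl => QDualQuot.proj_gen0 𝒜 e L (l := l) ?_ _ rfl
  simpa using hl

/-- The elements `f i ∘ κ`, `g i ∘ κ` need not satisfy a relation in `A^!` itself: they see only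
products `m e_L n`, whereas a relation of `A^!` comes from a functional of `m n`. The discrepancy
`γ` comes from `m (1 - e_L) n` and dies in the quotient. -/
lemma proj_quad {k : ℕ} (f g : Fin k → Module.Dual ℂ (ℬ 1)) (ξ : Module.Dual ℂ (ℬ 2))
    (h : ∀ m n : ℬ 1, ∑ i, f i n * g i m = ξ (lmul ℬ one_add_one_eq_two m n)) :
    ∑ i, QDualQuot.proj 𝒜 e L (QDual.gen1 𝒜 (f i ∘ₗ D.κ)) *
      QDualQuot.proj 𝒜 e L (QDual.gen1 𝒜 (g i ∘ₗ D.κ)) = 0 := by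
  obtain ⟨ξ', hξ⟩ := D.exists_extension ξ
  let b := basis1 𝒜
  let c : 𝒜 0 := ⟨1 - ∑ l ∈ L, e l, sub_mem SetLike.GradedOne.one_mem (hA.sum_mem L)⟩
  let E : 𝒜 2 →ₗ[ℂ] 𝒜 2 := (lmul 𝒜 (add_zero 2)).flip (eL hA L) ∘ₗ lmul 𝒜 (zero_add 2) (eL hA L)
  let β : 𝒜 1 →ₗ[ℂ] 𝒜 1 →ₗ[ℂ] ℂ := (lmul 𝒜 one_add_one_eq_two).compr₂ (ξ' ∘ₗ E)
  let γ : 𝒜 1 →ₗ[ℂ] 𝒜 1 →ₗ[ℂ] ℂ := β ∘ₗ (lmul 𝒜 (add_zero 1)).flip c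
  have hβ : ∀ m n, β m n = ξ (lmul ℬ one_add_one_eq_two (D.κ m) (D.κ n)) + γ m n := by
    intro m n
    rw [← hξ, D.ψ_κ, D.ψ_κ]
    change ξ' _ = _ + ξ' _
    rw [← map_add]
    refine congrArg ξ' (Subtype.ext ?_)
    have hid : (∑ l ∈ L, e l) * ∑ l ∈ L, e l = ∑ l ∈ L, e l := hA.isIdempotentElem L
    change (∑ l ∈ L, e l) * ((m : A) * n) * (∑ l ∈ L, e l) =
      (∑ l ∈ L, e l) * m * (∑ l ∈ L, e l) * ((∑ l ∈ L, e l) * n * (∑ l ∈ L, e l)) +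
      (∑ l ∈ L, e l) * ((m : A) * (1 - ∑ l ∈ L, e l) * n) * (∑ l ∈ L, e l)
    generalize (∑ l ∈ L, e l) = s at hid
    have : s * (m : A) * s * (s * n * s) = s * m * (s * s) * n * s := by noncomm_ring
    rw [this, hid]
    noncomm_ring
  -- The given tensor together with an expansion of `γ` in a basis of the second variable is exactly
  -- the relation attached to the functional `ξ' ∘ₗ E` on `A₂`.
  have := QDual.quad' 𝒜 (ι := Fin k ⊕ Fin (Module.finrank ℂ (𝒜 1)))
    (Sum.elim (fun i => f i ∘ₗ D.κ) (fun i => b.coord i))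
    (Sum.elim (fun i => g i ∘ₗ D.κ) (fun i => γ.flip (b i))) (ξ' ∘ₗ E) (fun m n => by
      rw [Fintype.sum_sum_type]
      refine Eq.trans ?_ (hβ m n).symm
      rw [← h]
      congr 1
      conv_rhs => rw [← b.sum_repr n]
      rw [map_sum]
      exact Finset.sum_congr rfl fun i _ => (map_smul (γ m) _ _).symm)
  have h2 := congrArg (QDualQuot.proj 𝒜 e L) this
  rw [Fintype.sum_sum_type, map_add, map_sum, map_sum, map_zero] at h2
  simp only [Sum.elim_inl, Sum.elim_inr, map_mul] at h2
  rw [Finset.sum_eq_zero (s := (Finset.univ : Finset (Fin (Module.finrank ℂ (𝒜 1))))),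
    add_zero] at h2
  · exact h2
  · intro i _
    -- Right multiplication of the argument by `c = 1 - e_L` is the left action of `c` on `A₁⋆`, and
    -- `c` maps to zero in the quotient.
    have h3 : QDual.gen1 𝒜 (γ.flip (b i)) = QDual.gen0 𝒜 c * QDual.gen1 𝒜 (β.flip (b i)) :=
      (QDual.gen0_mul_gen1 𝒜 _ _ _ fun m m' h => by
        obtain rfl : m' = lmul 𝒜 (add_zero 1) m c := Subtype.ext h
        rfl).symm
    rw [h3, map_mul, proj_gen0_compl (hA := hA) c rfl, zero_mul, mul_zero]

/-- The homomorphism `B^! → A^! / (e_l; l ∉ L)`. -/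
def θHom : QDual ℬ →ₐ[ℂ] QDualQuot 𝒜 e L :=
  QDual.lift ℬ ((QDualQuot.proj 𝒜 e L).toLinearMap ∘ₗ QDual.gen0 𝒜 ∘ₗ ψ₀ hA hB)
    ((QDualQuot.proj 𝒜 e L).toLinearMap ∘ₗ QDual.gen1 𝒜 ∘ₗ D.κ.dualMap)
    (fun b hb => by
      change QDualQuot.proj 𝒜 e L (QDual.gen0 𝒜 (ψ₀ hA hB b)) = 1
      have h1 : ψ₀ hA hB b = eL hA L := by
        apply Subtype.ext
        rw [ψ₀_apply, AddSubmonoidClass.coe_finsetSum]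
        refine Eq.trans ?_ (Finset.sum_coe_sort L _)
        refine Finset.sum_congr rfl fun l _ => ?_
        rw [hB.coef_one l b hb, one_smul]
        rfl
      have h2 : eL hA L = ⟨1, SetLike.GradedOne.one_mem⟩ -
          ⟨1 - ∑ l ∈ L, e l, sub_mem SetLike.GradedOne.one_mem (hA.sum_mem L)⟩ :=
        Subtype.ext (sub_sub_cancel _ _).symm
      rw [h1, h2, map_sub, map_sub, QDual.gen0_one 𝒜 _ rfl, map_one,
        proj_gen0_compl (hA := hA) _ rfl, sub_zero])
    (fun b c => (map_mul (QDualQuot.proj 𝒜 e L) _ _).symm.trans (congrArg (QDualQuot.proj 𝒜 e L)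
      ((QDual.gen0_mul 𝒜 _ _).trans (congrArg (QDual.gen0 𝒜) (ψ₀_mul b c).symm))))
    (fun b f => (map_mul (QDualQuot.proj 𝒜 e L) _ _).symm.trans (congrArg (QDualQuot.proj 𝒜 e L)
      (QDual.gen0_mul_gen1 𝒜 _ (f ∘ₗ D.κ) ((f ∘ₗ (lmul ℬ (add_zero 1)).flip b) ∘ₗ D.κ) fun m m' h => by
        obtain rfl : m' = lmul 𝒜 (add_zero 1) m (ψ₀ hA hB b) := Subtype.ext h
        exact congrArg f (D.κ_lmul_ψ₀_right m b).symm)))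
    (fun f b => (map_mul (QDualQuot.proj 𝒜 e L) _ _).symm.trans (congrArg (QDualQuot.proj 𝒜 e L)
      (QDual.gen1_mul_gen0 𝒜 (f ∘ₗ D.κ) ((f ∘ₗ lmul ℬ (zero_add 1) b) ∘ₗ D.κ) _ fun m m' h => by
        obtain rfl : m' = lmul 𝒜 (zero_add 1) (ψ₀ hA hB b) m := Subtype.ext h
        exact congrArg f (D.κ_lmul_ψ₀ b m).symm)))
    (fun _ f g ξ h => D.proj_quad f g ξ h)

@[simp] lemma θHom_gen0 (b : ℬ 0) :
    D.θHom (QDual.gen0 ℬ b) = QDualQuot.proj 𝒜 e L (QDual.gen0 𝒜 (ψ₀ hA hB b)) :=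
  QDual.lift_gen0 ..

@[simp] lemma θHom_gen1 (f : Module.Dual ℂ (ℬ 1)) :
    D.θHom (QDual.gen1 ℬ f) = QDualQuot.proj 𝒜 e L (QDual.gen1 𝒜 (f ∘ₗ D.κ)) :=
  QDual.lift_gen1 ..

/-- The homomorphism `A^! / (e_l; l ∉ L) → B^!`. -/
def θInv : QDualQuot 𝒜 e L →ₐ[ℂ] QDual ℬ :=
  QDualQuot.lift 𝒜 e L D.χ fun l hl b hb => by
    classical
    have : χ₀ hA hB b = 0 := by
      obtain rfl : b = hA.e₀ l := Subtype.ext hb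
      rw [χ₀_apply]
      refine Finset.sum_eq_zero fun m _ => ?_
      rw [hA.coef_e₀, if_neg (by rintro rfl; exact hl m.2), zero_smul]
    rw [χ_gen0, this, map_zero]

@[simp] lemma θInv_proj (a : QDual 𝒜) : D.θInv (QDualQuot.proj 𝒜 e L a) = D.χ a :=
  QDualQuot.lift_proj ..

/-- On `A₁⋆` the composite is `f ↦ e_L f e_L`, which becomes the identity because `e_L` is the unit
of the quotient. On `A₀` only coordinates outside `L` are lost, and those idempotents are zero
there. -/
lemma θHom_χ (a : QDual 𝒜) : D.θHom (D.χ a) = QDualQuot.proj 𝒜 e L a := by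
  refine AlgHom.congr_fun (φ₁ := D.θHom.comp D.χ) (QDual.algHom_ext 𝒜 (fun b => ?_) fun f => ?_) a
  · rw [AlgHom.comp_apply, χ_gen0, θHom_gen0, ← sub_eq_zero, ← map_sub, ← map_sub]
    set c := ψ₀ hA hB (χ₀ hA hB b) - b
    rw [← hA.basis.sum_repr c, map_sum, map_sum]
    refine Finset.sum_eq_zero fun l _ => ?_
    rw [map_smul, map_smul, hA.basis_apply]
    by_cases hl : l ∈ L
    · have : hA.coef l c = 0 := by
        have h1 := coef_ψ₀ (hA := hA) (hB := hB) ⟨l, hl⟩ (χ₀ hA hB b)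
        rw [coef_χ₀] at h1
        rw [map_sub, sub_eq_zero]
        exact h1
      exact (congrArg (· • _) this).trans (zero_smul _ _)
    · rw [QDualQuot.proj_gen0 𝒜 e L (l := l) (by simpa using hl) _ rfl, smul_zero]
  · rw [AlgHom.comp_apply, χ_gen1, θHom_gen1]
    have h1 : QDual.gen1 𝒜 ((f ∘ₗ D.ψ) ∘ₗ D.κ) =
        QDual.gen0 𝒜 (eL hA L) * (QDual.gen1 𝒜 f * QDual.gen0 𝒜 (eL hA L)) := by
      rw [QDual.gen1_mul_gen0 𝒜 f (f ∘ₗ lmul 𝒜 (zero_add 1) (eL hA L)) _ fun m m' h => by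
        obtain rfl : m' = lmul 𝒜 (zero_add 1) (eL hA L) m := Subtype.ext h
        rfl]
      refine (QDual.gen0_mul_gen1 𝒜 _ _ _ fun m m' h => ?_).symm
      obtain rfl : m' = lmul 𝒜 (add_zero 1) m (eL hA L) := Subtype.ext h
      refine (congrArg f (D.ψ_κ m)).trans (congrArg f (Subtype.ext ?_))
      exact mul_assoc _ _ _
    have h2 : QDualQuot.proj 𝒜 e L (QDual.gen0 𝒜 (eL hA L)) = 1 := by
      have h2 : eL hA L = ⟨1, SetLike.GradedOne.one_mem⟩ -
          ⟨1 - ∑ l ∈ L, e l, sub_mem SetLike.GradedOne.one_mem (hA.sum_mem L)⟩ :=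
        Subtype.ext (sub_sub_cancel _ _).symm
      rw [h2, map_sub, map_sub, QDual.gen0_one 𝒜 _ rfl, map_one,
        proj_gen0_compl (hA := hA) _ rfl, sub_zero]
    rw [h1, map_mul, map_mul, h2, one_mul, mul_one]

/-- The isomorphism `B^! ≃ A^! / (e_l; l ∉ L)`. -/
def θ : QDual ℬ ≃ₐ[ℂ] QDualQuot 𝒜 e L :=
  AlgEquiv.ofAlgHom D.θHom D.θInv
    (QDualQuot.algHom_ext 𝒜 e L (AlgHom.ext fun a =>
      (congrArg D.θHom (D.θInv_proj a)).trans (D.θHom_χ a)))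
    (QDual.algHom_ext ℬ (fun b => by
      rw [AlgHom.comp_apply, θHom_gen0, θInv_proj, χ_gen0, χ₀_ψ₀]; rfl) fun f => by
      rw [AlgHom.comp_apply, θHom_gen1, θInv_proj, χ_gen1]
      exact congrArg (QDual.gen1 ℬ) (LinearMap.ext fun b => congrArg f (D.κ_ψ b)))

lemma θ_gen0 (b : ℬ 0) :
    D.θ (QDual.gen0 ℬ b) = QDualQuot.proj 𝒜 e L (QDual.gen0 𝒜 (ψ₀ hA hB b)) := D.θHom_gen0 b

lemma θ_χ (a : QDual 𝒜) : D.θ (D.χ a) = QDualQuot.proj 𝒜 e L a := D.θHom_χ a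

lemma θ_gen1 (f : Module.Dual ℂ (𝒜 1)) :
    D.θ (QDual.gen1 ℬ (f ∘ₗ D.ψ)) = QDualQuot.proj 𝒜 e L (QDual.gen1 𝒜 f) := by
  rw [← χ_gen1, θ_χ]

lemma θ_mem_iff (n : ℤ) (a : QDual ℬ) :
    D.θ a ∈ QDualQuot.gr 𝒜 e L n ↔ a ∈ QDual.gr ℬ n := by
  constructor
  · rintro ⟨c, hc, h⟩
    -- A homogeneous lift `c` to `A^!` exists by definition of the quotient grading, and `χ`
    -- preserves degrees.
    have : a = D.χ c := D.θ.injective ((D.θ_χ c).trans h).symm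
    rw [this]
    exact D.χ_mem n c hc
  · intro ha
    rw [QDualQuot.gr_eq]
    exact QDual.map_gr_le ℬ D.θHom _ _ (fun b => by rw [θHom_gen0]; exact ⟨_, rfl⟩)
      (fun f => by rw [θHom_gen1]; exact ⟨_, rfl⟩) n ⟨a, ha, rfl⟩

end CornerDatum

end CornerDual

/-! ### Free modules and `A ⊗_{A₀} N_k` as a retract of a finite free module. -/

section Free

variable {A : Type u} [Ring A] [Algebra ℂ A] [FiniteDimensional ℂ A]
  (𝒜 : ℤ → Submodule ℂ A) [SetLike.GradedMonoid 𝒜]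

/-- The free graded module `A⟨-k⟩`. -/
def free (k : ℤ) : GrMod 𝒜 where
  V j := 𝒜 (j + k)
  act {n i j} h := lmul 𝒜 (by omega : n + (i + k) = j + k)
  one_act h a v ha := Subtype.ext (by simp [ha])
  mul_act h₁ h₂ h₃ a b c v hc := Subtype.ext (by simp [hc, mul_assoc])

/-- The projective graded module `A s⟨-k⟩`. -/
def freeCut (s : A) (k : ℤ) : GrMod 𝒜 where
  V j := rightCut 𝒜 s (j + k)
  act {n i j} h := cutMul 𝒜 s (by omega : n + (i + k) = j + k)
  one_act h a v ha := Subtype.ext (by simp [ha])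
  mul_act h₁ h₂ h₃ a b c v hc := Subtype.ext (by simp [hc, mul_assoc])

variable {𝒜}

/-- The underlying element of `A`. -/
def freeVal {k j : ℤ} : (free 𝒜 k).V j →ₗ[ℂ] A := Submodule.subtype (𝒜 (j + k))

/-- The underlying element of `A`. -/
def cutVal {s : A} {k j : ℤ} : (freeCut 𝒜 s k).V j →ₗ[ℂ] A :=
  Submodule.subtype (rightCut 𝒜 s (j + k))

lemma freeVal_injective {k j : ℤ} : Function.Injective (freeVal : (free 𝒜 k).V j →ₗ[ℂ] A) :=
  Subtype.val_injective

lemma cutVal_injective {s : A} {k j : ℤ} :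
    Function.Injective (cutVal : (freeCut 𝒜 s k).V j →ₗ[ℂ] A) :=
  Subtype.val_injective

lemma cutVal_act {s : A} {k n i j : ℤ} (h : n + i = j) (a : 𝒜 n) (z : (freeCut 𝒜 s k).V i) :
    cutVal ((freeCut 𝒜 s k).act h a z) = a * cutVal z := rfl

lemma cutVal_mem {s : A} {k j : ℤ} (z : (freeCut 𝒜 s k).V j) : cutVal z ∈ 𝒜 (j + k) := z.2.1

lemma cutVal_mul {s : A} {k j : ℤ} (z : (freeCut 𝒜 s k).V j) : cutVal z * s = cutVal z := z.2.2

/-- The element of `A s⟨-k⟩` underlying an element of `A⟨-k⟩` that is fixed by `s`. -/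
def cutMk (s : 𝒜 0) (hs : (s : A) * s = s) {k j : ℤ} :
    𝒜 (j + k) →ₗ[ℂ] (freeCut 𝒜 (s : A) k).V j :=
  LinearMap.codRestrict (rightCut 𝒜 (s : A) (j + k)) ((LinearMap.mulRight ℂ (s : A)) ∘ₗ
    Submodule.subtype _) fun x => ⟨(lmul 𝒜 (add_zero _) x s).2, by
      change (x : A) * s * s = x * s
      rw [mul_assoc, hs]⟩

variable (𝒜) in
/-- Right multiplication by an element of degree `p`. -/
def freeMul {p k k' : ℤ} (h : k + p = k') : 𝒜 p →ₗ[ℂ] (free 𝒜 k ⟶ free 𝒜 k') where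
  toFun b := mkHom (fun j => (lmul 𝒜 (show j + k + p = j + k' by omega)).flip b)
    (fun _ _ _ => Subtype.ext (mul_assoc _ _ _))
  map_add' _ _ := GrMod.hom_ext fun _ => map_add (lmul 𝒜 _).flip _ _
  map_smul' _ _ := GrMod.hom_ext fun _ => map_smul (lmul 𝒜 _).flip _ _

/-- The morphism `A⟨-k⟩ ⟶ A ⊗ N_k` given by an element of `N_k`. -/
def freeTo (N : GrMod (QDual.gr 𝒜)) (k : ℤ) : N.V k →ₗ[ℂ] (free 𝒜 k ⟶ ind 𝒜 k N) where
  toFun v := mkHom (fun j => (indMk₂ 𝒜 N j).flip v) (fun _ _ _ => rfl)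
  map_add' _ _ := GrMod.hom_ext fun j => map_add (indMk₂ 𝒜 N j).flip _ _
  map_smul' _ _ := GrMod.hom_ext fun j => map_smul (indMk₂ 𝒜 N j).flip _ _

lemma freeTo_act₀ (N : GrMod (QDual.gr 𝒜)) (k : ℤ) (b : 𝒜 0) (v : N.V k) :
    freeTo N k (N.act (zero_add k) (QDual.deg0 𝒜 b) v) =
      freeMul 𝒜 (add_zero k) b ≫ freeTo N k v :=
  GrMod.hom_ext fun _ => LinearMap.ext fun x => (IndComp.mk_smul N x b v).symm

lemma freeTo_indMap {M N : GrMod (QDual.gr 𝒜)} (f : M ⟶ N) (k : ℤ) (v : M.V k) :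
    freeTo M k v ≫ indMap 𝒜 k f = freeTo N k (app f k v) := rfl

/-- Tested on free modules, the linear differential becomes a sum of right multiplications by degree
one elements. In this form any additive functor with known effect on right multiplications can be
applied to it. -/
lemma freeTo_koszulD (N : GrMod (QDual.gr 𝒜)) (k : ℤ) (v : N.V k) :
    freeTo N k v ≫ koszulD 𝒜 k N = ∑ i, freeMul 𝒜 rfl (basis1 𝒜 i) ≫
      freeTo N (k + 1) (dualAct 𝒜 N k ((basis1 𝒜).coord i) v) := by
  ext j : 1
  rw [sum_app]
  refine LinearMap.ext fun x => ?_
  rw [LinearMap.sum_apply]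
  exact koszulD_mk 𝒜 k N j x v

variable {Λ : Type*} [Fintype Λ] {e : Λ → A} (hA : IsBasic 𝒜 e)

/-- The map `v ↦ ∑ f(e_l v) e_l`. -/
def matrixCoef (N : GrMod (QDual.gr 𝒜)) (k : ℤ) (f : Module.Dual ℂ (N.V k)) : N.V k →ₗ[ℂ] 𝒜 0 :=
  ∑ l, (f ∘ₗ N.act (zero_add k) (QDual.deg0 𝒜 (hA.e₀ l))).smulRight (hA.e₀ l)

lemma matrixCoef_apply (N : GrMod (QDual.gr 𝒜)) (k : ℤ) (f : Module.Dual ℂ (N.V k)) (v : N.V k) :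
    matrixCoef hA N k f v =
      ∑ l, f (N.act (zero_add k) (QDual.deg0 𝒜 (hA.e₀ l)) v) • hA.e₀ l := by
  rw [matrixCoef, LinearMap.sum_apply]
  rfl

lemma matrixCoef_act (N : GrMod (QDual.gr 𝒜)) (k : ℤ) (f : Module.Dual ℂ (N.V k)) (s : 𝒜 0)
    (v : N.V k) : matrixCoef hA N k f (N.act (zero_add k) (QDual.deg0 𝒜 s) v) =
      lmul 𝒜 (zero_add 0) s (matrixCoef hA N k f v) := by
  rw [matrixCoef_apply, matrixCoef_apply, map_sum]
  refine Finset.sum_congr rfl fun l _ => Subtype.ext ?_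
  rw [hA.deg0_mul, map_smul, map_smul]
  change (_ • _) • e l = _ • ((s : A) * e l)
  rw [hA.mul_e, smul_eq_mul, smul_smul, mul_comm]

/-- The components of `indTo`. -/
def indToLin (N : GrMod (QDual.gr 𝒜)) (k : ℤ) (f : Module.Dual ℂ (N.V k)) (j : ℤ) :
    (ind 𝒜 k N).V j →ₗ[ℂ] 𝒜 (j + k) :=
  IndComp.lift N ((lmul 𝒜 (add_zero (j + k))).compl₂ (matrixCoef hA N k f)) fun x s v => by
    rw [LinearMap.compl₂_apply, LinearMap.compl₂_apply, matrixCoef_act]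
    exact Subtype.ext (mul_assoc _ _ _)

/-- The morphism `A ⊗ N_k ⟶ A⟨-k⟩` given by a linear form on `N_k`. -/
def indTo (N : GrMod (QDual.gr 𝒜)) (k : ℤ) (f : Module.Dual ℂ (N.V k)) : ind 𝒜 k N ⟶ free 𝒜 k :=
  mkHom (indToLin hA N k f) fun {n i j} h a z =>
    LinearMap.congr_fun (ind_linear_ext (W := 𝒜 (j + k))
      (f := indToLin hA N k f j ∘ₗ (ind 𝒜 k N).act h a)
      (g := lmul 𝒜 (by omega : n + (i + k) = j + k) a ∘ₗ indToLin hA N k f i)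
      fun x v => Subtype.ext (mul_assoc _ _ _)) z

lemma freeTo_indTo (N : GrMod (QDual.gr 𝒜)) (k : ℤ) (f : Module.Dual ℂ (N.V k)) (v : N.V k) :
    freeTo N k v ≫ indTo hA N k f = freeMul 𝒜 (add_zero k) (matrixCoef hA N k f v) := rfl

lemma sum_matrixCoef (N : GrMod (QDual.gr 𝒜)) (k : ℤ) (v : N.V k) :
    ∑ i, N.act (zero_add k) (QDual.deg0 𝒜
      (matrixCoef hA N k ((Module.finBasis ℂ (N.V k)).coord i) v)) (Module.finBasis ℂ (N.V k) i) =
      v := by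
  classical
  conv_rhs => rw [← hA.sum_deg0 N v]
  simp only [matrixCoef_apply, map_sum, LinearMap.sum_apply, map_smul, LinearMap.smul_apply]
  rw [Finset.sum_comm]
  refine Finset.sum_congr rfl fun l _ => ?_
  simp only [← map_smul, ← map_sum]
  have := (Module.finBasis ℂ (N.V k)).sum_repr (N.act (zero_add k) (QDual.deg0 𝒜 (hA.e₀ l)) v)
  refine (congrArg (N.act (zero_add k) (QDual.deg0 𝒜 (hA.e₀ l))) this).trans ?_
  rw [hA.deg0_mul, hA.coef_e₀, if_pos rfl, one_smul]

/-- The identity factors through finitely many copies of `A⟨-k⟩`, and such a factorization survives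
every additive functor. -/
lemma sum_indTo_freeTo (N : GrMod (QDual.gr 𝒜)) (k : ℤ) :
    ∑ i, indTo hA N k ((Module.finBasis ℂ (N.V k)).coord i) ≫
      freeTo N k (Module.finBasis ℂ (N.V k) i) = 𝟙 _ := by
  refine ind_hom_ext 𝒜 fun j x v => ?_
  rw [sum_app, LinearMap.sum_apply]
  have h : ∀ i, app (indTo hA N k ((Module.finBasis ℂ (N.V k)).coord i) ≫
      freeTo N k (Module.finBasis ℂ (N.V k) i)) j (indMk N x v) =
      indMk₂ 𝒜 N j x (N.act (zero_add k) (QDual.deg0 𝒜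
        (matrixCoef hA N k ((Module.finBasis ℂ (N.V k)).coord i) v))
          (Module.finBasis ℂ (N.V k) i)) := fun i => by
    have := congrArg (fun t => app (t ≫ freeTo N k (Module.finBasis ℂ (N.V k) i)) j x)
      (freeTo_indTo hA N k ((Module.finBasis ℂ (N.V k)).coord i) v)
    refine this.trans ?_
    exact IndComp.mk_smul N _ _ _
  rw [Finset.sum_congr rfl fun i _ => h i, ← map_sum, sum_matrixCoef]
  rfl

end Free

/-! ### Functors with `F(B⟨-k⟩) ≅ A e_L⟨-k⟩` and the comparison `A ⊗ N_k ≅ F(B ⊗ N_k)`. -/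

section Transport

variable {A : Type u} [Ring A] [Algebra ℂ A] [FiniteDimensional ℂ A]
  {𝒜 : ℤ → Submodule ℂ A} [SetLike.GradedMonoid 𝒜]
  {Λ : Type*} [Fintype Λ] {e : Λ → A} {hA : IsBasic 𝒜 e} {L : Finset Λ}
  {B : Type u} [Ring B] [Algebra ℂ B] [FiniteDimensional ℂ B]
  {ℬ : ℤ → Submodule ℂ B} [SetLike.GradedMonoid ℬ]
  {e' : L → B} {hB : IsBasic ℬ e'}

/-- Isomorphisms `F(B⟨-k⟩) ≃ A e_L⟨-k⟩` that are compatible with the right multiplications by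
elements of `B` of degree `0` and `1`. -/
structure Transport (D : CornerDatum hA hB) (F : GrMod ℬ ⥤ GrMod 𝒜) where
  φ (k : ℤ) : F.obj (free ℬ k) ≅ freeCut 𝒜 (∑ l ∈ L, e l) k
  map₀ (k : ℤ) (b : ℬ 0) (j : ℤ) (z : (F.obj (free ℬ k)).V j) :
    cutVal (app (φ k).hom j (app (F.map (freeMul ℬ (add_zero k) b)) j z)) =
      cutVal (app (φ k).hom j z) * CornerDatum.ψ₀ hA hB b
  map₁ (k : ℤ) (b : ℬ 1) (j : ℤ) (z : (F.obj (free ℬ k)).V j) :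
    cutVal (app (φ (k + 1)).hom j (app (F.map (freeMul ℬ rfl b)) j z)) =
      cutVal (app (φ k).hom j z) * D.ψ b

namespace CornerDatum

lemma mul_eL (s : 𝒜 0) : (s : A) * ∑ l ∈ L, e l = ψ₀ hA hB (χ₀ hA hB s) := by
  rw [ψ₀_apply, AddSubmonoidClass.coe_finsetSum, Finset.mul_sum]
  rw [← Finset.sum_coe_sort]
  refine Finset.sum_congr rfl fun l _ => ?_
  rw [coef_χ₀, hA.mul_e]
  rfl

lemma eL_mul_ψ₀ (b : ℬ 0) : (∑ l ∈ L, e l) * (ψ₀ hA hB b : A) = ψ₀ hA hB b := by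
  rw [ψ₀_apply, AddSubmonoidClass.coe_finsetSum, Finset.mul_sum]
  refine Finset.sum_congr rfl fun l _ => ?_
  change (∑ l ∈ L, e l) * (hB.coef l b • e l) = (hB.coef l b • e l)
  rw [mul_smul_comm, eL_mul_e hA]

lemma ψ₀_mul_eL (b : ℬ 0) : (ψ₀ hA hB b : A) * (∑ l ∈ L, e l) = ψ₀ hA hB b := by
  rw [mul_eL (hB := hB), χ₀_ψ₀]

end CornerDatum

open CornerDatum

namespace Transport

variable {D : CornerDatum hA hB} {F : GrMod ℬ ⥤ GrMod 𝒜} (t : Transport D F)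

lemma hom_inv (k j : ℤ) (y : (freeCut 𝒜 (∑ l ∈ L, e l) k).V j) :
    app (t.φ k).hom j (app (t.φ k).inv j y) = y :=
  congrArg (fun f => app f j y) (t.φ k).inv_hom_id

lemma inv_hom (k j : ℤ) (y : (F.obj (free ℬ k)).V j) :
    app (t.φ k).inv j (app (t.φ k).hom j y) = y :=
  congrArg (fun f => app f j y) (t.φ k).hom_inv_id

lemma ext (k j : ℤ) {y z : (F.obj (free ℬ k)).V j}
    (h : cutVal (app (t.φ k).hom j y) = cutVal (app (t.φ k).hom j z)) : y = z := by
  rw [← t.inv_hom k j y, cutVal_injective h, t.inv_hom]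

/-- The element of `F(B⟨-k⟩)` corresponding to `x e_L`. -/
def elt (k j : ℤ) : 𝒜 (j + k) →ₗ[ℂ] (F.obj (free ℬ k)).V j :=
  app (t.φ k).inv j ∘ₗ cutMk (eL hA L) (show (eL hA L : A) * eL hA L = eL hA L from hA.isIdempotentElem L)

lemma cutVal_elt (k j : ℤ) (x : 𝒜 (j + k)) :
    cutVal (app (t.φ k).hom j (t.elt k j x)) = x * ∑ l ∈ L, e l := by
  exact congrArg cutVal (t.hom_inv k j _)

lemma elt_act {k n i j : ℤ} (h : n + i = j) (a : 𝒜 n) (x : 𝒜 (i + k)) :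
    t.elt k j (lmul 𝒜 (by omega : n + (i + k) = j + k) a x) =
      (F.obj (free ℬ k)).act h a (t.elt k i x) := by
  apply t.ext
  rw [app_act, cutVal_act, cutVal_elt, cutVal_elt, coe_lmul, mul_assoc]

lemma elt_eq {k j : ℤ} {x y : 𝒜 (j + k)} (h : (x : A) * ∑ l ∈ L, e l = y * ∑ l ∈ L, e l) :
    t.elt k j x = t.elt k j y := by
  apply t.ext
  rw [cutVal_elt, cutVal_elt, h]

lemma map_elt₀ (k j : ℤ) (b : ℬ 0) (x : 𝒜 (j + k)) :
    app (F.map (freeMul ℬ (add_zero k) b)) j (t.elt k j x) =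
      t.elt k j (lmul 𝒜 (add_zero (j + k)) x (ψ₀ hA hB b)) := by
  apply t.ext
  rw [map₀, cutVal_elt, cutVal_elt, coe_lmul, mul_assoc, eL_mul_ψ₀, mul_assoc, ψ₀_mul_eL]

lemma map_elt₁ (k j : ℤ) (b : ℬ 1) (x : 𝒜 (j + k)) :
    app (F.map (freeMul ℬ rfl b)) j (t.elt k j x) =
      t.elt (k + 1) j (lmul 𝒜 (add_assoc j k 1) x (D.ψ b)) := by
  apply t.ext
  rw [map₁, cutVal_elt, cutVal_elt, coe_lmul, mul_assoc, D.eL_mul_ψ, mul_assoc, D.ψ_mul_eL]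

variable [F.Additive] [F.Linear ℂ]

/-- Restriction of scalars along `χ`. -/
abbrev resχ (D : CornerDatum hA hB) : GrMod (QDual.gr ℬ) ⥤ GrMod (QDual.gr 𝒜) :=
  res (QDual.gr 𝒜) (QDual.gr ℬ) D.χ D.χ_mem

/-- The identity map from a component of the restriction of `N` to the one of `N`. -/
def fromRes (D : CornerDatum hA hB) (N : GrMod (QDual.gr ℬ)) (k : ℤ) :
    ((resχ D).obj N).V k →ₗ[ℂ] N.V k := LinearMap.id

lemma fromRes_injective (N : GrMod (QDual.gr ℬ)) (k : ℤ) :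
    Function.Injective (fromRes D N k) := fun _ _ h => h

lemma fromRes_act₀ (N : GrMod (QDual.gr ℬ)) {k : ℤ} (s : 𝒜 0) (v : ((resχ D).obj N).V k) :
    fromRes D N k (((resχ D).obj N).act (zero_add k) (QDual.deg0 𝒜 s) v) =
      N.act (zero_add k) (QDual.deg0 ℬ (χ₀ hA hB s)) (fromRes D N k v) :=
  congrArg (fun a => N.act (zero_add k) a v) (Subtype.ext (D.χ_gen0 s))

lemma fromRes_act₁ (N : GrMod (QDual.gr ℬ)) {k : ℤ} (f : Module.Dual ℂ (𝒜 1))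
    (v : ((resχ D).obj N).V k) :
    fromRes D N (k + 1) (dualAct 𝒜 ((resχ D).obj N) k f v) =
      dualAct ℬ N k (f ∘ₗ D.ψ) (fromRes D N k v) :=
  congrArg (fun a => N.act (add_comm 1 k) a v) (Subtype.ext (D.χ_gen1 f))

lemma map_freeTo_act₀ (N : GrMod (QDual.gr ℬ)) (k j : ℤ) (x : 𝒜 (j + k)) (b : ℬ 0) (v : N.V k) :
    app (F.map (freeTo N k (N.act (zero_add k) (QDual.deg0 ℬ b) v))) j (t.elt k j x) =
      app (F.map (freeTo N k v)) j (t.elt k j (lmul 𝒜 (add_zero (j + k)) x (ψ₀ hA hB b))) := by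
  rw [freeTo_act₀, F.map_comp, app_comp_apply, map_elt₀]

/-- The class of `x ⊗ v` in `F(B ⊗ N_k)`. -/
def mk₂ (N : GrMod (QDual.gr ℬ)) (k j : ℤ) :
    𝒜 (j + k) →ₗ[ℂ] ((resχ D).obj N).V k →ₗ[ℂ] (F.obj (ind ℬ k N)).V j :=
  LinearMap.mk₂ ℂ (fun x v => app (F.map (freeTo N k (fromRes D N k v))) j (t.elt k j x))
    (fun x y v => by rw [map_add, map_add]) (fun c x v => by rw [map_smul, map_smul])
    (fun x v w => by rw [map_add, map_add, F.map_add]; rfl)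
    (fun c x v => by rw [map_smul, map_smul, F.map_smul]; rfl)

lemma mk₂_apply (N : GrMod (QDual.gr ℬ)) (k j : ℤ) (x : 𝒜 (j + k)) (v : ((resχ D).obj N).V k) :
    t.mk₂ N k j x v = app (F.map (freeTo N k (fromRes D N k v))) j (t.elt k j x) := rfl

/-- The components of `indHom`. -/
def indLin (N : GrMod (QDual.gr ℬ)) (k j : ℤ) :
    (ind 𝒜 k ((resχ D).obj N)).V j →ₗ[ℂ] (F.obj (ind ℬ k N)).V j :=
  IndComp.lift ((resχ D).obj N) (t.mk₂ N k j) fun x s v => by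
    rw [mk₂_apply, mk₂_apply, fromRes_act₀, map_freeTo_act₀]
    congr 1
    apply t.elt_eq
    rw [coe_lmul, coe_lmul, mul_assoc, mul_assoc, ψ₀_mul_eL, mul_eL (hB := hB)]

lemma indLin_mk (N : GrMod (QDual.gr ℬ)) (k j : ℤ) (x : 𝒜 (j + k)) (v : ((resχ D).obj N).V k) :
    t.indLin N k j (indMk ((resχ D).obj N) x v) = t.mk₂ N k j x v := rfl

/-- The natural morphism `A ⊗ N_k ⟶ F(B ⊗ N_k)`. -/
def indHom (N : GrMod (QDual.gr ℬ)) (k : ℤ) :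
    ind 𝒜 k ((resχ D).obj N) ⟶ F.obj (ind ℬ k N) :=
  mkHom (t.indLin N k) fun {n i j} h a z => LinearMap.congr_fun (ind_linear_ext
    (f := t.indLin N k j ∘ₗ (ind 𝒜 k ((resχ D).obj N)).act h a)
    (g := (F.obj (ind ℬ k N)).act h a ∘ₗ t.indLin N k i) fun x v => by
      rw [LinearMap.comp_apply, LinearMap.comp_apply, indLin_mk, mk₂_apply, ← app_act, ← elt_act]
      rfl) z

lemma indHom_mk (N : GrMod (QDual.gr ℬ)) (k j : ℤ) (x : 𝒜 (j + k))
    (v : ((resχ D).obj N).V k) :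
    app (t.indHom N k) j (indMk ((resχ D).obj N) x v) = t.mk₂ N k j x v := rfl

lemma indHom_naturality {M N : GrMod (QDual.gr ℬ)} (f : M ⟶ N) (k : ℤ) :
    t.indHom M k ≫ F.map (indMap ℬ k f) = indMap 𝒜 k ((resχ D).map f) ≫ t.indHom N k := by
  refine ind_hom_ext 𝒜 fun j x v => ?_
  rw [app_comp_apply, app_comp_apply, indHom_mk, indMap_mk, mk₂_apply, ← app_comp_apply,
    ← F.map_comp, freeTo_indMap]
  rfl

/-- Both sides come from the same element of `A₁ ⊗ B₁⋆`, the one that represents `f : B₁ → A₁`,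
written with a basis of `B₁` or of `A₁`. -/
lemma sum_dual_basis {W : Type u} [AddCommGroup W] [Module ℂ W] (f : ℬ 1 →ₗ[ℂ] 𝒜 1)
    (γ : 𝒜 1 →ₗ[ℂ] Module.Dual ℂ (ℬ 1) →ₗ[ℂ] W) :
    ∑ i, γ (f (basis1 ℬ i)) ((basis1 ℬ).coord i) =
      ∑ i, γ (basis1 𝒜 i) ((basis1 𝒜).coord i ∘ₗ f) := by
  have h1 : ∀ i, f (basis1 ℬ i) = ∑ l, (basis1 𝒜).coord l (f (basis1 ℬ i)) • basis1 𝒜 l :=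
    fun i => ((basis1 𝒜).sum_repr _).symm
  have h2 : ∀ l, (basis1 𝒜).coord l ∘ₗ f =
      ∑ i, (basis1 𝒜).coord l (f (basis1 ℬ i)) • (basis1 ℬ).coord i := by
    intro l
    apply (basis1 ℬ).ext
    intro i
    simp [Finsupp.single_apply]
  simp_rw [h2]
  conv_lhs => enter [2, i]; rw [h1 i]
  simp only [map_sum, map_smul, LinearMap.sum_apply, LinearMap.smul_apply]
  rw [Finset.sum_comm]

/-- Right multiplication by `b` becomes right multiplication by `ψ b`, which gives `∑ x ψ(bᵢ) ⊗ bᵢ⋆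
v` over a basis of `B₁`. By `sum_dual_basis` this is the sum over a basis of `A₁`, where `A₁⋆` acts
on `N` through `f ↦ f ∘ ψ`. -/
lemma indHom_koszulD (N : GrMod (QDual.gr ℬ)) (k : ℤ) :
    t.indHom N k ≫ F.map (koszulD ℬ k N) =
      koszulD 𝒜 k ((resχ D).obj N) ≫ t.indHom N (k + 1) := by
  refine ind_hom_ext 𝒜 fun j x v => ?_
  let γ : 𝒜 1 →ₗ[ℂ] Module.Dual ℂ (ℬ 1) →ₗ[ℂ] (F.obj (ind ℬ (k + 1) N)).V j :=
    (show 𝒜 (j + (k + 1)) →ₗ[ℂ] N.V (k + 1) →ₗ[ℂ] (F.obj (ind ℬ (k + 1) N)).V j from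
      t.mk₂ N (k + 1) j).compl₁₂ (lmul 𝒜 (add_assoc j k 1) x)
      ((N.act (add_comm 1 k)).flip (fromRes D N k v) ∘ₗ QDual.deg1 ℬ)
  rw [app_comp_apply, app_comp_apply, indHom_mk, koszulD_mk, map_sum, mk₂_apply, ← app_comp_apply,
    ← F.map_comp, freeTo_koszulD, F.map_sum, sum_app, LinearMap.sum_apply]
  refine Eq.trans ?_ ((sum_dual_basis D.ψ γ).trans ?_)
  · refine Finset.sum_congr rfl fun i _ => ?_
    rw [F.map_comp, app_comp_apply, map_elt₁]
    rfl
  · refine Finset.sum_congr rfl fun i _ => ?_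
    rw [indHom_mk, mk₂_apply, fromRes_act₁]
    rfl

/-- The inverse is obtained by applying `F` to the factorization of `sum_indTo_freeTo`: the image of
`z` under each coordinate `F(B ⊗ N_k) → F(B⟨-k⟩)` is an element of `A e_L`, and it is tensored with
the corresponding basis vector of `N_k`. -/
lemma indHom_bijective (N : GrMod (QDual.gr ℬ)) (k j : ℤ) :
    Function.Bijective (app (t.indHom N k) j) := by
  let v := Module.finBasis ℂ (N.V k)
  let v' (i) : ((resχ D).obj N).V k := v i
  let val : (F.obj (free ℬ k)).V j →ₗ[ℂ] 𝒜 (j + k) :=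
    Submodule.inclusion (fun _ h => h.1 : rightCut 𝒜 (∑ l ∈ L, e l) (j + k) ≤ 𝒜 (j + k)) ∘ₗ
      app (t.φ k).hom j
  have hval : ∀ z, t.elt k j (val z) = z := fun z => t.ext k j (by
    rw [cutVal_elt]
    exact cutVal_mul (app (t.φ k).hom j z))
  let β : (F.obj (ind ℬ k N)).V j →ₗ[ℂ] (ind 𝒜 k ((resχ D).obj N)).V j :=
    ∑ i, (indMk₂ 𝒜 ((resχ D).obj N) j).flip (v' i) ∘ₗ val ∘ₗ app (F.map (indTo hB N k (v.coord i))) j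
  have hβ : ∀ z, β z = ∑ i, indMk ((resχ D).obj N)
      (val (app (F.map (indTo hB N k (v.coord i))) j z)) (v' i) := fun z => by
    rw [LinearMap.sum_apply]; rfl
  refine Function.bijective_iff_has_inverse.2 ⟨β, fun z => ?_, fun z => ?_⟩
  · refine LinearMap.congr_fun (ind_linear_ext (f := β ∘ₗ app (t.indHom N k) j)
      (g := LinearMap.id) fun x w => ?_) z
    rw [LinearMap.comp_apply, indHom_mk, hβ, mk₂_apply]
    have h1 : ∀ i, indMk ((resχ D).obj N) (val (app (F.map (indTo hB N k (v.coord i))) j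
        (app (F.map (freeTo N k (fromRes D N k w))) j (t.elt k j x)))) (v' i) =
        indMk₂ 𝒜 ((resχ D).obj N) j x (((resχ D).obj N).act (zero_add k) (QDual.deg0 𝒜
          (ψ₀ hA hB (matrixCoef hB N k (v.coord i) (fromRes D N k w)))) (v' i)) := fun i => by
      set b := matrixCoef hB N k (v.coord i) (fromRes D N k w) with hb
      have h2 : val (app (F.map (indTo hB N k (v.coord i))) j
        (app (F.map (freeTo N k (fromRes D N k w))) j (t.elt k j x))) =
          lmul 𝒜 (add_zero (j + k)) x (ψ₀ hA hB b) := by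
        rw [← app_comp_apply, ← F.map_comp, freeTo_indTo, ← hb, map_elt₀]
        apply Subtype.ext
        refine (t.cutVal_elt k j _).trans ?_
        rw [coe_lmul, mul_assoc, ψ₀_mul_eL]
      rw [h2]
      exact IndComp.mk_smul ((resχ D).obj N) x (ψ₀ hA hB b) (v' i)
    rw [Finset.sum_congr rfl fun i _ => h1 i, ← map_sum]
    refine congrArg (indMk ((resχ D).obj N) x) (fromRes_injective N k ?_)
    rw [map_sum]
    simp only [fromRes_act₀, χ₀_ψ₀]
    exact sum_matrixCoef hB N k (fromRes D N k w)
  · rw [hβ, map_sum]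
    have h1 : ∀ i, app (t.indHom N k) j (indMk ((resχ D).obj N)
      (val (app (F.map (indTo hB N k (v.coord i))) j z)) (v' i)) =
        app (F.map (indTo hB N k (v.coord i) ≫ freeTo N k (v i))) j z := fun i => by
      rw [indHom_mk, mk₂_apply, hval, F.map_comp, app_comp_apply]; rfl
    rw [Finset.sum_congr rfl fun i _ => h1 i]
    have h2 := congrArg (fun f => app f j z) (congrArg F.map (sum_indTo_freeTo hB N k))
    simp only [F.map_sum, F.map_id, sum_app, LinearMap.sum_apply] at h2
    exact h2

end Transport

end Transport

/-! ### Bijectivity checked on the summands of a decomposition. -/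

section SplittingBijective

variable {R : Type u} [Ring R] [Algebra ℂ R] {ℛ : ℤ → Submodule ℂ R}

lemma Splitting.bijective {K L : GrMod ℛ} {A B : ℤ → GrMod ℛ} (σ : Splitting K A)
    (τ : Splitting L B) (f : K ⟶ L) (g : ∀ k, A k ⟶ B k)
    (hf : ∀ k, f ≫ τ.pr k = σ.pr k ≫ g k) (hf' : ∀ k, σ.inc k ≫ f = g k ≫ τ.inc k)
    (hg : ∀ k j, Function.Bijective (app (g k) j)) (j : ℤ) : Function.Bijective (app f j) := by
  constructor
  · rw [injective_iff_map_eq_zero]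
    intro z hz
    refine σ.eq_zero fun k => (injective_iff_map_eq_zero _).1 (hg k j).1 _ ?_
    refine (congrArg (fun t => app t j z) (hf k)).symm.trans ?_
    rw [app_comp_apply, hz, map_zero]
  · intro y
    obtain ⟨s, -, hs⟩ := τ.sum_eq j y
    choose w hw using fun k => (hg k j).2 (app (τ.pr k) j y)
    refine ⟨∑ k ∈ s, app (σ.inc k) j (w k), ?_⟩
    rw [hs, map_sum]
    refine Finset.sum_congr rfl fun k _ => ?_
    rw [← hw k]
    exact congrArg (fun t => app t j (w k)) (hf' k)

end SplittingBijective

/-! ### The comparison on total complexes. -/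

section TransportComplex

variable {A : Type u} [Ring A] [Algebra ℂ A] [FiniteDimensional ℂ A]
  {𝒜 : ℤ → Submodule ℂ A} [GradedAlgebra 𝒜]
  {Λ : Type*} [Fintype Λ] {e : Λ → A} {hA : IsBasic 𝒜 e} {L : Finset Λ}
  {B : Type u} [Ring B] [Algebra ℂ B] [FiniteDimensional ℂ B]
  {ℬ : ℤ → Submodule ℂ B} [GradedAlgebra ℬ]
  {e' : L → B} {hB : IsBasic ℬ e'}

open CornerDatum

namespace Transport

variable {D : CornerDatum hA hB} {F : GrMod ℬ ⥤ GrMod 𝒜} (t : Transport D F)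
  [F.Additive] [F.Linear ℂ]

/-- Restriction of scalars along `χ`, on complexes. -/
abbrev resχCom (D : CornerDatum hA hB) :
    CochainComplex (GrMod (QDual.gr ℬ)) ℤ ⥤ CochainComplex (GrMod (QDual.gr 𝒜)) ℤ :=
  (resχ D).mapHomologicalComplex (ComplexShape.up ℤ)

/-- The morphisms `indHom` for the terms of a complex. -/
def indHomX (M : CochainComplex (GrMod (QDual.gr ℬ)) ℤ) (i k : ℤ) :
    ind 𝒜 k (((resχCom D).obj M).X i) ⟶ F.obj (ind ℬ k (M.X i)) := t.indHom (M.X i) k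

lemma indHomX_d (M : CochainComplex (GrMod (QDual.gr ℬ)) ℤ) (i i' k : ℤ) :
    t.indHomX M i k ≫ F.map (indMap ℬ k (M.d i i')) =
      indMap 𝒜 k (((resχCom D).obj M).d i i') ≫ t.indHomX M i' k :=
  t.indHom_naturality (M.d i i') k

lemma indHomX_f {M N : CochainComplex (GrMod (QDual.gr ℬ)) ℤ} (f : M ⟶ N) (i k : ℤ) :
    t.indHomX M i k ≫ F.map (indMap ℬ k (f.f i)) =
      indMap 𝒜 k (((resχCom D).map f).f i) ≫ t.indHomX N i k :=
  t.indHom_naturality (f.f i) k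

lemma indHomX_koszulD (M : CochainComplex (GrMod (QDual.gr ℬ)) ℤ) (i k : ℤ) :
    t.indHomX M i k ≫ F.map (koszulD ℬ k (M.X i)) =
      koszulD 𝒜 k (((resχCom D).obj M).X i) ≫ t.indHomX M i (k + 1) :=
  t.indHom_koszulD (M.X i) k

/-- The components of the comparison of total complexes. -/
def totHom (M : CochainComplex (GrMod (QDual.gr ℬ)) ℤ) (n : ℤ) :
    totX 𝒜 ((resχCom D).obj M).X n ⟶ F.obj (totX ℬ M.X n) :=
  totDesc 𝒜 ((resχCom D).obj M).X fun i k h => t.indHomX M i k ≫ F.map (totInj ℬ M.X h)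

lemma totInj_totHom (M : CochainComplex (GrMod (QDual.gr ℬ)) ℤ) {n i k : ℤ} (h : i + k = n) :
    totInj 𝒜 ((resχCom D).obj M).X h ≫ t.totHom M n =
      t.indHomX M i k ≫ F.map (totInj ℬ M.X h) := totInj_desc ..

lemma totInj_totD (M : CochainComplex (GrMod (QDual.gr 𝒜)) ℤ) {n m i k : ℤ} (h : n + 1 = m)
    (hik : i + k = n) : totInj 𝒜 M.X hik ≫ totD 𝒜 M h =
      indMap 𝒜 k (M.d i (i + 1)) ≫ totInj 𝒜 M.X (by omega : i + 1 + k = m) +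
        i.negOnePow • (koszulD 𝒜 k (M.X i) ≫ totInj 𝒜 M.X (by omega : i + (k + 1) = m)) :=
  totInj_desc ..

lemma totHom_d (M : CochainComplex (GrMod (QDual.gr ℬ)) ℤ) {n m : ℤ} (h : n + 1 = m) :
    t.totHom M n ≫ F.map (koszulDiff ℬ M n m) =
      koszulDiff 𝒜 ((resχCom D).obj M) n m ≫ t.totHom M m := by
  refine tot_ext 𝒜 fun i k hik => ?_
  rw [koszulDiff_eq 𝒜 _ h, koszulDiff_eq ℬ _ h, reassoc_of% (t.totInj_totHom M hik),
    ← F.map_comp, totInj_totD, reassoc_of% (totInj_totD ((resχCom D).obj M) h hik),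
    Preadditive.add_comp, Linear.units_smul_comp, Category.assoc,
    Category.assoc, totInj_totHom, totInj_totHom, F.map_add,
    Preadditive.comp_add, F.map_comp, reassoc_of% (t.indHomX_d M), F.map_units_smul, F.map_comp,
    Linear.comp_units_smul, reassoc_of% (t.indHomX_koszulD M)]

lemma totHom_f {M N : CochainComplex (GrMod (QDual.gr ℬ)) ℤ} (f : M ⟶ N) (n : ℤ) :
    t.totHom M n ≫ F.map (koszulMap ℬ f n) =
      koszulMap 𝒜 ((resχCom D).map f) n ≫ t.totHom N n := by
  refine tot_ext 𝒜 fun i k hik => ?_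
  rw [koszulMap_eq, koszulMap_eq, reassoc_of% (t.totInj_totHom M hik), totInj_desc_assoc,
    Category.assoc, totInj_totHom, ← F.map_comp, totInj_desc, F.map_comp,
    reassoc_of% (t.indHomX_f f)]

lemma totHom_proj (M : CochainComplex (GrMod (QDual.gr ℬ)) ℤ) {n i k : ℤ} (h : i + k = n) :
    t.totHom M n ≫ F.map (totProj ℬ M.X h) =
      totProj 𝒜 ((resχCom D).obj M).X h ≫ t.indHomX M i k := by
  refine tot_ext 𝒜 fun i' k' h' => ?_
  rw [reassoc_of% (t.totInj_totHom M h'), ← F.map_comp]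
  by_cases hk : k = k'
  · subst hk
    obtain rfl : i = i' := by omega
    rw [totInj_proj, ← Category.assoc, totInj_proj, F.map_id, Category.comp_id, Category.id_comp]
  · rw [totInj_proj_ne _ _ _ _ hk, ← Category.assoc, totInj_proj_ne _ _ _ _ hk, F.map_zero,
      comp_zero, zero_comp]

/-- The image under `F` of an infinite direct sum is still decomposed by the images of the summands
(`totSplit`), so it suffices that each `indHomX` is bijective. -/
instance (M : CochainComplex (GrMod (QDual.gr ℬ)) ℤ) (n : ℤ) : IsIso (t.totHom M n) :=
  isIso_of_bijective _ <| Splitting.bijective (totSplitting 𝒜 ((resχCom D).obj M).X n)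
    (totSplit ℬ F M.X n) _ (fun k => t.indHomX M (n - k) k)
    (fun _ => t.totHom_proj M _) (fun _ => t.totInj_totHom M _)
    (fun k => t.indHom_bijective (M.X (n - k)) k)

/-- The comparison of the terms of the total complexes. -/
def totIso (M : CochainComplex (GrMod (QDual.gr ℬ)) ℤ) (n : ℤ) :
    totX 𝒜 ((resχCom D).obj M).X n ≅ F.obj (totX ℬ M.X n) := asIso (t.totHom M n)

/-- The functor `F` commutes with the quadratic duality functors on complexes. -/
def koszulComIso : resχCom D ⋙ koszulCom 𝒜 ≅ koszulCom ℬ ⋙ F.mapHomologicalComplex _ :=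
  NatIso.ofComponents (fun M => HomologicalComplex.Hom.isoOfComponents
    (fun n => t.totIso M n) (fun _ _ h => t.totHom_d M h)) (fun f => by
      ext n : 1
      exact (t.totHom_f f n).symm)

end Transport

end TransportComplex

/-! ### Isomorphisms of functors on full subcategories and on localizations. -/

section Generalities

variable {C₀ C₁ C₁' C₂ C₃ : Type*} [Category C₀] [Category C₁] [Category C₁'] [Category C₂]
  [Category C₃]

/-- An isomorphism of composed functors, restricted to full subcategories. -/
def isoOfLiftIso {P₀ : ObjectProperty C₀} {P₁ : ObjectProperty C₁} {P₁' : ObjectProperty C₁'}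
    {P₂ : ObjectProperty C₂} {P₃ : ObjectProperty C₃} {G₁ : C₀ ⥤ C₁} {G₂ : C₁ ⥤ C₂} {G₃ : C₂ ⥤ C₃}
    {H₁ : C₀ ⥤ C₁'} {H₂ : C₁' ⥤ C₃} (i : G₁ ⋙ G₂ ⋙ G₃ ≅ H₁ ⋙ H₂)
    (h₁ : ∀ X, P₁ ((P₀.ι ⋙ G₁).obj X)) (h₂ : ∀ X, P₂ ((P₁.ι ⋙ G₂).obj X))
    (h₃ : ∀ X, P₃ ((P₂.ι ⋙ G₃).obj X)) (h₁' : ∀ X, P₁' ((P₀.ι ⋙ H₁).obj X))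
    (h₂' : ∀ X, P₃ ((P₁'.ι ⋙ H₂).obj X)) :
    P₁.lift (P₀.ι ⋙ G₁) h₁ ⋙ P₂.lift (P₁.ι ⋙ G₂) h₂ ⋙ P₃.lift (P₂.ι ⋙ G₃) h₃ ≅
      P₁'.lift (P₀.ι ⋙ H₁) h₁' ⋙ P₃.lift (P₁'.ι ⋙ H₂) h₂' :=
  NatIso.ofComponents (fun X => P₃.isoMk (i.app X.obj))
    (fun f => ObjectProperty.hom_ext _ (i.hom.naturality f.hom))

/-- An isomorphism between functors on a localization, obtained from an isomorphism before
localization. -/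
def localizedIso {D₀ D₁ D₁' D₂ D₃ : Type*} [Category D₀] [Category D₁] [Category D₁'] [Category D₂]
    [Category D₃] (W : MorphismProperty C₀) {Q₀ : C₀ ⥤ D₀} [Q₀.IsLocalization W] {Q₁ : C₁ ⥤ D₁}
    {Q₁' : C₁' ⥤ D₁'} {Q₂ : C₂ ⥤ D₂} {r₁ : C₀ ⥤ C₁} {k₁ : C₁ ⥤ C₂} {f : C₂ ⥤ C₃} {r₂ : C₀ ⥤ C₁'}
    {k₂ : C₁' ⥤ C₃} (i : r₁ ⋙ k₁ ⋙ f ≅ r₂ ⋙ k₂) (Q₃ : C₃ ⥤ D₃)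
    {R₁ : D₀ ⥤ D₁} {K₁ : D₁ ⥤ D₂} {F : D₂ ⥤ D₃} {R₂ : D₀ ⥤ D₁'} {K₂ : D₁' ⥤ D₃}
    (a₁ : Q₀ ⋙ R₁ ≅ r₁ ⋙ Q₁) (b₁ : Q₁ ⋙ K₁ ≅ k₁ ⋙ Q₂) (β : k₁ ⋙ Q₂ ⋙ F ≅ k₁ ⋙ f ⋙ Q₃)
    (a₂ : Q₀ ⋙ R₂ ≅ r₂ ⋙ Q₁') (b₂ : Q₁' ⋙ K₂ ≅ k₂ ⋙ Q₃) : R₁ ⋙ K₁ ⋙ F ≅ R₂ ⋙ K₂ :=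
  letI : Localization.Lifting Q₀ W (r₂ ⋙ k₂ ⋙ Q₃) (R₁ ⋙ K₁ ⋙ F) :=
    ⟨Functor.isoWhiskerRight a₁ (K₁ ⋙ F) ≪≫
      Functor.isoWhiskerLeft r₁ (Functor.isoWhiskerRight b₁ F ≪≫ β) ≪≫
      Functor.isoWhiskerRight i Q₃⟩
  letI : Localization.Lifting Q₀ W (r₂ ⋙ k₂ ⋙ Q₃) (R₂ ⋙ K₂) :=
    ⟨Functor.isoWhiskerRight a₂ K₂ ≪≫ Functor.isoWhiskerLeft r₂ b₂⟩
  Localization.liftNatIso Q₀ W (r₂ ⋙ k₂ ⋙ Q₃) (r₂ ⋙ k₂ ⋙ Q₃) _ _ (Iso.refl _)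

end Generalities

/-! ### The square of derived categories for a transported functor. -/

section DerivedComparison

variable {A : Type u} [Ring A] [Algebra ℂ A] [FiniteDimensional ℂ A]
  {𝒜 : ℤ → Submodule ℂ A} [GradedAlgebra 𝒜] [NonnegGraded 𝒜]
  {Λ : Type*} [Fintype Λ] {e : Λ → A} {hA : IsBasic 𝒜 e} {L : Finset Λ}
  {B : Type u} [Ring B] [Algebra ℂ B] [FiniteDimensional ℂ B]
  {ℬ : ℤ → Submodule ℂ B} [GradedAlgebra ℬ] [NonnegGraded ℬ]
  {e' : L → B} {hB : IsBasic ℬ e'}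

namespace CornerDatum

variable (D : CornerDatum hA hB)

lemma θ_mem (n : ℤ) : ∀ a ∈ QDual.gr ℬ n, (D.θ : QDual ℬ →ₐ[ℂ] QDualQuot 𝒜 e L) a ∈
    QDualQuot.gr 𝒜 e L n := fun a ha => (D.θ_mem_iff n a).2 ha

/-- Restriction of scalars along `θ`, followed by restriction of scalars along `χ`, is restriction
of scalars along the projection. -/
def resIso : res (QDual.gr ℬ) (QDualQuot.gr 𝒜 e L) (D.θ : QDual ℬ →ₐ[ℂ] QDualQuot 𝒜 e L) D.θ_mem ⋙
    Transport.resχ D ≅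
      res (QDual.gr 𝒜) (QDualQuot.gr 𝒜 e L) (QDualQuot.proj 𝒜 e L) (QDualQuot.proj_mem 𝒜 e L) :=
  NatIso.ofComponents (fun M =>
    { hom := mkHom (fun _ => LinearMap.id) (fun h a v =>
        congrArg (fun a => M.act h a v) (Subtype.ext (D.θ_χ a)))
      inv := mkHom (fun _ => LinearMap.id) (fun h a v =>
        congrArg (fun a => M.act h a v) (Subtype.ext (D.θ_χ a).symm)) })

end CornerDatum

namespace Transport

variable {D : CornerDatum hA hB} {F : GrMod ℬ ⥤ GrMod 𝒜} (t : Transport D F)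
  [F.Additive] [F.Linear ℂ]

/-- The commutation of `F` with quadratic duality, on unbounded complexes. -/
def unboundedComIso :
    (res (QDual.gr ℬ) (QDualQuot.gr 𝒜 e L) (D.θ : QDual ℬ →ₐ[ℂ] QDualQuot 𝒜 e L)
      D.θ_mem).mapHomologicalComplex (ComplexShape.up ℤ) ⋙
      koszulCom ℬ ⋙ F.mapHomologicalComplex (ComplexShape.up ℤ) ≅
    (res (QDual.gr 𝒜) (QDualQuot.gr 𝒜 e L) (QDualQuot.proj 𝒜 e L)
      (QDualQuot.proj_mem 𝒜 e L)).mapHomologicalComplex (ComplexShape.up ℤ) ⋙ koszulCom 𝒜 :=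
  Functor.isoWhiskerLeft _ t.koszulComIso.symm ≪≫ (Functor.associator _ _ _).symm ≪≫
    Functor.isoWhiskerRight
      (Functor.mapHomologicalComplexCompIso D.resIso (ComplexShape.up ℤ)) (koszulCom 𝒜)

/-- The commutation of `F` with quadratic duality, on complexes. -/
def comIso (hF : PreservesDown F) :
    resCom (QDual.gr ℬ) (QDualQuot.gr 𝒜 e L) (D.θ : QDual ℬ →ₐ[ℂ] QDualQuot 𝒜 e L) D.θ_mem ⋙
      koszulUpDown ℬ ⋙ comDownMap F hF ≅
    resCom (QDual.gr 𝒜) (QDualQuot.gr 𝒜 e L) (QDualQuot.proj 𝒜 e L) (QDualQuot.proj_mem 𝒜 e L) ⋙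
      koszulUpDown 𝒜 :=
  isoOfLiftIso t.unboundedComIso (fun X : ComUp (QDualQuot.gr 𝒜 e L) => X.property)
    (fun X => koszulCom_isDown ℬ X.obj X.property) (fun X => hF X.obj X.property)
    (fun X : ComUp (QDualQuot.gr 𝒜 e L) => X.property)
    (fun X => koszulCom_isDown 𝒜 X.obj X.property)

/-- The commutation of a functor on derived categories with quadratic duality. -/
def derivedIso (hF : PreservesDown F) (hA' : KoszulExact 𝒜) (hB' : KoszulExact ℬ)
    (LF : DDown ℬ ⥤ DDown 𝒜)
    (β : koszulUpDown ℬ ⋙ QDown ℬ ⋙ LF ≅ koszulUpDown ℬ ⋙ comDownMap F hF ⋙ QDown 𝒜) :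
    resD (QDual.gr ℬ) (QDualQuot.gr 𝒜 e L) (D.θ : QDual ℬ →ₐ[ℂ] QDualQuot 𝒜 e L) D.θ_mem ⋙
      koszulDual ℬ hB' ⋙ LF ≅
    resD (QDual.gr 𝒜) (QDualQuot.gr 𝒜 e L) (QDualQuot.proj 𝒜 e L) (QDualQuot.proj_mem 𝒜 e L) ⋙
      koszulDual 𝒜 hA' :=
  localizedIso (qisUp (QDualQuot.gr 𝒜 e L)) (t.comIso hF) (QDown 𝒜)
    (Localization.fac _ _ (QUp (QDualQuot.gr 𝒜 e L))) (Localization.fac _ _ (QUp (QDual.gr ℬ))) β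
    (Localization.fac _ _ (QUp (QDualQuot.gr 𝒜 e L))) (Localization.fac _ _ (QUp (QDual.gr 𝒜)))

end Transport

end DerivedComparison

/-! ### Standard modules `P M = A ⊗_{A₀} M` and syzygies `Ω M`. -/

section StandardProjective

variable {A : Type u} [Ring A] [Algebra ℂ A] (𝒜 : ℤ → Submodule ℂ A)

section Trivial

variable [SetLike.GradedMonoid 𝒜]

/-- The augmentation `A^! → A₀ ⊆ A`. -/
def augment : QDual 𝒜 →ₐ[ℂ] A :=
  QDual.lift 𝒜 (𝒜 0).subtype 0 (fun _ h => h) (fun _ _ => rfl) (fun _ _ => mul_zero _)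
    (fun _ _ => zero_mul _) (fun _ _ _ _ _ => Finset.sum_eq_zero fun _ _ => mul_zero _)

lemma augment_gen0 (b : 𝒜 0) : augment 𝒜 (QDual.gen0 𝒜 b) = b := QDual.lift_gen0 ..

lemma augment_eq_zero {n : ℤ} (hn : n ≠ 0) {a : QDual 𝒜} (ha : a ∈ QDual.gr 𝒜 n) :
    augment 𝒜 a = 0 := by
  have := QDual.map_gr_le 𝒜 (augment 𝒜) (𝒜 0) ⊥ (fun b => by rw [augment_gen0]; exact b.2)
    (fun f => (Submodule.mem_bot ℂ).2 (QDual.lift_gen1 ..)) n ⟨a, ha, rfl⟩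
  split_ifs at this with h
  · exact (Submodule.mem_bot ℂ).1 this
  · have h2 : n.toNat ≠ 0 := by omega
    rw [← Submodule.zero_eq_bot, zero_pow h2, zero_mul] at this
    exact (Submodule.mem_bot ℂ).1 this

lemma augment_mem {n : ℤ} {a : QDual 𝒜} (ha : a ∈ QDual.gr 𝒜 n) : augment 𝒜 a ∈ 𝒜 0 := by
  by_cases hn : n = 0
  · subst hn
    have := QDual.map_gr_le 𝒜 (augment 𝒜) (𝒜 0) ⊥ (fun b => by rw [augment_gen0]; exact b.2)
      (fun f => (Submodule.mem_bot ℂ).2 (QDual.lift_gen1 ..)) 0 ⟨a, ha, rfl⟩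
    simpa using this
  · rw [augment_eq_zero 𝒜 hn ha]
    exact zero_mem _

/-- The restriction of the augmentation to the component of degree `n`. -/
def augmentDeg (n : ℤ) : QDual.gr 𝒜 n →ₗ[ℂ] 𝒜 0 :=
  (augment 𝒜).toLinearMap.restrict fun _ h => augment_mem 𝒜 h

lemma augmentDeg_deg0 (b : 𝒜 0) : augmentDeg 𝒜 0 (QDual.deg0 𝒜 b) = b :=
  Subtype.ext (augment_gen0 𝒜 b)

/-- The graded `A^!`-module whose component of degree `k` is the `A₀`-module `M_{-k}`, and on which
`A₁⋆` acts by zero. -/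
def trivObj (M : GrMod 𝒜) : GrMod (QDual.gr 𝒜) where
  V k := M.V (-k)
  act {n i j} h := if hn : n = 0 then (M.act (by omega : 0 + -i = -j)).comp (augmentDeg 𝒜 n) else 0
  one_act h a v ha := by
    rw [dif_pos rfl]
    refine M.one_act _ _ v ?_
    change augment 𝒜 a = 1
    rw [ha, map_one]
  mul_act {m n p i j k} h₁ h₂ h₃ a b c v hc := by
    by_cases hn : n = 0
    · by_cases hm : m = 0
      · rw [dif_pos hn, dif_pos hm, dif_pos (by omega)]
        refine M.mul_act _ _ _ _ _ _ v ?_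
        change augment 𝒜 c = augment 𝒜 a * augment 𝒜 b
        rw [hc, map_mul]
      · rw [dif_neg hm, dif_neg (by omega)]
        rfl
    · rw [dif_neg hn, LinearMap.zero_apply, LinearMap.zero_apply, map_zero]
      split_ifs with hp
      · have : augmentDeg 𝒜 p c = 0 := Subtype.ext (by
          change augment 𝒜 c = 0
          rw [hc, map_mul, augment_eq_zero 𝒜 hn b.2, mul_zero])
        rw [LinearMap.comp_apply, this, map_zero, LinearMap.zero_apply]
      · rfl

lemma trivObj_act_zero (M : GrMod 𝒜) {i j : ℤ} (h : 0 + i = j) (a : QDual.gr 𝒜 0) (v : M.V (-i)) :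
    (trivObj 𝒜 M).act h a v = M.act (by omega : 0 + -i = -j) (augmentDeg 𝒜 0 a) v := rfl

lemma trivObj_act_of_ne (M : GrMod 𝒜) {n i j : ℤ} (h : n + i = j) (hn : n ≠ 0) (a : QDual.gr 𝒜 n)
    (v : (trivObj 𝒜 M).V i) : (trivObj 𝒜 M).act h a v = 0 :=
  LinearMap.congr_fun (LinearMap.congr_fun (dif_neg hn : (trivObj 𝒜 M).act h = 0) a) v

lemma trivObj_act_deg0 (M : GrMod 𝒜) {k : ℤ} (b : 𝒜 0) (v : M.V (-k)) :
    (trivObj 𝒜 M).act (zero_add k) (QDual.deg0 𝒜 b) v = M.act (zero_add (-k)) b v :=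
  (trivObj_act_zero 𝒜 M (zero_add k) _ v).trans
    (congrArg (fun b => M.act (zero_add (-k)) b v) (augmentDeg_deg0 𝒜 b))

variable {𝒜} in
/-- The functoriality of `trivObj`. -/
def trivMap {M N : GrMod 𝒜} (f : M ⟶ N) : trivObj 𝒜 M ⟶ trivObj 𝒜 N :=
  mkHom (fun k => app f (-k)) (fun {n i j} h a v => by
    by_cases hn : n = 0
    · subst hn
      exact app_act f _ _ (v : M.V (-i))
    · rw [trivObj_act_of_ne _ _ _ hn, trivObj_act_of_ne _ _ _ hn]
      exact (app f (-j)).map_zero)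

end Trivial

section Desc

variable [SetLike.GradedMonoid 𝒜] [FiniteDimensional ℂ A]

/-- The components of `indDesc`. -/
def indDescLin {k : ℤ} {N : GrMod (QDual.gr 𝒜)} {M : GrMod 𝒜} (φ : N.V k →ₗ[ℂ] M.V (-k))
    (hφ : ∀ (b : 𝒜 0) v, φ (N.act (zero_add k) (QDual.deg0 𝒜 b) v) =
      M.act (zero_add (-k)) b (φ v)) (j : ℤ) : (ind 𝒜 k N).V j →ₗ[ℂ] M.V j :=
  IndComp.lift N ((M.act (by omega : j + k + -k = j)).compl₂ φ) fun x s v => by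
    rw [LinearMap.compl₂_apply, LinearMap.compl₂_apply, hφ]
    exact M.mul_act _ _ _ _ _ _ _ rfl

variable {𝒜} in
/-- The morphism out of `A ⊗_{A₀} N_k` given by an `A₀`-linear map. -/
def indDesc {k : ℤ} {N : GrMod (QDual.gr 𝒜)} {M : GrMod 𝒜} (φ : N.V k →ₗ[ℂ] M.V (-k))
    (hφ : ∀ (b : 𝒜 0) v, φ (N.act (zero_add k) (QDual.deg0 𝒜 b) v) =
      M.act (zero_add (-k)) b (φ v)) : ind 𝒜 k N ⟶ M :=
  mkHom (indDescLin 𝒜 φ hφ) fun {n i j} h a v => by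
    refine LinearMap.congr_fun (ind_linear_ext (N := N)
      (f := indDescLin 𝒜 φ hφ j ∘ₗ (ind 𝒜 k N).act h a)
      (g := M.act h a ∘ₗ indDescLin 𝒜 φ hφ i) fun x v => ?_) v
    exact M.mul_act _ _ _ _ _ _ _ rfl

variable {𝒜} in
lemma indDesc_mk {k : ℤ} {N : GrMod (QDual.gr 𝒜)} {M : GrMod 𝒜} (φ : N.V k →ₗ[ℂ] M.V (-k))
    (hφ) {j : ℤ} (x : 𝒜 (j + k)) (v : N.V k) :
    app (indDesc φ hφ) j (indMk N x v) = M.act (by omega : j + k + -k = j) x (φ v) := rfl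

/-- The action `A ⊗_{A₀} M_{-k} → M`. -/
def actHom (k : ℤ) (M : GrMod 𝒜) : ind 𝒜 k (trivObj 𝒜 M) ⟶ M :=
  indDesc (N := trivObj 𝒜 M) LinearMap.id (trivObj_act_deg0 𝒜 M)

lemma actHom_naturality (k : ℤ) {M N : GrMod 𝒜} (f : M ⟶ N) :
    actHom 𝒜 k M ≫ f = indMap 𝒜 k (trivMap f) ≫ actHom 𝒜 k N :=
  ind_hom_ext 𝒜 fun j x v => app_act f (by omega : j + k + -k = j) x (v : M.V (-k))

end Desc

variable [GradedAlgebra 𝒜] [FiniteDimensional ℂ A]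

lemma genFinite (M : GrMod 𝒜) (j : ℤ) :
    {k : ℤ | Nontrivial ((ind 𝒜 k (trivObj 𝒜 M)).V j)}.Finite := by
  refine ((finite_ne_bot 𝒜).preimage (f := fun k => j + k)
    (fun _ _ _ _ h => add_left_cancel h)).subset fun k hk h => ?_
  have := ind_subsingleton 𝒜 (trivObj 𝒜 M) (Or.inl h)
  exact not_nontrivial_iff_subsingleton.2 this hk

/-- The standard graded module `P M = A ⊗_{A₀} M`. -/
def std (M : GrMod 𝒜) : GrMod 𝒜 := dsum (fun k : ℤ => ind 𝒜 k (trivObj 𝒜 M)) (genFinite 𝒜 M)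

/-- The inclusion of the part of `P M` generated by `M_{-k}`. -/
def stdInj (M : GrMod 𝒜) (k : ℤ) : ind 𝒜 k (trivObj 𝒜 M) ⟶ std 𝒜 M :=
  inj (N := fun k : ℤ => ind 𝒜 k (trivObj 𝒜 M)) k

/-- The projection to the part of `P M` generated by `M_{-k}`. -/
def stdProj (M : GrMod 𝒜) (k : ℤ) : std 𝒜 M ⟶ ind 𝒜 k (trivObj 𝒜 M) :=
  proj (N := fun k : ℤ => ind 𝒜 k (trivObj 𝒜 M)) k

/-- The morphism out of `P M` with given components. -/
def stdDesc {M N : GrMod 𝒜} (f : ∀ k, ind 𝒜 k (trivObj 𝒜 M) ⟶ N) : std 𝒜 M ⟶ N := desc f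

lemma stdInj_desc {M N : GrMod 𝒜} (f : ∀ k, ind 𝒜 k (trivObj 𝒜 M) ⟶ N) (k : ℤ) :
    stdInj 𝒜 M k ≫ stdDesc 𝒜 f = f k := inj_desc _ _

lemma stdInj_proj_self (M : GrMod 𝒜) (k : ℤ) : stdInj 𝒜 M k ≫ stdProj 𝒜 M k = 𝟙 _ :=
  inj_proj_self _

lemma stdInj_proj_ne (M : GrMod 𝒜) {k l : ℤ} (h : k ≠ l) : stdInj 𝒜 M k ≫ stdProj 𝒜 M l = 0 :=
  inj_proj_ne h

variable {𝒜} in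
lemma std_ext {M N : GrMod 𝒜} {f g : std 𝒜 M ⟶ N}
    (h : ∀ k, stdInj 𝒜 M k ≫ f = stdInj 𝒜 M k ≫ g) : f = g := dsum_ext h

variable {𝒜} in
/-- The functoriality of `P M`. -/
def stdMap {M N : GrMod 𝒜} (f : M ⟶ N) : std 𝒜 M ⟶ std 𝒜 N :=
  stdDesc 𝒜 fun k => indMap 𝒜 k (trivMap f) ≫ stdInj 𝒜 N k

lemma stdInj_map {M N : GrMod 𝒜} (f : M ⟶ N) (k : ℤ) :
    stdInj 𝒜 M k ≫ stdMap f = indMap 𝒜 k (trivMap f) ≫ stdInj 𝒜 N k := stdInj_desc ..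

lemma stdInj_map_assoc {M N N' : GrMod 𝒜} (f : M ⟶ N) (k : ℤ) (g : std 𝒜 N ⟶ N') :
    stdInj 𝒜 M k ≫ stdMap f ≫ g = indMap 𝒜 k (trivMap f) ≫ stdInj 𝒜 N k ≫ g := by
  rw [← Category.assoc, stdInj_map, Category.assoc]

lemma stdMap_id (M : GrMod 𝒜) : stdMap (𝟙 M) = 𝟙 (std 𝒜 M) := std_ext fun k => by
  rw [stdInj_map, Category.comp_id]
  exact (congrArg (· ≫ _) (indMap_id 𝒜 k _)).trans (Category.id_comp _)

lemma stdMap_comp {M N N' : GrMod 𝒜} (f : M ⟶ N) (g : N ⟶ N') :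
    stdMap (f ≫ g) = stdMap f ≫ stdMap g := std_ext fun k => by
  rw [stdInj_map, stdInj_map_assoc, stdInj_map, ← Category.assoc, ← indMap_comp]
  rfl

lemma stdMap_add {M N : GrMod 𝒜} (f g : M ⟶ N) : stdMap (f + g) = stdMap f + stdMap g :=
  std_ext fun k => by
    rw [Preadditive.comp_add, stdInj_map, stdInj_map, stdInj_map, ← Preadditive.add_comp]
    exact congrArg (· ≫ _) ((indF 𝒜 k).map_add (f := trivMap f) (g := trivMap g))

lemma stdMap_proj {M N : GrMod 𝒜} (f : M ⟶ N) (k : ℤ) :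
    stdMap f ≫ stdProj 𝒜 N k = stdProj 𝒜 M k ≫ indMap 𝒜 k (trivMap f) := std_ext fun l => by
  rw [stdInj_map_assoc]
  by_cases h : l = k
  · subst h
    rw [stdInj_proj_self, Category.comp_id, ← Category.assoc, stdInj_proj_self, Category.id_comp]
  · rw [stdInj_proj_ne _ _ h, comp_zero, ← Category.assoc, stdInj_proj_ne _ _ h, zero_comp]

/-- The projection `P M → M`. -/
def stdε (M : GrMod 𝒜) : std 𝒜 M ⟶ M := stdDesc 𝒜 fun k => actHom 𝒜 k M

lemma stdInj_ε (M : GrMod 𝒜) (k : ℤ) : stdInj 𝒜 M k ≫ stdε 𝒜 M = actHom 𝒜 k M := stdInj_desc ..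

lemma stdε_naturality {M N : GrMod 𝒜} (f : M ⟶ N) : stdMap f ≫ stdε 𝒜 N = stdε 𝒜 M ≫ f :=
  std_ext fun k => by
    rw [stdInj_map_assoc, stdInj_ε, ← actHom_naturality, ← Category.assoc, stdInj_ε]

/-- The unit, in a component of degree `0`. -/
def oneDeg {n : ℤ} (h : n = 0) : 𝒜 n := ⟨1, h ▸ SetLike.GradedOne.one_mem⟩

@[simp] lemma coe_oneDeg {n : ℤ} (h : n = 0) : (oneDeg 𝒜 h : A) = 1 := rfl

/-- The identification of `M_j` with a component of the associated trivial module. -/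
def toTriv (M : GrMod 𝒜) (j : ℤ) : M.V j →ₗ[ℂ] (trivObj 𝒜 M).V (-j) :=
  M.act (by omega : 0 + j = - -j) (oneDeg 𝒜 rfl)

lemma toTriv_act₀ (M : GrMod 𝒜) (j : ℤ) (b : 𝒜 0) (v : M.V j) :
    toTriv 𝒜 M j (M.act (zero_add j) b v) =
      (trivObj 𝒜 M).act (zero_add (-j)) (QDual.deg0 𝒜 b) (toTriv 𝒜 M j v) := by
  refine Eq.trans ?_ (trivObj_act_deg0 𝒜 M (k := -j) b _).symm
  have h : 0 + j = - -j := by omega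
  exact (M.mul_act (p := 0) _ _ h _ b b v (by simp)).symm.trans
    (M.mul_act _ _ h b _ b v (by simp))

/-- The section `v ↦ 1 ⊗ v` of the projection `P M → M`. -/
def stdη (M : GrMod 𝒜) (j : ℤ) : M.V j →ₗ[ℂ] (std 𝒜 M).V j :=
  app (stdInj 𝒜 M (-j)) j ∘ₗ indMk₂ 𝒜 (trivObj 𝒜 M) j (oneDeg 𝒜 (by omega)) ∘ₗ toTriv 𝒜 M j

lemma stdη_apply (M : GrMod 𝒜) (j : ℤ) (v : M.V j) : stdη 𝒜 M j v =
    app (stdInj 𝒜 M (-j)) j (indMk (trivObj 𝒜 M) (oneDeg 𝒜 (by omega : j + -j = 0))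
      (toTriv 𝒜 M j v)) := rfl

lemma ε_η (M : GrMod 𝒜) (j : ℤ) (v : M.V j) : app (stdε 𝒜 M) j (stdη 𝒜 M j v) = v := by
  rw [stdη_apply]
  refine (congrArg (fun t => app t j _) (stdInj_ε 𝒜 M (-j))).trans ?_
  refine (M.mul_act (p := 0) _ _ (zero_add j) _ _ (oneDeg 𝒜 rfl) v (by simp)).symm.trans ?_
  exact M.one_act _ _ _ rfl

lemma η_naturality {M N : GrMod 𝒜} (f : M ⟶ N) (j : ℤ) (v : M.V j) :
    app (stdMap f) j (stdη 𝒜 M j v) = stdη 𝒜 N j (app f j v) := by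
  rw [stdη_apply, stdη_apply]
  refine (congrArg (fun t => app t j _) (stdInj_map 𝒜 f (-j))).trans ?_
  refine congrArg (app (stdInj 𝒜 N (-j)) j) ?_
  exact congrArg (indMk₂ 𝒜 (trivObj 𝒜 N) j _) (app_act f _ _ v)

/-- The section `v ↦ 1 ⊗ v` is linear over `A₀`, though generally not over `A`. Linearity over `A₀`
is enough to extend it to an `A`-linear section when the module is induced from `A₀`. -/
lemma η_act₀ (M : GrMod 𝒜) (j : ℤ) (b : 𝒜 0) (v : M.V j) :
    stdη 𝒜 M j (M.act (zero_add j) b v) = (std 𝒜 M).act (zero_add j) b (stdη 𝒜 M j v) := by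
  rw [stdη_apply, stdη_apply, ← app_act, toTriv_act₀]
  refine congrArg (app (stdInj 𝒜 M (-j)) j) ?_
  refine (IndComp.mk_smul (trivObj 𝒜 M) (oneDeg 𝒜 (by omega : j + -j = 0)) b _).symm.trans ?_
  exact congrArg (fun x => IndComp.mk (trivObj 𝒜 M) x (toTriv 𝒜 M j v)) (Subtype.ext (by simp))

/-- The kernel `Ω M` of the projection `P M → M`. -/
def syz (M : GrMod 𝒜) : GrMod 𝒜 := kerObj (stdε 𝒜 M)

/-- The inclusion `Ω M → P M`. -/
def syzι (M : GrMod 𝒜) : syz 𝒜 M ⟶ std 𝒜 M := kerι _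

lemma syzι_injective (M : GrMod 𝒜) (j : ℤ) : Function.Injective (app (syzι 𝒜 M) j) :=
  kerι_injective _ j

lemma syzι_ε (M : GrMod 𝒜) : syzι 𝒜 M ≫ stdε 𝒜 M = 0 := kerι_comp _

lemma exists_syzι (M : GrMod 𝒜) (j : ℤ) (z : (std 𝒜 M).V j) (hz : app (stdε 𝒜 M) j z = 0) :
    ∃ w, app (syzι 𝒜 M) j w = z := ⟨⟨z, hz⟩, rfl⟩

/-- Lift to the kernel of `P M → M`. -/
def syzLift {M N : GrMod 𝒜} (f : N ⟶ std 𝒜 M) (h : f ≫ stdε 𝒜 M = 0) : N ⟶ syz 𝒜 M :=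
  kerLift _ f h

lemma syzLift_ι {M N : GrMod 𝒜} (f : N ⟶ std 𝒜 M) (h : f ≫ stdε 𝒜 M = 0) :
    syzLift 𝒜 f h ≫ syzι 𝒜 M = f := rfl

variable {𝒜} in
/-- The functoriality of `Ω M`. -/
def syzMap {M N : GrMod 𝒜} (f : M ⟶ N) : syz 𝒜 M ⟶ syz 𝒜 N :=
  syzLift 𝒜 (syzι 𝒜 M ≫ stdMap f) (by
    rw [Category.assoc, stdε_naturality, ← Category.assoc, syzι_ε, zero_comp])

lemma syzMap_ι {M N : GrMod 𝒜} (f : M ⟶ N) :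
    syzMap f ≫ syzι 𝒜 N = syzι 𝒜 M ≫ stdMap f := syzLift_ι ..

variable {𝒜} in
lemma syz_ext {M N : GrMod 𝒜} {f g : N ⟶ syz 𝒜 M} (h : f ≫ syzι 𝒜 M = g ≫ syzι 𝒜 M) : f = g :=
  hom_ext_of_injective _ (syzι_injective 𝒜 M) h

/-- The functor `Ω`. -/
def syzF : GrMod 𝒜 ⥤ GrMod 𝒜 where
  obj := syz 𝒜
  map := syzMap
  map_id M := syz_ext (by rw [syzMap_ι, stdMap_id, Category.comp_id, Category.id_comp])
  map_comp f g := syz_ext (by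
    rw [syzMap_ι, stdMap_comp, Category.assoc, syzMap_ι, ← Category.assoc, ← Category.assoc,
      syzMap_ι])

instance : (syzF 𝒜).Additive where
  map_add {_ _ f g} := syz_ext ((syzMap_ι 𝒜 (f + g)).trans (by
    rw [stdMap_add, Preadditive.comp_add, ← syzMap_ι, ← syzMap_ι, ← Preadditive.add_comp]
    rfl))

/-- The functor `P`. -/
def stdF : GrMod 𝒜 ⥤ GrMod 𝒜 where
  obj := std 𝒜
  map := stdMap
  map_id := stdMap_id 𝒜
  map_comp := stdMap_comp 𝒜

end StandardProjective

/-! ### Exactness, degree bounds and splitting for `P` and `Ω`. -/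

section StandardExact

variable {A : Type u} [Ring A] [Algebra ℂ A] {𝒜 : ℤ → Submodule ℂ A}
  [GradedAlgebra 𝒜] [FiniteDimensional ℂ A]
  {S : Type u} [Ring S] [Algebra ℂ S] {𝒮 : ℤ → Submodule ℂ S}

/-- The decomposition of the image of `P M` under a linear functor. -/
def stdSplit (F : GrMod 𝒜 ⥤ GrMod 𝒮) [F.Additive] [F.Linear ℂ] (M : GrMod 𝒜) :
    Splitting (F.obj (std 𝒜 M)) (fun k => F.obj (ind 𝒜 k (trivObj 𝒜 M))) :=
  dsumSplit F (fun k => F.map (stdInj 𝒜 M k)) (fun k => F.map (stdProj 𝒜 M k)) id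
    Function.injective_id (fun _ => rfl) (fun k _ _ hz => hz k rfl)

/-- A linear functor sees `P M` through its summands `A ⊗_{A₀} M_{-k}`. Preimages are chosen on the
finitely many relevant summands and added. -/
lemma std_preservesExact (F : GrMod 𝒜 ⥤ GrMod 𝒮) [F.Additive] [F.Linear ℂ]
    (hF : ∀ k, PreservesExact (indF 𝒜 k ⋙ F)) : PreservesExact (stdF 𝒜 ⋙ F) := by
  intro M N P f g hfg h j z hz
  let σ (M : GrMod 𝒜) := stdSplit F M
  have hpr : ∀ {M N : GrMod 𝒜} (f : M ⟶ N) (k : ℤ) (z : (F.obj (std 𝒜 M)).V j),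
      app (F.map (stdProj 𝒜 N k)) j (app (F.map (stdMap f)) j z) =
        app (F.map (indMap 𝒜 k (trivMap f))) j (app (F.map (stdProj 𝒜 M k)) j z) := by
    intro M N f k z
    rw [← app_comp_apply, ← app_comp_apply, ← F.map_comp, ← F.map_comp, stdMap_proj]
  have key : ∀ k, ∃ w : (F.obj (ind 𝒜 k (trivObj 𝒜 M))).V j,
      app (F.map (indMap 𝒜 k (trivMap f))) j w = app (F.map (stdProj 𝒜 N k)) j z := by
    intro k
    refine hF k (trivMap f) (trivMap g) ?_ ?_ j _ ?_
    · ext j x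
      exact congrArg (fun t => app t (-j) x) hfg
    · exact fun j z hz => h (-j) z hz
    · refine (hpr g k z).symm.trans ?_
      refine (congrArg (app (F.map (stdProj 𝒜 P k)) j) hz).trans (map_zero _)
  choose w hw using key
  obtain ⟨s, -, hs⟩ := (σ N).sum_eq j z
  refine ⟨∑ k ∈ s, app (F.map (stdInj 𝒜 M k)) j (w k), ?_⟩
  refine (map_sum (app (F.map (stdMap f)) j) _ s).trans (Eq.trans ?_ hs.symm)
  refine Finset.sum_congr rfl fun k _ => ?_
  refine Eq.trans ?_ (congrArg (app (F.map (stdInj 𝒜 N k)) j) (hw k))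
  refine (app_comp_apply (F.map (stdInj 𝒜 M k)) (F.map (stdMap f)) j (w k)).symm.trans ?_
  rw [← F.map_comp, stdInj_map, F.map_comp]
  rfl

/-- A preimage `w` in `P M` exists by exactness of `P`. Subtracting `η (ε w)` moves it into `Ω M`
without changing its image: by naturality the change is `η (f (ε w))`, and `f (ε w) = ε (ι z) = 0`.
-/
lemma syz_preservesExact {Λ : Type*} [Fintype Λ] {e : Λ → A} (hA : IsBasic 𝒜 e) :
    PreservesExact (syzF 𝒜) := by
  intro M N P f g hfg h j z hz
  obtain ⟨w, hw⟩ : ∃ w : (std 𝒜 M).V j, app (stdMap f) j w = app (syzι 𝒜 N) j z :=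
    std_preservesExact (𝟭 _) (indF_preservesExact hA) f g hfg h j (app (syzι 𝒜 N) j z) (by
    refine (congrArg (fun t => app t j z) (syzMap_ι 𝒜 g)).symm.trans ?_
    exact (congrArg (app (syzι 𝒜 P) j) hz).trans (map_zero _))
  obtain ⟨y, hy⟩ := exists_syzι 𝒜 M j (w - stdη 𝒜 M j (app (stdε 𝒜 M) j w)) (by
    rw [map_sub, ε_η, sub_self])
  refine ⟨y, syzι_injective 𝒜 N j ?_⟩
  refine (congrArg (fun t => app t j y) (syzMap_ι 𝒜 f)).trans ?_
  rw [app_comp_apply, hy, map_sub, hw, η_naturality, sub_eq_self]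
  have e : app f j (app (stdε 𝒜 M) j w) = 0 := by
    rw [← app_comp_apply, ← stdε_naturality, app_comp_apply, hw]
    exact congrArg (fun t => app t j z) (syzι_ε 𝒜 N)
  rw [e, map_zero]

section Bounds

variable [NonnegGraded 𝒜]

lemma std_component_subsingleton {M : GrMod 𝒜} {m : ℤ} (hM : ∀ j < m, Subsingleton (M.V j))
    {j k : ℤ} (h : j + k < 0 ∨ -k < m) : Subsingleton ((ind 𝒜 k (trivObj 𝒜 M)).V j) :=
  ind_subsingleton 𝒜 _ (h.imp (fun h => NonnegGraded.eq_bot _ h) (fun h => hM _ h))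

lemma std_subsingleton {M : GrMod 𝒜} {m : ℤ} (hM : ∀ j < m, Subsingleton (M.V j)) :
    ∀ j < m, Subsingleton ((std 𝒜 M).V j) := fun j hj =>
  subsingleton_of_forall_eq 0 fun z => (stdSplit (𝟭 _) M).eq_zero fun k =>
    have := std_component_subsingleton hM (j := j) (k := k) (by omega)
    Subsingleton.elim (α := (ind 𝒜 k (trivObj 𝒜 M)).V j) _ _

/-- In degree `j` the summand generated by `M_j` has coefficients in `A₀`, so each of its elements
has the form `1 ⊗ v`. -/
lemma η_ε_stdInj (M : GrMod 𝒜) (j : ℤ) (y : (ind 𝒜 (-j) (trivObj 𝒜 M)).V j) :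
    stdη 𝒜 M j (app (stdε 𝒜 M) j (app (stdInj 𝒜 M (-j)) j y)) = app (stdInj 𝒜 M (-j)) j y := by
  refine LinearMap.congr_fun (ind_linear_ext (N := trivObj 𝒜 M)
    (f := stdη 𝒜 M j ∘ₗ app (stdε 𝒜 M) j ∘ₗ app (stdInj 𝒜 M (-j)) j)
    (g := app (stdInj 𝒜 M (-j)) j) fun x v => ?_) y
  have h1 : app (stdε 𝒜 M) j (app (stdInj 𝒜 M (-j)) j (indMk (trivObj 𝒜 M) x v)) =
      M.act (by omega : j + -j + - -j = j) x v :=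
    (congrArg (fun t => app t j _) (stdInj_ε 𝒜 M (-j)))
  change stdη 𝒜 M j (app (stdε 𝒜 M) j (app (stdInj 𝒜 M (-j)) j (indMk (trivObj 𝒜 M) x v))) = _
  rw [h1, stdη_apply]
  refine congrArg (app (stdInj 𝒜 M (-j)) j) ?_
  have hx : (x : A) ∈ 𝒜 0 := add_neg_cancel j ▸ x.2
  have h2 : toTriv 𝒜 M j (M.act (by omega : j + -j + - -j = j) x v) =
      (trivObj 𝒜 M).act (zero_add (-j)) (QDual.deg0 𝒜 ⟨x, hx⟩) v := by
    refine Eq.trans ?_ (trivObj_act_deg0 𝒜 M (k := -j) ⟨x, hx⟩ v).symm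
    exact (M.mul_act _ _ (zero_add (- -j)) (oneDeg 𝒜 rfl) x ⟨x, hx⟩ v (by simp)).symm
  rw [h2]
  refine (IndComp.mk_smul (trivObj 𝒜 M) (oneDeg 𝒜 (by omega : j + -j = 0)) ⟨x, hx⟩ v).symm.trans ?_
  exact congrArg (fun x => IndComp.mk (trivObj 𝒜 M) x v) (Subtype.ext (by simp))

/-- If `M` vanishes below `m`, then in degrees at most `m` only the summand `A₀ ⊗ M_j` of `P M` can
be nonzero, and `ε` is injective on it. Each syzygy thus gains one degree, which keeps the total
resolution inside `Com^↓`. -/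
lemma syz_subsingleton {M : GrMod 𝒜} {m : ℤ} (hM : ∀ j < m, Subsingleton (M.V j)) :
    ∀ j < m + 1, Subsingleton ((syz 𝒜 M).V j) := fun j hj =>
  subsingleton_of_forall_eq 0 fun z => syzι_injective 𝒜 M j <| by
    rw [map_zero]
    have h0 : app (stdε 𝒜 M) j (app (syzι 𝒜 M) j z) = 0 :=
      congrArg (fun t => app t j z) (syzι_ε 𝒜 M)
    obtain ⟨s, hs', hs⟩ := (stdSplit (𝟭 _) M).sum_eq j (app (syzι 𝒜 M) j z)
    replace hs : app (syzι 𝒜 M) j z = ∑ k ∈ s, app (stdInj 𝒜 M k) j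
      (app (stdProj 𝒜 M k) j (app (syzι 𝒜 M) j z)) := hs
    have h1 : app (syzι 𝒜 M) j z = app (stdInj 𝒜 M (-j)) j
        (app (stdProj 𝒜 M (-j)) j (app (syzι 𝒜 M) j z)) := by
      refine hs.trans (Finset.sum_eq_single _ (fun k _ hk => ?_) fun h => ?_)
      · have := std_component_subsingleton hM (j := j) (k := k) (by omega)
        rw [Subsingleton.elim (app (stdProj 𝒜 M k) j (app (syzι 𝒜 M) j z)) 0, map_zero]
      · exact (congrArg (app (stdInj 𝒜 M (-j)) j) (hs' _ h)).trans (map_zero _)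
    rw [h1, ← η_ε_stdInj, ← h1, h0, map_zero]

end Bounds

section Split

/-- The projection `P M → M` has a section. -/
def IsGood (M : GrMod 𝒜) : Prop := ∃ σ : M ⟶ std 𝒜 M, σ ≫ stdε 𝒜 M = 𝟙 M

/-- A morphism out of `A ⊗_{A₀} N_k` is the same as an `A₀`-linear map out of `N_k`. Here it is `v ↦
η (1 ⊗ v)`. -/
lemma isGood_ind (k : ℤ) (N : GrMod (QDual.gr 𝒜)) : IsGood (ind 𝒜 k N) := by
  let h : -k + k = 0 := by omega
  let ι : N.V k →ₗ[ℂ] (ind 𝒜 k N).V (-k) := indMk₂ 𝒜 N (-k) (oneDeg 𝒜 h)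
  refine ⟨indDesc (stdη 𝒜 (ind 𝒜 k N) (-k) ∘ₗ ι) fun b v => ?_, ind_hom_ext 𝒜 fun j x v => ?_⟩
  · refine Eq.trans ?_ (η_act₀ 𝒜 (ind 𝒜 k N) (-k) b (ι v))
    refine congrArg (stdη 𝒜 (ind 𝒜 k N) (-k)) ?_
    refine (IndComp.mk_smul N (oneDeg 𝒜 h) b v).symm.trans ?_
    exact congrArg (fun x => IndComp.mk N x v) (Subtype.ext (by simp))
  · rw [app_comp_apply, indDesc_mk, app_act]
    refine (congrArg _ (ε_η 𝒜 (ind 𝒜 k N) (-k) (ι v))).trans ?_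
    refine (ind_act_mk 𝒜 k N _ x (oneDeg 𝒜 h) v).trans ?_
    exact congrArg (fun x => IndComp.mk N x v) (Subtype.ext (by simp))

lemma isGood_dsum {ι : Type} [DecidableEq ι] {N : ι → GrMod 𝒜}
    {hN : ∀ j, {i | Nontrivial ((N i).V j)}.Finite} (h : ∀ i, IsGood (N i)) :
    IsGood (dsum N hN) := by
  choose σ hσ using h
  refine ⟨desc fun i => σ i ≫ stdMap (inj i), dsum_ext fun i => ?_⟩
  rw [← Category.assoc, inj_desc, Category.assoc, stdε_naturality, ← Category.assoc, hσ,
    Category.id_comp, Category.comp_id]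

lemma isGood_of_retract {M N : GrMod 𝒜} (i : M ⟶ N) (p : N ⟶ M) (h : i ≫ p = 𝟙 M)
    (hN : IsGood N) : IsGood M := by
  obtain ⟨σ, hσ⟩ := hN
  refine ⟨i ≫ σ ≫ stdMap p, ?_⟩
  rw [Category.assoc, Category.assoc, stdε_naturality, ← Category.assoc σ, hσ, Category.id_comp, h]

lemma isGood_std (M : GrMod 𝒜) : IsGood (std 𝒜 M) := isGood_dsum fun k => isGood_ind k _

lemma IsGood.exists_retraction {M : GrMod 𝒜} {σ : M ⟶ std 𝒜 M} (hσ : σ ≫ stdε 𝒜 M = 𝟙 M) :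
    ∃ ρ : std 𝒜 M ⟶ syz 𝒜 M, ρ ≫ syzι 𝒜 M = 𝟙 _ - stdε 𝒜 M ≫ σ ∧ syzι 𝒜 M ≫ ρ = 𝟙 _ := by
  have h : (𝟙 _ - stdε 𝒜 M ≫ σ) ≫ stdε 𝒜 M = 0 := by
    rw [Preadditive.sub_comp, Category.assoc, hσ, Category.comp_id, Category.id_comp, sub_self]
  refine ⟨syzLift 𝒜 _ h, syzLift_ι 𝒜 _ h, syz_ext ?_⟩
  rw [Category.assoc, syzLift_ι, Preadditive.comp_sub, ← Category.assoc, syzι_ε, zero_comp,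
    sub_zero, Category.comp_id, Category.id_comp]

/-- A section of `P M → M` makes `Ω M` a retract of `P M`. -/
lemma IsGood.syz {M : GrMod 𝒜} (hM : IsGood M) : IsGood (syz 𝒜 M) := by
  obtain ⟨σ, hσ⟩ := hM
  obtain ⟨ρ, -, hρ⟩ := IsGood.exists_retraction hσ
  exact isGood_of_retract _ ρ hρ (isGood_std M)

/-- The functor `F` sends the sequence `0 → Ω M → P M → M → 0` to an exact sequence. -/
structure ExactOn (F : GrMod 𝒜 ⥤ GrMod 𝒮) (M : GrMod 𝒜) : Prop where
  inj : ∀ j, Function.Injective (app (F.map (syzι 𝒜 M)) j)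
  exact : ExactSeq (F.map (syzι 𝒜 M)) (F.map (stdε 𝒜 M))
  surj : ∀ j, Function.Surjective (app (F.map (stdε 𝒜 M)) j)

lemma exactOn_id (M : GrMod 𝒜) : ExactOn (𝟭 _) M where
  inj := syzι_injective 𝒜 M
  exact j z hz := exists_syzι 𝒜 M j z hz
  surj j v := ⟨_, ε_η 𝒜 M j v⟩

/-- Split short exact sequences are preserved by every additive functor, so these modules are
acyclic for all of them. -/
lemma IsGood.exactOn {M : GrMod 𝒜} (hM : IsGood M) (F : GrMod 𝒜 ⥤ GrMod 𝒮) [F.Additive] :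
    ExactOn F M := by
  obtain ⟨σ, hσ⟩ := hM
  obtain ⟨ρ, hρ', hρ⟩ := IsGood.exists_retraction hσ
  refine ⟨fun j => ?_, fun j z hz => ⟨app (F.map ρ) j z, ?_⟩, fun j v => ⟨app (F.map σ) j v, ?_⟩⟩
  · refine Function.LeftInverse.injective (g := app (F.map ρ) j) fun w => ?_
    rw [← app_comp_apply, ← F.map_comp, hρ, F.map_id]
    rfl
  · rw [← app_comp_apply, ← F.map_comp, hρ', F.map_sub, F.map_id, F.map_comp, sub_app,
      LinearMap.sub_apply, app_comp_apply, hz, map_zero, sub_zero]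
    rfl
  · rw [← app_comp_apply, ← F.map_comp, hσ, F.map_id]
    rfl

end Split

end StandardExact

/-! ### Exactness of a transported functor on induced modules. -/

section TransportExact

variable {A : Type u} [Ring A] [Algebra ℂ A] [FiniteDimensional ℂ A]
  {𝒜 : ℤ → Submodule ℂ A} [GradedAlgebra 𝒜]
  {Λ : Type*} [Fintype Λ] {e : Λ → A} {hA : IsBasic 𝒜 e} {L : Finset Λ}
  {B : Type u} [Ring B] [Algebra ℂ B] [FiniteDimensional ℂ B]
  {ℬ : ℤ → Submodule ℂ B} [GradedAlgebra ℬ]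
  {e' : L → B} {hB : IsBasic ℬ e'} {D : CornerDatum hA hB} {F : GrMod ℬ ⥤ GrMod 𝒜}

/-- `F` itself need not be exact, but on modules `B ⊗_{B₀} N_k` it agrees naturally with `A ⊗_{A₀}
N_k`, which is exact in `N`. -/
lemma Transport.ind_preservesExact (t : Transport D F) [F.Additive] [F.Linear ℂ] (k : ℤ) :
    PreservesExact (indF ℬ k ⋙ F) := by
  intro M N P f g hfg h j z hz
  obtain ⟨y, rfl⟩ := (t.indHom_bijective N k j).2 z
  have e1 : ∀ {M N : GrMod (QDual.gr ℬ)} (f : M ⟶ N) y,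
      app (F.map (indMap ℬ k f)) j (app (t.indHom M k) j y) =
      app (t.indHom N k) j (app (indMap 𝒜 k ((Transport.resχ D).map f)) j y) := fun f y =>
    congrArg (fun q => app q j y) (t.indHom_naturality f k)
  have hy : app (indMap 𝒜 k ((Transport.resχ D).map g)) j y = 0 :=
    (t.indHom_bijective P k j).1 ((e1 g y).symm.trans (hz.trans (map_zero _).symm))
  obtain ⟨w, hw⟩ := indF_preservesExact hA k ((Transport.resχ D).map f)
    ((Transport.resχ D).map g) (by rw [← Functor.map_comp, hfg]; rfl) h j y hy
  exact ⟨app (t.indHom M k) j w, (e1 f w).trans (congrArg _ hw)⟩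

end TransportExact

/-! ### The functorial resolution by standard modules. -/

section Resolution

variable {A : Type u} [Ring A] [Algebra ℂ A] (𝒜 : ℤ → Submodule ℂ A)
  [GradedAlgebra 𝒜] [FiniteDimensional ℂ A]
  {S : Type u} [Ring S] [Algebra ℂ S] {𝒮 : ℤ → Submodule ℂ S}

/-- The zero module. -/
def zeroMod : GrMod 𝒜 where
  V _ := PUnit
  act _ := 0
  one_act _ _ _ _ := Subsingleton.elim _ _
  mul_act _ _ _ _ _ _ _ _ := Subsingleton.elim _ _

instance (j : ℤ) : Subsingleton ((zeroMod 𝒜).V j) := inferInstanceAs (Subsingleton PUnit)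

/-- The iterates of `Ω`. -/
def syzIter : ℕ → GrMod 𝒜 ⥤ GrMod 𝒜
  | 0 => 𝟭 _
  | s + 1 => syzIter s ⋙ syzF 𝒜

instance syzIter_additive : ∀ s, (syzIter 𝒜 s).Additive
  | 0 => inferInstanceAs (𝟭 _ : GrMod 𝒜 ⥤ _).Additive
  | s + 1 =>
    have := syzIter_additive s
    inferInstanceAs (syzIter 𝒜 s ⋙ syzF 𝒜).Additive

/-- The functor `Ω^s` in degree `-s`, and zero in positive degrees. -/
def resW : ℤ → GrMod 𝒜 ⥤ GrMod 𝒜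
  | .ofNat 0 => 𝟭 _
  | .ofNat (_ + 1) => (Functor.const _).obj (zeroMod 𝒜)
  | .negSucc s => syzIter 𝒜 (s + 1)

instance resW_additive : ∀ k, (resW 𝒜 k).Additive
  | .ofNat 0 => inferInstanceAs (𝟭 _ : GrMod 𝒜 ⥤ _).Additive
  | .ofNat (_ + 1) => ⟨fun {_ _ _ _} => GrMod.hom_ext fun _ => LinearMap.ext fun _ => rfl⟩
  | .negSucc s => inferInstanceAs (syzIter 𝒜 (s + 1)).Additive

lemma resW_pos : ∀ {k : ℤ} (_ : 0 < k) (M : GrMod 𝒜) (j : ℤ), Subsingleton (((resW 𝒜 k).obj M).V j)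
  | .ofNat 0, h, _, _ => absurd h (lt_irrefl _)
  | .ofNat (_ + 1), _, _, j => inferInstanceAs (Subsingleton ((zeroMod 𝒜).V j))

attribute [local irreducible] std stdMap stdε syz syzι syzMap

/-- The term of degree `k` of the resolution of `M`. -/
def resX (M : GrMod 𝒜) (k : ℤ) : GrMod 𝒜 := std 𝒜 ((resW 𝒜 k).obj M)

/-- The functoriality of the terms of the resolution. -/
def resMap {M N : GrMod 𝒜} (f : M ⟶ N) (k : ℤ) : resX 𝒜 M k ⟶ resX 𝒜 N k :=
  stdMap ((resW 𝒜 k).map f)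

/-- The projection of the term of degree `k` of the resolution to the syzygy. -/
def resε (M : GrMod 𝒜) (k : ℤ) : resX 𝒜 M k ⟶ (resW 𝒜 k).obj M := stdε 𝒜 _

lemma resε_naturality {M N : GrMod 𝒜} (f : M ⟶ N) (k : ℤ) :
    resMap 𝒜 f k ≫ resε 𝒜 N k = resε 𝒜 M k ≫ (resW 𝒜 k).map f := stdε_naturality 𝒜 _

/-- The inclusion `Ω^{s + 1} M → P Ω^s M`, in degree `-(s + 1)`. -/
def resConn (M : GrMod 𝒜) : ∀ k : ℤ, (resW 𝒜 k).obj M ⟶ resX 𝒜 M (k + 1)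
  | .ofNat _ => 0
  | .negSucc 0 => syzι 𝒜 M
  | .negSucc (s + 1) => syzι 𝒜 ((syzIter 𝒜 (s + 1)).obj M)

lemma resConn_naturality {M N : GrMod 𝒜} (f : M ⟶ N) : ∀ k : ℤ,
    resConn 𝒜 M k ≫ resMap 𝒜 f (k + 1) = (resW 𝒜 k).map f ≫ resConn 𝒜 N k
  | .ofNat _ => zero_comp.trans comp_zero.symm
  | .negSucc 0 => (syzMap_ι 𝒜 f).symm
  | .negSucc (s + 1) => (syzMap_ι 𝒜 ((syzIter 𝒜 (s + 1)).map f)).symm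

lemma resConn_ε (M : GrMod 𝒜) : ∀ k : ℤ, resConn 𝒜 M k ≫ resε 𝒜 M (k + 1) = 0
  | .ofNat _ => zero_comp
  | .negSucc 0 => syzι_ε 𝒜 M
  | .negSucc (s + 1) => syzι_ε 𝒜 ((syzIter 𝒜 (s + 1)).obj M)

/-- The inclusion of the syzygy of a term of the resolution. -/
def resι (M : GrMod 𝒜) (k : ℤ) : syz 𝒜 ((resW 𝒜 k).obj M) ⟶ resX 𝒜 M k := syzι 𝒜 _

lemma resConn_eq (M : GrMod 𝒜) : ∀ {k : ℤ} (_ : k < 0),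
    ∃ i : (resW 𝒜 k).obj M ≅ syz 𝒜 ((resW 𝒜 (k + 1)).obj M),
      resConn 𝒜 M k = i.hom ≫ resι 𝒜 M (k + 1)
  | .ofNat n, h => absurd h (by simp)
  | .negSucc 0, _ => ⟨Iso.refl (syz 𝒜 M), (Category.id_comp (syzι 𝒜 M)).symm⟩
  | .negSucc (s + 1), _ => ⟨Iso.refl (syz 𝒜 ((syzIter 𝒜 (s + 1)).obj M)),
      (Category.id_comp (syzι 𝒜 ((syzIter 𝒜 (s + 1)).obj M))).symm⟩

variable {𝒜} in
lemma resConn_injective (F : GrMod 𝒜 ⥤ GrMod 𝒮) (M : GrMod 𝒜) {k : ℤ} (hk : k < 0)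
    (h : ExactOn F ((resW 𝒜 (k + 1)).obj M)) (j : ℤ) :
    Function.Injective (app (F.map (resConn 𝒜 M k)) j) := by
  obtain ⟨i, hi⟩ := resConn_eq 𝒜 M hk
  rw [hi, F.map_comp]
  refine (h.inj j).comp (Function.LeftInverse.injective (g := app (F.map i.inv) j) fun w => ?_)
  refine (app_comp_apply (F.map i.hom) (F.map i.inv) j w).symm.trans ?_
  rw [← F.map_comp, i.hom_inv_id, F.map_id]
  rfl

variable {𝒜} in
lemma resConn_exact (F : GrMod 𝒜 ⥤ GrMod 𝒮) (M : GrMod 𝒜) {k : ℤ} (hk : k < 0)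
    (h : ExactOn F ((resW 𝒜 (k + 1)).obj M)) :
    ExactSeq (F.map (resConn 𝒜 M k)) (F.map (resε 𝒜 M (k + 1))) := by
  intro j z hz
  obtain ⟨i, hi⟩ := resConn_eq 𝒜 M hk
  obtain ⟨w, hw⟩ := h.exact j z hz
  refine ⟨app (F.map i.inv) j w, ?_⟩
  rw [hi, ← app_comp_apply, ← F.map_comp, i.inv_hom_id_assoc]
  exact hw

variable {𝒜} in
lemma IsGood.syzIter {M : GrMod 𝒜} (hM : IsGood M) : ∀ s, IsGood ((syzIter 𝒜 s).obj M)
  | 0 => hM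
  | s + 1 => (IsGood.syzIter hM s).syz

variable {𝒜} in
lemma IsGood.resW {M : GrMod 𝒜} (hM : IsGood M) : ∀ {k : ℤ} (_ : k ≤ 0), IsGood ((resW 𝒜 k).obj M)
  | .ofNat 0, _ => hM
  | .ofNat (n + 1), h => absurd h (by simp)
  | .negSucc s, _ => hM.syzIter (s + 1)

lemma syzIter_preservesExact {Λ : Type*} [Fintype Λ] {e : Λ → A} (hA : IsBasic 𝒜 e) :
    ∀ s, PreservesExact (syzIter 𝒜 s)
  | 0 => PreservesExact.id
  | s + 1 => PreservesExact.comp (syzIter_preservesExact hA s) (syz_preservesExact hA)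

lemma resW_preservesExact {Λ : Type*} [Fintype Λ] {e : Λ → A} (hA : IsBasic 𝒜 e) :
    ∀ k, PreservesExact (resW 𝒜 k)
  | .ofNat 0 => PreservesExact.id
  | .ofNat (_ + 1) => fun _ _ _ _ _ _ _ _ _ _ => ⟨PUnit.unit, rfl⟩
  | .negSucc s => syzIter_preservesExact 𝒜 hA (s + 1)

lemma syzIter_subsingleton [NonnegGraded 𝒜] {M : GrMod 𝒜} {m : ℤ}
    (hM : ∀ j < m, Subsingleton (M.V j)) :
    ∀ (s : ℕ), ∀ j < m + s, Subsingleton (((syzIter 𝒜 s).obj M).V j)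
  | 0 => fun j hj => hM j (by simpa using hj)
  | s + 1 => fun j hj => syz_subsingleton (syzIter_subsingleton hM s) j (by push_cast at hj; omega)

lemma resW_subsingleton [NonnegGraded 𝒜] {M : GrMod 𝒜} {m : ℤ}
    (hM : ∀ j < m, Subsingleton (M.V j)) :
    ∀ k : ℤ, ∀ j < m - k, Subsingleton (((resW 𝒜 k).obj M).V j)
  | .ofNat 0 => fun j hj => hM j (by simpa using hj)
  | .ofNat (_ + 1) => fun j _ => inferInstanceAs (Subsingleton ((zeroMod 𝒜).V j))
  | .negSucc s => fun j hj => syzIter_subsingleton 𝒜 hM (s + 1) j (by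
      rw [Int.negSucc_eq] at hj; push_cast; omega)

/-- The differential of the resolution of `M`. -/
def resDiff (M : GrMod 𝒜) (k : ℤ) : resX 𝒜 M k ⟶ resX 𝒜 M (k + 1) :=
  resε 𝒜 M k ≫ resConn 𝒜 M k

lemma resDiff_comp (M : GrMod 𝒜) (k : ℤ) : resDiff 𝒜 M k ≫ resDiff 𝒜 M (k + 1) = 0 := by
  rw [resDiff, resDiff, Category.assoc, ← Category.assoc (resConn 𝒜 M k), resConn_ε, zero_comp,
    comp_zero]

lemma resMap_diff {M N : GrMod 𝒜} (f : M ⟶ N) (k : ℤ) :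
    resMap 𝒜 f k ≫ resDiff 𝒜 N k = resDiff 𝒜 M k ≫ resMap 𝒜 f (k + 1) := by
  rw [resDiff, resDiff, Category.assoc, resConn_naturality, ← Category.assoc, resε_naturality,
    Category.assoc]

lemma resMap_id (M : GrMod 𝒜) (k : ℤ) : resMap 𝒜 (𝟙 M) k = 𝟙 _ :=
  (congrArg stdMap ((resW 𝒜 k).map_id M)).trans (stdMap_id 𝒜 _)

lemma resMap_comp {M N P : GrMod 𝒜} (f : M ⟶ N) (g : N ⟶ P) (k : ℤ) :
    resMap 𝒜 (f ≫ g) k = resMap 𝒜 f k ≫ resMap 𝒜 g k :=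
  (congrArg stdMap ((resW 𝒜 k).map_comp f g)).trans (stdMap_comp 𝒜 _ _)

lemma resMap_add {M N : GrMod 𝒜} (f g : M ⟶ N) (k : ℤ) :
    resMap 𝒜 (f + g) k = resMap 𝒜 f k + resMap 𝒜 g k :=
  (congrArg stdMap ((resW 𝒜 k).map_add (f := f) (g := g))).trans (stdMap_add 𝒜 _ _)

lemma resMap_zero (M N : GrMod 𝒜) (k : ℤ) : resMap 𝒜 (0 : M ⟶ N) k = 0 := by
  simpa using resMap_add 𝒜 (0 : M ⟶ N) 0 k

/-- Each term of the resolution is the functor `P Ω^s`, or `P` of the zero module in positive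
degrees. Since `Ω` is exact and `P` followed by `F` is exact, so is each term followed by `F`. -/
lemma resMap_exact (F : GrMod 𝒜 ⥤ GrMod 𝒮) [F.Additive] [F.Linear ℂ] {Λ : Type*} [Fintype Λ]
    {e : Λ → A} (hA : IsBasic 𝒜 e) (hF : ∀ k, PreservesExact (indF 𝒜 k ⋙ F)) (k : ℤ)
    {M N P : GrMod 𝒜} (f : M ⟶ N) (g : N ⟶ P) (hfg : f ≫ g = 0) (h : ExactSeq f g) :
    ExactSeq (F.map (resMap 𝒜 f k)) (F.map (resMap 𝒜 g k)) :=
  (resW_preservesExact 𝒜 hA k).comp (std_preservesExact F hF) f g hfg h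

/-- The augmentation of the resolution. -/
def resAug (M : GrMod 𝒜) : ∀ k : ℤ, resX 𝒜 M k ⟶ M
  | .ofNat 0 => stdε 𝒜 M
  | .ofNat (_ + 1) => 0
  | .negSucc _ => 0

lemma resAug_of_ne (M : GrMod 𝒜) : ∀ {k : ℤ} (_ : k ≠ 0), resAug 𝒜 M k = 0
  | .ofNat 0, h => absurd rfl h
  | .ofNat (_ + 1), _ => rfl
  | .negSucc _, _ => rfl

lemma resAug_naturality {M N : GrMod 𝒜} (f : M ⟶ N) (k : ℤ) :
    resMap 𝒜 f k ≫ resAug 𝒜 N k = resAug 𝒜 M k ≫ f := by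
  by_cases hk : k = 0
  · subst hk
    exact stdε_naturality 𝒜 f
  · rw [resAug_of_ne 𝒜 M hk, resAug_of_ne 𝒜 N hk, comp_zero, zero_comp]

lemma resDiff_aug (M : GrMod 𝒜) (k : ℤ) : resDiff 𝒜 M k ≫ resAug 𝒜 M (k + 1) = 0 := by
  by_cases hk : k = -1
  · subst hk
    rw [resDiff, Category.assoc]
    exact (congrArg (_ ≫ ·) (resConn_ε 𝒜 M (-1))).trans comp_zero
  · rw [resAug_of_ne 𝒜 M (by omega), comp_zero]

lemma resX_pos {k : ℤ} (hk : 0 < k) (M : GrMod 𝒜) (j : ℤ) : Subsingleton ((resX 𝒜 M k).V j) := by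
  refine subsingleton_of_forall_eq 0 fun z => (stdSplit (𝟭 _) _).eq_zero fun l => ?_
  have := ind_subsingleton 𝒜 (k := l) (j := j) (trivObj 𝒜 ((resW 𝒜 k).obj M))
    (Or.inr (resW_pos 𝒜 hk M (-l)))
  exact Subsingleton.elim (α := (ind 𝒜 l (trivObj 𝒜 ((resW 𝒜 k).obj M))).V j) _ _

/-- The term in degree `k = -s` is built on the `s`-th syzygy, whose lowest degree has risen by `s`.
-/
lemma resX_subsingleton [NonnegGraded 𝒜] {M : GrMod 𝒜} {m : ℤ}
    (hM : ∀ j < m, Subsingleton (M.V j)) (k : ℤ) : ∀ j < m - k, Subsingleton ((resX 𝒜 M k).V j) :=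
  std_subsingleton (resW_subsingleton 𝒜 hM k)

variable {𝒜} in
lemma subsingleton_map (F : GrMod 𝒜 ⥤ GrMod 𝒮) [F.Additive] {M : GrMod 𝒜}
    (hM : ∀ j, Subsingleton (M.V j)) (j : ℤ) : Subsingleton ((F.obj M).V j) := by
  have h : 𝟙 M = 0 := GrMod.hom_ext fun j => LinearMap.ext fun x => (hM j).elim _ _
  refine subsingleton_of_forall_eq 0 fun z => ?_
  have := congrArg (fun t => app t j z) (F.map_id M)
  rw [h, F.map_zero] at this
  exact this.symm

/-- The functor `F` sends the augmented resolution of `M` to an exact sequence. -/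
def ResExact (F : GrMod 𝒜 ⥤ GrMod 𝒮) (M : GrMod 𝒜) : Prop :=
  ∀ k ≤ 0, ExactOn F ((resW 𝒜 k).obj M)

lemma resExact_id (M : GrMod 𝒜) : ResExact 𝒜 (𝟭 _) M := fun _ _ => exactOn_id _

variable {𝒜} in
lemma IsGood.resExact {M : GrMod 𝒜} (hM : IsGood M) (F : GrMod 𝒜 ⥤ GrMod 𝒮) [F.Additive] :
    ResExact 𝒜 F M := fun _ hk => (hM.resW hk).exactOn F

variable {𝒜} in
lemma ResExact.surj {F : GrMod 𝒜 ⥤ GrMod 𝒮} {M : GrMod 𝒜} (h : ResExact 𝒜 F M) (j : ℤ) :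
    Function.Surjective (app (F.map (resAug 𝒜 M 0)) j) := (h 0 le_rfl).surj j

variable {𝒜} in
lemma ResExact.exact {F : GrMod 𝒜 ⥤ GrMod 𝒮} [F.Additive] {M : GrMod 𝒜} (h : ResExact 𝒜 F M)
    (k j : ℤ) (x : (F.obj (resX 𝒜 M (k + 1))).V j)
    (hx : app (F.map (resDiff 𝒜 M (k + 1))) j x = 0)
    (hx' : app (F.map (resAug 𝒜 M (k + 1))) j x = 0) :
    ∃ w, app (F.map (resDiff 𝒜 M k)) j w = x := by
  by_cases hk : 0 ≤ k
  · have := subsingleton_map F (resX_pos 𝒜 (by omega : 0 < k + 1) M) j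
    exact ⟨0, Subsingleton.elim _ _⟩
  -- In degrees `k + 1 < 0` the syzygy embeds in the next term, so `d x = 0` forces `ε x = 0`. In
  -- degree `k + 1 = 0` the projection is the augmentation, which kills `x` by assumption.
  · have hε : app (F.map (resε 𝒜 M (k + 1))) j x = 0 := by
      by_cases h1 : k + 1 < 0
      · refine resConn_injective F M h1 (h _ (by omega)) j ?_
        rw [map_zero, ← app_comp_apply, ← F.map_comp]
        exact hx
      · obtain rfl : k = -1 := by omega
        exact hx'
    obtain ⟨y, hy⟩ := resConn_exact F M (by omega) (h _ (by omega)) j x hε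
    obtain ⟨w, hw⟩ : ∃ w, app (F.map (resε 𝒜 M k)) j w = y := (h k (by omega)).surj j y
    refine ⟨w, ?_⟩
    rw [resDiff, F.map_comp, app_comp_apply, hw, hy]

end Resolution

/-! ### The total resolution of a complex in `Com^↓`. -/

section TotalResolution

variable {A : Type u} [Ring A] [Algebra ℂ A] {𝒜 : ℤ → Submodule ℂ A}
  [GradedAlgebra 𝒜] [FiniteDimensional ℂ A] [NonnegGraded 𝒜]

attribute [local irreducible] std stdMap stdε resX resMap resDiff resAug

lemma resX_subsingleton_of_forall {M : GrMod 𝒜} (hM : ∀ j, Subsingleton (M.V j)) (k j : ℤ) :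
    Subsingleton ((resX 𝒜 M k).V j) :=
  resX_subsingleton 𝒜 (m := j + k + 1) (fun j _ => hM j) k j (by omega)

/-- `Xⁱ` vanishes below `-N - i` and the term `k` of its resolution below `-N - i - k`. The total
resolution therefore satisfies the same bound `N` as `X`. -/
lemma resX_component {X : CochainComplex (GrMod 𝒜) ℤ} {N : ℤ}
    (hN : ∀ i j : ℤ, N < i ∨ i + j < -N → Subsingleton ((X.X i).V j)) {i k j : ℤ}
    (h : 0 < k ∨ N < i ∨ i + k + j < -N) : Subsingleton ((resX 𝒜 (X.X i) k).V j) := by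
  rcases h with h | h | h
  · exact resX_pos 𝒜 h _ j
  · exact resX_subsingleton_of_forall (fun j => hN i j (Or.inl h)) k j
  · exact resX_subsingleton 𝒜 (m := -N - i) (fun j' hj' => hN i j' (Or.inr (by omega))) k j
      (by omega)

lemma resX_finite (X : ComDown 𝒜) (n j : ℤ) :
    {p : Pairs n | Nontrivial ((resX 𝒜 (X.obj.X p.1.1) p.1.2).V j)}.Finite := by
  obtain ⟨N, hN⟩ := X.property
  have hinj : Function.Injective fun p : Pairs n => p.1.1 := by
    rintro ⟨⟨a, b⟩, h⟩ ⟨⟨c, d⟩, h'⟩ (hp : a = c)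
    simp only at h h'
    obtain rfl : a = c := hp
    obtain rfl : b = d := by omega
    rfl
  -- A nonzero summand has `k = n - i ≤ 0` and `i ≤ N`, which leaves finitely many `i`.
  refine ((Set.finite_Icc n N).preimage hinj.injOn).subset fun p hp => ?_
  by_contra h
  have hp2 := p.2
  have : ¬ (n ≤ p.1.1 ∧ p.1.1 ≤ N) := h
  have := resX_component hN (i := p.1.1) (k := p.1.2) (j := j) (by omega)
  exact not_nontrivial_iff_subsingleton.2 this hp

/-- The term of degree `n` of the total resolution of a complex. -/
def rX (X : ComDown 𝒜) (n : ℤ) : GrMod 𝒜 :=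
  dsum (fun p : Pairs n => resX 𝒜 (X.obj.X p.1.1) p.1.2) (resX_finite X n)

/-- The inclusion of the summand with index `(i, k)`. -/
def rInj (X : ComDown 𝒜) {n i k : ℤ} (h : i + k = n) : resX 𝒜 (X.obj.X i) k ⟶ rX X n :=
  inj (N := fun p : Pairs n => resX 𝒜 (X.obj.X p.1.1) p.1.2) ⟨(i, k), h⟩

/-- The projection to the summand with index `(i, k)`. -/
def rProj (X : ComDown 𝒜) {n i k : ℤ} (h : i + k = n) : rX X n ⟶ resX 𝒜 (X.obj.X i) k :=
  proj (N := fun p : Pairs n => resX 𝒜 (X.obj.X p.1.1) p.1.2) ⟨(i, k), h⟩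

/-- The morphism out of the total resolution with given components. -/
def rDesc (X : ComDown 𝒜) {n : ℤ} {P : GrMod 𝒜}
    (f : ∀ i k : ℤ, i + k = n → (resX 𝒜 (X.obj.X i) k ⟶ P)) : rX X n ⟶ P :=
  desc fun p : Pairs n => f p.1.1 p.1.2 p.2

lemma rInj_desc (X : ComDown 𝒜) {n i k : ℤ} {P : GrMod 𝒜}
    (f : ∀ i k : ℤ, i + k = n → (resX 𝒜 (X.obj.X i) k ⟶ P)) (h : i + k = n) :
    rInj X h ≫ rDesc X f = f i k h := inj_desc _ _

lemma r_ext {X : ComDown 𝒜} {n : ℤ} {P : GrMod 𝒜} {f g : rX X n ⟶ P}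
    (h : ∀ i k (hik : i + k = n), rInj X hik ≫ f = rInj X hik ≫ g) : f = g :=
  dsum_ext fun p => h p.1.1 p.1.2 p.2

lemma rInj_proj (X : ComDown 𝒜) {n i k : ℤ} (h : i + k = n) : rInj X h ≫ rProj X h = 𝟙 _ :=
  inj_proj_self _

lemma rInj_proj_ne (X : ComDown 𝒜) {n i k i' k' : ℤ} (h : i + k = n) (h' : i' + k' = n)
    (hk : k' ≠ k) : rInj X h ≫ rProj X h' = 0 :=
  inj_proj_ne fun e => hk (congrArg (fun p => p.1.2) e).symm

/-- The differential of the total resolution. -/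
def rD (X : ComDown 𝒜) (n m : ℤ) : rX X n ⟶ rX X m :=
  if h : n + 1 = m then
    rDesc X fun i k hik =>
      resMap 𝒜 (X.obj.d i (i + 1)) k ≫ rInj X (by omega : i + 1 + k = m) +
        i.negOnePow • (resDiff 𝒜 (X.obj.X i) k ≫ rInj X (by omega : i + (k + 1) = m))
  else 0

lemma rInj_D (X : ComDown 𝒜) {n m i k : ℤ} (h : n + 1 = m) (hik : i + k = n) :
    rInj X hik ≫ rD X n m =
      resMap 𝒜 (X.obj.d i (i + 1)) k ≫ rInj X (by omega : i + 1 + k = m) +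
        i.negOnePow • (resDiff 𝒜 (X.obj.X i) k ≫ rInj X (by omega : i + (k + 1) = m)) := by
  rw [rD, dif_pos h, rInj_desc]

lemma rD_of_ne (X : ComDown 𝒜) {n m : ℤ} (h : n + 1 ≠ m) : rD X n m = 0 := dif_neg h

lemma rD_comp (X : ComDown 𝒜) {n m l : ℤ} (h : n + 1 = m) (h' : m + 1 = l) :
    rD X n m ≫ rD X m l = 0 := by
  refine r_ext fun i k hik => ?_
  rw [← Category.assoc, rInj_D X h, Preadditive.add_comp, Linear.units_smul_comp, Category.assoc,
    Category.assoc, rInj_D X h', rInj_D X h', Preadditive.comp_add, Preadditive.comp_add,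
    Linear.comp_units_smul, Linear.comp_units_smul, ← Category.assoc, ← Category.assoc,
    ← Category.assoc, ← Category.assoc, ← resMap_comp, X.obj.d_comp_d, resMap_zero, resMap_diff,
    resDiff_comp, zero_comp, zero_comp, Int.negOnePow_succ, smul_zero, comp_zero]
  simp

/-- The morphism of total resolutions. -/
def rMap {X Y : ComDown 𝒜} (f : X ⟶ Y) (n : ℤ) : rX X n ⟶ rX Y n :=
  rDesc X fun _ k hik => resMap 𝒜 (f.hom.f _) k ≫ rInj Y hik

lemma rInj_map {X Y : ComDown 𝒜} (f : X ⟶ Y) {n i k : ℤ} (hik : i + k = n) :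
    rInj X hik ≫ rMap f n = resMap 𝒜 (f.hom.f i) k ≫ rInj Y hik := rInj_desc ..

lemma rMap_d {X Y : ComDown 𝒜} (f : X ⟶ Y) {n m : ℤ} (h : n + 1 = m) :
    rMap f n ≫ rD Y n m = rD X n m ≫ rMap f m := by
  refine r_ext fun i k hik => ?_
  rw [← Category.assoc, rInj_map, Category.assoc, rInj_D Y h, ← Category.assoc, rInj_D X h,
    Preadditive.add_comp, Preadditive.comp_add, Linear.units_smul_comp, Linear.comp_units_smul,
    Category.assoc, Category.assoc, rInj_map, rInj_map, ← Category.assoc, ← Category.assoc,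
    ← Category.assoc, ← Category.assoc, ← resMap_comp, ← resMap_comp, f.hom.comm, resMap_diff]

/-- The total resolution of a complex. -/
def rCom (X : ComDown 𝒜) : CochainComplex (GrMod 𝒜) ℤ where
  X := rX X
  d := rD X
  shape n m h := rD_of_ne X h
  d_comp_d' n m l h h' := rD_comp X h h'

lemma rX_subsingleton {X : ComDown 𝒜} {n j : ℤ}
    (h : ∀ i k, i + k = n → Subsingleton ((resX 𝒜 (X.obj.X i) k).V j)) :
    Subsingleton ((rX X n).V j) := by
  have : ∀ p : Pairs n, Subsingleton ((resX 𝒜 (X.obj.X p.1.1) p.1.2).V j) := fun p => h _ _ p.2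
  exact inferInstanceAs (Subsingleton (⨁ p : Pairs n, (resX 𝒜 (X.obj.X p.1.1) p.1.2).V j))

lemma rCom_isDown (X : ComDown 𝒜) : isDown 𝒜 (rCom X) := by
  obtain ⟨N, hN⟩ := X.property
  exact ⟨N, fun n j h => rX_subsingleton fun i k hik => resX_component hN (by omega)⟩

/-- The morphism of total resolutions of complexes. -/
def rComMap {X Y : ComDown 𝒜} (f : X ⟶ Y) : rCom X ⟶ rCom Y where
  f := rMap f
  comm' _ _ h := rMap_d f h

variable (𝒜) in
/-- The total resolution, as a functor. -/
def resolution : ComDown 𝒜 ⥤ ComDown 𝒜 where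
  obj X := ⟨rCom X, rCom_isDown X⟩
  map f := ObjectProperty.homMk (rComMap f)
  map_id X := ObjectProperty.hom_ext _ (HomologicalComplex.hom_ext _ _ fun n =>
    r_ext fun i k hik => (rInj_map (𝟙 X) hik).trans (by
      refine Eq.trans ?_ (Category.comp_id _).symm
      refine (congrArg (· ≫ _) (resMap_id 𝒜 _ _)).trans (Category.id_comp _)))
  map_comp {X Y Z} f g := ObjectProperty.hom_ext _ (HomologicalComplex.hom_ext _ _ fun n =>
    r_ext fun i k hik => (rInj_map (f ≫ g) hik).trans (by
      refine Eq.trans ?_ (Category.assoc (rInj X hik) (rMap f n) (rMap g n))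
      rw [rInj_map, Category.assoc, rInj_map, ← Category.assoc, ← resMap_comp]
      rfl))

/-- The identification of two terms of a complex with the same degree. -/
def termCast (X : CochainComplex (GrMod 𝒜) ℤ) (i n : ℤ) : X.X i ⟶ X.X n :=
  if h : i = n then (X.XIsoOfEq h).hom else 0

lemma termCast_self (X : CochainComplex (GrMod 𝒜) ℤ) (n : ℤ) : termCast X n n = 𝟙 _ := by
  rw [termCast, dif_pos rfl]; simp

lemma termCast_of_ne (X : CochainComplex (GrMod 𝒜) ℤ) {i n : ℤ} (h : i ≠ n) :
    termCast X i n = 0 := dif_neg h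

lemma termCast_d (X : CochainComplex (GrMod 𝒜) ℤ) {i n m : ℤ} (h : n + 1 = m) :
    termCast X i n ≫ X.d n m = X.d i (i + 1) ≫ termCast X (i + 1) m := by
  by_cases hi : i = n
  · subst hi
    subst h
    rw [termCast_self, termCast_self, Category.id_comp, Category.comp_id]
  · rw [termCast_of_ne X hi, termCast_of_ne X (by omega), zero_comp, comp_zero]

lemma termCast_naturality {X Y : CochainComplex (GrMod 𝒜) ℤ} (f : X ⟶ Y) (i n : ℤ) :
    termCast X i n ≫ f.f n = f.f i ≫ termCast Y i n := by
  by_cases hi : i = n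
  · subst hi
    rw [termCast_self, termCast_self, Category.id_comp, Category.comp_id]
  · rw [termCast_of_ne X hi, termCast_of_ne Y hi, zero_comp, comp_zero]

/-- The components of the augmentation of the total resolution. -/
def rAug (X : ComDown 𝒜) (n : ℤ) : rX X n ⟶ X.obj.X n :=
  rDesc X fun i k _ => resAug 𝒜 (X.obj.X i) k ≫ termCast X.obj i n

lemma rInj_aug (X : ComDown 𝒜) {n i k : ℤ} (hik : i + k = n) :
    rInj X hik ≫ rAug X n = resAug 𝒜 (X.obj.X i) k ≫ termCast X.obj i n := rInj_desc ..

lemma rAug_d (X : ComDown 𝒜) {n m : ℤ} (h : n + 1 = m) :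
    rAug X n ≫ X.obj.d n m = rD X n m ≫ rAug X m := by
  refine r_ext fun i k hik => ?_
  rw [← Category.assoc, rInj_aug, ← Category.assoc, rInj_D X h, Preadditive.add_comp,
    Linear.units_smul_comp, Category.assoc, Category.assoc, Category.assoc, rInj_aug, rInj_aug,
    ← Category.assoc (resMap _ _ _), resAug_naturality, ← Category.assoc (resDiff _ _ _),
    resDiff_aug, zero_comp, smul_zero, add_zero, termCast_d X.obj h, Category.assoc]

/-- The augmentation of the total resolution. -/
def resolutionAug : resolution 𝒜 ⟶ 𝟭 _ where
  app X := ObjectProperty.homMk { f := rAug X, comm' := fun _ _ h => rAug_d X h }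
  naturality X Y f := ObjectProperty.hom_ext _ (HomologicalComplex.hom_ext _ _ fun n =>
    r_ext fun i k hik => by
      change rInj X hik ≫ rMap f n ≫ rAug Y n = rInj X hik ≫ rAug X n ≫ f.hom.f n
      rw [← Category.assoc, rInj_map, Category.assoc, rInj_aug, ← Category.assoc,
        resAug_naturality, ← Category.assoc, rInj_aug, Category.assoc, Category.assoc,
        termCast_naturality])

end TotalResolution

/-! ### Exactness properties of the total resolution. -/

section ResolutionExact

variable {A : Type u} [Ring A] [Algebra ℂ A] {𝒜 : ℤ → Submodule ℂ A}
  [GradedAlgebra 𝒜] [FiniteDimensional ℂ A] [NonnegGraded 𝒜]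
  {S : Type u} [Ring S] [Algebra ℂ S] {𝒮 : ℤ → Submodule ℂ S}
  (F : GrMod 𝒜 ⥤ GrMod 𝒮)

attribute [local irreducible] std stdMap stdε resX resMap resDiff resAug

lemma map_comp₃ {M N P Q : GrMod 𝒜} (f : M ⟶ N) (g : N ⟶ P) (h : P ⟶ Q) :
    F.map f ≫ F.map g ≫ F.map h = F.map (f ≫ g ≫ h) := by
  rw [F.map_comp, F.map_comp]

lemma rInj_D_proj_lt (X : ComDown 𝒜) {n m i k i' k' : ℤ} (h : i + k = n) (h' : i' + k' = m)
    (hk : k' < k) : rInj X h ≫ rD X n m ≫ rProj X h' = 0 := by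
  by_cases hnm : n + 1 = m
  · rw [← Category.assoc, rInj_D X hnm, Preadditive.add_comp, Linear.units_smul_comp,
      Category.assoc, Category.assoc, rInj_proj_ne _ _ _ (by omega),
      rInj_proj_ne _ _ _ (by omega)]
    simp
  · rw [rD_of_ne X hnm, zero_comp, comp_zero]

/-- The differential lowers neither `i` nor `k`, so the total resolution can be filtered in two
ways. The filtration by `k` handles functoriality in `X`, and the one by `i` handles the
augmentation. -/
lemma rInj_D_proj_lt' (X : ComDown 𝒜) {n m i k i' k' : ℤ} (h : i + k = n) (h' : i' + k' = m)
    (hi : i' < i) : rInj X h ≫ rD X n m ≫ rProj X h' = 0 := by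
  by_cases hnm : n + 1 = m
  · rw [← Category.assoc, rInj_D X hnm, Preadditive.add_comp, Linear.units_smul_comp,
      Category.assoc, Category.assoc, rInj_proj_ne _ _ _ (by omega),
      rInj_proj_ne _ _ _ (by omega)]
    simp
  · rw [rD_of_ne X hnm, zero_comp, comp_zero]

lemma rInj_D_proj_self (X : ComDown 𝒜) {n m i k i' : ℤ} (hnm : n + 1 = m) (h : i + k = n)
    (h' : i' + k = m) : rInj X h ≫ rD X n m ≫ rProj X h' = resMap 𝒜 (X.obj.d i i') k := by
  obtain rfl : i' = i + 1 := by omega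
  rw [← Category.assoc, rInj_D X hnm, Preadditive.add_comp, Linear.units_smul_comp,
    Category.assoc, Category.assoc, rInj_proj, rInj_proj_ne _ _ _ (by omega)]
  simp

lemma rInj_D_proj_succ (X : ComDown 𝒜) {n m i k : ℤ} (hnm : n + 1 = m) (h : i + k = n)
    (h' : i + (k + 1) = m) :
    rInj X h ≫ rD X n m ≫ rProj X h' = i.negOnePow • resDiff 𝒜 (X.obj.X i) k := by
  rw [← Category.assoc, rInj_D X hnm, Preadditive.add_comp, Linear.units_smul_comp,
    Category.assoc, Category.assoc, rInj_proj, rInj_proj_ne _ _ _ (by omega)]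
  simp

lemma rInj_map_proj_ne {X Y : ComDown 𝒜} (f : X ⟶ Y) {n i k i' k' : ℤ} (h : i + k = n)
    (h' : i' + k' = n) (hk : k' ≠ k) : rInj X h ≫ rMap f n ≫ rProj Y h' = 0 := by
  rw [← Category.assoc, rInj_map, Category.assoc, rInj_proj_ne _ _ _ hk, comp_zero]

lemma rInj_map_proj_self {X Y : ComDown 𝒜} (f : X ⟶ Y) {n i k : ℤ} (h : i + k = n) :
    rInj X h ≫ rMap f n ≫ rProj Y h = resMap 𝒜 (f.hom.f i) k := by
  rw [← Category.assoc, rInj_map, Category.assoc, rInj_proj, Category.comp_id]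

variable [F.Additive] [F.Linear ℂ]

/-- The decomposition of the total resolution by the degree in the resolution. -/
def rSplitCol (X : ComDown 𝒜) (n : ℤ) :
    Splitting (F.obj (rX X n)) (fun k => F.obj (resX 𝒜 (X.obj.X (n - k)) k)) :=
  dsumSplit F (fun k => F.map (rInj X (sub_add_cancel n k)))
    (fun k => F.map (rProj X (sub_add_cancel n k)))
    (fun p => p.1.2) (by
      rintro ⟨⟨i, k⟩, h⟩ ⟨⟨i', k'⟩, h'⟩ (e : k = k')
      subst e
      obtain rfl : i = i' := by omega
      rfl) (by
      rintro ⟨⟨i, k⟩, h⟩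
      obtain rfl : i = n - k := by omega
      rfl) (fun k j z hz => hz ⟨(n - k, k), by omega⟩ rfl)

/-- The decomposition of the total resolution by the degree in the complex. -/
def rSplitRow (X : ComDown 𝒜) (n : ℤ) :
    Splitting (F.obj (rX X n)) (fun i => F.obj (resX 𝒜 (X.obj.X i) (n - i))) :=
  dsumSplit F (fun i => F.map (rInj X (add_sub_cancel i n)))
    (fun i => F.map (rProj X (add_sub_cancel i n)))
    (fun p => p.1.1) (by
      rintro ⟨⟨i, k⟩, h⟩ ⟨⟨i', k'⟩, h'⟩ (e : i = i')
      subst e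
      obtain rfl : k = k' := by omega
      rfl) (by
      rintro ⟨⟨i, k⟩, h⟩
      obtain rfl : k = n - i := by omega
      rfl) (fun i j z hz => hz ⟨(i, n - i), by omega⟩ rfl)

/-- A graded module as a sum with a single summand. -/
def singleSplit (M : GrMod 𝒮) (n : ℤ) : Splitting M (fun _ => M) where
  inc k := if k = n then 𝟙 M else 0
  pr k := if k = n then 𝟙 M else 0
  sum_eq j z := ⟨{n}, fun k hk => by rw [if_neg (by simpa using hk)]; rfl, by simp⟩

variable (𝒜) in
/-- The terms of degree `k` of the resolutions, as a functor. -/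
def resXF (k : ℤ) : GrMod 𝒜 ⥤ GrMod 𝒜 where
  obj M := resX 𝒜 M k
  map f := resMap 𝒜 f k
  map_id M := resMap_id 𝒜 M k
  map_comp f g := resMap_comp 𝒜 f g k

instance (k : ℤ) : (resXF 𝒜 k).Additive where
  map_add {_ _ f g} := resMap_add 𝒜 f g k

/-- Filtered by `k`, the diagonal part is the complex of the `k`-th terms of the resolutions of the
`Xⁱ`. It is obtained from `X` by a functor that is exact after `F`. The index is bounded above by
`0`. -/
theorem rComMap_coneAcyclic {Λ : Type*} [Fintype Λ] {e : Λ → A} (hA : IsBasic 𝒜 e)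
    (hF : ∀ k, PreservesExact (indF 𝒜 k ⋙ F)) {X Y : ComDown 𝒜} {f : X ⟶ Y}
    (hf : ConeAcyclic f.hom) :
    ConeAcyclic ((F.mapHomologicalComplex (ComplexShape.up ℤ)).map (rComMap f)) := by
  have hb : ∀ (X : ComDown 𝒜) (n j : ℤ), ∃ b : ℤ, ∀ k, b < k → ∀ z : (F.obj (rX X n)).V j,
      app ((rSplitCol F X n).pr k) j z = 0 := fun X n j => ⟨0, fun k hk z => by
    have := subsingleton_map F (resX_pos 𝒜 hk (X.obj.X (n - k))) j
    exact Subsingleton.elim _ _⟩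
  have hD : ∀ (X : ComDown 𝒜) (n m k k' : ℤ), k' < k → (rSplitCol F X n).inc k ≫
      F.map (rD X n m) ≫ (rSplitCol F X m).pr k' = 0 := fun X n m k k' h =>
    (map_comp₃ F _ _ _).trans ((congrArg F.map (rInj_D_proj_lt X _ _ h)).trans (F.map_zero _ _))
  have eD : ∀ (X : ComDown 𝒜) {n m k : ℤ}, n + 1 = m → (rSplitCol F X n).inc k ≫
      F.map (rD X n m) ≫ (rSplitCol F X m).pr k =
        F.map (resMap 𝒜 (X.obj.d (n - k) (m - k)) k) := fun X n m k h =>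
    (map_comp₃ F _ _ _).trans (congrArg F.map (rInj_D_proj_self X h _ _))
  have ef : ∀ n k : ℤ, (rSplitCol F X n).inc k ≫ F.map (rMap f n) ≫ (rSplitCol F Y n).pr k =
      F.map (resMap 𝒜 (f.hom.f (n - k)) k) := fun n k =>
    (map_comp₃ F _ _ _).trans (congrArg F.map (rInj_map_proj_self f _))
  refine ConeAcyclic.of_triangular
    (K := (F.mapHomologicalComplex (ComplexShape.up ℤ)).obj (rCom X))
    (L := (F.mapHomologicalComplex (ComplexShape.up ℤ)).obj (rCom Y))
    (rSplitCol F X) (rSplitCol F Y) (hD X) (hD Y) (fun n k k' h => (map_comp₃ F _ _ _).trans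
      ((congrArg F.map (rInj_map_proj_ne f _ _ h.ne)).trans (F.map_zero _ _))) (hb X) (hb Y) ?_
  intro j l n m r hl hm hr k x y hx hy
  obtain ⟨x', y', h1, h2⟩ := hf.map (resXF 𝒜 k ⋙ F)
    (fun _ _ _ f g => resMap_exact 𝒜 F hA hF k f g) j (l - k) (n - k)
    (m - k) (r - k) (by omega) (by omega) (by omega) (app ((rSplitCol F X m).pr k) j x)
    (app ((rSplitCol F Y n).pr k) j y)
    ((congrArg (fun t => app t j _) (eD X hr)).symm.trans hx)
    ((congrArg (fun t => app t j _) (ef m k)).symm.trans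
      (hy.trans (congrArg (fun t => app t j _) (eD Y hm))))
  exact ⟨x', y', (congrArg (fun t => app t j _) (eD X hm)).trans h1,
    (congrArg (fun t => app t j _) (ef n k)).trans
      (h2.trans (congrArg (fun t => _ + app t j y') (eD Y hl)).symm)⟩

lemma app_map_units_smul {M N : GrMod 𝒜} (f : M ⟶ N) (u : ℤˣ) (j : ℤ) (x : (F.obj M).V j) :
    app (F.map (u • f)) j x = u • app (F.map f) j x := by
  rcases Int.units_eq_one_or u with rfl | rfl
  · simp
  · simp

/-- In a fixed row `i` the differential is that of the resolution of `Xⁱ` up to the sign `(-1)ⁱ`,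
which does not affect exactness. -/
lemma row_exact {X : ComDown 𝒜} {n m r i k₁ k₂ k₃ : ℤ} (hm : n + 1 = m) (hr : m + 1 = r)
    (h : ResExact 𝒜 F (X.obj.X i)) (h₁ : i + k₁ = n) (h₂ : i + k₂ = m) (h₃ : i + k₃ = r)
    {j : ℤ} (x : (F.obj (resX 𝒜 (X.obj.X i) k₂)).V j)
    (hx : app (F.map (rInj X h₂ ≫ rD X m r ≫ rProj X h₃)) j x = 0)
    (hx' : app (F.map (resAug 𝒜 (X.obj.X i) k₂)) j x = 0) :
    ∃ w, app (F.map (rInj X h₁ ≫ rD X n m ≫ rProj X h₂)) j w = x := by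
  obtain rfl : k₂ = k₁ + 1 := by omega
  obtain rfl : k₃ = k₁ + 1 + 1 := by omega
  rw [rInj_D_proj_succ X hr, app_map_units_smul, smul_eq_zero_iff_eq] at hx
  obtain ⟨w, hw⟩ := h.exact k₁ j x hx hx'
  refine ⟨i.negOnePow • w, ?_⟩
  rw [rInj_D_proj_succ X hm, app_map_units_smul]
  refine Eq.trans ?_ hw
  rcases Int.units_eq_one_or i.negOnePow with h | h <;> rw [h] <;> simp

lemma ResExact.surj_of_eq {M : GrMod 𝒜} (h : ResExact 𝒜 F M) {k : ℤ} (hk : k = 0) (j : ℤ) :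
    Function.Surjective (app (F.map (resAug 𝒜 M k)) j) := by
  subst hk
  exact h.surj j

/-- Filtered by `i`, the target is concentrated in index `n` in degree `n`, so its differential
strictly raises the index. The diagonal part of the cone is the augmented resolution of `Xⁱ`, whose
exactness after `F` is the hypothesis. The index is bounded above because `X` is. -/
theorem resolutionAug_coneAcyclic {X : ComDown 𝒜} (hX : ∀ i, ResExact 𝒜 F (X.obj.X i)) :
    ConeAcyclic ((F.mapHomologicalComplex (ComplexShape.up ℤ)).map (resolutionAug.app X).hom) := by
  obtain ⟨N, hN⟩ := X.property
  let τ (n : ℤ) := singleSplit (F.obj (X.obj.X n)) n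
  have eD : ∀ {n m i : ℤ}, n + 1 = m → (rSplitRow F X n).inc i ≫ F.map (rD X n m) ≫
      (rSplitRow F X m).pr i = F.map (rInj X (add_sub_cancel i n) ≫ rD X n m ≫
        rProj X (add_sub_cancel i m)) := fun h => map_comp₃ F _ _ _
  have ef : ∀ n i, (rSplitRow F X n).inc i ≫ F.map (rAug X n) =
      F.map (resAug 𝒜 (X.obj.X i) (n - i) ≫ termCast X.obj i n) := fun n i =>
    (F.map_comp _ _).symm.trans (congrArg F.map (rInj_aug X _))
  have ef_ne : ∀ n i k, i ≠ k → (rSplitRow F X n).inc i ≫ F.map (rAug X n) ≫ (τ n).pr k = 0 := by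
    intro n i k hik
    rw [← Category.assoc, ef]
    by_cases hk : k = n
    · rw [termCast_of_ne _ (by omega), comp_zero, F.map_zero, zero_comp]
    · exact (congrArg (_ ≫ ·) (if_neg hk)).trans comp_zero
  have ef_self : ∀ n, (rSplitRow F X n).inc n ≫ F.map (rAug X n) ≫ (τ n).pr n =
      F.map (resAug 𝒜 (X.obj.X n) (n - n)) := by
    intro n
    rw [← Category.assoc, ef, termCast_self, Category.comp_id]
    exact (congrArg (_ ≫ ·) (if_pos rfl)).trans (Category.comp_id _)
  have hL : ∀ n m k k', (k = n → k' = m → n + 1 ≠ m) →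
      (τ n).inc k ≫ F.map (X.obj.d n m) ≫ (τ m).pr k' = 0 := by
    intro n m k k' h
    by_cases hk : k = n
    · by_cases hk' : k' = m
      · rw [X.obj.shape n m (h hk hk'), F.map_zero, zero_comp, comp_zero]
      · rw [show (τ m).pr k' = 0 from if_neg hk', comp_zero, comp_zero]
    · rw [show (τ n).inc k = 0 from if_neg hk, zero_comp]
  refine ConeAcyclic.of_triangular
    (K := (F.mapHomologicalComplex (ComplexShape.up ℤ)).obj (rCom X))
    (L := (F.mapHomologicalComplex (ComplexShape.up ℤ)).obj X.obj)
    (rSplitRow F X) τ (fun n m k k' h => (map_comp₃ F _ _ _).trans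
      ((congrArg F.map (rInj_D_proj_lt' X _ _ h)).trans (F.map_zero _ _)))
    (fun n m k k' h => hL n m k k' (by omega)) (fun n k k' h => ef_ne n k k' h.ne')
    (fun n j => ⟨N, fun i hi z => by
      have := subsingleton_map F (resX_subsingleton_of_forall (fun j => hN i j (Or.inl hi))
        (n - i)) j
      exact Subsingleton.elim _ _⟩)
    (fun n j => ⟨n, fun k hk z => congrArg (fun t => app t j z) (if_neg hk.ne')⟩) ?_
  intro j l n m r hl hm hr i x y hx hy
  -- In the row `i = m` this is the cocycle condition, as the differential of the target has no
  -- diagonal part. In all other rows the augmentation is zero.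
  have hy0 : app (F.map (resAug 𝒜 (X.obj.X i) (m - i))) j (app ((rSplitRow F X m).pr i) j x) = 0 := by
    by_cases hi : i = m
    · subst hi
      refine (congrArg (fun t => app t j _) (ef_self i)).symm.trans (hy.trans ?_)
      exact congrArg (fun t => app t j _) (hL n i i i (by omega))
    · rw [resAug_of_ne 𝒜 _ (by omega), F.map_zero]
      rfl
  by_cases hi : i = n
  -- At the augmented end of the row, `y` is hit by surjectivity of the augmentation, while the
  -- component of `x` lies in the zero term of degree `1` of the resolution.
  · subst hi
    obtain ⟨x', hx'⟩ := (hX i).surj_of_eq F (sub_self i) j (app ((τ i).pr i) j y)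
    refine ⟨x', 0, ?_, ?_⟩
    · have := subsingleton_map F (resX_pos 𝒜 (by omega : 0 < m - i) (X.obj.X i)) j
      exact Subsingleton.elim (α := (F.obj (resX 𝒜 (X.obj.X i) (m - i))).V j) _ _
    · rw [map_zero, add_zero]
      exact (congrArg (fun t => app t j x') (ef_self i)).trans hx'
  · obtain ⟨x', hx'⟩ := row_exact F hm hr (hX i) (add_sub_cancel i n) (add_sub_cancel i m)
      (add_sub_cancel i r) (app ((rSplitRow F X m).pr i) j x)
      ((congrArg (fun t => app t j _) (eD hr)).symm.trans hx) hy0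
    refine ⟨x', 0, (congrArg (fun t => app t j _) (eD hm)).trans hx', ?_⟩
    rw [map_zero, add_zero]
    have e : (τ n).pr i = 0 := if_neg hi
    refine Eq.trans ?_ (congrArg (fun t => app t j y) e).symm
    have e2 : (rSplitRow F X n).inc i ≫ F.map (rAug X n) ≫ (τ n).pr i = 0 := by
      rw [e, comp_zero, comp_zero]
    exact congrArg (fun t => app t j x') e2

end ResolutionExact

/-! ### Left derived functors from functorial acyclic resolutions. -/

section DeformationDerived

variable {C D E : Type*} [Category C] [Category D] [Category E]

/-- A functor has a left derived functor when there is a functorial resolution by objects that are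
acyclic for it. -/
theorem isLeftDerivedFunctor_of_resolution (W : MorphismProperty C) (Q : C ⥤ D)
    [Q.IsLocalization W] {G : C ⥤ E} {P : C ⥤ C} (ε : P ⟶ 𝟭 C) (hε : ∀ X, W (ε.app X))
    (hG : ∀ X, IsIso (G.map (ε.app (P.obj X)))) {LG : D ⥤ E} (i : Q ⋙ LG ≅ P ⋙ G)
    {α : Q ⋙ LG ⟶ G} (hα : ∀ X, α.app X = i.hom.app X ≫ G.map (ε.app X)) :
    LG.IsLeftDerivedFunctor α W := by
  have hQ : ∀ X, IsIso (Q.map (ε.app X)) := fun X => Localization.inverts Q W _ (hε X)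
  have hαi : ∀ X, IsIso (α.app (P.obj X)) := fun X => by
    rw [hα]
    infer_instance
  refine ⟨⟨⟨IsTerminal.ofUniqueHom (fun Y => ?_) fun Y m => ?_⟩⟩⟩
  · let β : Q ⋙ Y.left ⟶ G := Y.hom
    letI : Localization.Lifting Q W (Q ⋙ Y.left) Y.left := ⟨Iso.refl _⟩
    letI : Localization.Lifting Q W (P ⋙ G) LG := ⟨i⟩
    -- `Y.left` inverts the image of `ε`, so the competing transformation can be evaluated at the
    -- resolution of `X`. The result descends to the localization.
    let τ : Q ⋙ Y.left ⟶ P ⋙ G :=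
      { app := fun X => inv (Y.left.map (Q.map (ε.app X))) ≫ β.app (P.obj X)
        naturality := fun X X' f => by
          rw [← cancel_epi (Y.left.map (Q.map (ε.app X)))]
          have h1 := congrArg (fun t => Y.left.map (Q.map t)) (ε.naturality f)
          have h2 := β.naturality (P.map f)
          simp only [Functor.map_comp, Functor.id_map, Functor.comp_map] at h1 h2 ⊢
          rw [← Category.assoc, ← h1, Category.assoc, IsIso.hom_inv_id_assoc,
            Category.assoc, IsIso.hom_inv_id_assoc, h2] }
    refine CostructuredArrow.homMk (Localization.liftNatTrans Q W _ (P ⋙ G) Y.left LG τ) ?_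
    ext X
    change (Localization.liftNatTrans Q W _ (P ⋙ G) Y.left LG τ).app (Q.obj X) ≫ α.app X = β.app X
    rw [Localization.liftNatTrans_app, hα]
    change (𝟙 (Y.left.obj (Q.obj X)) ≫ τ.app X ≫ i.inv.app X) ≫ i.hom.app X ≫ G.map (ε.app X) =
      β.app X
    rw [Category.id_comp, Category.assoc, Iso.inv_hom_id_app_assoc, Category.assoc,
      IsIso.inv_comp_eq]
    exact (β.naturality (ε.app X)).symm
  -- On a resolution `P.obj X` the map `α` is invertible and determines `m`. Every object is
  -- isomorphic to its resolution in the localization, so `m` is determined everywhere by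
  -- naturality.
  · have key : ∀ (H : D ⥤ E) (m m' : H ⟶ LG), Functor.whiskerLeft Q m ≫ α =
        Functor.whiskerLeft Q m' ≫ α → m = m' := by
      intro H m m' hm
      refine Localization.natTrans_ext Q W fun X => ?_
      have h0 : m.app (Q.obj (P.obj X)) = m'.app (Q.obj (P.obj X)) := by
        have := hαi X
        exact (cancel_mono (α.app (P.obj X))).1 (congrArg (fun t => t.app (P.obj X)) hm)
      have hm1 := m.naturality (Q.map (ε.app X))
      have hm2 := m'.naturality (Q.map (ε.app X))
      rw [h0, ← hm2] at hm1
      exact (cancel_epi (H.map (Q.map (ε.app X)))).1 hm1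
    ext1
    exact key Y.left m.left _
      ((CostructuredArrow.w m).trans (CostructuredArrow.w _).symm)

end DeformationDerived

/-! ### The left derived functor and its value on the image of quadratic duality. -/

section LeftDerived

variable {B : Type u} [Ring B] [Algebra ℂ B] {ℬ : ℤ → Submodule ℂ B}
  [GradedAlgebra ℬ] [FiniteDimensional ℂ B] [NonnegGraded ℬ]
  {A : Type u} [Ring A] [Algebra ℂ A] {𝒜 : ℤ → Submodule ℂ A}
  (F : GrMod ℬ ⥤ GrMod 𝒜) [F.Additive] [F.Linear ℂ] (hF : PreservesDown F)

attribute [local irreducible] std stdMap stdε resX resMap resDiff resAug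

lemma resolution_inverts {Λ : Type*} [Fintype Λ] {e : Λ → B} (hB : IsBasic ℬ e)
    (hF' : ∀ k, PreservesExact (indF ℬ k ⋙ F)) :
    (qisDown ℬ).IsInvertedBy (resolution ℬ ⋙ comDownMap F hF ⋙ QDown 𝒜) := fun _ _ f hf =>
  Localization.inverts (QDown 𝒜) (qisDown 𝒜) ((comDownMap F hF).map ((resolution ℬ).map f))
    ((qis_iff _).2 (rComMap_coneAcyclic F hB hF' ((qis_iff _).1 hf)))

lemma resolutionAug_qis (X : ComDown ℬ) : qisDown ℬ ((resolutionAug (𝒜 := ℬ)).app X) :=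
  (qis_iff _).2 (resolutionAug_coneAcyclic (𝟭 (GrMod ℬ)) fun i => resExact_id ℬ (X.obj.X i))

/-- The terms are acyclic for `F`, so applying `F` to the augmentation still gives a
quasi-isomorphism. This is used both for resolutions and for complexes in the image of quadratic
duality. -/
lemma isIso_map_resolutionAug {X : ComDown ℬ} (hX : ∀ i, IsGood (X.obj.X i)) :
    IsIso ((comDownMap F hF ⋙ QDown 𝒜).map ((resolutionAug (𝒜 := ℬ)).app X)) :=
  Localization.inverts (QDown 𝒜) (qisDown 𝒜) ((comDownMap F hF).map (resolutionAug.app X))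
    ((qis_iff _).2 (resolutionAug_coneAcyclic F fun i => (hX i).resExact F))

lemma resolution_isGood (X : ComDown ℬ) (n : ℤ) : IsGood (((resolution ℬ).obj X).obj.X n) :=
  isGood_dsum (hN := resX_finite X n) fun p => by
    unfold resX
    exact isGood_std _

/-- The terms are direct sums of modules `B ⊗_{B₀} N_k`, so on these complexes the derived functor
needs no resolution. -/
lemma koszulUpDown_isGood (X : ComUp (QDual.gr ℬ)) (n : ℤ) :
    IsGood (((koszulUpDown ℬ).obj X).obj.X n) :=
  isGood_dsum (hN := ind_finite ℬ X.obj.X n) fun p => isGood_ind p.1.2 (X.obj.X p.1.1)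

/-- The left derived functor. -/
def leftD (h : (qisDown ℬ).IsInvertedBy (resolution ℬ ⋙ comDownMap F hF ⋙ QDown 𝒜)) :
    DDown ℬ ⥤ DDown 𝒜 :=
  Localization.lift (resolution ℬ ⋙ comDownMap F hF ⋙ QDown 𝒜) h (QDown ℬ)

variable (h : (qisDown ℬ).IsInvertedBy (resolution ℬ ⋙ comDownMap F hF ⋙ QDown 𝒜))

/-- The morphism from the left derived functor to the functor. -/
def leftDCounit : QDown ℬ ⋙ leftD F hF h ⟶ comDownMap F hF ⋙ QDown 𝒜 :=
  (Localization.fac (resolution ℬ ⋙ comDownMap F hF ⋙ QDown 𝒜) h (QDown ℬ)).hom ≫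
    Functor.whiskerRight resolutionAug (comDownMap F hF ⋙ QDown 𝒜)

lemma leftD_isLeftDerived : IsLeftDerived F hF (leftD F hF h) :=
  ⟨leftDCounit F hF h, isLeftDerivedFunctor_of_resolution (qisDown ℬ) (QDown ℬ)
    (G := comDownMap F hF ⋙ QDown 𝒜) resolutionAug resolutionAug_qis
    (fun X => isIso_map_resolutionAug F hF (resolution_isGood X)) (Localization.fac _ h (QDown ℬ))
    fun _ => rfl⟩

/-- The left derived functor of `F` is given by `F` on the image of quadratic duality. -/
def leftDKoszulIso : koszulUpDown ℬ ⋙ QDown ℬ ⋙ leftD F hF h ≅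
    koszulUpDown ℬ ⋙ comDownMap F hF ⋙ QDown 𝒜 :=
  Functor.isoWhiskerLeft (koszulUpDown ℬ)
      (Localization.fac (resolution ℬ ⋙ comDownMap F hF ⋙ QDown 𝒜) h (QDown ℬ)) ≪≫
    have := fun X => isIso_map_resolutionAug F hF (koszulUpDown_isGood X)
    have : ∀ X, IsIso ((Functor.whiskerLeft (koszulUpDown ℬ)
      (Functor.whiskerRight resolutionAug (comDownMap F hF ⋙ QDown 𝒜))).app X) := this
    have := NatIso.isIso_of_isIso_app (Functor.whiskerLeft (koszulUpDown ℬ)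
      (Functor.whiskerRight resolutionAug (comDownMap F hF ⋙ QDown 𝒜)))
    asIso (Functor.whiskerLeft (koszulUpDown ℬ)
      (Functor.whiskerRight resolutionAug (comDownMap F hF ⋙ QDown 𝒜)))

end LeftDerived

/-! ### Inverting `ψ` in the degrees where it is bijective. -/

section CornerSymm

variable {A : Type u} [Ring A] [Algebra ℂ A] {𝒜 : ℤ → Submodule ℂ A}
  {B : Type u} [Ring B] [Algebra ℂ B] {ℬ : ℤ → Submodule ℂ B}
  {s : A} {he : IsIdempotentElem s} {ψ : B →ₐ[ℂ] he.Corner}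
  (hψ : ∀ n, ∀ b ∈ ℬ n, ψ b ∈ cornerGr he 𝒜 n)

/-- The inverse of `ψ` in a degree where it is bijective. -/
def cornerSymm {n : ℤ} (hn : Set.BijOn ψ (ℬ n) (cornerGr he 𝒜 n)) : cornerGr he 𝒜 n ≃ₗ[ℂ] ℬ n :=
  (LinearEquiv.ofBijective (ψ.toLinearMap.restrict (hψ n)) (by
    refine ⟨fun x y hxy => Subtype.ext (hn.injOn x.2 y.2 (congrArg Subtype.val hxy)), fun y => ?_⟩
    obtain ⟨b, hb, hby⟩ := hn.surjOn y.2
    exact ⟨⟨b, hb⟩, Subtype.ext hby⟩)).symm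

lemma ψ_cornerSymm {n : ℤ} (hn : Set.BijOn ψ (ℬ n) (cornerGr he 𝒜 n)) (x : cornerGr he 𝒜 n) :
    ψ (cornerSymm hψ hn x) = x :=
  congrArg Subtype.val ((cornerSymm hψ hn).symm_apply_apply x)

lemma cornerSymm_ψ {n : ℤ} (hn : Set.BijOn ψ (ℬ n) (cornerGr he 𝒜 n)) (x : ℬ n) :
    cornerSymm hψ hn (ψ.toLinearMap.restrict (hψ n) x) = x :=
  (cornerSymm hψ hn).apply_symm_apply x

end CornerSymm

/-! ### The corner datum of a homomorphism `B → e_L A e_L`. -/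

section CornerHom

variable {A : Type u} [Ring A] [Algebra ℂ A] [FiniteDimensional ℂ A]
  {𝒜 : ℤ → Submodule ℂ A} [GradedAlgebra 𝒜]
  {Λ : Type*} [Fintype Λ] {e : Λ → A} {hA : IsBasic 𝒜 e} {L : Finset Λ}
  {B : Type u} [Ring B] [Algebra ℂ B] {ℬ : ℤ → Submodule ℂ B} [GradedAlgebra ℬ]

lemma IsBasic.e_corner (hA : IsBasic 𝒜 e) (l : L) :
    (∑ m ∈ L, e m) * e l * (∑ m ∈ L, e m) = e l := by
  rw [CornerDatum.eL_mul_e hA, CornerDatum.e_mul_eL hA]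

/-- The element `e_l` of the corner. -/
def cornerE (hA : IsBasic 𝒜 e) (l : L) : (hA.isIdempotentElem L).Corner :=
  ⟨e l, ⟨e l, hA.e_corner l⟩⟩

lemma corner_ext {s : A} {he : IsIdempotentElem s} {x y : he.Corner}
    (h : cornerVal he x = cornerVal he y) : x = y := Subtype.ext h

/-- A homomorphism of graded algebras to a corner that is bijective in degrees `0` and `1`, and
bijective on the quadratic relations. -/
structure IsQuadraticCornerHom (ℬ : ℤ → Submodule ℂ B) [GradedAlgebra ℬ] (hA : IsBasic 𝒜 e)
    (ψ : B →ₐ[ℂ] (hA.isIdempotentElem L).Corner)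
    (hψ : ∀ n, ∀ b ∈ ℬ n, ψ b ∈ cornerGr (hA.isIdempotentElem L) 𝒜 n) : Prop where
  bij₀ : Set.BijOn ψ (ℬ 0) (cornerGr (hA.isIdempotentElem L) 𝒜 0)
  bij₁ : Set.BijOn ψ (ℬ 1) (cornerGr (hA.isIdempotentElem L) 𝒜 1)
  rel : haveI := corner_gradedMonoid (hA.isIdempotentElem L) 𝒜 (hA.sum_mem L)
    Set.BijOn (Deg2.map ℬ (cornerGr (hA.isIdempotentElem L) 𝒜) ψ hψ) (LinearMap.ker (Deg2.mul ℬ))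
      (LinearMap.ker (Deg2.mul (cornerGr (hA.isIdempotentElem L) 𝒜)))

namespace IsQuadraticCornerHom

variable {ψ : B →ₐ[ℂ] (hA.isIdempotentElem L).Corner}
  {hψ : ∀ n, ∀ b ∈ ℬ n, ψ b ∈ cornerGr (hA.isIdempotentElem L) 𝒜 n}
  (h : IsQuadraticCornerHom ℬ hA ψ hψ)

lemma exists_e (h : IsQuadraticCornerHom ℬ hA ψ hψ) (l : L) : ∃ b ∈ ℬ 0, ψ b = cornerE hA l :=
  h.bij₀.surjOn (show cornerVal _ (cornerE hA l) ∈ 𝒜 0 from hA.mem l)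

/-- The idempotents of `B`. -/
def idem (l : L) : B := (h.exists_e l).choose

lemma idem_mem (l : L) : h.idem l ∈ ℬ 0 := (h.exists_e l).choose_spec.1

lemma map_idem (l : L) : ψ (h.idem l) = cornerE hA l := (h.exists_e l).choose_spec.2

lemma cornerVal_map_idem (l : L) : cornerVal _ (ψ (h.idem l)) = e l :=
  congrArg (cornerVal _) (h.map_idem l)

lemma eq_of_cornerVal (h : IsQuadraticCornerHom ℬ hA ψ hψ) {b c : B} (hb : b ∈ ℬ 0) (hc : c ∈ ℬ 0)
    (hbc : cornerVal _ (ψ b) = cornerVal _ (ψ c)) : b = c :=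
  h.bij₀.injOn hb hc (corner_ext hbc)

lemma isBasic : IsBasic ℬ h.idem where
  idem :=
    { idem := fun l => h.eq_of_cornerVal
        (by simpa using SetLike.mul_mem_graded (h.idem_mem l) (h.idem_mem l)) (h.idem_mem l) (by
          rw [map_mul, cornerVal_mul, cornerVal_map_idem, hA.e_mul_self])
      ortho := fun l m hlm => h.eq_of_cornerVal
        (by simpa using SetLike.mul_mem_graded (h.idem_mem l) (h.idem_mem m)) (zero_mem _) (by
          rw [map_mul, cornerVal_mul, cornerVal_map_idem, cornerVal_map_idem, map_zero, map_zero,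
            hA.e_mul_ne fun h => hlm (Subtype.ext h)])
      complete := h.eq_of_cornerVal (Submodule.sum_mem _ fun l _ => h.idem_mem l)
        SetLike.GradedOne.one_mem (by
          rw [map_sum, map_sum, map_one, cornerVal_one, Finset.sum_congr rfl fun l _ =>
            h.cornerVal_map_idem l]
          exact Finset.sum_coe_sort L e) }
  ne_zero l h0 := hA.ne_zero l (by
    rw [← h.cornerVal_map_idem, h0, map_zero, map_zero])
  span := by
    refine le_antisymm (Submodule.span_le.2 ?_) fun b hb => ?_
    · rintro _ ⟨l, rfl⟩
      exact h.idem_mem l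
    · have hb' : cornerVal _ (ψ b) ∈ 𝒜 0 := hψ 0 b hb
      have e1 : b = ∑ l : L, hA.coef (l : Λ) ⟨_, hb'⟩ • h.idem l := by
        refine h.eq_of_cornerVal hb
          (Submodule.sum_mem _ fun l _ => Submodule.smul_mem _ _ (h.idem_mem l)) ?_
        simp only [map_sum, map_smul, h.cornerVal_map_idem]
        refine (cornerVal_mul_right _ (ψ b)).symm.trans ?_
        rw [Finset.mul_sum, ← Finset.sum_coe_sort]
        exact Finset.sum_congr rfl fun l _ => hA.mul_e ⟨_, hb'⟩ l
      rw [e1]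
      exact Submodule.sum_mem _ fun l _ => Submodule.smul_mem _ _ (Submodule.subset_span ⟨l, rfl⟩)

/-- The inverses of `ψ` in degrees `0` and `1` are compatible with the actions and induce a left
inverse on the tensor products. -/
lemma deg2_injective (h : IsQuadraticCornerHom ℬ hA ψ hψ) :
    haveI := corner_gradedMonoid (hA.isIdempotentElem L) 𝒜 (hA.sum_mem L)
    Function.Injective (Deg2.map ℬ (cornerGr (hA.isIdempotentElem L) 𝒜) ψ hψ) := by
  have := corner_gradedMonoid (hA.isIdempotentElem L) 𝒜 (hA.sum_mem L)
  let s₁ := cornerSymm hψ h.bij₁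
  let s₀ := cornerSymm hψ h.bij₀
  let g : Deg2 (cornerGr (hA.isIdempotentElem L) 𝒜) →ₗ[ℂ] Deg2 ℬ :=
    Bal.map (s₁ : _ →ₗ[ℂ] ℬ 1) s₀ (s₁ : _ →ₗ[ℂ] ℬ 1)
      (fun x s => Subtype.ext (h.bij₁.injOn (s₁ _).2 (lmul ℬ (add_zero 1) _ _).2 (by
        rw [coe_lmul, map_mul]
        exact (ψ_cornerSymm hψ h.bij₁ _).trans (congrArg₂ (· * ·) (ψ_cornerSymm hψ h.bij₁ x) (ψ_cornerSymm hψ h.bij₀ s)).symm)))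
      (fun s x => Subtype.ext (h.bij₁.injOn (s₁ _).2 (lmul ℬ (zero_add 1) _ _).2 (by
        rw [coe_lmul, map_mul]
        exact (ψ_cornerSymm hψ h.bij₁ _).trans (congrArg₂ (· * ·) (ψ_cornerSymm hψ h.bij₀ s) (ψ_cornerSymm hψ h.bij₁ x)).symm)))
  have hg : g ∘ₗ Deg2.map ℬ (cornerGr (hA.isIdempotentElem L) 𝒜) ψ hψ = LinearMap.id := by
    refine Submodule.linearMap_qext _ (TensorProduct.ext' fun x y => ?_)
    exact congrArg Submodule.Quotient.mk
      (congrArg₂ (· ⊗ₜ[ℂ] ·) (cornerSymm_ψ hψ h.bij₁ x) (cornerSymm_ψ hψ h.bij₁ y))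
  exact Function.LeftInverse.injective (LinearMap.congr_fun hg)

/-- The corner datum attached to `ψ`. -/
def cornerDatum : CornerDatum (𝒜 := 𝒜) (ℬ := ℬ) hA h.isBasic where
  ψ := cornerDeg 𝒜 ℬ ψ hψ 1
  injective x y hxy := Subtype.ext
    (h.bij₁.injOn x.2 y.2 (corner_ext (congrArg (Submodule.subtype (𝒜 1)) hxy)))
  exists_eq a ha := by
    obtain ⟨b, hb, hba⟩ := h.bij₁.surjOn
      (show (⟨a, ⟨a, ha⟩⟩ : (hA.isIdempotentElem L).Corner) ∈ _ from a.2)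
    exact ⟨⟨b, hb⟩, Subtype.ext (congrArg (cornerVal _) hba)⟩
  map_e_mul l b := Subtype.ext (by
    change cornerVal _ (ψ (h.idem l * b)) = e l * cornerVal _ (ψ b)
    rw [map_mul, cornerVal_mul, cornerVal_map_idem])
  map_mul_e l b := Subtype.ext (by
    change cornerVal _ (ψ (b * h.idem l)) = cornerVal _ (ψ b) * e l
    rw [map_mul, cornerVal_mul, cornerVal_map_idem])
  ψ₂ := cornerDeg 𝒜 ℬ ψ hψ 2
  ψ₂_lmul b c := Subtype.ext (by
    change cornerVal _ (ψ (b * c)) = cornerVal _ (ψ b) * cornerVal _ (ψ c)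
    rw [map_mul, cornerVal_mul])
  rel t ht := by
    have := corner_gradedMonoid (hA.isIdempotentElem L) 𝒜 (hA.sum_mem L)
    let q : Deg2 ℬ := Submodule.Quotient.mk t
    have hmul : Deg2.mul (cornerGr (hA.isIdempotentElem L) 𝒜) ∘ₗ
        Deg2.map ℬ (cornerGr (hA.isIdempotentElem L) 𝒜) ψ hψ ∘ₗ Submodule.mkQ _ =
          ψ.toLinearMap.restrict (hψ 2) ∘ₗ TensorProduct.lift (lmul ℬ one_add_one_eq_two) :=
      TensorProduct.ext' fun x y => Subtype.ext (map_mul ψ (x : B) (y : B)).symm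
    have hq : Deg2.mul (cornerGr (hA.isIdempotentElem L) 𝒜)
        (Deg2.map ℬ (cornerGr (hA.isIdempotentElem L) 𝒜) ψ hψ q) = 0 :=
      (LinearMap.congr_fun hmul t).trans (Subtype.ext (corner_ext (congrArg (Submodule.subtype (𝒜 2)) ht)))
    -- The image of `q` is a quadratic relation of the corner, hence the image of a relation `p` of
    -- `B`. Injectivity gives `p = q`, so `q` is itself a relation.
    obtain ⟨p, hp, hpq⟩ := h.rel.surjOn hq
    rw [h.deg2_injective hpq] at hp
    exact hp

lemma ψ₀_eq (b : ℬ 0) : CornerDatum.ψ₀ hA h.isBasic b = cornerDeg 𝒜 ℬ ψ hψ 0 b := by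
  apply Subtype.ext
  change _ = cornerVal _ (ψ b)
  rw [CornerDatum.ψ₀_apply]
  conv_rhs => rw [← h.isBasic.sum_coef b]
  simp only [map_sum, map_smul, h.cornerVal_map_idem, AddSubmonoidClass.coe_finsetSum]
  rfl

end IsQuadraticCornerHom

end CornerHom

/-! ### The functor `A e_L ⊗_B -` on free modules. -/

section TensTransport

variable {A : Type u} [Ring A] [Algebra ℂ A] [FiniteDimensional ℂ A]
  {𝒜 : ℤ → Submodule ℂ A} [GradedAlgebra 𝒜]
  {B : Type u} [Ring B] [Algebra ℂ B] [FiniteDimensional ℂ B]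
  {ℬ : ℤ → Submodule ℂ B} [GradedAlgebra ℬ]
  {s : A} {he : IsIdempotentElem s} (ψ : B →ₐ[ℂ] he.Corner)
  (hψ : ∀ n, ∀ b ∈ ℬ n, ψ b ∈ cornerGr he 𝒜 n)

instance : (tens 𝒜 ℬ ψ hψ).Linear ℂ where
  map_smul {M N} f c := GrMod.hom_ext fun j => tens_ext fun p q hpq x v => by
    change tensMap 𝒜 ℬ ψ hψ (c • f) j _ = c • tensMap 𝒜 ℬ ψ hψ f j _
    rw [tensMap_mk, tensMap_mk]
    refine congrArg Submodule.Quotient.mk ?_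
    exact (congrArg (DirectSum.lof ℂ (Pairs j)
      (fun pq => rightCut 𝒜 s pq.1.1 ⊗[ℂ] N.V pq.1.2) ⟨(p, q), hpq⟩)
      (TensorProduct.tmul_smul c x (app f q v))).trans (map_smul _ _ _)

/-- The map `A_p s ⊗ B_{q + k} ⟶ A_{j + k} s` given by multiplication. -/
def tensMulComp (k j : ℤ) (pq : Pairs j) :
    rightCut 𝒜 s pq.1.1 ⊗[ℂ] (free ℬ k).V pq.1.2 →ₗ[ℂ] rightCut 𝒜 s (j + k) :=
  TensorProduct.lift
    (LinearMap.mk₂ ℂ (fun (x : rightCut 𝒜 s pq.1.1) (y : ℬ (pq.1.2 + k)) =>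
        cutAct 𝒜 ℬ ψ hψ (by have := pq.2; omega) x y)
      (fun _ _ _ => Subtype.ext (add_mul _ _ _)) (fun _ _ _ => Subtype.ext (smul_mul_assoc _ _ _))
      (fun x (y z : ℬ (pq.1.2 + k)) => Subtype.ext (by
        change (x : A) * cornerVal he (ψ ((y : B) + z)) =
          x * cornerVal he (ψ y) + x * cornerVal he (ψ z)
        rw [map_add, map_add, mul_add]))
      (fun c x (y : ℬ (pq.1.2 + k)) => Subtype.ext (by
        change (x : A) * cornerVal he (ψ (c • (y : B))) = c • ((x : A) * cornerVal he (ψ y))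
        rw [map_smul, map_smul, mul_smul_comm])))

/-- The morphism `A s ⊗ B⟨-k⟩ ⟶ A s⟨-k⟩` given by multiplication, in degree `j`. -/
def tensFreeHomFun (k j : ℤ) : TensFree 𝒜 ℬ s (free ℬ k) j →ₗ[ℂ] rightCut 𝒜 s (j + k) :=
  DirectSum.toModule ℂ _ _ (tensMulComp ψ hψ k j)

lemma tensFreeHomFun_mk (k j : ℤ) {p q : ℤ} (h : p + q = j) (x : rightCut 𝒜 s p)
    (y : ℬ (q + k)) : (tensFreeHomFun ψ hψ k j (tensFreeMk 𝒜 (free ℬ k) h x y) : A) =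
      x * cornerVal he (ψ y) := by
  have := DirectSum.toModule_lof
    (M := fun pq : Pairs j => rightCut 𝒜 s pq.1.1 ⊗[ℂ] (free ℬ k).V pq.1.2)
    (φ := tensMulComp ψ hψ k j) ℂ ⟨(p, q), h⟩ (TensorProduct.tmul ℂ (N := (free ℬ k).V q) x y)
  exact congrArg (fun t : rightCut 𝒜 s (j + k) => (t : A)) this

/-- The morphism `A s ⊗_B B⟨-k⟩ ⟶ A s⟨-k⟩` given by multiplication, in degree `j`. -/
def tensHomFun (k j : ℤ) : TensComp 𝒜 ℬ ψ hψ (free ℬ k) j →ₗ[ℂ] rightCut 𝒜 s (j + k) :=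
  Submodule.liftQ _ (tensFreeHomFun ψ hψ k j) <| by
    rw [tensRel, Submodule.span_le]
    rintro _ ⟨p, n, q, hi, x, b, v, rfl⟩
    rw [SetLike.mem_coe, LinearMap.mem_ker, map_sub, sub_eq_zero]
    apply Subtype.ext
    refine (tensFreeHomFun_mk ψ hψ k j _ _ _).trans (Eq.trans ?_
      (tensFreeHomFun_mk ψ hψ k j _ _ _).symm)
    change (x : A) * cornerVal he (ψ b) * cornerVal he (ψ (freeVal v)) =
      x * cornerVal he (ψ (b * freeVal v))
    rw [map_mul, cornerVal_mul, mul_assoc]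

lemma tensHomFun_mk (k j : ℤ) {p q : ℤ} (h : p + q = j) (x : rightCut 𝒜 s p)
    (y : ℬ (q + k)) :
    (tensHomFun ψ hψ k j (Submodule.Quotient.mk (tensFreeMk 𝒜 (free ℬ k) h x y)) : A) =
      x * cornerVal he (ψ y) := tensFreeHomFun_mk ψ hψ k j h x y

lemma tensFreeMk_free_congr {k : ℤ} {p q q' j : ℤ} (h : p + q = j) (h' : p + q' = j)
    (x : rightCut 𝒜 s p) (v : (free ℬ k).V q) (v' : (free ℬ k).V q')
    (hv : freeVal v = freeVal v') :
    tensFreeMk 𝒜 (free ℬ k) h x v = tensFreeMk 𝒜 (free ℬ k) h' x v' := by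
  obtain rfl : q = q' := by omega
  rw [freeVal_injective hv]

/-- The map `A s⟨-k⟩ → A s ⊗_B B⟨-k⟩`, `x ↦ x ⊗ 1`, in degree `j`. -/
def tensInvFun (k j : ℤ) (x : rightCut 𝒜 s (j + k)) : TensComp 𝒜 ℬ ψ hψ (free ℬ k) j :=
  Submodule.Quotient.mk (tensFreeMk 𝒜 (free ℬ k) (show j + k + -k = j by omega) x
    (oneDeg ℬ (neg_add_cancel k)))

/-- Moving `y` across the tensor sign gives `x ⊗ y = x ψ(y) ⊗ 1`. -/
lemma tens_mk_eq (k : ℤ) {j p q : ℤ} (h : p + q = j) (x : rightCut 𝒜 s p) (y : ℬ (q + k)) :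
    (Submodule.Quotient.mk (tensFreeMk 𝒜 (free ℬ k) h x y) : TensComp 𝒜 ℬ ψ hψ (free ℬ k) j) =
      tensInvFun ψ hψ k j (cutAct 𝒜 ℬ ψ hψ (by omega) x y) := by
  have h1 : p + (q + k) + -k = j := by omega
  have h2 := (Submodule.Quotient.eq (tensRel 𝒜 ℬ ψ hψ (free ℬ k) j)).2 (Submodule.subset_span
    ⟨p, q + k, -k, h1, x, y, oneDeg ℬ (neg_add_cancel k), rfl⟩)
  refine Eq.trans (congrArg Submodule.Quotient.mk ?_) (h2.symm.trans
    (congrArg Submodule.Quotient.mk ?_))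
  · exact tensFreeMk_free_congr _ _ _ _ _ (mul_one (y : B)).symm
  · exact tensFreeMk_congr _ _ _ _ _ _ _ _ rfl

/-- `A s ⊗_B B⟨-k⟩` is `A s⟨-k⟩`. -/
def tensHom (k : ℤ) : (tens 𝒜 ℬ ψ hψ).obj (free ℬ k) ⟶ freeCut 𝒜 s k :=
  mkHom (tensHomFun ψ hψ k) fun {n i j} h a v => by
    have : tensHomFun ψ hψ k j ∘ₗ tensAct 𝒜 ℬ ψ hψ (free ℬ k) h a =
        (freeCut 𝒜 s k).act h a ∘ₗ tensHomFun ψ hψ k i := tens_ext fun p q hpq x y => by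
      apply Subtype.ext
      rw [LinearMap.comp_apply, tensAct_mk]
      refine (tensHomFun_mk ψ hψ k j _ _ _).trans ((mul_assoc _ _ _).trans ?_)
      exact congrArg ((a : A) * ·) (tensHomFun_mk ψ hψ k i _ _ _).symm
    exact LinearMap.congr_fun this v

lemma tensHom_mk (k : ℤ) {j p q : ℤ} (h : p + q = j) (x : rightCut 𝒜 s p) (y : ℬ (q + k)) :
    cutVal (app (tensHom ψ hψ k) j (Submodule.Quotient.mk (tensFreeMk 𝒜 (free ℬ k) h x y))) =
      x * cornerVal he (ψ y) := tensHomFun_mk ψ hψ k j h x y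

lemma tensHom_tensInvFun (k j : ℤ) (x : rightCut 𝒜 s (j + k)) :
    app (tensHom ψ hψ k) j (tensInvFun ψ hψ k j x) = x := by
  refine cutVal_injective ((tensHom_mk ψ hψ k _ _ _).trans ?_)
  rw [coe_oneDeg, map_one, cornerVal_one]
  exact x.2.2

/-- The map `x ↦ x ⊗ 1` is a right inverse of multiplication, and it is surjective by `tens_mk_eq`,
hence a two-sided inverse. -/
lemma tensHom_bijective (k j : ℤ) : Function.Bijective (app (tensHom ψ hψ k) j) := by
  refine ⟨?_, fun x => ⟨_, tensHom_tensInvFun ψ hψ k j x⟩⟩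
  have key : ∀ z : TensComp 𝒜 ℬ ψ hψ (free ℬ k) j, ∃ x, tensInvFun ψ hψ k j x = z := by
    let T : rightCut 𝒜 s (j + k) →ₗ[ℂ] TensComp 𝒜 ℬ ψ hψ (free ℬ k) j :=
      { toFun := tensInvFun ψ hψ k j
        map_add' := fun _ _ => congrArg Submodule.Quotient.mk (tensFreeMk_add ..)
        map_smul' := fun _ _ => congrArg Submodule.Quotient.mk (tensFreeMk_smul ..) }
    intro z
    have : LinearMap.range T = ⊤ := by
      rw [← Submodule.ker_mkQ (LinearMap.range T), LinearMap.ker_eq_top]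
      refine tens_ext fun p q h x y => ?_
      exact (Submodule.Quotient.mk_eq_zero (LinearMap.range T)).2
        ⟨_, (tens_mk_eq ψ hψ k h x y).symm⟩
    exact LinearMap.range_eq_top.1 this z
  intro z w hzw
  obtain ⟨x, rfl⟩ := key z
  obtain ⟨y, rfl⟩ := key w
  rw [tensHom_tensInvFun, tensHom_tensInvFun] at hzw
  rw [hzw]

/-- `A s ⊗_B B⟨-k⟩` is `A s⟨-k⟩`. -/
def tensIso (k : ℤ) : (tens 𝒜 ℬ ψ hψ).obj (free ℬ k) ≅ freeCut 𝒜 s k :=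
  have := isIso_of_bijective (tensHom ψ hψ k) (tensHom_bijective ψ hψ k)
  asIso (tensHom ψ hψ k)

lemma tensHom_freeMul {p k k' : ℤ} (h : k + p = k') (b : ℬ p) (j : ℤ)
    (z : ((tens 𝒜 ℬ ψ hψ).obj (free ℬ k)).V j) :
    cutVal (app (tensHom ψ hψ k') j (app ((tens 𝒜 ℬ ψ hψ).map (freeMul ℬ h b)) j z)) =
      cutVal (app (tensHom ψ hψ k) j z) * cornerVal he (ψ b) := by
  have : cutVal ∘ₗ app (tensHom ψ hψ k') j ∘ₗ tensMap 𝒜 ℬ ψ hψ (freeMul ℬ h b) j =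
      LinearMap.mulRight ℂ (cornerVal he (ψ b)) ∘ₗ cutVal ∘ₗ app (tensHom ψ hψ k) j :=
    tens_ext fun q r hqr x y => by
      refine (congrArg (fun t => cutVal (app (tensHom ψ hψ k') j t)) (tensMap_mk ..)).trans ?_
      refine (tensHom_mk ψ hψ k' _ _ _).trans (Eq.trans ?_
        (congrArg (· * cornerVal he (ψ b)) (tensHom_mk ψ hψ k hqr x y)).symm)
      change (x : A) * cornerVal he (ψ (freeVal y * b)) = x * cornerVal he (ψ (freeVal y)) * _
      rw [map_mul, cornerVal_mul, mul_assoc]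
  exact LinearMap.congr_fun this z

end TensTransport

section

variable {A : Type u} [Ring A] [Algebra ℂ A] [FiniteDimensional ℂ A]
  {𝒜 : ℤ → Submodule ℂ A} [GradedAlgebra 𝒜]
  {Λ : Type*} [Fintype Λ] {e : Λ → A} {hA : IsBasic 𝒜 e} {L : Finset Λ}
  {B : Type u} [Ring B] [Algebra ℂ B] [FiniteDimensional ℂ B]
  {ℬ : ℤ → Submodule ℂ B} [GradedAlgebra ℬ]
  {ψ : B →ₐ[ℂ] (hA.isIdempotentElem L).Corner}
  {hψ : ∀ n, ∀ b ∈ ℬ n, ψ b ∈ cornerGr (hA.isIdempotentElem L) 𝒜 n}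

/-- The tensor product functor is compatible with the corner datum. -/
def IsQuadraticCornerHom.transport (h : IsQuadraticCornerHom ℬ hA ψ hψ) :
    Transport h.cornerDatum (tens 𝒜 ℬ ψ hψ) where
  φ := tensIso ψ hψ
  map₀ k b j z := by
    rw [h.ψ₀_eq]
    exact tensHom_freeMul ψ hψ (add_zero k) b j z
  map₁ k b j z := tensHom_freeMul ψ hψ rfl b j z

end

/-! ### Propagating a choice at `0` along bijections indexed by ℤ. -/

section IntSections

lemma int_induction_iff {P : ℤ → Prop} (h0 : P 0) (h : ∀ k, P k ↔ P (k + 1)) (k : ℤ) : P k := by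
  induction k using Int.induction_on with
  | zero => exact h0
  | succ i hi => exact (h _).1 hi
  | pred i hi => exact (h _).2 (by rwa [sub_add_cancel])

/-- The section of a family of types with transition bijections, in nonnegative degrees. -/
def intSectionPos {X : ℤ → Type u} (c : ∀ k, X k ≃ X (k + 1)) (x : X 0) : ∀ n : ℕ, X (.ofNat n)
  | 0 => x
  | n + 1 => c (.ofNat n) (intSectionPos c x n)

/-- The section of a family of types with transition bijections, in negative degrees. -/
def intSectionNeg {X : ℤ → Type u} (c : ∀ k, X k ≃ X (k + 1)) (x : X 0) : ∀ n : ℕ, X (.negSucc n)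
  | 0 => (c (.negSucc 0)).symm x
  | n + 1 => (c (.negSucc (n + 1))).symm (intSectionNeg c x n)

/-- The section of a family of types with transition bijections that extends a given element. -/
def intSection {X : ℤ → Type u} (c : ∀ k, X k ≃ X (k + 1)) (x : X 0) : ∀ k, X k
  | .ofNat n => intSectionPos c x n
  | .negSucc n => intSectionNeg c x n

lemma intSection_succ {X : ℤ → Type u} (c : ∀ k, X k ≃ X (k + 1)) (x : X 0) :
    ∀ k, intSection c x (k + 1) = c k (intSection c x k)
  | .ofNat _ => rfl
  | .negSucc 0 => ((c (.negSucc 0)).apply_symm_apply x).symm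
  | .negSucc (n + 1) =>
    ((c (.negSucc (n + 1))).apply_symm_apply (intSectionNeg c x n)).symm

end IntSections

/-! ### Comparison of `T(B⟨-k⟩)` with `T(B⟨-k-1⟩)`. -/

section Shift

variable {A : Type u} [Ring A] [Algebra ℂ A] [FiniteDimensional ℂ A]
  {𝒜 : ℤ → Submodule ℂ A} [SetLike.GradedMonoid 𝒜]
  {B : Type u} [Ring B] [Algebra ℂ B] [FiniteDimensional ℂ B]
  {ℬ : ℤ → Submodule ℂ B} [SetLike.GradedMonoid ℬ]
  {T : GrMod ℬ ⥤ GrMod 𝒜} (σ : shift ℬ 1 ⋙ T ≅ T ⋙ shift 𝒜 1)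

variable (ℬ) in
/-- The identification of two homogeneous components of the same degree. -/
def castDeg {m n : ℤ} (h : m = n) : ℬ m →ₗ[ℂ] ℬ n := Submodule.inclusion (congrArg ℬ h).le

variable (ℬ) in
/-- The identification of `B⟨-k⟩` with the shift of `B⟨-k-1⟩`. -/
def freeShift (k : ℤ) : free ℬ k ⟶ (shift ℬ 1).obj (free ℬ (k + 1)) :=
  mkHom (fun j => castDeg ℬ (show j + k = j - 1 + (k + 1) by omega)) fun _ _ _ => rfl

lemma freeShift_bijective (k j : ℤ) : Function.Bijective (app (freeShift ℬ k) j) :=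
  ⟨fun _ _ h => freeVal_injective (congrArg (Submodule.subtype (ℬ (j - 1 + (k + 1)))) h), fun y =>
    ⟨castDeg ℬ (show j - 1 + (k + 1) = j + k by omega) y, rfl⟩⟩

/-- The comparison of `T(B⟨-k⟩)` with the shift of `T(B⟨-k-1⟩)`. -/
def shiftHom (k : ℤ) : T.obj (free ℬ k) ⟶ (shift 𝒜 1).obj (T.obj (free ℬ (k + 1))) :=
  T.map (freeShift ℬ k) ≫ σ.hom.app (free ℬ (k + 1))

lemma shiftHom_bijective (k j : ℤ) : Function.Bijective (app (shiftHom σ k) j) := by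
  have := isIso_of_bijective (freeShift ℬ k) (freeShift_bijective k)
  have h : IsIso (shiftHom σ k) :=
    inferInstanceAs (IsIso (T.map (freeShift ℬ k) ≫ σ.hom.app (free ℬ (k + 1))))
  refine Function.bijective_iff_has_inverse.2 ⟨app (inv (shiftHom σ k)) j, fun x => ?_, fun x => ?_⟩
  · exact congrArg (fun t => app t j x) (IsIso.hom_inv_id (shiftHom σ k))
  · exact congrArg (fun t => app t j x) (IsIso.inv_hom_id (shiftHom σ k))

lemma freeMul_shift {p k k' : ℤ} (h : k + p = k') (h' : k + 1 + p = k' + 1) (b : ℬ p) :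
    freeMul ℬ h b ≫ freeShift ℬ k' = freeShift ℬ k ≫ (shift ℬ 1).map (freeMul ℬ h' b) := rfl

lemma freeMul_shiftHom {p k k' : ℤ} (h : k + p = k') (h' : k + 1 + p = k' + 1) (b : ℬ p) :
    T.map (freeMul ℬ h b) ≫ shiftHom σ k' =
      shiftHom σ k ≫ (shift 𝒜 1).map (T.map (freeMul ℬ h' b)) := by
  rw [shiftHom, shiftHom, ← Category.assoc, ← T.map_comp, freeMul_shift h h', T.map_comp,
    Category.assoc, Category.assoc]
  exact congrArg (_ ≫ ·) (σ.hom.naturality (freeMul ℬ h' b))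

/-- The comparison of `T(B⟨-k⟩)` and `T(B⟨-k-1⟩)`, on components. -/
def shiftEquiv (k : ℤ) {i i' : ℤ} (h : i - 1 = i') :
    (T.obj (free ℬ k)).V i ≃ (T.obj (free ℬ (k + 1))).V i' :=
  (Equiv.ofBijective (app (shiftHom σ k) i) (shiftHom_bijective σ k i)).trans
    (Equiv.cast (congrArg (T.obj (free ℬ (k + 1))).V h))

lemma shiftEquiv_act (k : ℤ) {n i i' j j' : ℤ} (hi : i - 1 = i') (hj : j - 1 = j') (h : n + i = j)
    (h' : n + i' = j') (a : 𝒜 n) (z : (T.obj (free ℬ k)).V i) :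
    shiftEquiv σ k hj ((T.obj (free ℬ k)).act h a z) =
      (T.obj (free ℬ (k + 1))).act h' a (shiftEquiv σ k hi z) := by
  subst hi
  subst hj
  exact app_act (shiftHom σ k) h a z

lemma shiftEquiv_freeMul {p k k' : ℤ} (h : k + p = k') (h' : k + 1 + p = k' + 1) (b : ℬ p)
    {i i' : ℤ} (hi : i - 1 = i') (z : (T.obj (free ℬ k)).V i) :
    shiftEquiv σ k' hi (app (T.map (freeMul ℬ h b)) i z) =
      app (T.map (freeMul ℬ h' b)) i' (shiftEquiv σ k hi z) := by
  subst hi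
  exact congrArg (fun t => app t i z) (freeMul_shiftHom σ h h' b)

end Shift

/-! ### Coherent generators of the modules `T(B⟨-k⟩)`. -/

section Frame

variable {A : Type u} [Ring A] [Algebra ℂ A] [FiniteDimensional ℂ A]
  {𝒜 : ℤ → Submodule ℂ A} [SetLike.GradedMonoid 𝒜]
  {Λ : Type*} [Fintype Λ] {e : Λ → A} {hA : IsBasic 𝒜 e} {L : Finset Λ}
  {B : Type u} [Ring B] [Algebra ℂ B] [FiniteDimensional ℂ B]
  {ℬ : ℤ → Submodule ℂ B} [SetLike.GradedMonoid ℬ]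
  {e' : L → B} {hB : IsBasic ℬ e'}

/-- The inclusion of `A_p s` in `A_p`. -/
def cutDeg {s : A} {p : ℤ} : rightCut 𝒜 s p →ₗ[ℂ] 𝒜 p := Submodule.inclusion fun _ hx => hx.1

/-- The map `x ↦ x u`. -/
def actOn {M : GrMod 𝒜} {s : A} {p i j : ℤ} (h : p + i = j) (u : M.V i) :
    rightCut 𝒜 s p →ₗ[ℂ] M.V j := (M.act h).flip u ∘ₗ cutDeg

/-- Generators `u_k` of the modules `T(B⟨-k⟩)` that identify them with `A e_L⟨-k⟩`, compatibly with
the idempotents and with the shift of the grading. -/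
structure Frame (hA : IsBasic 𝒜 e) (hB : IsBasic ℬ e') (T : GrMod ℬ ⥤ GrMod 𝒜) where
  u (k : ℤ) : (T.obj (free ℬ k)).V (-k)
  bij (k : ℤ) {p j : ℤ} (h : p + -k = j) :
    Function.Bijective (actOn (s := ∑ l ∈ L, e l) h (u k))
  idem (k : ℤ) (l : L) : app (T.map (freeMul ℬ (add_zero k) (hB.e₀ l))) (-k) (u k) =
    (T.obj (free ℬ k)).act (zero_add _) (hA.e₀ (l : Λ)) (u k)
  shift {p k k' : ℤ} (h : k + p = k') (h₁ : p + -k' = -k) (h' : k + 1 + p = k' + 1)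
    (h₁' : p + -(k' + 1) = -(k + 1)) (b : ℬ p) (x : 𝒜 p) :
    app (T.map (freeMul ℬ h b)) (-k) (u k) = (T.obj (free ℬ k')).act h₁ x (u k') →
    app (T.map (freeMul ℬ h' b)) (-(k + 1)) (u (k + 1)) =
      (T.obj (free ℬ (k' + 1))).act h₁' x (u (k' + 1))

/-- A generator of `T(B)` gives generators of all shifts. -/
def Frame.ofGenerator {T : GrMod ℬ ⥤ GrMod 𝒜} (σ : GrMod.shift ℬ 1 ⋙ T ≅ T ⋙ GrMod.shift 𝒜 1)
    (u : (T.obj (free ℬ 0)).V 0)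
    (bij : ∀ {p j : ℤ} (h : p + 0 = j), Function.Bijective (actOn (s := ∑ l ∈ L, e l) h u))
    (idem : ∀ l : L, app (T.map (freeMul ℬ (add_zero 0) (hB.e₀ l))) 0 u =
      (T.obj (free ℬ 0)).act (zero_add _) (hA.e₀ (l : Λ)) u) : Frame hA hB T :=
  let c (k : ℤ) : (T.obj (free ℬ k)).V (-k) ≃ (T.obj (free ℬ (k + 1))).V (-(k + 1)) :=
    shiftEquiv σ k (by omega)
  -- The generator for `k = 0` is carried to all `k` by the shift isomorphisms. Independent choices
  -- for each `k` could give right multiplications whose coefficients depend on `k`.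
  let v := intSection (X := fun k => (T.obj (free ℬ k)).V (-k)) c u
  have hv : ∀ k, v (k + 1) = c k (v k) := intSection_succ c u
  { u := v
    bij := fun k => int_induction_iff (P := fun k => ∀ {p j : ℤ} (h : p + -k = j),
        Function.Bijective (actOn (s := ∑ l ∈ L, e l) h (v k))) bij (fun k => by
      have key : ∀ {p j j' : ℤ} (h : p + -k = j) (h' : p + -(k + 1) = j') (hj : j - 1 = j'),
          ⇑(actOn (s := ∑ l ∈ L, e l) h' (v (k + 1))) =
            shiftEquiv σ k hj ∘ actOn (s := ∑ l ∈ L, e l) h (v k) := fun h h' hj => funext fun x =>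
        Eq.symm ((shiftEquiv_act σ k _ hj h h' (cutDeg x) (v k)).trans
          (congrArg (actOn h' · x) (hv k).symm))
      constructor
      · intro H p j h
        rw [key (j := j + 1) (by omega) h (by omega)]
        exact (Equiv.bijective _).comp (H _)
      · intro H p j h
        have := H (p := p) (j := j - 1) (by omega)
        rw [key h (by omega) rfl] at this
        exact (Equiv.comp_bijective _ _).1 this) k
    idem := fun k l => int_induction_iff (P := fun k =>
        app (T.map (freeMul ℬ (add_zero k) (hB.e₀ l))) (-k) (v k) =
          (T.obj (free ℬ k)).act (zero_add _) (hA.e₀ (l : Λ)) (v k)) (idem l) (fun k => by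
      rw [← (c k).injective.eq_iff, hv]
      rw [show c k (app _ _ _) = _ from shiftEquiv_freeMul σ (add_zero k) (add_zero _) _ _ _,
        show c k ((T.obj (free ℬ k)).act _ _ _) = _ from
          shiftEquiv_act σ k (by omega) _ _ (zero_add _) _ _]) k
    shift := fun {p k k'} h h₁ h' h₁' b x hx => by
      rw [hv, hv]
      refine (shiftEquiv_freeMul σ h h' b _ (v k)).symm.trans ?_
      rw [hx]
      exact shiftEquiv_act σ k' _ _ _ _ _ _ }

end Frame

/-! ### Coefficients of right multiplications, and the transport of a frame. -/

section FrameTransport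

variable {A : Type u} [Ring A] [Algebra ℂ A] [FiniteDimensional ℂ A]
  {𝒜 : ℤ → Submodule ℂ A} [SetLike.GradedMonoid 𝒜]
  {Λ : Type*} [Fintype Λ] {e : Λ → A} {hA : IsBasic 𝒜 e} {L : Finset Λ}
  {B : Type u} [Ring B] [Algebra ℂ B] [FiniteDimensional ℂ B]
  {ℬ : ℤ → Submodule ℂ B} [SetLike.GradedMonoid ℬ]
  {e' : L → B} {hB : IsBasic ℬ e'}

lemma freeMul_comp {p q k k' k'' r : ℤ} (h : k + p = k') (h' : k' + q = k'') (hr : p + q = r)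
    (h'' : k + r = k'') (b : ℬ p) (c : ℬ q) :
    freeMul ℬ h b ≫ freeMul ℬ h' c = freeMul ℬ h'' (lmul ℬ hr b c) :=
  GrMod.hom_ext fun _ => LinearMap.ext fun _ => freeVal_injective (mul_assoc _ _ _)

namespace Frame

variable {T : GrMod ℬ ⥤ GrMod 𝒜} (fr : Frame hA hB T)

lemma act_injective {k p j : ℤ} (h : p + -k = j) {x y : 𝒜 p} (hx : (x : A) * ∑ l ∈ L, e l = x)
    (hy : (y : A) * ∑ l ∈ L, e l = y)
    (hxy : (T.obj (free ℬ k)).act h x (fr.u k) = (T.obj (free ℬ k)).act h y (fr.u k)) : x = y :=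
  Subtype.ext (congrArg (Submodule.subtype (rightCut 𝒜 (∑ l ∈ L, e l) p))
    ((fr.bij k h).1 (a₁ := ⟨x, x.2, hx⟩) (a₂ := ⟨y, y.2, hy⟩) hxy))

/-- The morphism `A e_L⟨-k⟩ ⟶ T(B⟨-k⟩)` given by the generator. -/
def fromCut (k : ℤ) : freeCut 𝒜 (∑ l ∈ L, e l) k ⟶ T.obj (free ℬ k) :=
  mkHom (fun j => actOn (by omega : j + k + -k = j) (fr.u k)) fun _ _ _ =>
    (T.obj (free ℬ k)).mul_act _ _ _ _ _ _ _ rfl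

lemma fromCut_bijective (k j : ℤ) : Function.Bijective (app (fr.fromCut k) j) := fr.bij k _

/-- The isomorphism `T(B⟨-k⟩) ≅ A e_L⟨-k⟩`. -/
def φ (k : ℤ) : T.obj (free ℬ k) ≅ freeCut 𝒜 (∑ l ∈ L, e l) k :=
  have := isIso_of_bijective (fr.fromCut k) (fr.fromCut_bijective k)
  (asIso (fr.fromCut k)).symm

lemma fromCut_φ (k j : ℤ) (z : (T.obj (free ℬ k)).V j) :
    app (fr.fromCut k) j (app (fr.φ k).hom j z) = z :=
  congrArg (fun t => app t j z) (fr.φ k).hom_inv_id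

lemma act_φ (k j : ℤ) (z : (T.obj (free ℬ k)).V j) :
    (T.obj (free ℬ k)).act (by omega : j + k + -k = j)
      (cutDeg (app (fr.φ k).hom j z : rightCut 𝒜 (∑ l ∈ L, e l) (j + k))) (fr.u k) = z :=
  fr.fromCut_φ k j z

/-- A morphism out of `T(B⟨-k⟩) ≅ A e_L⟨-k⟩` is determined by the image of the generator, so knowing
that image is `x u_{k'}` shows that the morphism is right multiplication by `x`. -/
lemma φ_freeMul {p k k' : ℤ} (h : k + p = k') (h₁ : p + -k' = -k) (b : ℬ p) (x : 𝒜 p)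
    (hx : (x : A) * ∑ l ∈ L, e l = x) (hb : app (T.map (freeMul ℬ h b)) (-k) (fr.u k) =
      (T.obj (free ℬ k')).act h₁ x (fr.u k')) (j : ℤ) (z : (T.obj (free ℬ k)).V j) :
    cutVal (app (fr.φ k').hom j (app (T.map (freeMul ℬ h b)) j z)) =
      cutVal (app (fr.φ k).hom j z) * x := by
  set y : rightCut 𝒜 (∑ l ∈ L, e l) (j + k) := app (fr.φ k).hom j z with hy
  have hz : (T.obj (free ℬ k)).act (by omega : j + k + -k = j) (cutDeg y) (fr.u k) = z :=
    fr.act_φ k j z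
  let w : 𝒜 (j + k') := lmul 𝒜 (by omega : j + k + p = j + k') (cutDeg y) x
  have hw : (w : A) * ∑ l ∈ L, e l = w := by
    rw [coe_lmul, mul_assoc, hx]
  have := fr.act_injective (k := k') (j := j) (by omega)
    (x := cutDeg (app (fr.φ k').hom j (app (T.map (freeMul ℬ h b)) j z) :
      rightCut 𝒜 (∑ l ∈ L, e l) (j + k'))) (y := w)
    (app (fr.φ k').hom j (app (T.map (freeMul ℬ h b)) j z)).2.2 hw (by
      refine (fr.act_φ k' j _).trans ?_
      rw [← hz, app_act, hb]
      exact ((T.obj (free ℬ k')).mul_act h₁ (by omega) (by omega) (cutDeg y) x w (fr.u k')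
        rfl).symm)
  exact congrArg (Submodule.subtype (𝒜 (j + k'))) this

variable [T.Additive] [T.Linear ℂ]

/-- The action of `T(· b)` on the generator. -/
def mulOn {p k k' : ℤ} (h : k + p = k') : ℬ p →ₗ[ℂ] (T.obj (free ℬ k')).V (-k) where
  toFun b := app (T.map (freeMul ℬ h b)) (-k) (fr.u k)
  map_add' b c := by rw [map_add, T.map_add]; rfl
  map_smul' r b := by rw [map_smul, T.map_smul]; rfl

/-- The elements of `A` that describe the morphisms `T(· b)`. -/
def coef {p k k' : ℤ} (h : k + p = k') : ℬ p →ₗ[ℂ] 𝒜 p :=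
  cutDeg ∘ₗ ((LinearEquiv.ofBijective _ (fr.bij k' (by omega : p + -k' = -k))).symm :
    _ →ₗ[ℂ] rightCut 𝒜 (∑ l ∈ L, e l) p) ∘ₗ fr.mulOn h

lemma coef_mul_eL {p k k' : ℤ} (h : k + p = k') (b : ℬ p) :
    (fr.coef h b : A) * ∑ l ∈ L, e l = fr.coef h b :=
  ((LinearEquiv.ofBijective _ (fr.bij k' (by omega : p + -k' = -k))).symm (fr.mulOn h b)).2.2

lemma map_freeMul {p k k' : ℤ} (h : k + p = k') (h₁ : p + -k' = -k) (b : ℬ p) :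
    app (T.map (freeMul ℬ h b)) (-k) (fr.u k) =
      (T.obj (free ℬ k')).act h₁ (fr.coef h b) (fr.u k') :=
  ((LinearEquiv.ofBijective _ (fr.bij k' h₁)).apply_symm_apply (fr.mulOn h b)).symm

lemma coef_unique {p k k' : ℤ} (h : k + p = k') (h₁ : p + -k' = -k) (b : ℬ p) (x : 𝒜 p)
    (hx : (x : A) * ∑ l ∈ L, e l = x) (hb : app (T.map (freeMul ℬ h b)) (-k) (fr.u k) =
      (T.obj (free ℬ k')).act h₁ x (fr.u k')) : fr.coef h b = x :=
  fr.act_injective h₁ (fr.coef_mul_eL h b) hx ((fr.map_freeMul h h₁ b).symm.trans hb)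

lemma coef_shift {p k k' : ℤ} (h : k + p = k') (h' : k + 1 + p = k' + 1) (b : ℬ p) :
    fr.coef h' b = fr.coef h b :=
  fr.coef_unique h' (by omega) b _ (fr.coef_mul_eL h b)
    (fr.shift h (by omega) h' (by omega) b _ (fr.map_freeMul h (by omega) b))

/-- The coefficient is unchanged when `k` and `k'` both grow by one, so it is the same for every
`k`. Multiplicativity then holds for a single map `B_p → A_p`. -/
lemma coef_eq {p : ℤ} (b : ℬ p) (x : 𝒜 p) (h : fr.coef (zero_add p) b = x) (k : ℤ) :
    ∀ {k' : ℤ} (hk : k + p = k'), fr.coef hk b = x :=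
  int_induction_iff (P := fun k => ∀ {k' : ℤ} (hk : k + p = k'), fr.coef hk b = x)
    (fun {k'} hk => by
      obtain rfl : p = k' := by omega
      exact h) (fun k => ⟨fun H k' hk => by
        obtain rfl : k + p + 1 = k' := by omega
        exact (fr.coef_shift rfl hk b).trans (H rfl), fun H k' hk =>
        (fr.coef_shift hk (by omega) b).symm.trans (H _)⟩) k

/-- Composition of right multiplications and functoriality of `T`: the generator is sent first to `β
u_{k'}`, then to `β γ u_{k''}`, where `β` and `γ` are the coefficients of `b` and `c`. -/
lemma coef_mul {p q k k' k'' r : ℤ} (h : k + p = k') (h' : k' + q = k'') (hr : p + q = r)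
    (h'' : k + r = k'') (b : ℬ p) (c : ℬ q) :
    fr.coef h'' (lmul ℬ hr b c) = lmul 𝒜 hr (fr.coef h b) (fr.coef h' c) := by
  refine fr.coef_unique h'' (by omega) _ _ ?_ ?_
  · rw [coe_lmul, mul_assoc, fr.coef_mul_eL]
  · rw [← freeMul_comp h h' hr h'', T.map_comp, app_comp_apply,
      fr.map_freeMul h (by omega : p + -k' = -k), app_act,
      fr.map_freeMul h' (by omega : q + -k'' = -k')]
    exact ((T.obj (free ℬ k'')).mul_act _ _ _ _ _ _ _ (coe_lmul 𝒜 hr _ _)).symm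

lemma coef_e₀ (k : ℤ) (l : L) : fr.coef (add_zero k) (hB.e₀ l) = hA.e₀ (l : Λ) :=
  fr.coef_unique _ _ _ _ (CornerDatum.e_mul_eL hA l) (fr.idem k l)

lemma coef_ψ₀ (k : ℤ) (b : ℬ 0) : fr.coef (add_zero k) b = CornerDatum.ψ₀ hA hB b := by
  have : fr.coef (add_zero k) = CornerDatum.ψ₀ hA hB := hB.basis.ext fun l => by
    rw [hB.basis_apply, CornerDatum.ψ₀_e₀]
    exact fr.coef_e₀ k l
  rw [this]

/-- The corner datum of a functor with generators. -/
def cornerDatum (h₁ : Function.Injective (fr.coef (zero_add 1)))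
    (h₁' : ∀ a : 𝒜 1, (∑ l ∈ L, e l) * (a : A) * (∑ l ∈ L, e l) = a →
      ∃ b, fr.coef (zero_add 1) b = a)
    (h₂ : Function.Injective (fr.coef (zero_add 2))) : CornerDatum hA hB where
  ψ := fr.coef (zero_add 1)
  injective := h₁
  exists_eq := h₁'
  map_e_mul l _ := (fr.coef_mul (add_zero 0) (zero_add 1) (zero_add 1) (zero_add 1) _ _).trans
    (congrArg (fun t => lmul 𝒜 (zero_add 1) t _) (fr.coef_e₀ 0 l))
  map_mul_e l _ := (fr.coef_mul (zero_add 1) (add_zero 1) (add_zero 1) (zero_add 1) _ _).trans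
    (congrArg (fun t => lmul 𝒜 (add_zero 1) _ t) (fr.coef_e₀ 1 l))
  ψ₂ := fr.coef (zero_add 2)
  ψ₂_lmul b c := (fr.coef_mul (zero_add 1) one_add_one_eq_two one_add_one_eq_two (zero_add 2)
    b c).trans (congrArg (fun t => lmul 𝒜 one_add_one_eq_two _ t)
      (fr.coef_eq c _ rfl 1 one_add_one_eq_two))
  rel _ ht := h₂ (ht.trans (map_zero _).symm)

/-- A functor with generators is compatible with its corner datum. -/
def transport (h₁ : Function.Injective (fr.coef (zero_add 1)))
    (h₁' : ∀ a : 𝒜 1, (∑ l ∈ L, e l) * (a : A) * (∑ l ∈ L, e l) = a →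
      ∃ b, fr.coef (zero_add 1) b = a)
    (h₂ : Function.Injective (fr.coef (zero_add 2))) :
    Transport (fr.cornerDatum h₁ h₁' h₂) T where
  φ := fr.φ
  map₀ k b j z := fr.φ_freeMul (add_zero k) (by omega) b _ (CornerDatum.ψ₀_mul_eL b) (by
    rw [← fr.coef_ψ₀ k b]
    exact fr.map_freeMul _ _ b) j z
  map₁ k b j z := fr.φ_freeMul rfl (by omega) b _ (fr.coef_mul_eL _ b) (by
    rw [← fr.coef_eq b _ rfl k rfl]
    exact fr.map_freeMul _ _ b) j z

end Frame

end FrameTransport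

/-! ### The decomposition of `A⟨-k⟩` into the modules `A e_l⟨-k⟩`. -/

section Summands

variable {A : Type u} [Ring A] [Algebra ℂ A] {𝒜 : ℤ → Submodule ℂ A} [SetLike.GradedMonoid 𝒜]
  [FiniteDimensional ℂ A]

/-- The inclusion of `A s⟨-k⟩` in `A⟨-k⟩`. -/
def cutIncl (s : A) (k : ℤ) : freeCut 𝒜 s k ⟶ free 𝒜 k :=
  mkHom (fun _ => cutDeg) fun _ _ _ => rfl

/-- The projection of `A⟨-k⟩` to `A s⟨-k⟩`. -/
def cutProj (s : 𝒜 0) (hs : (s : A) * s = s) (k : ℤ) : free 𝒜 k ⟶ freeCut 𝒜 (s : A) k :=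
  mkHom (fun _ => cutMk s hs) fun _ _ _ => Subtype.ext (mul_assoc _ _ _)

/-- The identification of two homogeneous components of the same degree. -/
def cutCast (s : A) {m n : ℤ} (h : m = n) : rightCut 𝒜 s m →ₗ[ℂ] rightCut 𝒜 s n :=
  Submodule.inclusion (congrArg (rightCut 𝒜 s) h).le

/-- The identification of a shift of `A s` with `A s⟨-k⟩`. -/
def idealShiftIso (s : A) {r k : ℤ} (h : k = -r) :
    (shift 𝒜 r).obj (idealMod 𝒜 s) ≅ freeCut 𝒜 s k where
  hom := mkHom (fun j => cutCast s (show j - r = j + k by omega)) fun _ _ _ => rfl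
  inv := mkHom (fun j => cutCast s (show j + k = j - r by omega)) fun _ _ _ => rfl

/-- The identification of `A s` with its trivial shift. -/
def idealIso (s : A) : idealMod 𝒜 s ≅ freeCut 𝒜 s 0 where
  hom := mkHom (fun j => cutCast s (show j = j + 0 by omega)) fun _ _ _ => rfl
  inv := mkHom (fun j => cutCast s (show j + 0 = j by omega)) fun _ _ _ => rfl

lemma map_bijective_of_iso {C D : Type*} [Category C] [Category D] (T : C ⥤ D) {X X' Y Y' : C}
    (a : X ≅ X') (b : Y ≅ Y') (h : Function.Bijective fun f : X ⟶ Y => T.map f) :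
    Function.Bijective fun f : X' ⟶ Y' => T.map f := by
  constructor
  · intro f g hfg
    have := h.1 (a₁ := a.hom ≫ f ≫ b.inv) (a₂ := a.hom ≫ g ≫ b.inv) (by
      simp only [Functor.map_comp]
      rw [show T.map f = T.map g from hfg])
    simpa using this
  · intro g
    obtain ⟨f, hf⟩ := h.2 (T.map a.hom ≫ g ≫ T.map b.inv)
    refine ⟨a.inv ≫ f ≫ b.hom, ?_⟩
    simp only [Functor.map_comp]
    rw [show T.map f = _ from hf]
    simp only [Category.assoc, ← Functor.map_comp, b.inv_hom_id]
    rw [← Category.assoc, ← T.map_comp, a.inv_hom_id, T.map_id, T.map_id, Category.id_comp,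
      Category.comp_id]

namespace IsBasic

variable {Λ : Type*} [Fintype Λ] {e : Λ → A} (hA : IsBasic 𝒜 e)

/-- The projection of `A⟨-k⟩` to `A e_l⟨-k⟩`. -/
def proj (l : Λ) (k : ℤ) : free 𝒜 k ⟶ freeCut 𝒜 (e l) k :=
  cutProj (hA.e₀ l) (hA.e_mul_self l) k

lemma proj_incl (l : Λ) (k : ℤ) :
    hA.proj l k ≫ cutIncl (e l) k = freeMul 𝒜 (add_zero k) (hA.e₀ l) := rfl

lemma incl_proj_self (l : Λ) (k : ℤ) : cutIncl (e l) k ≫ hA.proj l k = 𝟙 (freeCut 𝒜 (e l) k) :=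
  GrMod.hom_ext fun _ => LinearMap.ext fun x => cutVal_injective (cutVal_mul x)

lemma incl_proj_ne {l m : Λ} (hlm : l ≠ m) (k : ℤ) : cutIncl (e l) k ≫ hA.proj m k = 0 :=
  GrMod.hom_ext fun _ => LinearMap.ext fun x => cutVal_injective (by
    change cutVal x * e m = _
    rw [← cutVal_mul x, mul_assoc, hA.e_mul_ne hlm, mul_zero]
    rfl)

lemma sum_proj_incl (k : ℤ) : ∑ l, hA.proj l k ≫ cutIncl (e l) k = 𝟙 (free 𝒜 k) :=
  GrMod.hom_ext fun j => LinearMap.ext fun x => by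
    rw [sum_app, LinearMap.sum_apply]
    refine freeVal_injective ?_
    rw [map_sum]
    change ∑ l, freeVal x * e l = freeVal x
    rw [← Finset.mul_sum, hA.sum_e, mul_one]

end IsBasic

end Summands

/-! ### A generator of `T(B)` from isomorphisms `T(B e'_l) ≅ A e_l`. -/

section Generator

variable {A : Type u} [Ring A] [Algebra ℂ A] [FiniteDimensional ℂ A]
  {𝒜 : ℤ → Submodule ℂ A} [SetLike.GradedMonoid 𝒜]
  {Λ : Type*} [Fintype Λ] {e : Λ → A} (hA : IsBasic 𝒜 e) {L : Finset Λ}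
  {B : Type u} [Ring B] [Algebra ℂ B] [FiniteDimensional ℂ B]
  {ℬ : ℤ → Submodule ℂ B} [SetLike.GradedMonoid ℬ]
  {e' : L → B} (hB : IsBasic ℬ e') {T : GrMod ℬ ⥤ GrMod 𝒜} [T.Additive]
  (τ : ∀ l : L, T.obj (freeCut ℬ (e' l) 0) ≅ freeCut 𝒜 (e (l : Λ)) 0)

lemma map_incl_proj_self (l : L) (k j : ℤ) (z : (T.obj (freeCut ℬ (e' l) k)).V j) :
    app (T.map (hB.proj l k)) j (app (T.map (cutIncl (e' l) k)) j z) = z := by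
  have : T.map (cutIncl (e' l) k) ≫ T.map (hB.proj l k) = 𝟙 _ := by
    rw [← T.map_comp, hB.incl_proj_self, T.map_id]
  exact congrArg (fun t => app t j z) this

lemma map_incl_proj_ne {l m : L} (hlm : l ≠ m) (k j : ℤ) (z : (T.obj (freeCut ℬ (e' l) k)).V j) :
    app (T.map (hB.proj m k)) j (app (T.map (cutIncl (e' l) k)) j z) = 0 := by
  have : T.map (cutIncl (e' l) k) ≫ T.map (hB.proj m k) = 0 := by
    rw [← T.map_comp, hB.incl_proj_ne hlm, T.map_zero _ _]
  exact congrArg (fun t => app t j z) this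

lemma map_proj_ext {k j : ℤ} {z z' : (T.obj (free ℬ k)).V j}
    (h : ∀ m, app (T.map (hB.proj m k)) j z = app (T.map (hB.proj m k)) j z') : z = z' := by
  have key : ∀ z : (T.obj (free ℬ k)).V j,
      z = ∑ m, app (T.map (cutIncl (e' m) k)) j (app (T.map (hB.proj m k)) j z) := fun z => by
    have : 𝟙 (T.obj (free ℬ k)) = ∑ m, T.map (hB.proj m k) ≫ T.map (cutIncl (e' m) k) := by
      rw [← T.map_id, ← hB.sum_proj_incl k, T.map_sum]
      simp only [T.map_comp]
    refine (congrArg (fun t => app t j z) this).trans ?_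
    rw [sum_app, LinearMap.sum_apply]
    rfl
  rw [key z, key z']
  simp only [h]

/-- The generator `e_l` of `A e_l`. -/
def cutGen (l : Λ) : (freeCut 𝒜 (e l) 0).V 0 :=
  ⟨e l, by rw [add_zero]; exact hA.mem l, hA.e_mul_self l⟩

/-- The generator of `T(B)` given by isomorphisms `T(B e'_l) ≅ A e_l`. -/
def generator : (T.obj (free ℬ 0)).V 0 :=
  ∑ l : L, app (T.map (cutIncl (e' l) 0)) 0 (app (τ l).inv 0 (cutGen hA (l : Λ)))

lemma proj_act_generator {p j : ℤ} (h : p + 0 = j) (x : 𝒜 p) (m : L) :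
    cutVal (app (τ m).hom j (app (T.map (hB.proj m 0)) j
      ((T.obj (free ℬ 0)).act h x (generator hA τ)))) = x * e (m : Λ) := by
  have : app (T.map (hB.proj m 0)) 0 (generator hA τ) =
      app (τ m).inv 0 (cutGen hA (m : Λ)) := by
    rw [generator, map_sum, Finset.sum_eq_single m]
    · exact map_incl_proj_self hB m 0 0 _
    · exact fun l _ hl => map_incl_proj_ne hB hl 0 0 _
    · simp
  rw [app_act, this, app_act]
  have h2 : app (τ m).hom 0 (app (τ m).inv 0 (cutGen hA (m : Λ))) = cutGen hA (m : Λ) :=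
    congrArg (fun t => app t 0 (cutGen hA (m : Λ))) (τ m).inv_hom_id
  rw [h2]
  rfl

lemma generator_ext {j : ℤ} {z z' : (T.obj (free ℬ 0)).V j}
    (h : ∀ m, cutVal (app (τ m).hom j (app (T.map (hB.proj m 0)) j z)) =
      cutVal (app (τ m).hom j (app (T.map (hB.proj m 0)) j z'))) : z = z' :=
  map_proj_ext hB fun m => by
    have key : ∀ y, app (τ m).inv j (app (τ m).hom j y) = y := fun y =>
      congrArg (fun t => app t j y) (τ m).hom_inv_id
    rw [← key (app (T.map (hB.proj m 0)) j z), cutVal_injective (h m), key]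

include hB in
-- The component `m` of `x` times the generator is `x e_m`. If `x = x e_L`, then `x` is the sum of
-- these components, and conversely any family of components in the `A e_m` is realized by its sum.
lemma generator_bijective {p j : ℤ} (h : p + 0 = j) :
    Function.Bijective (actOn (s := ∑ l ∈ L, e l) h (generator hA τ)) := by
  constructor
  · intro x y hxy
    have key : ∀ z : rightCut 𝒜 (∑ l ∈ L, e l) p, (z : A) = ∑ m : L, cutVal (app (τ m).hom j
        (app (T.map (hB.proj m 0)) j (actOn h (generator hA τ) z))) := fun z => by
      have : ∀ m : L, cutVal (app (τ m).hom j (app (T.map (hB.proj m 0)) j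
          (actOn h (generator hA τ) z))) = (z : A) * e (m : Λ) := fun m =>
        proj_act_generator hA hB τ h (cutDeg z) m
      simp only [this]
      rw [← Finset.mul_sum, Finset.sum_coe_sort L e, z.2.2]
    exact Subtype.ext (by rw [key x, key y, hxy])
  · intro z
    subst h
    let y (m : L) : rightCut 𝒜 (e (m : Λ)) (p + 0 + 0) :=
      app (τ m).hom (p + 0) (app (T.map (hB.proj m 0)) (p + 0) z)
    have hy : ∀ m, (y m : A) ∈ 𝒜 p := fun m =>
      (congrArg 𝒜 (show p + 0 + 0 = p by omega)).le (y m).2.1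
    have hye : ∀ m : L, (y m : A) * e (m : Λ) = y m := fun m => (y m).2.2
    have hsum : ∀ m : L, (∑ l, (y l : A)) * e (m : Λ) = y m := fun m => by
      rw [Finset.sum_mul, Finset.sum_eq_single m]
      · exact hye m
      · intro l _ hl
        rw [← hye l, mul_assoc, hA.e_mul_ne (fun h => hl (Subtype.ext h)), mul_zero]
      · simp
    refine ⟨⟨∑ l, (y l : A), sum_mem fun l _ => hy l, ?_⟩, generator_ext hB τ fun m =>
      (proj_act_generator hA hB τ rfl _ m).trans (hsum m)⟩
    rw [← Finset.sum_coe_sort L e, Finset.mul_sum]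
    exact Finset.sum_congr rfl fun m _ => hsum m

lemma generator_idem (l : L) :
    app (T.map (freeMul ℬ (add_zero 0) (hB.e₀ l))) 0 (generator hA τ) =
      (T.obj (free ℬ 0)).act (zero_add _) (hA.e₀ (l : Λ)) (generator hA τ) := by
  have h1 : app (T.map (freeMul ℬ (add_zero 0) (hB.e₀ l))) 0 (generator hA τ) =
      app (T.map (cutIncl (e' l) 0)) 0 (app (T.map (hB.proj l 0)) 0 (generator hA τ)) := by
    rw [← hB.proj_incl, T.map_comp]
    rfl
  have h2 : (T.obj (free ℬ 0)).act (zero_add _) ⟨1, SetLike.GradedOne.one_mem⟩ (generator hA τ) =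
      generator hA τ := (T.obj (free ℬ 0)).one_act _ _ _ rfl
  refine generator_ext hB τ fun m => ?_
  rw [proj_act_generator, h1]
  by_cases hlm : l = m
  · subst hlm
    rw [map_incl_proj_self, ← h2, proj_act_generator, one_mul]
    exact (hA.e_mul_self _).symm
  · rw [map_incl_proj_ne hB hlm, map_zero, map_zero]
    exact (hA.e_mul_ne fun h => hlm (Subtype.ext h)).symm

/-- The frame given by isomorphisms `T(B e'_l) ≅ A e_l`. -/
def Frame.ofIsos (σ : GrMod.shift ℬ 1 ⋙ T ≅ T ⋙ GrMod.shift 𝒜 1) : Frame hA hB T :=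
  Frame.ofGenerator σ (generator hA τ) (generator_bijective hA hB τ) (generator_idem hA hB τ)

end Generator

/-! ### The coefficient map in degree one. -/

section DegreeOne

variable {A : Type u} [Ring A] [Algebra ℂ A] [FiniteDimensional ℂ A]
  {𝒜 : ℤ → Submodule ℂ A} [SetLike.GradedMonoid 𝒜]
  {Λ : Type*} [Fintype Λ] {e : Λ → A} {hA : IsBasic 𝒜 e} {L : Finset Λ}
  {B : Type u} [Ring B] [Algebra ℂ B] [FiniteDimensional ℂ B]
  {ℬ : ℤ → Submodule ℂ B} [SetLike.GradedMonoid ℬ]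
  {e' : L → B} {hB : IsBasic ℬ e'} {T : GrMod ℬ ⥤ GrMod 𝒜}

/-- A morphism between shifts of the free module is right multiplication by the image of `1`. -/
lemma exists_freeMul {p k k' : ℤ} (h : k + p = k') (f : free ℬ k ⟶ free ℬ k') :
    ∃ b, f = freeMul ℬ h b := by
  let o : (free ℬ k).V (-k) := (⟨1, by
    rw [neg_add_cancel]; exact SetLike.GradedOne.one_mem⟩ : ℬ (-k + k))
  refine ⟨castDeg ℬ (by omega : -k + k' = p) (app f (-k) o), GrMod.hom_ext fun j =>
    LinearMap.ext fun x => ?_⟩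
  have hx : (free ℬ k).act (by omega : j + k + -k = j) (x : ℬ (j + k)) o = x :=
    freeVal_injective (mul_one _)
  exact (congrArg (app f j) hx.symm).trans (app_act f _ (x : ℬ (j + k)) o)

namespace Frame

variable (fr : Frame hA hB T)

lemma φ_fromCut (k j : ℤ) (x : (freeCut 𝒜 (∑ l ∈ L, e l) k).V j) :
    app (fr.φ k).hom j (app (fr.fromCut k) j x) = x :=
  congrArg (fun t => app t j x) (fr.φ k).inv_hom_id

variable [T.Additive] [T.Linear ℂ]

lemma eL_mul_coef {p k k' : ℤ} (h : k + p = k') (b : ℬ p) :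
    (∑ l ∈ L, e l) * (fr.coef h b : A) = fr.coef h b := by
  conv_rhs => rw [← hB.sum_lmul_left b, map_sum, AddSubmonoidClass.coe_finsetSum]
  rw [← Finset.sum_coe_sort L e, Finset.sum_mul]
  refine Finset.sum_congr rfl fun l _ => ?_
  rw [fr.coef_mul (add_zero k) h (zero_add p) h, fr.coef_e₀]
  rfl

lemma map_freeMul_eq_zero {p k k' : ℤ} (h : k + p = k') {b : ℬ p} (hb : fr.coef h b = 0) :
    T.map (freeMul ℬ h b) = 0 := GrMod.hom_ext fun j => LinearMap.ext fun z => by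
  conv_lhs => rw [← fr.act_φ k j z]
  rw [app_act, fr.map_freeMul h (by omega : p + -k' = -k), hb, map_zero, LinearMap.zero_apply,
    map_zero]
  rfl

lemma map_freeMul_eq_zero' {p : ℤ} {b : ℬ p} (hb : fr.coef (zero_add p) b = 0) {k k' : ℤ}
    (h : k + p = k') : T.map (freeMul ℬ h b) = 0 :=
  fr.map_freeMul_eq_zero h (fr.coef_eq b 0 hb k h)

variable (hbij : ∀ l m : L, Function.Bijective
  fun f : freeCut ℬ (e' l) (-1) ⟶ freeCut ℬ (e' m) 0 => T.map f)

include hbij in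
-- A zero coefficient means that `T` kills right multiplication by `b`. Faithfulness of `T` on maps
-- `B e'_l⟨1⟩ → B e'_m` then kills every `e'_l b e'_m`, and these add up to `b`.
lemma coef_one_injective : Function.Injective (fr.coef (zero_add 1)) := by
  refine (injective_iff_map_eq_zero _).2 fun b hb => ?_
  have hT := fr.map_freeMul_eq_zero' hb (neg_add_cancel 1)
  have key : ∀ l m, e' l * (b : B) * e' m = 0 := fun l m => by
    have : cutIncl (e' l) (-1) ≫ freeMul ℬ (neg_add_cancel 1) b ≫ hB.proj m 0 = 0 := by
      apply (hbij l m).1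
      change T.map _ = T.map _
      rw [T.map_comp, T.map_comp, hT, zero_comp, comp_zero, T.map_zero _ _]
    exact congrArg cutVal (congrArg (fun t => app t 1 (⟨e' l, by
      rw [show (1 : ℤ) + -1 = 0 by omega]; exact hB.mem l, hB.e_mul_self l⟩ :
      rightCut ℬ (e' l) (1 + -1))) this)
  refine Subtype.ext ?_
  calc (b : B) = (∑ l, e' l) * b * ∑ m, e' m := by rw [hB.sum_e, one_mul, mul_one]
    _ = 0 := by
      rw [Finset.sum_mul, Finset.sum_mul]
      refine Finset.sum_eq_zero fun l _ => ?_
      rw [Finset.mul_sum]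
      exact Finset.sum_eq_zero fun m _ => key l m

include hbij in
lemma exists_coef_eq (l m : L) (a : 𝒜 1) : ∃ b, fr.coef (zero_add 1) b =
    lmul 𝒜 (add_zero 1) (lmul 𝒜 (zero_add 1) (hA.e₀ (l : Λ)) a) (hA.e₀ (m : Λ)) := by
  let s := CornerDatum.eL hA L
  have hs : (s : A) * s = s := hA.isIdempotentElem L
  let R : freeCut 𝒜 (∑ l ∈ L, e l) (-1) ⟶ freeCut 𝒜 (∑ l ∈ L, e l) 0 :=
    cutIncl (s : A) (-1) ≫ freeMul 𝒜 (neg_add_cancel 1) a ≫ cutProj s hs 0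
  -- Right multiplication by `a e_L` on `A e_L`, read through the generators and cut down to the
  -- summands `l` and `m`, is in the image of `T`. Extended to the free modules, its preimage is
  -- right multiplication by some `b`, and evaluation at `e_L` gives the coefficient `e_l a e_m`.
  obtain ⟨f, hf⟩ := (hbij l m).2 (T.map (cutIncl (e' l) (-1)) ≫ (fr.φ (-1)).hom ≫ R ≫
    fr.fromCut 0 ≫ T.map (hB.proj m 0))
  obtain ⟨b, hb⟩ := exists_freeMul (neg_add_cancel 1) (hB.proj l (-1) ≫ f ≫ cutIncl (e' m) 0)
  have hTb : T.map (freeMul ℬ (neg_add_cancel 1) b) =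
      T.map (freeMul ℬ (add_zero (-1)) (hB.e₀ l)) ≫ (fr.φ (-1)).hom ≫ R ≫ fr.fromCut 0 ≫
        T.map (freeMul ℬ (add_zero 0) (hB.e₀ m)) := by
    rw [← hb, T.map_comp, T.map_comp, show T.map f = _ from hf, ← hB.proj_incl, ← hB.proj_incl,
      T.map_comp, T.map_comp]
    simp only [Category.assoc]
  refine ⟨b, ?_⟩
  have he : ∀ (k : ℤ) (i : L) (j : ℤ) (z : (T.obj (free ℬ k)).V j),
      cutVal (app (fr.φ k).hom j (app (T.map (freeMul ℬ (add_zero k) (hB.e₀ i))) j z)) =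
        cutVal (app (fr.φ k).hom j z) * e (i : Λ) := fun k i =>
    fr.φ_freeMul _ (by omega) _ _ (CornerDatum.e_mul_eL hA i) (fr.idem k i)
  let x : (freeCut 𝒜 (∑ l ∈ L, e l) (-1)).V 1 := (⟨∑ l ∈ L, e l, by
    rw [show (1 : ℤ) + -1 = 0 by omega]; exact s.2, hs⟩ : rightCut 𝒜 (∑ l ∈ L, e l) (1 + -1))
  set z := app (fr.fromCut (-1)) 1 x with hz
  have hzx : app (fr.φ (-1)).hom 1 z = x := fr.φ_fromCut (-1) 1 x
  have h1 := fr.φ_freeMul (neg_add_cancel 1) (by omega) b _ (fr.coef_mul_eL _ b)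
    (fr.map_freeMul _ (by omega) b) 1 z
  have h2 : cutVal (app (fr.φ 0).hom 1 (app (T.map (freeMul ℬ (neg_add_cancel 1) b)) 1 z)) =
      (∑ l ∈ L, e l) * e (l : Λ) * a * (∑ l ∈ L, e l) * e (m : Λ) := by
    rw [hTb]
    refine (he 0 m 1 _).trans ?_
    refine congrArg (· * e (m : Λ)) ?_
    refine (congrArg cutVal (fr.φ_fromCut 0 1 _)).trans ?_
    refine congrArg (· * (a : A) * (∑ l ∈ L, e l)) ?_
    exact (he (-1) l 1 z).trans (congrArg (fun t => cutVal t * e (l : Λ)) hzx)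
  rw [hzx, h2] at h1
  refine Subtype.ext ((congrArg Subtype.val (fr.coef_eq b _ rfl (-1) (neg_add_cancel 1))).symm.trans
    ((fr.eL_mul_coef _ b).symm.trans (h1.symm.trans ?_)))
  rw [CornerDatum.eL_mul_e hA, mul_assoc _ (∑ l ∈ L, e l), CornerDatum.eL_mul_e hA]
  rfl

include hbij in
lemma exists_coef_one (a : 𝒜 1) (ha : (∑ l ∈ L, e l) * (a : A) * (∑ l ∈ L, e l) = a) :
    ∃ b, fr.coef (zero_add 1) b = a := by
  choose b hb using fun l m => fr.exists_coef_eq hbij l m a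
  refine ⟨∑ l, ∑ m, b l m, Subtype.ext ?_⟩
  simp only [map_sum, hb, AddSubmonoidClass.coe_finsetSum, coe_lmul, IsBasic.coe_e₀]
  simp only [← Finset.mul_sum, ← Finset.sum_mul, Finset.sum_coe_sort L e]
  exact ha

end Frame

end DegreeOne

/-! ### Degree bounds for an exact `T`, and injectivity in degree two. -/

section Bounds

variable {A : Type u} [Ring A] [Algebra ℂ A] [FiniteDimensional ℂ A]
  {𝒜 : ℤ → Submodule ℂ A} [SetLike.GradedMonoid 𝒜] [NonnegGraded 𝒜]
  {Λ : Type*} [Fintype Λ] {e : Λ → A} {hA : IsBasic 𝒜 e} {L : Finset Λ}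
  {B : Type u} [Ring B] [Algebra ℂ B] [FiniteDimensional ℂ B]
  {ℬ : ℤ → Submodule ℂ B} [GradedAlgebra ℬ]
  {e' : L → B} {hB : IsBasic ℬ e'} {T : GrMod ℬ ⥤ GrMod 𝒜} [T.Additive] [T.Linear ℂ]
  (fr : Frame hA hB T)

namespace Frame

include fr in
lemma subsingleton_map_free {k j : ℤ} (h : j + k < 0) :
    Subsingleton ((T.obj (free ℬ k)).V j) :=
  subsingleton_of_forall_eq 0 fun z => by
    obtain ⟨x, rfl⟩ := (fr.fromCut_bijective k j).2 z
    have : x = 0 := cutVal_injective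
      ((Submodule.mem_bot ℂ).1 (NonnegGraded.eq_bot (𝒜 := 𝒜) _ h ▸ cutVal_mem x))
    rw [this, map_zero]

include fr in
lemma subsingleton_map_ind {k j : ℤ} (N : GrMod (QDual.gr ℬ)) (h : j + k < 0) :
    Subsingleton ((T.obj (ind ℬ k N)).V j) :=
  subsingleton_of_forall_eq 0 fun z => by
    have h1 : 𝟙 (T.obj (ind ℬ k N)) = ∑ i,
        T.map (indTo hB N k ((Module.finBasis ℂ (N.V k)).coord i)) ≫
          T.map (freeTo N k (Module.finBasis ℂ (N.V k) i)) := by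
      rw [← T.map_id, ← sum_indTo_freeTo hB N k, T.map_sum]
      simp only [T.map_comp]
    refine (congrArg (fun t => app t j z) h1).trans ?_
    rw [sum_app, LinearMap.sum_apply]
    have := fr.subsingleton_map_free h
    exact Finset.sum_eq_zero fun i _ => by
      rw [app_comp_apply, Subsingleton.elim (app (T.map (indTo hB N k _)) j z) 0, map_zero]

variable [PreservesFiniteColimits T]

include fr in
-- `T` keeps the surjection `P M → M`, and `T(B ⊗ M_{-k})` is a retract of copies of `A e_L⟨-k⟩`,
-- hence lives in degrees at least `-k`. Summands with `-k < m` are zero because `M_{-k}` is.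
lemma subsingleton_map_of_lt {M : GrMod ℬ} {m : ℤ} (hM : ∀ j < m, Subsingleton (M.V j)) :
    ∀ j < m, Subsingleton ((T.obj M).V j) := fun j hj =>
  subsingleton_of_forall_eq 0 fun z => by
    obtain ⟨y, rfl⟩ := surjective_map T (stdε ℬ M) (fun j v => ⟨_, ε_η ℬ M j v⟩) j z
    suffices y = 0 by rw [this, map_zero]
    refine (stdSplit T M).eq_zero fun k => ?_
    have : Subsingleton ((T.obj (ind ℬ k (trivObj ℬ M))).V j) := by
      by_cases hk : -k < m
      · have h : Subsingleton ((trivObj ℬ M).V k) := hM (-k) hk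
        exact subsingleton_map T (fun i => ind_subsingleton ℬ _ (Or.inr h)) j
      · exact fr.subsingleton_map_ind _ (by omega)
    exact Subsingleton.elim _ _

variable [PreservesFiniteLimits T]

include fr in
lemma preservesDown : PreservesDown T := by
  rintro X ⟨N, hN⟩
  refine ⟨N, fun i j hij => ?_⟩
  by_cases hi : N < i
  · exact subsingleton_map T (fun j => hN i j (Or.inl hi)) j
  · exact fr.subsingleton_map_of_lt (m := -N - i) (fun j hj => hN i j (Or.inr (by omega))) j
      (by omega)

/-- If `e'_l c ≠ 0`, then right multiplication by `c` on `B e'_l` has a kernel in positive degrees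
only. If moreover `T` kills this map, then by exactness `T` of the kernel maps onto `T(B e'_l) ≅ A
e_l`. But it vanishes in degree `0`, where `A e_l` contains `e_l ≠ 0`. -/
lemma coef_two_injective [NonnegGraded ℬ]
    (τ : ∀ l : L, T.obj (freeCut ℬ (e' l) 0) ≅ freeCut 𝒜 (e (l : Λ)) 0) :
    Function.Injective (fr.coef (zero_add 2)) := by
  refine (injective_iff_map_eq_zero _).2 fun c hc => ?_
  have key : ∀ l, e' l * (c : B) = 0 := fun l => by
    by_contra hlc
    let g : freeCut ℬ (e' l) 0 ⟶ free ℬ 2 := cutIncl (e' l) 0 ≫ freeMul ℬ (zero_add 2) c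
    have hg : T.map g = 0 := by
      rw [T.map_comp, fr.map_freeMul_eq_zero' hc, comp_zero]
    -- Negative degrees of `B e'_l` are zero, and its component of degree `0` is the line spanned by
    -- `e'_l`, on which multiplication by `c` is injective.
    have hker : ∀ j < 1, Subsingleton ((kerObj g).V j) := fun j hj =>
      subsingleton_of_forall_eq 0 fun y => kerι_injective g j (cutVal_injective (by
        rw [map_zero, map_zero]
        set x : (freeCut ℬ (e' l) 0).V j := app (kerι g) j y
        have hx : cutVal x * (c : B) = 0 := congrArg freeVal y.2
        rcases lt_or_eq_of_le (Int.lt_add_one_iff.1 hj : j ≤ 0) with hj | rfl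
        · exact (Submodule.mem_bot ℂ).1
            (NonnegGraded.eq_bot (𝒜 := ℬ) (j + 0) (by omega) ▸ cutVal_mem x)
        · have h0 : cutVal x ∈ ℬ 0 := cutVal_mem x
          have h1 : cutVal x = hB.coef l ⟨cutVal x, h0⟩ • e' l :=
            (cutVal_mul x).symm.trans (hB.mul_e ⟨cutVal x, h0⟩ l)
          rw [h1, smul_mul_assoc] at hx
          rw [h1, (smul_eq_zero.1 hx).resolve_right hlc, zero_smul]))
    have hT0 := fr.subsingleton_map_of_lt hker 0 one_pos
    obtain ⟨w, hw⟩ := preservesExact_of_preservesLimits T (kerι g) g (kerι_comp g)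
      (fun j x hx => ⟨⟨x, hx⟩, rfl⟩) 0 (app (τ l).inv 0 (cutGen hA (l : Λ)))
      (by rw [hg]; rfl)
    rw [Subsingleton.elim w 0, map_zero] at hw
    have h2 : app (τ l).hom 0 (app (τ l).inv 0 (cutGen hA (l : Λ))) = cutGen hA (l : Λ) :=
      congrArg (fun t => app t 0 (cutGen hA (l : Λ))) (τ l).inv_hom_id
    rw [← hw, map_zero] at h2
    exact hA.ne_zero l (congrArg cutVal h2).symm
  exact Subtype.ext (by
    rw [← one_mul (c : B), ← hB.sum_e, Finset.sum_mul]
    exact Finset.sum_eq_zero fun l _ => key l)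

end Frame

end Bounds

/-! ### Exact functors on `D^↓`. -/

section ExactFunctor

variable {R S : Type u} [Ring R] [Algebra ℂ R] [Ring S] [Algebra ℂ S]
  {ℛ : ℤ → Submodule ℂ R} {𝒮 : ℤ → Submodule ℂ S}

lemma inverts_of_exact (T : GrMod ℛ ⥤ GrMod 𝒮) [T.Additive] [PreservesFiniteLimits T]
    [PreservesFiniteColimits T] (hT : PreservesDown T) :
    (qisDown ℛ).IsInvertedBy (comDownMap T hT ⋙ QDown 𝒮) := fun _ _ f hf =>
  Localization.inverts (QDown 𝒮) (qisDown 𝒮) ((comDownMap T hT).map f)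
    ((qis_iff _).2 (((qis_iff _).1 hf).map T (preservesExact_of_preservesLimits T)))

end ExactFunctor

end QuadDual

end

theorem mainTheorem4
    {A : Type u} [Ring A] [Algebra ℂ A] [FiniteDimensional ℂ A]
    (𝒜 : ℤ → Submodule ℂ A) [GradedAlgebra 𝒜] [QuadDual.NonnegGraded 𝒜]
    {Λ : Type*} [Fintype Λ] (e : Λ → A) (hA : QuadDual.IsBasic 𝒜 e) (L : Finset Λ)
    {B : Type u} [Ring B] [Algebra ℂ B] [FiniteDimensional ℂ B]
    (ℬ : ℤ → Submodule ℂ B) [GradedAlgebra ℬ] [QuadDual.NonnegGraded ℬ] :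
    -- the lemma, for a homomorphism `ψ : B → e_L A e_L`
    (∀ (ψ : B →ₐ[ℂ] (hA.isIdempotentElem L).Corner)
        (hψ : ∀ n, ∀ b ∈ ℬ n, ψ b ∈ QuadDual.cornerGr (hA.isIdempotentElem L) 𝒜 n),
      Set.BijOn ψ (ℬ 0) (QuadDual.cornerGr (hA.isIdempotentElem L) 𝒜 0) →
      Set.BijOn ψ (ℬ 1) (QuadDual.cornerGr (hA.isIdempotentElem L) 𝒜 1) →
      haveI := QuadDual.corner_gradedMonoid (hA.isIdempotentElem L) 𝒜 (hA.sum_mem L)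
      Set.BijOn
        (QuadDual.Deg2.map ℬ (QuadDual.cornerGr (hA.isIdempotentElem L) 𝒜) ψ hψ)
        (LinearMap.ker (QuadDual.Deg2.mul ℬ))
        (LinearMap.ker
          (QuadDual.Deg2.mul (QuadDual.cornerGr (hA.isIdempotentElem L) 𝒜))) →
      ∃ (θ : QuadDual.QDual ℬ ≃ₐ[ℂ] QuadDual.QDualQuot 𝒜 e L)
        (hθ : ∀ n a, θ a ∈ QuadDual.QDualQuot.gr 𝒜 e L n ↔ a ∈ QuadDual.QDual.gr ℬ n),
        (∀ b : ℬ 0, θ (QuadDual.QDual.gen0 ℬ b) = QuadDual.QDualQuot.proj 𝒜 e L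
          (QuadDual.QDual.gen0 𝒜 (QuadDual.cornerDeg 𝒜 ℬ ψ hψ 0 b))) ∧
        (∀ f : Module.Dual ℂ (𝒜 1),
          θ (QuadDual.QDual.gen1 ℬ (f ∘ₗ QuadDual.cornerDeg 𝒜 ℬ ψ hψ 1)) =
            QuadDual.QDualQuot.proj 𝒜 e L (QuadDual.QDual.gen1 𝒜 f)) ∧
        ∃ (hA' : QuadDual.KoszulExact 𝒜) (hB' : QuadDual.KoszulExact ℬ)
          (LT : QuadDual.DDown ℬ ⥤ QuadDual.DDown 𝒜),
          QuadDual.IsLeftDerived (QuadDual.tens 𝒜 ℬ ψ hψ)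
            (QuadDual.tens_preservesDown 𝒜 ℬ ψ hψ) LT ∧
          Nonempty
            (QuadDual.resD (QuadDual.QDual.gr ℬ) (QuadDual.QDualQuot.gr 𝒜 e L)
                (θ : QuadDual.QDual ℬ →ₐ[ℂ] QuadDual.QDualQuot 𝒜 e L)
                (fun n a ha => (hθ n a).2 ha) ⋙
              QuadDual.koszulDual ℬ hB' ⋙ LT ≅
            QuadDual.resD (QuadDual.QDual.gr 𝒜) (QuadDual.QDualQuot.gr 𝒜 e L)
                (QuadDual.QDualQuot.proj 𝒜 e L) (QuadDual.QDualQuot.proj_mem 𝒜 e L) ⋙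
              QuadDual.koszulDual 𝒜 hA')) ∧
    -- the corollary, for an exact functor `T`
    (∀ (e' : L → B), QuadDual.IsBasic ℬ e' →
      Module.rank ℂ (QuadDual.QDual ℬ) = Module.rank ℂ (QuadDual.QDualQuot 𝒜 e L) →
      ∀ (T : QuadDual.GrMod ℬ ⥤ QuadDual.GrMod 𝒜) [T.Additive] [T.Linear ℂ]
        [PreservesFiniteLimits T] [PreservesFiniteColimits T],
      Nonempty (QuadDual.GrMod.shift ℬ 1 ⋙ T ≅ T ⋙ QuadDual.GrMod.shift 𝒜 1) →
      (∀ l : L, Nonempty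
        (T.obj (QuadDual.idealMod ℬ (e' l)) ≅ QuadDual.idealMod 𝒜 (e l))) →
      (∀ l m : L, Function.Bijective
        (fun f : (QuadDual.GrMod.shift ℬ 1).obj (QuadDual.idealMod ℬ (e' l)) ⟶
          QuadDual.idealMod ℬ (e' m) => T.map f)) →
      ∃ (θ : QuadDual.QDual ℬ ≃ₐ[ℂ] QuadDual.QDualQuot 𝒜 e L)
        (hθ : ∀ n a, θ a ∈ QuadDual.QDualQuot.gr 𝒜 e L n ↔ a ∈ QuadDual.QDual.gr ℬ n),
        (∀ (l : L) (b : ℬ 0) (a : 𝒜 0), (b : B) = e' l → (a : A) = e l →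
          θ (QuadDual.QDual.gen0 ℬ b) =
            QuadDual.QDualQuot.proj 𝒜 e L (QuadDual.QDual.gen0 𝒜 a)) ∧
        ∃ (hA' : QuadDual.KoszulExact 𝒜) (hB' : QuadDual.KoszulExact ℬ)
          (hT : QuadDual.PreservesDown T)
          (hT' : (QuadDual.qisDown ℬ).IsInvertedBy
            (QuadDual.comDownMap T hT ⋙ QuadDual.QDown 𝒜)),
          Nonempty
            (QuadDual.resD (QuadDual.QDual.gr ℬ) (QuadDual.QDualQuot.gr 𝒜 e L)
                (θ : QuadDual.QDual ℬ →ₐ[ℂ] QuadDual.QDualQuot 𝒜 e L)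
                (fun n a ha => (hθ n a).2 ha) ⋙
              QuadDual.koszulDual ℬ hB' ⋙ QuadDual.inducedD T hT hT' ≅
            QuadDual.resD (QuadDual.QDual.gr 𝒜) (QuadDual.QDualQuot.gr 𝒜 e L)
                (QuadDual.QDualQuot.proj 𝒜 e L) (QuadDual.QDualQuot.proj_mem 𝒜 e L) ⋙
              QuadDual.koszulDual 𝒜 hA')) := by
  refine ⟨fun ψ hψ h₀ h₁ h₂ => ?_, ?_⟩
  · have h : QuadDual.IsQuadraticCornerHom ℬ hA ψ hψ := ⟨h₀, h₁, h₂⟩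
    refine ⟨h.cornerDatum.θ, h.cornerDatum.θ_mem_iff, fun b => ?_, h.cornerDatum.θ_gen1,
      QuadDual.koszulExact 𝒜 hA, QuadDual.koszulExact ℬ h.isBasic,
      QuadDual.leftD _ _ (QuadDual.resolution_inverts _ _ h.isBasic
        h.transport.ind_preservesExact), QuadDual.leftD_isLeftDerived _ _ _,
      ⟨h.transport.derivedIso _ _ _ _ (QuadDual.leftDKoszulIso _ _ _)⟩⟩
    rw [h.cornerDatum.θ_gen0, h.ψ₀_eq]
  · rintro e' hB - T _ _ _ _ ⟨σ⟩ hτ hbij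
    -- Hypothesis (b) is moved to the models `freeCut`, in which the shift `⟨1⟩` corresponds to the
    -- index `-1`.
    have hbij' : ∀ l m : L, Function.Bijective fun f : QuadDual.freeCut ℬ (e' l) (-1) ⟶
        QuadDual.freeCut ℬ (e' m) 0 => T.map f := fun l m =>
      QuadDual.map_bijective_of_iso T (QuadDual.idealShiftIso (e' l) rfl)
        (QuadDual.idealIso (e' m)) (hbij l m)
    let τ (l : L) : T.obj (QuadDual.freeCut ℬ (e' l) 0) ≅ QuadDual.freeCut 𝒜 (e l) 0 :=
      (T.mapIso (QuadDual.idealIso (e' l))).symm ≪≫ (hτ l).some ≪≫ QuadDual.idealIso (e l)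
    let fr : QuadDual.Frame hA hB T := QuadDual.Frame.ofIsos hA hB τ σ
    let D := fr.cornerDatum (fr.coef_one_injective hbij') (fr.exists_coef_one hbij')
      (fr.coef_two_injective τ)
    let t : QuadDual.Transport D T := fr.transport (fr.coef_one_injective hbij')
      (fr.exists_coef_one hbij') (fr.coef_two_injective τ)
    -- Here `T` is exact and induces its functor on `D^↓` termwise, so the last comparison is just
    -- the factorization through the localization.
    refine ⟨D.θ, D.θ_mem_iff, fun l b a hb ha => ?_, QuadDual.koszulExact 𝒜 hA,
      QuadDual.koszulExact ℬ hB, fr.preservesDown, QuadDual.inverts_of_exact T fr.preservesDown,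
      ⟨t.derivedIso _ _ _ _ (Functor.isoWhiskerLeft (QuadDual.koszulUpDown ℬ)
        (Localization.fac _ _ _))⟩⟩
    obtain rfl : b = hB.e₀ l := Subtype.ext hb
    obtain rfl : a = hA.e₀ (l : Λ) := Subtype.ext ha
    rw [D.θ_gen0, QuadDual.CornerDatum.ψ₀_e₀]
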